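/- Let $X$ be a compact complex manifold of dimension $d\ge 1$ and $D\subset X$ a smooth hypersurface (a closed complex submanifold of codimension one, possibly empty or disconnected). Let $L\to X$ be a holomorphic line bundle with a smooth hermitian metric $|\cdot|$ and $s$ a holomorphic section of $L$ with $D=\{s=0\}$. Let $\mathcal E^{p,q}(*D)$ be the space of semi-meromorphic $(p,q)$-forms with polar set in $D$, i.e. of smooth $(p,q)$-forms $\alpha$ on $X\setminus D$ which near every point of $X$ can be written $\alpha=\widetilde\alpha/f$ with $\widetilde\alpha$ smooth and $f\not\equiv0$ holomorphic. For $\alpha\in\mathcal E(*D)$ and a test form (smooth form) $\xi$ of complementary bidegree, the principal value current $[\alpha]$ is defined by $$\langle[\alpha],\xi\rangle=\Big(\int_X|s|^{2\lambda}\,\alpha\wedge\xi\Big)\Big|_{\lambda=0},$$ the value at $0$ of the analytic continuation to some half plane $\mathrm{Re}\,\lambda>-\epsilon$, $\epsilon>0$, of a function given by a convergent integral for $\mathrm{Re}\,\lambda\gg1$. For a current $T$ of degree $k$ put $\langle\bar\partial T,\xi\rangle=(-1)^{k+1}\langle T,\bar\partial\xi\rangle$. For $\omega\in\mathcal E^{d,q'}(*D)$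 choose a finite partition of unity $(\rho_j)$ subordinate to a cover of $X$ by holomorphic charts with coordinates $z_j=(z_{j,1},\dots,z_{j,d})$ in which $D=\{z_{j,1}=0\}$ and $\omega=dz_{j,1}\wedge\widetilde\omega_j/z_{j,1}^{m_j}$ with $m_j\ge1$ and $\widetilde\omega_j$ smooth and not containing $dz_{j,1}$. The conjugate Dolbeault residue $\mathrm{Res}_\partial(\omega)$ is the class in $H^{d-1,q'}_\partial(D)$ (smooth $\partial$-closed $(d-1,q')$-forms on $D$ modulo $\partial$ of smooth $(d-2,q')$-forms) of $$\sum_j\frac1{(m_j-1)!}\,\frac{\partial^{m_j-1}(\rho_j\widetilde\omega_j)}{\partial z_{j,1}^{m_j-1}}\bigg|_D ,$$ the derivatives being applied to the coefficients of the forms. **Theorem.** Let $\alpha\in\mathcal E^{p,q}(*D)$ with $0\le p\le d$, $0\le q\le d-1$, and let $\xi$ be a test form of bidegree $(d-p,d-q-1)$. Then the analytic continuations defining $\langle[\alpha],\bar\partial\xi\rangle$ and $\langle[\bar\partial\alpha],\xi\rangle$ exist, choices as in the definition of $\mathrm{Res}_\partial(\alpha\wedge\xi)$ exist, and $$\langle\bar\partial[\alpha],\xi\rangle=\langle[\bar\partial\alpha],\xi\rangle+2\pi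 i\int_D\mathrm{Res}_\partial(\alpha\wedge\xi),$$ where $\int_D\mathrm{Res}_\partial(\alpha\wedge\xi)$ is the integral over $D$ of any smooth form representing the residue, for any choice of charts, partition of unity, exponents $m_j$ and representative. -/

import Mathlib

open scoped Manifold ContDiff
open Bundle

noncomputable section

/-- The model space `ℂ^d` of a complex manifold of dimension `d`. -/
abbrev Cn (d : ℕ) : Type := Fin d → ℂ

/-- Complex valued `ℝ`-multilinear alternating `k`-forms on `ℂ^d`. -/
abbrev AltForm (d k : ℕ) : Type := Cn d [⋀^Fin k]→L[ℝ] ℂ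

/-- Multiplication by `i` on `ℂ^d`, as a real linear map. -/
def mulI (d : ℕ) : Cn d →L[ℝ] Cn d := Complex.I • ContinuousLinearMap.id ℝ (Cn d)

namespace AltForm

theorem update_castAdd {d k l : ℕ} (v : Fin (k + l) → Cn d) (i : Fin k) (z : Cn d) :
    (fun i' => Function.update v (Fin.castAdd l i) z (Fin.castAdd l i')) =
        Function.update (fun i' => v (Fin.castAdd l i')) i z ∧
      (fun i' => Function.update v (Fin.castAdd l i) z (Fin.natAdd k i')) =
        fun i' => v (Fin.natAdd k i') :=
  ⟨Function.update_comp_eq_of_injective v (Fin.castAdd_injective k l) i z,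
    funext fun i' => Function.update_of_ne (by simp [Fin.ext_iff]; omega) _ _⟩

theorem update_natAdd {d k l : ℕ} (v : Fin (k + l) → Cn d) (i : Fin l) (z : Cn d) :
    (fun i' => Function.update v (Fin.natAdd k i) z (Fin.natAdd k i')) =
        Function.update (fun i' => v (Fin.natAdd k i')) i z ∧
      (fun i' => Function.update v (Fin.natAdd k i) z (Fin.castAdd l i')) =
        fun i' => v (Fin.castAdd l i') :=
  ⟨Function.update_comp_eq_of_injective v (Fin.natAdd_injective l k) i z,
    funext fun i' => Function.update_of_ne (by simp [Fin.ext_iff]; omega) _ _⟩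

/-- The multilinear map `v ↦ a (v₁, …, v_k) * b (v_{k+1}, …, v_{k+l})`. -/
def prodMap {d k l : ℕ} (a : AltForm d k) (b : AltForm d l) :
    ContinuousMultilinearMap ℝ (fun _ : Fin (k + l) => Cn d) ℂ where
  toFun v := a (fun i => v (Fin.castAdd l i)) * b (fun i => v (Fin.natAdd k i))
  map_update_add' := by
    intro inst v i x y
    obtain rfl : inst = instDecidableEqFin _ := Subsingleton.elim _ _
    induction i using Fin.addCases with
    | left i =>
      rw [(update_castAdd v i _).1, (update_castAdd v i _).2, (update_castAdd v i x).1,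
        (update_castAdd v i x).2, (update_castAdd v i y).1, (update_castAdd v i y).2,
        ContinuousAlternatingMap.map_update_add, add_mul]
    | right i =>
      rw [(update_natAdd v i _).1, (update_natAdd v i _).2, (update_natAdd v i x).1,
        (update_natAdd v i x).2, (update_natAdd v i y).1, (update_natAdd v i y).2,
        ContinuousAlternatingMap.map_update_add, mul_add]
  map_update_smul' := by
    intro inst v i c x
    obtain rfl : inst = instDecidableEqFin _ := Subsingleton.elim _ _
    induction i using Fin.addCases with
    | left i =>
      rw [(update_castAdd v i _).1, (update_castAdd v i _).2, (update_castAdd v i x).1,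
        (update_castAdd v i x).2, ContinuousAlternatingMap.map_update_smul, smul_mul_assoc]
    | right i =>
      rw [(update_natAdd v i _).1, (update_natAdd v i _).2, (update_natAdd v i x).1,
        (update_natAdd v i x).2, ContinuousAlternatingMap.map_update_smul, mul_smul_comm]
  cont := by fun_prop

/-- The wedge product
`(a ∧ b)(v) = 1/(k! l!) ∑_σ sign σ · a (v_{σ 1}, …, v_{σ k}) · b (v_{σ (k+1)}, …, v_{σ (k+l)})`. -/
def wedge {d k l : ℕ} (a : AltForm d k) (b : AltForm d l) : AltForm d (k + l) :=
  (((k.factorial * l.factorial : ℕ) : ℝ)⁻¹) • ContinuousMultilinearMap.alternatization (prodMap a b)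

/-- A form of degree `k = p + q` has bidegree `(p, q)`: multiplying all arguments by a complex
scalar `c` multiplies the value by `c ^ p * conj c ^ q`.  (On a `(p', q')`-form with
`p' + q' = k`, i.e. a combination of the `dz_I ∧ dz̄_J` with `|I| = p'`, `|J| = q'`, the factor
is `c ^ p' * conj c ^ q'`, so this singles out the summand of bidegree `(p, q)`.) -/
def IsType {d k : ℕ} (p q : ℕ) (a : AltForm d k) : Prop :=
  k = p + q ∧ ∀ (c : ℂ) (v : Fin k → Cn d),
    a (fun i => c • v i) = c ^ p * (starRingEnd ℂ c) ^ q * a v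

/-- `dz₁ ∧ a`, where `z₁` is the first coordinate:
`(dz₁ ∧ a)(v₀, …, v_k) = ∑_i (-1)^i dz₁(v_i) a(v₀, …, v̂_i, …, v_k)`. -/
def dzOneWedge {n k : ℕ} (a : AltForm (n + 1) k) : AltForm (n + 1) (k + 1) :=
  ContinuousAlternatingMap.alternatizeUncurryFin
    ((ContinuousLinearMap.proj (R := ℝ) (φ := fun _ : Fin (n + 1) => ℂ) 0).smulRight a)

/-- `a` does not contain `dz₁`: the contraction of `a` with
`∂/∂z₁ = (1/2) (∂/∂x₁ - i ∂/∂y₁)` vanishes. -/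
def NoDzOne {n k : ℕ} (a : AltForm (n + 1) k) : Prop :=
  ∀ (v : Fin k → Cn (n + 1)) (l : Fin k),
    a (Function.update v l (Pi.single 0 1))
      - Complex.I * a (Function.update v l (Pi.single 0 Complex.I)) = 0

end AltForm

/-- The complex linear part `v ↦ (1/2) (T v - i T (i v))` of a real linear map. -/
def linPart {d k : ℕ} (T : Cn d →L[ℝ] AltForm d k) : Cn d →L[ℝ] AltForm d k :=
  (1 / 2 : ℂ) • (T - Complex.I • T.comp (mulI d))

/-- The conjugate linear part `v ↦ (1/2) (T v + i T (i v))` of a real linear map. -/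
def antilinPart {d k : ℕ} (T : Cn d →L[ℝ] AltForm d k) : Cn d →L[ℝ] AltForm d k :=
  (1 / 2 : ℂ) • (T + Complex.I • T.comp (mulI d))

/-- `∂` on forms on `ℂ^d`: for `a = ∑ a_{IJ} dz_I ∧ dz̄_J` this is
`∑ ∂a_{IJ} ∧ dz_I ∧ dz̄_J`, the part of `extDeriv a` coming from the complex linear part of the
derivatives of the coefficients. -/
def delCn {d k : ℕ} (a : Cn d → AltForm d k) (y : Cn d) : AltForm d (k + 1) :=
  ContinuousAlternatingMap.alternatizeUncurryFin (linPart (fderiv ℝ a y))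

/-- `∂̄` on forms on `ℂ^d`: for `a = ∑ a_{IJ} dz_I ∧ dz̄_J` this is
`∑ ∂̄a_{IJ} ∧ dz_I ∧ dz̄_J`. -/
def dbarCn {d k : ℕ} (a : Cn d → AltForm d k) (y : Cn d) : AltForm d (k + 1) :=
  ContinuousAlternatingMap.alternatizeUncurryFin (antilinPart (fderiv ℝ a y))

/-- The derivative `∂/∂z₁ = (1/2) (∂/∂x₁ - i ∂/∂y₁)` applied to the coefficients of a form. -/
def wirtingerOne {n k : ℕ} (a : Cn (n + 1) → AltForm (n + 1) k) (y : Cn (n + 1)) :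
    AltForm (n + 1) k :=
  (1 / 2 : ℂ) • (fderiv ℝ a y (Pi.single 0 1)
    - Complex.I • fderiv ℝ a y (Pi.single 0 Complex.I))

/-- The positively oriented real frame `e₁, i e₁, e₂, i e₂, …, e_d, i e_d` of `ℂ^d`. -/
def stdFrame (d : ℕ) (i : Fin (2 * d)) : Cn d :=
  Pi.single ⟨(i : ℕ) / 2, by omega⟩ (if (i : ℕ) % 2 = 0 then 1 else Complex.I)

/-- Complex valued differential `k`-forms (not necessarily smooth or even continuous) on a complex
manifold of dimension `d`.  As always in Mathlib, the tangent space at `x` is the model space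
`ℂ^d`, identified with it through the preferred chart at `x`. -/
abbrev DForm (d : ℕ) (X : Type*) (k : ℕ) : Type _ := X → AltForm d k

/-- The holomorphic charts of `X`. -/
abbrev holCharts (d : ℕ) (X : Type*) [TopologicalSpace X] [ChartedSpace (Cn d) X] :
    Set (OpenPartialHomeomorph X (Cn d)) :=
  IsManifold.maximalAtlas 𝓘(ℂ, Cn d) ω X

/-- A finite smooth partition of unity subordinate to holomorphic charts. -/
structure ChartPartition (d : ℕ) (X : Type*) [TopologicalSpace X] [ChartedSpace (Cn d) X] where
  N : ℕ
  chart : Fin N → OpenPartialHomeomorph X (Cn d)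
  chart_mem : ∀ i, chart i ∈ holCharts d X
  ρ : Fin N → X → ℝ
  smooth : ∀ i, ContMDiff 𝓘(ℝ, Cn d) 𝓘(ℝ, ℝ) ∞ (ρ i)
  nonneg : ∀ i x, 0 ≤ ρ i x
  support : ∀ i, tsupport (ρ i) ⊆ (chart i).source
  sum_eq_one : ∀ x, ∑ i, ρ i x = 1

namespace DForm

/-- Transport of a form along an equality of degrees. -/
def recast {d k l : ℕ} {X : Type*} (h : k = l) (a : DForm d X k) : DForm d X l := fun x => h ▸ a x

section
variable {d k l : ℕ} {X : Type*} [TopologicalSpace X] [ChartedSpace (Cn d) X]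

/-- The expression of a form in a chart `φ`, i.e. its pull-back by `φ⁻¹`. -/
def inChart (a : DForm d X k) (φ : OpenPartialHomeomorph X (Cn d)) (y : Cn d) : AltForm d k :=
  (a (φ.symm y)).compContinuousLinearMap
    (mfderiv 𝓘(ℝ, Cn d) 𝓘(ℝ, Cn d) φ.symm y : Cn d →L[ℝ] Cn d)

/-- A form is smooth on the open set `U`. -/
def SmoothOn (a : DForm d X k) (U : Set X) : Prop :=
  ∀ φ ∈ holCharts d X, ContDiffOn ℝ ∞ (a.inChart φ) (φ.target ∩ φ.symm ⁻¹' U)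

/-- The form has bidegree `(p, q)` at the points of `U`. -/
def IsTypeOn (p q : ℕ) (a : DForm d X k) (U : Set X) : Prop :=
  ∀ x ∈ U, AltForm.IsType p q (a x)

/-- Pointwise wedge product. -/
def wedge (a : DForm d X k) (b : DForm d X l) : DForm d X (k + l) := fun x => (a x).wedge (b x)

/-- The operator `∂`, computed at `x` in the preferred chart at `x`. -/
def del (a : DForm d X k) : DForm d X (k + 1) :=
  fun x => delCn (a.inChart (chartAt (Cn d) x)) (chartAt (Cn d) x x)

/-- The operator `∂̄`, computed at `x` in the preferred chart at `x`. -/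
def dbar (a : DForm d X k) : DForm d X (k + 1) :=
  fun x => dbarCn (a.inChart (chartAt (Cn d) x)) (chartAt (Cn d) x x)

/-- `a` is integrable over `X` with integral `c`: for every finite smooth partition of unity
subordinate to holomorphic charts `φ_i`, the coefficient of `ρ_i a` with respect to
`dx₁ ∧ dy₁ ∧ … ∧ dx_d ∧ dy_d` in the chart `φ_i` is Lebesgue integrable, and the sum of the
integrals is `c`. -/
def HasIntegral (a : DForm d X (2 * d)) (c : ℂ) : Prop :=
  ∀ P : ChartPartition d X,
    (∀ i, MeasureTheory.IntegrableOn
      (fun y => (P.ρ i ((P.chart i).symm y) : ℂ) * a.inChart (P.chart i) y (stdFrame d))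
      (P.chart i).target) ∧
    ∑ i, ∫ y in (P.chart i).target,
      (P.ρ i ((P.chart i).symm y) : ℂ) * a.inChart (P.chart i) y (stdFrame d) = c

/-- The integral `∫_X a` over the compact complex manifold `X` (`0` if `a` is not integrable). -/
def integral (a : DForm d X (2 * d)) : ℂ :=
  open Classical in if h : ∃ c, a.HasIntegral c then h.choose else 0

/-- `c` is the value at `0` of the analytic continuation of `λ ↦ ∫_X σ^{2λ} a`: this integral
converges for `Re λ` large, where it agrees with a function `G` which is holomorphic on
`Re λ > -ε` for some `ε > 0`, and `G 0 = c`. -/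
def IsPrincipalValue (σ : X → ℝ) (a : DForm d X (2 * d)) (c : ℂ) : Prop :=
  ∃ (R ε : ℝ) (G : ℂ → ℂ), 0 < ε ∧ AnalyticOnNhd ℂ G {z | -ε < z.re} ∧
    (∀ z : ℂ, R < z.re → HasIntegral (fun x => ((σ x : ℂ) ^ (2 * z)) • a x) (G z)) ∧ G 0 = c

/-- The analytic continuation defining the pairing `⟨[a], ξ⟩` exists. -/
def PVDefined (σ : X → ℝ) (hkl : k + l = 2 * d) (a : DForm d X k) (ξ : DForm d X l) : Prop :=
  ∃ c, IsPrincipalValue σ (recast hkl (a.wedge ξ)) c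

/-- The principal value current `⟨[a], ξ⟩ = (∫_X |s|^{2λ} a ∧ ξ)|_{λ = 0}`, with `σ = |s|`
(`0` if the analytic continuation does not exist). -/
def pvCurrent (σ : X → ℝ) (hkl : k + l = 2 * d) (a : DForm d X k) (ξ : DForm d X l) : ℂ :=
  open Classical in if h : PVDefined σ hkl a ξ then h.choose else 0

/-- `∂̄T` for a current `T` of degree `k`: `⟨∂̄T, ξ⟩ = (-1)^{k+1} ⟨T, ∂̄ξ⟩`. -/
def dbarCurrent (k : ℕ) (T : DForm d X (l + 1) → ℂ) (ξ : DForm d X l) : ℂ :=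
  (-1) ^ (k + 1) * T ξ.dbar

/-- `a` is a semi-meromorphic form whose polar set is contained in the closed set `D`: `a` is
smooth outside `D`, and locally `a = b / f` with `b` a smooth form and `f` a holomorphic function
which does not vanish identically (on any nonempty open set).  The values of `a` at points of `D`
are irrelevant. -/
def IsSemiMeromorphic (D : Set X) (a : DForm d X k) : Prop :=
  a.SmoothOn Dᶜ ∧
  ∀ x : X, ∃ U : Set X, IsOpen U ∧ x ∈ U ∧ ∃ (f : X → ℂ) (b : DForm d X k),
    ContMDiffOn 𝓘(ℂ, Cn d) 𝓘(ℂ, ℂ) ω f U ∧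
    (∀ V ⊆ U, IsOpen V → V.Nonempty → ∃ y ∈ V, f y ≠ 0) ∧
    b.SmoothOn U ∧ ∀ y ∈ U \ D, b y = f y • a y

/-- The form `a` of bidegree `(p, q)` is `∂`-exact: `a = ∂b` with `b` a smooth form of bidegree
`(p - 1, q)`; if `p = 0` this means `a = 0`. -/
def IsDelExact (p q : ℕ) (a : DForm d X (p + q)) : Prop :=
  a = 0 ∨ ∃ (p' : ℕ) (hp : p' + 1 = p) (b : DForm d X (p' + q)),
    b.SmoothOn Set.univ ∧ b.IsTypeOn p' q Set.univ ∧ a = recast (by omega) b.del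

end

end DForm

/-- The data entering the residue of a form `a` along the hypersurface `D`: a partition of unity
subordinate to charts in which `D` is given by `z₁ = 0`, and in each of these charts smooth forms
`ã` not containing `dz₁` with `a = dz₁ ∧ ã / z₁^m`. -/
structure ResidueData {n k : ℕ} {X : Type*} [TopologicalSpace X] [ChartedSpace (Cn (n + 1)) X]
    (D : Set X) (a : DForm (n + 1) X (k + 1)) extends ChartPartition (n + 1) X where
  adapted : ∀ i, ∀ x ∈ (chart i).source, x ∈ D ↔ chart i x 0 = 0
  m : Fin N → ℕ
  m_pos : ∀ i, 1 ≤ m i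
  coeff : Fin N → Cn (n + 1) → AltForm (n + 1) k
  coeff_smooth : ∀ i, ContDiffOn ℝ ∞ (coeff i) (chart i).target
  coeff_noDz : ∀ i, ∀ y ∈ (chart i).target, (coeff i y).NoDzOne
  eq_coeff : ∀ i, ∀ y ∈ (chart i).target, y 0 ≠ 0 →
    a.inChart (chart i) y = ((y 0) ^ m i)⁻¹ • (coeff i y).dzOneWedge

/-- The form `∑_i 1/(m_i - 1)! (∂/∂z₁)^{m_i - 1} (ρ_i ã_i) |_D` on the hypersurface `D`, the image
of the embedding `j : Y → X`; restriction to `D` is pull-back by `j`. -/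
def ResidueData.form {n k : ℕ} {X : Type*} [TopologicalSpace X] [ChartedSpace (Cn (n + 1)) X]
    {Y : Type*} [TopologicalSpace Y] [ChartedSpace (Cn n) Y] {j : Y → X}
    {a : DForm (n + 1) X (k + 1)} (R : ResidueData (Set.range j) a) : DForm n Y k :=
  fun y => ∑ i, open Classical in
    if j y ∈ (R.chart i).source then
      (((R.m i - 1).factorial : ℂ)⁻¹) •
        ((wirtingerOne^[R.m i - 1]
            (fun w => (R.ρ i ((R.chart i).symm w) : ℂ) • R.coeff i w))
          (R.chart i (j y))).compContinuousLinearMap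
        (mfderiv 𝓘(ℝ, Cn n) 𝓘(ℝ, Cn (n + 1)) (fun y' => R.chart i (j y')) y :
          Cn n →L[ℝ] Cn (n + 1))
    else 0

/-- The conjugate Dolbeault residue along `D = j(Y)` of a form `a` of bidegree `(n + 1, q)`, as the
set of the smooth `(n, q)`-forms on `D` which represent it: those which are cohomologous, in the
conjugate Dolbeault cohomology of `D`, to the form given by some residue data. -/
def conjDolbeaultResidue {n q : ℕ} {X : Type*} [TopologicalSpace X]
    [ChartedSpace (Cn (n + 1)) X] {Y : Type*} [TopologicalSpace Y] [ChartedSpace (Cn n) Y]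
    (j : Y → X) (a : DForm (n + 1) X (n + q + 1)) : Set (DForm n Y (n + q)) :=
  {η | η.SmoothOn Set.univ ∧ η.IsTypeOn n q Set.univ ∧
    ∃ R : ResidueData (Set.range j) a, DForm.IsDelExact n q (η - R.form)}

/-- A (smooth hermitian) metric on a holomorphic line bundle, given by the norm on its fibres. -/
structure LineBundleMetric {d : ℕ} {X : Type*} [TopologicalSpace X] [ChartedSpace (Cn d) X]
    (L : X → Type*) [∀ x, AddCommGroup (L x)] [∀ x, Module ℂ (L x)]
    [∀ x, TopologicalSpace (L x)] [TopologicalSpace (TotalSpace ℂ L)]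
    [FiberBundle ℂ L] [VectorBundle ℂ ℂ L] where
  norm : ∀ x, L x → ℝ
  pos : ∀ x v, v ≠ 0 → 0 < norm x v
  homog : ∀ x (c : ℂ) v, norm x (c • v) = ‖c‖ * norm x v
  smooth : ∀ (e : Trivialization ℂ (TotalSpace.proj : TotalSpace ℂ L → X))
    [MemTrivializationAtlas e],
    ContMDiffOn 𝓘(ℝ, Cn d) 𝓘(ℝ, ℝ) ∞ (fun x => norm x (e.symm x 1)) e.baseSet

end

/-! The core is a computation on `ℂ^{n+1}`. In a chart where `D = {z₁ = 0}`, the norm of the section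
is locally `|z₁|^κ e^ψ` with `κ ≥ 1` and `ψ` smooth, so the pairings are finite sums of integrals `∫
|z₁|^{2κλ} e^{2λψ} z₁^{-m} b` with `b` smooth of compact support. Because `∂̄₁(|z₁|^{2κλ} z̄₁^{a+1}
z₁^{-m}) = (κλ + a + 1) |z₁|^{2κλ} z̄₁^a z₁^{-m}`, integrating by parts `m + 1` times turns the
kernel into `|z₁|^{2κλ} z̄₁^{m+1} z₁^{-m}`, of modulus `|z₁|^{2κ Re λ + 1}`. The resulting integral
is holomorphic for `Re λ > -1/(2κ)`. Derivatives falling on the exponential carry a factor `λ`, so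
the value at `0`, called `pvInt m b`, depends neither on `κ` nor on `ψ`
(`exists_continuation_pvIntegrand`, `hasContinuation_pvInt`).

By the Leibniz rule the two sides of the theorem differ, up to sign, by the principal value of `∂̄(α
∧ ξ) = ∑ ∂̄(ρ_i α ∧ ξ)`. In a chart `ρ_i α ∧ ξ = z₁^{-m} dz₁ ∧ B`, and the coefficient of its `∂̄`
is `z₁^{-m}` times a sum of derivatives `∂̄_j b_j`. The terms with `j ≠ 1` integrate to zero. For `j
= 1`, powers of `1/z₁` are traded for derivatives `∂₁` until only `1/z₁` is left, and the
Cauchy-Pompeiu formula produces `-π` times the restriction to `z₁ = 0` (`pvInt_succ_wd_eq`,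
`pvInt_dolb_dzOneWedge`). This gives the formula for every choice of residue data
(`DForm.isPrincipalValue_dbar_wedge`). Another representative differs by a `∂`-exact form, whose
integral vanishes by Stokes (`DForm.hasIntegral_del`).

The delicate point is that a semi-meromorphic form is only assumed to be `b / f` locally, with
arbitrary holomorphic `f ≢ 0`, and smooth off `D`; it must be shown to have a pole of finite order
in `z₁` (`exists_contDiffOn_eq_pow_first_smul`). Write `f = z₁^k g` with `g` not identically zero on
`z₁ = 0`. Then `u = z₁^k α` is smooth off `z₁ = 0` and `g u` is smooth. On discs tangent to `z₁ = 0`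
whose boundary circles avoid the zeros of `g`, the function `u` is bounded in terms of the
derivatives of `g u`, uniformly in the disc (`exists_bound_of_holomorphic_smul`): the zeros of `g`
are divided out one at a time. The derivatives of `u` satisfy an equation of the same kind with a
higher power of `g`, so all of them are bounded and `u` extends smoothly. -/

set_option linter.unusedSectionVars false

/-! ### Wirtinger derivatives in a complex direction. -/

section Wirtinger

variable {V E : Type*} [NormedAddCommGroup V] [NormedSpace ℝ V] [NormedSpace ℂ V]
  [NormedAddCommGroup E] [NormedSpace ℝ E] [NormedSpace ℂ E] [IsScalarTower ℝ ℂ E]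

/-- The derivative `(1/2) (∂_v + e ∂_{iv})`: for `e = -i` this is the Wirtinger derivative `∂/∂z`
in the complex direction `v`, for `e = i` it is `∂/∂z̄`. -/
noncomputable def wd (e : ℂ) (v : V) (f : V → E) (y : V) : E :=
  (1 / 2 : ℂ) • (fderiv ℝ f y v + e • fderiv ℝ f y (Complex.I • v))

omit [IsScalarTower ℝ ℂ E] in
theorem wd_congr {e : ℂ} {v : V} {f g : V → E} {y : V} (h : f =ᶠ[nhds y] g) :
    wd e v f y = wd e v g y := by
  simp only [wd, h.fderiv_eq]

omit [IsScalarTower ℝ ℂ E] in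
theorem wd_eqOn {e : ℂ} {v : V} {f g : V → E} {U : Set V} (hU : IsOpen U) (h : Set.EqOn f g U) :
    Set.EqOn (wd e v f) (wd e v g) U := fun _ hy =>
  wd_congr (h.eventuallyEq_of_mem (hU.mem_nhds hy))

omit [IsScalarTower ℝ ℂ E] in
theorem wd_iterate_eqOn {e : ℂ} {v : V} {f g : V → E} {U : Set V} (hU : IsOpen U)
    (h : Set.EqOn f g U) (k : ℕ) : Set.EqOn ((wd e v)^[k] f) ((wd e v)^[k] g) U := by
  induction k with
  | zero => exact h
  | succ k ih =>
    rw [Function.iterate_succ_apply', Function.iterate_succ_apply']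
    exact wd_eqOn hU ih

theorem ContDiffOn.wd {e : ℂ} {v : V} {f : V → E} {U : Set V} (hU : IsOpen U)
    (hf : ContDiffOn ℝ ∞ f U) : ContDiffOn ℝ ∞ (wd e v f) U := by
  have h1 : ContDiffOn ℝ ∞ (fderiv ℝ f) U := hf.fderiv_of_isOpen hU (by simp)
  have h2 : ∀ w : V, ContDiffOn ℝ ∞ (fun y => fderiv ℝ f y w) U := fun w =>
    h1.clm_apply contDiffOn_const
  exact ((h2 v).add ((h2 _).const_smul e)).const_smul _

theorem ContDiff.wd {e : ℂ} {v : V} {f : V → E} (hf : ContDiff ℝ ∞ f) :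
    ContDiff ℝ ∞ (wd e v f) :=
  contDiffOn_univ.1 (ContDiffOn.wd isOpen_univ hf.contDiffOn)

theorem ContDiffOn.wd_iterate {e : ℂ} {v : V} {f : V → E} {U : Set V} (hU : IsOpen U)
    (hf : ContDiffOn ℝ ∞ f U) (k : ℕ) : ContDiffOn ℝ ∞ ((_root_.wd e v)^[k] f) U := by
  induction k with
  | zero => exact hf
  | succ k ih => rw [Function.iterate_succ_apply']; exact ih.wd hU

theorem ContDiff.wd_iterate {e : ℂ} {v : V} {f : V → E}
    (hf : ContDiff ℝ ∞ f) (k : ℕ) : ContDiff ℝ ∞ ((_root_.wd e v)^[k] f) :=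
  contDiffOn_univ.1 (ContDiffOn.wd_iterate isOpen_univ hf.contDiffOn k)

omit [IsScalarTower ℝ ℂ E] in
theorem tsupport_wd_subset {e : ℂ} {v : V} {f : V → E} : tsupport (wd e v f) ⊆ tsupport f := by
  refine closure_minimal (fun y hy => ?_) (isClosed_tsupport f)
  by_contra h
  have := support_fderiv_subset ℝ (f := f)
  have h0 : fderiv ℝ f y = 0 := by
    by_contra h1
    exact h (this h1)
  exact hy (by simp [wd, h0])

omit [IsScalarTower ℝ ℂ E] in
theorem HasCompactSupport.wd {e : ℂ} {v : V} {f : V → E} (hf : HasCompactSupport f) :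
    HasCompactSupport (wd e v f) :=
  hf.mono' (subset_closure.trans tsupport_wd_subset)

omit [IsScalarTower ℝ ℂ E] in
theorem HasCompactSupport.wd_iterate {e : ℂ} {v : V} {f : V → E} (hf : HasCompactSupport f)
    (k : ℕ) : HasCompactSupport ((_root_.wd e v)^[k] f) := by
  induction k with
  | zero => exact hf
  | succ k ih => rw [Function.iterate_succ_apply']; exact ih.wd

omit [IsScalarTower ℝ ℂ E] in
theorem wd_add {e : ℂ} {v : V} {f g : V → E} {y : V} (hf : DifferentiableAt ℝ f y)
    (hg : DifferentiableAt ℝ g y) :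
    wd e v (fun x => f x + g x) y = wd e v f y + wd e v g y := by
  simp only [wd, fderiv_fun_add hf hg, add_apply, smul_add]
  abel

theorem wd_const_smul {e : ℂ} {v : V} {f : V → E} {y : V} (c : ℂ)
    (hf : DifferentiableAt ℝ f y) :
    wd e v (fun x => c • f x) y = c • wd e v f y := by
  simp only [wd, fderiv_fun_const_smul hf, smul_apply, smul_add]
  simp only [smul_smul]
  congr 2 <;> ring

theorem wd_sum {ι : Type*} {e : ℂ} {v : V} {f : ι → V → E} {y : V} {s : Finset ι}
    (hf : ∀ i ∈ s, DifferentiableAt ℝ (f i) y) :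
    wd e v (fun x => ∑ i ∈ s, f i x) y = ∑ i ∈ s, wd e v (f i) y := by
  simp only [wd, fderiv_fun_sum hf, sum_apply, Finset.smul_sum,
    Finset.sum_add_distrib, smul_add]

omit [NormedSpace ℂ V] [IsScalarTower ℝ ℂ E] in
theorem fderiv_complex_smul [IsScalarTower ℝ ℂ E] {c : V → ℂ} {f : V → E} {y : V}
    (hc : DifferentiableAt ℝ c y) (hf : DifferentiableAt ℝ f y) (w : V) :
    fderiv ℝ (fun x => c x • f x) y w = fderiv ℝ c y w • f y + c y • fderiv ℝ f y w := by
  have h := (hc.hasFDerivAt.smul hf.hasFDerivAt).fderiv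
  have h' : fderiv ℝ (fun x => c x • f x) y = _ := h
  rw [h']
  simp [add_comm]

theorem wd_smul {e : ℂ} {v : V} {c : V → ℂ} {f : V → E} {y : V}
    (hc : DifferentiableAt ℝ c y) (hf : DifferentiableAt ℝ f y) :
    wd e v (fun x => c x • f x) y = wd e v c y • f y + c y • wd e v f y := by
  simp only [wd, fderiv_complex_smul hc hf, smul_eq_mul]
  module

omit [IsScalarTower ℝ ℂ E] in
theorem wd_clm {F : Type*} [NormedAddCommGroup F] [NormedSpace ℝ F] [NormedSpace ℂ F]
    {e : ℂ} {v : V} {f : V → E} {y : V} (L : E →L[ℝ] F) (hL : ∀ (c : ℂ) x, L (c • x) = c • L x)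
    (hf : DifferentiableAt ℝ f y) :
    wd e v (fun x => L (f x)) y = L (wd e v f y) := by
  have : fderiv ℝ (fun x => L (f x)) y = L.comp (fderiv ℝ f y) :=
    (L.hasFDerivAt.comp y hf.hasFDerivAt).fderiv
  simp [wd, this, hL]

theorem wd_iterate_clm {F : Type*} [NormedAddCommGroup F] [NormedSpace ℝ F] [NormedSpace ℂ F]
    {e : ℂ} {v : V} {f : V → E} {U : Set V} (hU : IsOpen U) (hf : ContDiffOn ℝ ∞ f U)
    (L : E →L[ℝ] F) (hL : ∀ (c : ℂ) x, L (c • x) = c • L x) (k : ℕ) :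
    Set.EqOn ((wd e v)^[k] (fun x => L (f x))) (fun x => L ((wd e v)^[k] f x)) U := by
  induction k with
  | zero => intro x _; rfl
  | succ k ih =>
    intro x hx
    rw [Function.iterate_succ_apply', Function.iterate_succ_apply', wd_eqOn hU ih hx]
    exact wd_clm L hL (((hf.wd_iterate hU k).contDiffAt (hU.mem_nhds hx)).differentiableAt
      (by simp))

/-- Symmetry of the second real derivative: a Wirtinger derivative is a combination, with constant
coefficients, of two directional derivatives. -/
theorem wd_comm {e e' : ℂ} {v v' : V} {f : V → E} {y : V} (hf : ContDiffAt ℝ ∞ f y) :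
    wd e v (wd e' v' f) y = wd e' v' (wd e v f) y := by
  have h1 : ContDiffAt ℝ ∞ (fderiv ℝ f) y := hf.fderiv_right (by simp)
  have h2 : DifferentiableAt ℝ (fderiv ℝ f) y := h1.differentiableAt (by simp)
  have h3 : ∀ w, DifferentiableAt ℝ (fun x => fderiv ℝ f x w) y := fun w =>
    h2.clm_apply (differentiableAt_const w)
  have key : ∀ (e' : ℂ) (v' : V) (w : V), fderiv ℝ (wd e' v' f) y w = (1 / 2 : ℂ) •
      (fderiv ℝ (fderiv ℝ f) y w v' + e' • fderiv ℝ (fderiv ℝ f) y w (Complex.I • v')) := by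
    intro e' v' w
    have h4 : ∀ u, fderiv ℝ (fun x => fderiv ℝ f x u) y w = fderiv ℝ (fderiv ℝ f) y w u := by
      intro u
      rw [fderiv_clm_apply h2 (differentiableAt_const u)]
      simp
    have h5 : fderiv ℝ (wd e' v' f) y = (1 / 2 : ℂ) • (fderiv ℝ (fun x => fderiv ℝ f x v') y +
        e' • fderiv ℝ (fun x => fderiv ℝ f x (Complex.I • v')) y) := by
      have := (((h3 v').hasFDerivAt.add ((h3 (Complex.I • v')).hasFDerivAt.const_smul e')).const_smul
        (1 / 2 : ℂ)).fderiv
      exact this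
    rw [h5]
    simp [h4]
  have sym : ∀ u w, fderiv ℝ (fderiv ℝ f) y u w = fderiv ℝ (fderiv ℝ f) y w u :=
    fun u w => (hf.isSymmSndFDerivAt (by
      simp only [minSmoothness_of_isRCLikeNormedField]
      exact WithTop.coe_le_coe.2 (le_top : (2 : ℕ∞) ≤ ⊤))) u w
  unfold wd at key ⊢
  rw [key, key, key, key, sym v v', sym v (Complex.I • v'), sym (Complex.I • v) v',
    sym (Complex.I • v) (Complex.I • v')]
  simp only [smul_add, smul_smul]
  have h1 : (1 / 2 * (e' * (1 / 2)) : ℂ) = 1 / 2 * (1 / 2 * e') := by ring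
  have h2 : (1 / 2 * (e * (1 / 2)) : ℂ) = 1 / 2 * (1 / 2 * e) := by ring
  have h3 : (1 / 2 * (e * (1 / 2 * e')) : ℂ) = 1 / 2 * (e' * (1 / 2 * e)) := by ring
  rw [h1, h2, h3]
  abel

theorem wd_iterate_comm {e e' : ℂ} {v v' : V} {f : V → E} {U : Set V} (hU : IsOpen U)
    (hf : ContDiffOn ℝ ∞ f U) (k : ℕ) :
    Set.EqOn (wd e v ((wd e' v')^[k] f)) ((wd e' v')^[k] (wd e v f)) U := by
  induction k with
  | zero => intro x _; rfl
  | succ k ih =>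
    intro x hx
    rw [Function.iterate_succ_apply', Function.iterate_succ_apply',
      wd_comm ((hf.wd_iterate hU k).contDiffAt (hU.mem_nhds hx)), wd_eqOn hU ih hx]

/-- Restriction of a Wirtinger derivative to an affine complex line. -/
theorem wd_comp_line [IsScalarTower ℝ ℂ V] {e : ℂ} {v p : V} {f : V → E} {t : ℂ}
    (hf : DifferentiableAt ℝ f (p + t • v)) :
    wd e 1 (fun s : ℂ => f (p + s • v)) t = wd e v f (p + t • v) := by
  have h1 : HasFDerivAt (fun s : ℂ => p + s • v)
      ((ContinuousLinearMap.id ℝ ℂ).smulRight v) t :=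
    (((ContinuousLinearMap.id ℝ ℂ).smulRight v).hasFDerivAt (x := t)).const_add p
  have h2 := (hf.hasFDerivAt.comp t h1).fderiv
  have h3 : fderiv ℝ (fun s : ℂ => f (p + s • v)) t = _ := h2
  simp [wd, h3]

theorem wd_iterate_comp_line [IsScalarTower ℝ ℂ V] {e : ℂ} {v p : V} {f : V → E} {U : Set V}
    {W : Set ℂ} (hW : IsOpen W) (hU : IsOpen U) (hWU : ∀ t ∈ W, p + t • v ∈ U)
    (hf : ContDiffOn ℝ ∞ f U) (k : ℕ) :
    Set.EqOn ((wd e 1)^[k] (fun s : ℂ => f (p + s • v)))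
      (fun s => (wd e v)^[k] f (p + s • v)) W := by
  induction k with
  | zero => intro x _; rfl
  | succ k ih =>
    intro x hx
    rw [Function.iterate_succ_apply', Function.iterate_succ_apply', wd_eqOn hW ih hx]
    exact wd_comp_line (((hf.wd_iterate hU k).contDiffAt
      (hU.mem_nhds (hWU x hx))).differentiableAt (by simp))

omit [IsScalarTower ℝ ℂ E] in
theorem wd_of_differentiableAt_complex [IsScalarTower ℝ ℂ E] [IsScalarTower ℝ ℂ V]
    {v : V} {f : V → E} {y : V}
    (hf : DifferentiableAt ℂ f y) :
    wd Complex.I v f y = 0 ∧ wd (-Complex.I) v f y = fderiv ℂ f y v := by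
  have h : fderiv ℝ f y = (fderiv ℂ f y).restrictScalars ℝ :=
    (hf.hasFDerivAt.restrictScalars ℝ).fderiv
  have hI : (Complex.I * Complex.I : ℂ) = -1 := Complex.I_mul_I
  constructor
  · simp [wd, h, smul_smul]
  · simp only [wd, h, ContinuousLinearMap.coe_restrictScalars', map_smul, smul_smul]
    rw [neg_mul, hI, neg_neg, one_smul, ← two_smul ℂ, smul_smul]
    norm_num

/-- This is `df = ∂f + ∂̄f`: the real derivative is the sum of its complex linear and conjugate
linear parts, so two Wirtinger derivatives control every real direction in a complex line. -/
theorem fderiv_smul_direction [IsScalarTower ℝ ℂ V] (f : V → E) (y v : V) (c : ℂ) :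
    fderiv ℝ f y (c • v) = c • wd (-Complex.I) v f y + (starRingEnd ℂ c) • wd Complex.I v f y := by
  have h1 : c • v = c.re • v + c.im • (Complex.I • v) := by
    conv_lhs => rw [← Complex.re_add_im c]
    rw [add_smul, mul_smul, ← IsScalarTower.algebraMap_smul ℂ c.re v,
      ← IsScalarTower.algebraMap_smul ℂ c.im (Complex.I • v)]
    rfl
  have h2 : ∀ (r : ℝ) (x : E), r • x = (r : ℂ) • x := fun r x =>
    (IsScalarTower.algebraMap_smul ℂ r x).symm
  have hc : (starRingEnd ℂ) c = c.re - c.im * Complex.I := by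
    apply Complex.ext <;> simp
  have hc' : c = c.re + c.im * Complex.I := (Complex.re_add_im c).symm
  rw [h1, map_add, map_smul, map_smul, h2, h2, hc]
  nth_rewrite 3 [hc']
  simp only [wd]
  generalize fderiv ℝ f y (Complex.I • v) = B
  have hI : (Complex.I * Complex.I : ℂ) = -1 := Complex.I_mul_I
  match_scalars
  · ring
  · linear_combination (c.im : ℂ) * hI

end Wirtinger

/-! ### Bounds for a smooth function after division by a holomorphic one. -/

section Division

variable {E : Type*} [NormedAddCommGroup E] [NormedSpace ℝ E] [NormedSpace ℂ E]
  [IsScalarTower ℝ ℂ E]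

/-- The mixed Wirtinger derivatives on `ℂ`. -/
noncomputable def wdd (i j : ℕ) (f : ℂ → E) : ℂ → E :=
  (wd (-Complex.I) 1)^[i] ((wd Complex.I 1)^[j] f)

theorem ContDiffOn.wdd {f : ℂ → E} {U : Set ℂ} (hU : IsOpen U) (hf : ContDiffOn ℝ ∞ f U)
    (i j : ℕ) : ContDiffOn ℝ ∞ (wdd i j f) U :=
  (hf.wd_iterate hU j).wd_iterate hU i

theorem wdd_eqOn {f g : ℂ → E} {U : Set ℂ} (hU : IsOpen U) (h : Set.EqOn f g U) (i j : ℕ) :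
    Set.EqOn (wdd i j f) (wdd i j g) U :=
  wd_iterate_eqOn hU (wd_iterate_eqOn hU h j) i

theorem wd_sub_const_smul {a : ℂ} {f : ℂ → E} {t : ℂ} (hf : DifferentiableAt ℝ f t) :
    wd Complex.I 1 (fun s => (s - a) • f s) t = (t - a) • wd Complex.I 1 f t ∧
    wd (-Complex.I) 1 (fun s => (s - a) • f s) t = f t + (t - a) • wd (-Complex.I) 1 f t := by
  have hd : DifferentiableAt ℂ (fun s : ℂ => s - a) t := by fun_prop
  have hc : DifferentiableAt ℝ (fun s : ℂ => s - a) t := by fun_prop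
  have h := wd_of_differentiableAt_complex (v := (1 : ℂ)) hd
  have h1 : fderiv ℂ (fun s : ℂ => s - a) t 1 = 1 := by
    rw [fderiv_sub_const]; simp
  rw [wd_smul hc hf, wd_smul hc hf, h.1, h.2, h1]
  simp

theorem wdd_sub_const_smul {a : ℂ} {f : ℂ → E} {U : Set ℂ} (hU : IsOpen U)
    (hf : ContDiffOn ℝ ∞ f U) (i j : ℕ) :
    Set.EqOn (wdd i j (fun s => (s - a) • f s))
      (fun t => (t - a) • wdd i j f t + (i : ℂ) • wdd (i - 1) j f t) U := by
  have hj : ∀ j, Set.EqOn ((wd Complex.I 1)^[j] (fun s => (s - a) • f s))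
      (fun t => (t - a) • (wd Complex.I 1)^[j] f t) U := by
    intro j
    induction j with
    | zero => intro x _; rfl
    | succ j ih =>
      intro x hx
      rw [Function.iterate_succ_apply', Function.iterate_succ_apply', wd_eqOn hU ih hx]
      exact (wd_sub_const_smul (((hf.wd_iterate hU j).contDiffAt
        (hU.mem_nhds hx)).differentiableAt (by simp))).1
  induction i with
  | zero =>
    intro x hx
    simp [wdd, hj j hx]
  | succ i ih =>
    intro x hx
    have hdiff : ∀ i, DifferentiableAt ℝ (wdd i j f) x := fun i =>
      ((hf.wdd hU i j).contDiffAt (hU.mem_nhds hx)).differentiableAt (by simp)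
    have h1 : wdd (i + 1) j (fun s => (s - a) • f s) x =
        wd (-Complex.I) 1 (wdd i j (fun s => (s - a) • f s)) x := by
      simp only [wdd, Function.iterate_succ_apply']
    have h2 : ∀ i, wdd (i + 1) j f x = wd (-Complex.I) 1 (wdd i j f) x := by
      intro i
      simp only [wdd, Function.iterate_succ_apply']
    rw [h1, wd_eqOn hU ih hx]
    have hsub : DifferentiableAt ℝ (fun s : ℂ => s - a) x := by fun_prop
    rw [wd_add (f := fun t => (t - a) • wdd i j f t) (g := fun t => (i : ℂ) • wdd (i - 1) j f t)
      (hsub.smul (hdiff i)) ((hdiff _).const_smul (i : ℂ)), (wd_sub_const_smul (hdiff i)).2,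
      wd_const_smul _ (hdiff _), ← h2]
    rcases i with _ | i
    · simp [add_comm]
    · simp only [Nat.add_sub_cancel, ← h2]
      push_cast
      module

/-- If the derivatives of `(t - a) u` are bounded on the unit disc, then so are those of `u`,
with bounds which do not depend on the point `a` of the disc. -/
theorem exists_bound_wdd_of_sub_smul (K : ℕ → ℕ → ℝ) :
    ∃ K' : ℕ → ℕ → ℝ, ∀ a ∈ Metric.ball (0 : ℂ) 1, ∀ u : ℂ → E,
      ContDiffOn ℝ ∞ u (Metric.ball 0 1) →
      (∀ i j, ∀ t ∈ Metric.ball (0 : ℂ) 1, ‖wdd i j (fun s => (s - a) • u s) t‖ ≤ K i j) →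
      ∀ i j, ∀ t ∈ Metric.ball (0 : ℂ) 1, ‖wdd i j u t‖ ≤ K' i j := by
  -- bounds by negative powers of the distance to `a`
  have h0 : ∀ i : ℕ, ∃ C : ℕ → ℝ, ∀ a ∈ Metric.ball (0 : ℂ) 1, ∀ u : ℂ → E,
      ContDiffOn ℝ ∞ u (Metric.ball 0 1) →
      (∀ i j, ∀ t ∈ Metric.ball (0 : ℂ) 1, ‖wdd i j (fun s => (s - a) • u s) t‖ ≤ K i j) →
      ∀ j, ∀ t ∈ Metric.ball (0 : ℂ) 1, ‖t - a‖ ^ (i + 1) * ‖wdd i j u t‖ ≤ C j := by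
    intro i
    induction i with
    | zero =>
      refine ⟨fun j => K 0 j, fun a ha u hu hb j t ht => ?_⟩
      have h := wdd_sub_const_smul (a := a) Metric.isOpen_ball hu 0 j ht
      have h' := hb 0 j t ht
      rw [h] at h'
      simpa [norm_smul] using h'
    | succ i ih =>
      obtain ⟨C, hC⟩ := ih
      refine ⟨fun j => 2 ^ (i + 1) * K (i + 1) j + (i + 1) * C j, fun a ha u hu hb j t ht => ?_⟩
      have h := wdd_sub_const_smul (a := a) Metric.isOpen_ball hu (i + 1) j ht
      have h' := hb (i + 1) j t ht
      have hta : ‖t - a‖ ≤ 2 := by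
        have h1 : ‖t‖ < 1 := by simpa using ht
        have h2 : ‖a‖ < 1 := by simpa using ha
        linarith [norm_sub_le t a]
      have hC' := hC a ha u hu hb j t ht
      -- The commutator of `∂^{i+1}` with multiplication by `t - a` is `(i+1) ∂^i`, while `∂̄`
      -- commutes with it.
      have e1 : (t - a) • wdd (i + 1) j u t = wdd (i + 1) j (fun s => (s - a) • u s) t
          - ((i + 1 : ℕ) : ℂ) • wdd i j u t := by
        rw [h]; simp
      calc ‖t - a‖ ^ (i + 1 + 1) * ‖wdd (i + 1) j u t‖
          = ‖t - a‖ ^ (i + 1) * ‖(t - a) • wdd (i + 1) j u t‖ := by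
            rw [norm_smul]; ring
        _ ≤ ‖t - a‖ ^ (i + 1) * (K (i + 1) j + (i + 1) * ‖wdd i j u t‖) := by
            gcongr
            rw [e1]
            refine (norm_sub_le _ _).trans (add_le_add h' ?_)
            rw [norm_smul, Complex.norm_natCast]
            push_cast
            rfl
        _ = ‖t - a‖ ^ (i + 1) * K (i + 1) j
            + (i + 1) * (‖t - a‖ ^ (i + 1) * ‖wdd i j u t‖) := by ring
        _ ≤ 2 ^ (i + 1) * K (i + 1) j + (i + 1) * C j := by
            have : 0 ≤ K (i + 1) j := (norm_nonneg _).trans h'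
            gcongr
  -- improvement of the exponent
  have h1 : ∀ i l : ℕ, l ≤ i + 1 → ∃ C : ℕ → ℝ, ∀ a ∈ Metric.ball (0 : ℂ) 1, ∀ u : ℂ → E,
      ContDiffOn ℝ ∞ u (Metric.ball 0 1) →
      (∀ i j, ∀ t ∈ Metric.ball (0 : ℂ) 1, ‖wdd i j (fun s => (s - a) • u s) t‖ ≤ K i j) →
      ∀ j, ∀ t ∈ Metric.ball (0 : ℂ) 1,
        ‖t - a‖ ^ (i + 1 - l) * ‖wdd i j u t‖ ≤ C j := by
    intro i l
    induction l with
    | zero => intro _; simpa using h0 i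
    | succ l ih =>
      intro hl
      obtain ⟨C, hC⟩ := ih (by omega)
      refine ⟨fun j => 2 ^ (i + 1 - (l + 1)) * K (i + 1) j + C (j + 1),
        fun a ha u hu hb j t ht => ?_⟩
      set w := t - a with hw
      have hconv : ∀ τ ∈ Set.Icc (0 : ℝ) 1, a + τ • w ∈ Metric.ball (0 : ℂ) 1 := by
        intro τ hτ
        have := (convex_ball (0 : ℂ) 1).add_smul_sub_mem ha ht hτ
        exact this
      have hta : ‖w‖ ≤ 2 := by
        have h1 : ‖t‖ < 1 := by simpa using ht
        have h2 : ‖a‖ < 1 := by simpa using ha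
        linarith [norm_sub_le t a]
      have hK : 0 ≤ K (i + 1) j := (norm_nonneg _).trans (hb (i + 1) j t ht)
      let φ := wdd (i + 1) j (fun s => (s - a) • u s)
      -- Along the segment from `a` to `t`, the term `(i+1) ∂^i∂̄^j u` coming from `τ^{i+1}` and the
      -- term `τ w ∂^{i+1}∂̄^j u` combine to `φ`, a derivative of `(t - a) u`, which is bounded by
      -- hypothesis. Only `τ w̄ ∂^i∂̄^{j+1} u` remains; its factor `w̄` gains one power of the
      -- distance to `a`.
      let g : ℝ → E := fun τ => τ ^ (i + 1) • wdd i j u (a + τ • w)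
      have hderiv : ∀ τ ∈ Set.Icc (0 : ℝ) 1, HasDerivAt g
          (τ ^ i • (φ (a + τ • w) + (τ * starRingEnd ℂ w) • wdd i (j + 1) u (a + τ • w))) τ := by
        intro τ hτ
        have hx := hconv τ hτ
        have hd : DifferentiableAt ℝ (wdd i j u) (a + τ • w) :=
          ((hu.wdd Metric.isOpen_ball i j).contDiffAt
            (Metric.isOpen_ball.mem_nhds hx)).differentiableAt (by simp)
        have hl : HasDerivAt (fun τ : ℝ => a + τ • w) w τ := by
          simpa using ((hasDerivAt_id τ).smul_const w).const_add a
        have hz : HasDerivAt (fun τ : ℝ => wdd i j u (a + τ • w))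
            (fderiv ℝ (wdd i j u) (a + τ • w) w) τ := hd.hasFDerivAt.comp_hasDerivAt τ hl
        have hp : HasDerivAt (fun τ : ℝ => τ ^ (i + 1)) (((i + 1 : ℕ) : ℝ) * τ ^ i) τ := by
          simpa using hasDerivAt_pow (i + 1) τ
        convert! hp.smul hz using 1
        have e1 := fderiv_smul_direction (wdd i j u) (a + τ • w) (1 : ℂ) w
        rw [smul_eq_mul, mul_one] at e1
        have e2 : wd (-Complex.I) 1 (wdd i j u) (a + τ • w) = wdd (i + 1) j u (a + τ • w) := by
          simp only [wdd, Function.iterate_succ_apply']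
        have e3 : wd Complex.I 1 (wdd i j u) (a + τ • w) = wdd i (j + 1) u (a + τ • w) := by
          have := wd_iterate_comm (e := Complex.I) (e' := -Complex.I) (v := (1 : ℂ)) (v' := 1)
            Metric.isOpen_ball (hu.wd_iterate (e := Complex.I) (v := (1 : ℂ))
              Metric.isOpen_ball j) i hx
          simp only [wdd, Function.iterate_succ_apply'] at this ⊢
          exact this
        have e4 := wdd_sub_const_smul (a := a) Metric.isOpen_ball hu (i + 1) j hx
        rw [e1, e2, e3]
        simp only [φ]
        rw [e4]
        have hr : ∀ (r : ℝ) (x : E), r • x = (r : ℂ) • x := fun r x =>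
          (IsScalarTower.algebraMap_smul ℂ r x).symm
        have e5 : a + τ • w - a = (τ : ℂ) * w := by simp
        beta_reduce
        rw [e5]
        simp only [hr, Nat.add_sub_cancel]
        push_cast
        module
      have hmv : ‖g 1 - g 0‖ * ‖w‖ ^ (i + 1 - (l + 1)) ≤
          2 ^ (i + 1 - (l + 1)) * K (i + 1) j + C (j + 1) := by
        have hs := norm_image_sub_le_of_norm_deriv_le_segment_01'
          (f := fun τ => (‖w‖ ^ (i + 1 - (l + 1))) • g τ)
          (f' := fun τ => (‖w‖ ^ (i + 1 - (l + 1))) • (τ ^ i • (φ (a + τ • w)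
            + (τ * starRingEnd ℂ w) • wdd i (j + 1) u (a + τ • w))))
          (C := 2 ^ (i + 1 - (l + 1)) * K (i + 1) j + C (j + 1))
          (fun τ hτ => ((hderiv τ hτ).const_smul _).hasDerivWithinAt) ?_
        · rw [← smul_sub, norm_smul, norm_pow, norm_norm, mul_comm] at hs
          exact hs
        · intro τ hτ
          have hτ' : τ ∈ Set.Icc (0 : ℝ) 1 := ⟨hτ.1, hτ.2.le⟩
          have hx := hconv τ hτ'
          have hφ : ‖φ (a + τ • w)‖ ≤ K (i + 1) j := hb (i + 1) j _ hx
          have hCτ := hC a ha u hu hb (j + 1) _ hx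
          have e5 : a + τ • w - a = τ • w := by simp
          rw [e5, norm_smul, Real.norm_of_nonneg hτ.1] at hCτ
          set Z := ‖wdd i (j + 1) u (a + τ • w)‖ with hZ
          have hwn : 0 ≤ ‖w‖ := norm_nonneg _
          rw [norm_smul, norm_smul, norm_pow, norm_norm, norm_pow, Real.norm_of_nonneg hτ.1]
          have hn : ‖φ (a + τ • w) + (τ * starRingEnd ℂ w) • wdd i (j + 1) u (a + τ • w)‖
              ≤ K (i + 1) j + τ * ‖w‖ * Z := by
            refine (norm_add_le _ _).trans (add_le_add hφ ?_)
            rw [norm_smul, norm_mul, Complex.norm_real, RCLike.norm_conj,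
              Real.norm_of_nonneg hτ.1]
          have hCn : 0 ≤ C (j + 1) := le_trans (by positivity [hτ.1]) hCτ
          have hτi : τ ^ i ≤ 1 := pow_le_one₀ hτ.1 hτ.2.le
          have hτ0 : 0 ≤ τ := hτ.1
          -- Here `l ≤ i`. The factor `τ^{i-l}` of `τ^i` supplies the powers of `τ` needed to form
          -- `(τ ‖w‖)^{i+1-l}`, to which the previous bound applies.
          have hsplit : i + 1 - l = (i + 1 - (l + 1)) + 1 := by omega
          have hτl : τ ^ i = τ ^ l * τ ^ (i + 1 - (l + 1)) := by
            rw [← pow_add]; congr 1; omega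
          have hτl1 : τ ^ l ≤ 1 := pow_le_one₀ hτ.1 hτ.2.le
          calc ‖w‖ ^ (i + 1 - (l + 1)) * (τ ^ i * ‖φ (a + τ • w)
                + (τ * starRingEnd ℂ w) • wdd i (j + 1) u (a + τ • w)‖)
              ≤ ‖w‖ ^ (i + 1 - (l + 1)) * (τ ^ i * (K (i + 1) j + τ * ‖w‖ * Z)) := by gcongr
            _ = ‖w‖ ^ (i + 1 - (l + 1)) * (τ ^ i * K (i + 1) j)
                + τ ^ l * ((τ * ‖w‖) ^ (i + 1 - l) * Z) := by
                rw [hsplit, hτl]; ring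
            _ ≤ 2 ^ (i + 1 - (l + 1)) * (1 * K (i + 1) j) + 1 * C (j + 1) := by
                gcongr
            _ = _ := by ring
      have hg1 : g 1 - g 0 = wdd i j u t := by
        simp [g, hw]
      rw [hg1] at hmv
      linarith
  choose C hC using fun i => h1 i (i + 1) le_rfl
  refine ⟨C, fun a ha u hu hb i j t ht => ?_⟩
  simpa using hC i a ha u hu hb j t ht

/-- A smooth function `u` on the unit disc is bounded in terms of bounds for the derivatives of
`h u`, where `h` is holomorphic, uniformly in `h`. -/
theorem exists_bound_of_holomorphic_smul (N : ℕ) : ∀ (A c : ℝ), 0 < c → A < (3 / 2) ^ N * c →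
    ∀ K : ℕ → ℕ → ℝ, ∃ C : ℝ, ∀ (h : ℂ → ℂ) (u : ℂ → E),
      DifferentiableOn ℂ h (Metric.ball 0 5) →
      (∀ t ∈ Metric.closedBall (0 : ℂ) 4, ‖h t‖ ≤ A) →
      (∀ t ∈ Metric.sphere (0 : ℂ) 1, c ≤ ‖h t‖) →
      ContDiffOn ℝ ∞ u (Metric.ball 0 1) →
      (∀ i j, ∀ t ∈ Metric.ball (0 : ℂ) 1, ‖wdd i j (fun s => h s • u s) t‖ ≤ K i j) →
      ∀ t ∈ Metric.ball (0 : ℂ) 1, ‖u t‖ ≤ C := by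
  induction N with
  | zero =>
    intro A c hc hA K
    refine ⟨0, fun h u hh hA' hc' _ _ _ _ => ?_⟩
    -- In this case `A < c`, while `‖h 1‖` is at most `A` and at least `c`.
    exfalso
    have h1 := hA' 1 (by simp)
    have h2 := hc' 1 (by simp)
    simp at hA
    linarith
  | succ N ih =>
    intro A c hc hA K
    obtain ⟨K', hK'⟩ := exists_bound_wdd_of_sub_smul (E := E) K
    -- A zero `a` in the unit disc is at distance at least `3` from the circle of radius `4` and at
    -- most `2` from the unit circle. Dividing by `t - a` thus changes `(A, c)` into `(A / 3, c /
    -- 2)`, and `A / c` shrinks by the factor `2 / 3`: at most `N` zeros can be divided out.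
    obtain ⟨C, hC⟩ := ih (A / 3) (c / 2) (by positivity) (by rw [pow_succ] at hA; linarith) K'
    refine ⟨max C (K 0 0 / c), fun h u hh hA' hc' hu hb => ?_⟩
    by_cases hz : ∃ a ∈ Metric.ball (0 : ℂ) 1, h a = 0
    · obtain ⟨a, ha, ha0⟩ := hz
      have ha1 : ‖a‖ < 1 := by simpa using ha
      let h1 := dslope h a
      have hfac : ∀ t, h t = (t - a) * h1 t := by
        intro t
        have := sub_smul_dslope h a t
        simp only [smul_eq_mul, ha0, sub_zero] at this
        exact this.symm
      have h1d : DifferentiableOn ℂ h1 (Metric.ball 0 5) :=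
        (Complex.differentiableOn_dslope (Metric.isOpen_ball.mem_nhds (by
          simp; linarith))).2 hh
      have hsm : ContDiffOn ℝ ∞ (fun s => h1 s • u s) (Metric.ball 0 1) := by
        have : ContDiffOn ℂ ∞ h1 (Metric.ball 0 1) :=
          (h1d.contDiffOn Metric.isOpen_ball).mono (Metric.ball_subset_ball (by norm_num))
        exact (this.restrict_scalars ℝ).smul hu
      have heq : (fun s => h s • u s) = fun s => (s - a) • (h1 s • u s) := by
        funext s; rw [hfac, mul_smul]
      rw [heq] at hb
      have hb1 := hK' a ha _ hsm hb
      intro t ht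
      refine (hC h1 u h1d ?_ ?_ hu hb1 t ht).trans (le_max_left _ _)
      · intro t ht
        have hcl : closure (Metric.ball (0 : ℂ) 4) = Metric.closedBall 0 4 :=
          closure_ball _ (by norm_num)
        have hdc : DiffContOnCl ℂ h1 (Metric.ball 0 4) :=
          (h1d.mono (by
            rw [hcl]; exact Metric.closedBall_subset_ball (by norm_num))).diffContOnCl
        refine Complex.norm_le_of_forall_mem_frontier_norm_le Metric.isBounded_ball hdc ?_
          (hcl ▸ ht)
        intro z hz
        rw [frontier_ball _ (by norm_num)] at hz
        have hz4 : ‖z‖ = 4 := by simpa using hz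
        have h3 : 3 ≤ ‖z - a‖ := by linarith [norm_sub_norm_le z a]
        have h4 := hA' z (Metric.sphere_subset_closedBall hz)
        rw [hfac, norm_mul] at h4
        have := mul_le_mul_of_nonneg_right h3 (norm_nonneg (h1 z))
        linarith
      · intro t ht
        have ht1 : ‖t‖ = 1 := by simpa using ht
        have h3 : ‖t - a‖ ≤ 2 := by linarith [norm_sub_le t a]
        have h4 := hc' t ht
        rw [hfac, norm_mul] at h4
        have := mul_le_mul_of_nonneg_right h3 (norm_nonneg (h1 t))
        linarith
    · push Not at hz
      intro t ht
      have hcl : closure (Metric.ball (0 : ℂ) 1) = Metric.closedBall 0 1 :=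
        closure_ball _ (by norm_num)
      have hne : ∀ z ∈ Metric.closedBall (0 : ℂ) 1, h z ≠ 0 := by
        intro z hz'
        rcases (Metric.mem_closedBall.1 hz').lt_or_eq with h' | h'
        · exact hz z (Metric.mem_ball.2 h')
        · have := hc' z (Metric.mem_sphere.2 h')
          intro h0
          rw [h0, norm_zero] at this
          linarith
      -- Without zeros, the maximum principle for `1 / h` carries the lower bound from the circle
      -- into the disc.
      have hdc : DiffContOnCl ℂ (fun z => (h z)⁻¹) (Metric.ball 0 1) := by
        refine DifferentiableOn.diffContOnCl ?_
        rw [hcl]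
        exact (hh.mono (Metric.closedBall_subset_ball (by norm_num))).inv hne
      have hmin : ‖(h t)⁻¹‖ ≤ c⁻¹ := by
        refine Complex.norm_le_of_forall_mem_frontier_norm_le Metric.isBounded_ball hdc ?_
          (subset_closure ht)
        intro z hz
        rw [frontier_ball _ (by norm_num)] at hz
        rw [norm_inv]
        exact inv_anti₀ hc (hc' z hz)
      have hu0 : ‖h t • u t‖ ≤ K 0 0 := hb 0 0 t ht
      have : u t = (h t)⁻¹ • (h t • u t) := by
        rw [inv_smul_smul₀ (hne t (Metric.ball_subset_closedBall ht))]
      rw [this, norm_smul]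
      refine le_trans ?_ (le_max_right _ _)
      rw [div_eq_inv_mul]
      gcongr

end Division

/-! ### Division of holomorphic functions by the first coordinate. -/

section Hadamard

/-- Compactness of `[0, 1]` times a closed ball; the bound serves as dominating function under the
integral sign. -/
theorem exists_local_bound_of_continuousOn {V F : Type*} [NormedAddCommGroup V] [ProperSpace V]
    [NormedAddCommGroup F]
    {G : ℂ × V → F} {O : Set (ℂ × V)} {U : Set V} (hU : IsOpen U)
    (hG : ContinuousOn G O) (hOU : ∀ t ∈ Set.Icc (0 : ℝ) 1, ∀ z ∈ U, ((t : ℂ), z) ∈ O)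
    {z₀ : V} (hz : z₀ ∈ U) :
    ∃ ε > 0, Metric.ball z₀ ε ⊆ U ∧ ∃ C : ℝ, ∀ t ∈ Set.Icc (0 : ℝ) 1, ∀ z ∈ Metric.ball z₀ ε,
      ‖G ((t : ℂ), z)‖ ≤ C := by
  obtain ⟨ε, hε, hεU⟩ := Metric.nhds_basis_closedBall.mem_iff.1 (hU.mem_nhds hz)
  have hc : IsCompact (Set.Icc (0 : ℝ) 1 ×ˢ Metric.closedBall z₀ ε) :=
    isCompact_Icc.prod (isCompact_closedBall z₀ ε)
  have hcont : ContinuousOn (fun q : ℝ × V => G ((q.1 : ℂ), q.2))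
      (Set.Icc (0 : ℝ) 1 ×ˢ Metric.closedBall z₀ ε) := by
    refine hG.comp (by fun_prop) ?_
    rintro ⟨t, z⟩ ⟨ht, hz⟩
    exact hOU t ht z (hεU hz)
  obtain ⟨C, hC⟩ := hc.exists_bound_of_continuousOn hcont
  exact ⟨ε, hε, Metric.ball_subset_closedBall.trans hεU, C, fun t ht z hz =>
    hC (t, z) ⟨ht, Metric.ball_subset_closedBall hz⟩⟩

theorem continuousOn_slice {V F : Type*} [NormedAddCommGroup V]
    [NormedAddCommGroup F]
    {G : ℂ × V → F} {O : Set (ℂ × V)} (hG : ContinuousOn G O) {z : V}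
    (h : ∀ t ∈ Set.Icc (0 : ℝ) 1, ((t : ℂ), z) ∈ O) :
    ContinuousOn (fun t : ℝ => G ((t : ℂ), z)) (Set.Icc 0 1) :=
  hG.comp (by fun_prop) h

/-- Induction on the order with the codomain left free, because the derivative of the integral is
the integral of the partial derivative `G'`, whose values lie in `V →L[ℂ] F`. -/
theorem contDiffOn_parametric_integral {V : Type} [NormedAddCommGroup V] [NormedSpace ℂ V]
    [ProperSpace V] {U : Set V} (hU : IsOpen U) {O : Set (ℂ × V)} (hO : IsOpen O)
    (hOU : ∀ t ∈ Set.Icc (0 : ℝ) 1, ∀ z ∈ U, ((t : ℂ), z) ∈ O) (n : ℕ) :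
    ∀ {F : Type} [NormedAddCommGroup F] [NormedSpace ℝ F] [NormedSpace ℂ F]
      [IsScalarTower ℝ ℂ F] {G : ℂ × V → F}, ContDiffOn ℂ n G O →
      ContDiffOn ℂ n (fun z => ∫ t in (0 : ℝ)..1, G ((t : ℂ), z)) U := by
  have hI : Set.uIoc (0 : ℝ) 1 = Set.Ioc 0 1 := Set.uIoc_of_le zero_le_one
  have meas : ∀ {F : Type} [NormedAddCommGroup F] {G : ℂ × V → F}, ContinuousOn G O → ∀ z ∈ U,
      MeasureTheory.AEStronglyMeasurable (fun t : ℝ => G ((t : ℂ), z))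
        (MeasureTheory.volume.restrict (Set.uIoc (0 : ℝ) 1)) := by
    intro F _ G hG z hz
    rw [hI]
    exact ((continuousOn_slice hG fun t ht => hOU t ht z hz).mono
      Set.Ioc_subset_Icc_self).aestronglyMeasurable measurableSet_Ioc
  induction n with
  | zero =>
    intro F _ _ _ _ G hG
    have hGc := hG.continuousOn
    refine contDiffOn_zero.2 fun z₀ hz₀ => ?_
    obtain ⟨ε, hε, hεU, C, hC⟩ := exists_local_bound_of_continuousOn hU hGc hOU hz₀
    have hnear : ∀ᶠ z in nhdsWithin z₀ U, z ∈ Metric.ball z₀ ε :=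
      mem_nhdsWithin_of_mem_nhds (Metric.ball_mem_nhds _ hε)
    refine intervalIntegral.continuousWithinAt_of_dominated_interval (bound := fun _ => C) ?_ ?_
      intervalIntegrable_const ?_
    · filter_upwards [hnear] with z hz using meas hGc z (hεU hz)
    · filter_upwards [hnear] with z hz
      refine Filter.Eventually.of_forall fun t ht => hC t ?_ z hz
      rw [hI] at ht
      exact Set.Ioc_subset_Icc_self ht
    · refine Filter.Eventually.of_forall fun t ht => ?_
      rw [hI] at ht
      have hmem := hOU t (Set.Ioc_subset_Icc_self ht) z₀ hz₀
      have h1 : ContinuousAt G ((t : ℂ), z₀) := hGc.continuousAt (hO.mem_nhds hmem)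
      have h2 : ContinuousAt (fun z : V => ((t : ℂ), z)) z₀ := by fun_prop
      exact (ContinuousAt.comp (f := fun z : V => ((t : ℂ), z)) h1 h2).continuousWithinAt
  | succ n ih =>
    intro F _ _ _ _ G hG
    have hGc := hG.continuousOn
    let G' : ℂ × V → V →L[ℂ] F := fun q =>
      (fderiv ℂ G q).comp (ContinuousLinearMap.inr ℂ ℂ V)
    have hG' : ContDiffOn ℂ n G' O := by
      have h1 : ContDiffOn ℂ n (fderiv ℂ G) O :=
        hG.fderiv_of_isOpen hO (by norm_cast)
      exact h1.clm_comp contDiffOn_const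
    have hder : ∀ z₀ ∈ U, HasFDerivAt (fun z => ∫ t in (0 : ℝ)..1, G ((t : ℂ), z))
        (∫ t in (0 : ℝ)..1, G' ((t : ℂ), z₀)) z₀ := by
      intro z₀ hz₀
      obtain ⟨ε, hε, hεU, C, hC⟩ :=
        exists_local_bound_of_continuousOn hU hG'.continuousOn hOU hz₀
      refine intervalIntegral.hasFDerivAt_integral_of_dominated_of_fderiv_le
        (F' := fun z t => G' ((t : ℂ), z)) (bound := fun _ => C) (Metric.ball_mem_nhds z₀ hε)
        ?_ ?_ (meas hG'.continuousOn z₀ hz₀) ?_ intervalIntegrable_const ?_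
      · filter_upwards [Metric.ball_mem_nhds z₀ hε] with z hz using meas hGc z (hεU hz)
      · refine ContinuousOn.intervalIntegrable ?_
        rw [Set.uIcc_of_le zero_le_one]
        exact continuousOn_slice hGc fun t ht => hOU t ht z₀ hz₀
      · refine Filter.Eventually.of_forall fun t ht z hz => hC t ?_ z hz
        rw [hI] at ht
        exact Set.Ioc_subset_Icc_self ht
      · refine Filter.Eventually.of_forall fun t ht z hz => ?_
        rw [hI] at ht
        have hmem := hOU t (Set.Ioc_subset_Icc_self ht) z (hεU hz)
        have h1 : HasFDerivAt G (fderiv ℂ G ((t : ℂ), z)) ((t : ℂ), z) :=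
          ((hG.contDiffAt (hO.mem_nhds hmem)).differentiableAt (by simp)).hasFDerivAt
        have h2 : HasFDerivAt (fun z : V => ((t : ℂ), z)) (ContinuousLinearMap.inr ℂ ℂ V) z :=
          hasFDerivAt_prodMk_right _ _
        exact h1.comp z h2
    have hcast : ((n + 1 : ℕ) : WithTop ℕ∞) = (n : WithTop ℕ∞) + 1 := by norm_cast
    rw [hcast, contDiffOn_succ_iff_fderiv_of_isOpen hU]
    refine ⟨fun z hz => (hder z hz).differentiableAt.differentiableWithinAt, by simp, ?_⟩
    exact (ih hG').congr fun z hz => (hder z hz).fderiv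

variable {n : ℕ}

/-- Multiply the first coordinate by `t`. -/
def shrinkFirst (t : ℂ) (z : Cn (n + 1)) : Cn (n + 1) := z + ((t - 1) * z 0) • Pi.single 0 1

theorem shrinkFirst_mem_ball {p : Cn (n + 1)} (hp : p 0 = 0) {r : ℝ} {z : Cn (n + 1)}
    (hz : z ∈ Metric.ball p r) {t : ℝ} (ht : t ∈ Set.Icc (0 : ℝ) 1) :
    shrinkFirst t z ∈ Metric.ball p r := by
  rw [Metric.mem_ball, dist_eq_norm] at hz ⊢
  refine lt_of_le_of_lt ?_ hz
  rw [pi_norm_le_iff_of_nonneg (norm_nonneg _)]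
  intro i
  have hi := norm_le_pi_norm (z - p) i
  simp only [Pi.sub_apply] at hi ⊢
  by_cases h0 : i = 0
  · subst h0
    simp only [shrinkFirst, Pi.add_apply, Pi.smul_apply, Pi.single_eq_same, hp, sub_zero,
      smul_eq_mul, mul_one] at hi ⊢
    have : z 0 + (↑t - 1) * z 0 = t * z 0 := by ring
    rw [this, norm_mul, Complex.norm_real, Real.norm_of_nonneg ht.1]
    exact (mul_le_of_le_one_left (norm_nonneg _) ht.2).trans hi
  · simpa [shrinkFirst, Pi.single_eq_of_ne h0] using hi

/-- A holomorphic function vanishing on `z₁ = 0` is divisible by `z₁`. -/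
theorem exists_eq_first_mul {p : Cn (n + 1)} (hp : p 0 = 0) {r : ℝ} {g : Cn (n + 1) → ℂ}
    (hg : ContDiffOn ℂ ∞ g (Metric.ball p r))
    (h0 : ∀ z ∈ Metric.ball p r, z 0 = 0 → g z = 0) :
    ∃ h : Cn (n + 1) → ℂ, ContDiffOn ℂ ∞ h (Metric.ball p r) ∧
      ∀ z ∈ Metric.ball p r, g z = z 0 * h z := by
  let S : ℂ × Cn (n + 1) → Cn (n + 1) := fun q => shrinkFirst q.1 q.2
  have hS : ContDiff ℂ ∞ S := by
    simp only [S, shrinkFirst]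
    fun_prop
  let O := S ⁻¹' Metric.ball p r
  have hO : IsOpen O := Metric.isOpen_ball.preimage hS.continuous
  have hOU : ∀ t ∈ Set.Icc (0 : ℝ) 1, ∀ z ∈ Metric.ball p r, ((t : ℂ), z) ∈ O :=
    fun t ht z hz => shrinkFirst_mem_ball hp hz ht
  let G : ℂ × Cn (n + 1) → ℂ := fun q => fderiv ℂ g (S q) (Pi.single 0 1)
  have hG : ContDiffOn ℂ ∞ G O := by
    have h1 : ContDiffOn ℂ ∞ (fderiv ℂ g) (Metric.ball p r) :=
      hg.fderiv_of_isOpen Metric.isOpen_ball (by simp)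
    exact (h1.comp hS.contDiffOn fun q hq => hq).clm_apply contDiffOn_const
  -- Hadamard's formula `g(z) = z₁ ∫₀¹ (∂₁g)(t z₁, z') dt`, obtained by integrating `d/dt g(t z₁,
  -- z')`; the boundary term at `t = 0` vanishes by hypothesis.
  refine ⟨fun z => ∫ t in (0 : ℝ)..1, G ((t : ℂ), z), ?_, ?_⟩
  · rw [contDiffOn_infty]
    intro k
    exact contDiffOn_parametric_integral Metric.isOpen_ball hO hOU k (contDiffOn_infty.1 hG k)
  · intro z hz
    have hd : ∀ t ∈ Set.uIcc (0 : ℝ) 1, HasDerivAt (fun t : ℝ => g (shrinkFirst t z))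
        (z 0 * G ((t : ℂ), z)) t := by
      intro t ht
      rw [Set.uIcc_of_le zero_le_one] at ht
      have h1 : HasFDerivAt g (fderiv ℂ g (shrinkFirst t z)) (shrinkFirst t z) :=
        ((hg.contDiffAt (Metric.isOpen_ball.mem_nhds
          (shrinkFirst_mem_ball hp hz ht))).differentiableAt (by simp)).hasFDerivAt
      have h2 : HasDerivAt (fun s : ℂ => shrinkFirst s z) ((z 0) • Pi.single 0 1) (t : ℂ) := by
        have h3 : HasDerivAt (fun s : ℂ => (s - 1) * z 0) (z 0) (t : ℂ) := by
          simpa using ((hasDerivAt_id (t : ℂ)).sub_const 1).mul_const (z 0)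
        exact (h3.smul_const _).const_add z
      have h4 := (h1.comp_hasDerivAt (t : ℂ) h2).comp_ofReal
      simpa [G, S] using h4
    have hint : IntervalIntegrable (fun t : ℝ => z 0 * G ((t : ℂ), z))
        MeasureTheory.volume 0 1 := by
      refine ContinuousOn.intervalIntegrable ?_
      rw [Set.uIcc_of_le zero_le_one]
      exact continuousOn_const.mul
        (continuousOn_slice hG.continuousOn fun t ht => hOU t ht z hz)
    have hftc := intervalIntegral.integral_eq_sub_of_hasDerivAt hd hint
    rw [intervalIntegral.integral_const_mul] at hftc
    have e1 : shrinkFirst ((1 : ℝ) : ℂ) z = z := by simp [shrinkFirst]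
    have e0 : g (shrinkFirst ((0 : ℝ) : ℂ) z) = 0 :=
      h0 _ (shrinkFirst_mem_ball hp hz ⟨le_rfl, zero_le_one⟩) (by simp [shrinkFirst])
    rw [hftc, e1, e0, sub_zero]

theorem analyticAt_comp_line {V : Type*} [NormedAddCommGroup V] [NormedSpace ℂ V]
    {g : V → ℂ} {U : Set V} (hU : IsOpen U) (hg : ContDiffOn ℂ ∞ g U) (p v : V) (t : ℂ)
    (ht : p + t • v ∈ U) : AnalyticAt ℂ (fun s : ℂ => g (p + s • v)) t := by
  have hl : Continuous fun s : ℂ => p + s • v := by fun_prop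
  have hO : IsOpen ((fun s : ℂ => p + s • v) ⁻¹' U) := hU.preimage hl
  have hd : DifferentiableOn ℂ (fun s : ℂ => g (p + s • v)) ((fun s : ℂ => p + s • v) ⁻¹' U) :=
    (hg.differentiableOn (by simp)).comp (by fun_prop) fun s hs => hs
  exact hd.analyticAt (hO.mem_nhds ht)

/-- The identity theorem on the part of the line lying in the ball, which is convex, hence
connected, and contains the parameter `1` of `q`. -/
theorem not_eventually_comp_line_eq_zero {V : Type*} [NormedAddCommGroup V] [NormedSpace ℝ V]
    [NormedSpace ℂ V] [IsScalarTower ℝ ℂ V] {p q : V} {r : ℝ} {g : V → ℂ}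
    (hg : ContDiffOn ℂ ∞ g (Metric.ball p r)) (hq : q ∈ Metric.ball p r) (hgq : g q ≠ 0) :
    ¬ ∀ᶠ s in nhds (0 : ℂ), g (p + s • (q - p)) = 0 := by
  intro htop
  have hr : 0 < r := dist_nonneg.trans_lt hq
  let W := (fun s : ℂ => p + s • (q - p)) ⁻¹' Metric.ball p r
  have hW : IsPreconnected W := by
    have : Convex ℝ W := by
      intro s hs s' hs' a b ha hb hab
      have h1 := convex_ball p r (Set.mem_preimage.1 hs) (Set.mem_preimage.1 hs') ha hb hab
      have h2 : p + (a • s + b • s') • (q - p) = a • (p + s • (q - p)) + b • (p + s' • (q - p)) := by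
        have h3 : p = a • p + b • p := by rw [← add_smul, hab, one_smul]
        rw [smul_add, smul_add, add_smul, smul_assoc, smul_assoc]
        nth_rewrite 1 [h3]
        abel
      exact Set.mem_preimage.2 (h2 ▸ h1)
    exact this.isPreconnected
  have hz := AnalyticOnNhd.eqOn_zero_of_preconnected_of_eventuallyEq_zero
    (f := fun s : ℂ => g (p + s • (q - p))) (U := W)
    (fun s hs => analyticAt_comp_line Metric.isOpen_ball hg p _ s hs) hW (by simpa [W] using hr) htop
  have h1 : (1 : ℂ) ∈ W := by simpa [W] using hq
  have := hz h1
  simp at this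
  exact hgq this

/-- A holomorphic function which does not vanish on the ball is, near the centre of the ball,
a power of `z₁` times a function which does not vanish identically on `z₁ = 0`. -/
theorem exists_eq_pow_first_mul {p : Cn (n + 1)} (hp : p 0 = 0) {r : ℝ} {f : Cn (n + 1) → ℂ}
    (hf : ContDiffOn ℂ ∞ f (Metric.ball p r)) {q₀ : Cn (n + 1)} (hq₀ : q₀ ∈ Metric.ball p r)
    (hfq : f q₀ ≠ 0) :
    ∃ (k : ℕ) (g : Cn (n + 1) → ℂ), ContDiffOn ℂ ∞ g (Metric.ball p r) ∧
      (∀ z ∈ Metric.ball p r, f z = z 0 ^ k * g z) ∧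
      ∃ q ∈ Metric.ball p r, q 0 = 0 ∧ g q ≠ 0 := by
  by_contra hcon
  push Not at hcon
  -- If every quotient vanished on `z₁ = 0`, then `f` would be divisible by all powers of `z₁`.
  have hall : ∀ k : ℕ, ∃ g : Cn (n + 1) → ℂ, ContDiffOn ℂ ∞ g (Metric.ball p r) ∧
      ∀ z ∈ Metric.ball p r, f z = z 0 ^ k * g z := by
    intro k
    induction k with
    | zero => exact ⟨f, hf, by simp⟩
    | succ k ih =>
      obtain ⟨g, hg, hfg⟩ := ih
      obtain ⟨h, hh, hgh⟩ := exists_eq_first_mul hp hg (hcon k g hg hfg)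
      exact ⟨h, hh, fun z hz => by rw [hfg z hz, hgh z hz, pow_succ, mul_assoc]⟩
  set w := q₀ - p with hw
  have hr : 0 < r := dist_nonneg.trans_lt hq₀
  have hp0 : p + (0 : ℂ) • w ∈ Metric.ball p r := by simpa using hr
  have han := analyticAt_comp_line Metric.isOpen_ball hf p w 0 hp0
  -- On the line through `p` and `q₀` the factor `z₁^k` becomes a multiple of `s^k`, because `p 0 =
  -- 0`.
  have htop : analyticOrderAt (fun s : ℂ => f (p + s • w)) 0 = ⊤ := by
    refine ENat.eq_top_iff_forall_ge.2 fun k => ?_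
    obtain ⟨g, hg, hfg⟩ := hall k
    refine (natCast_le_analyticOrderAt han).2 ⟨fun s => w 0 ^ k * g (p + s • w),
      analyticAt_const.mul (analyticAt_comp_line Metric.isOpen_ball hg p w 0 hp0), ?_⟩
    have hl : Continuous fun s : ℂ => p + s • w := by fun_prop
    filter_upwards [(Metric.isOpen_ball.preimage hl).mem_nhds hp0] with s hs
    rw [hfg _ hs]
    simp [hp, mul_pow, mul_assoc]
  rw [analyticOrderAt_eq_top] at htop
  exact not_eventually_comp_line_eq_zero hf hq₀ hfq htop

end Hadamard

/-! ### Tangential discs, uniform bounds and a mean value inequality off the hyperplane. -/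

section Extension

variable {n : ℕ}

/-- A direction tangent to `z₁ = 0` in which `g` is bounded below on circles around all points
near `p`. -/
theorem exists_direction {p q : Cn (n + 1)} (hp : p 0 = 0) {r : ℝ} (hr : 0 < r)
    {g : Cn (n + 1) → ℂ}
    (hg : ContDiffOn ℂ ∞ g (Metric.ball p r)) (hq : q ∈ Metric.ball p r) (hq0 : q 0 = 0)
    (hgq : g q ≠ 0) :
    ∃ v : Cn (n + 1), v 0 = 0 ∧ ∃ c > 0, ∃ A : ℝ, ∃ ρ > 0, ρ ≤ r / 4 ∧
      (∀ p' ∈ Metric.ball p ρ, ∀ t ∈ Metric.ball (0 : ℂ) 5,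
        p' + t • v ∈ Metric.closedBall p (r / 2)) ∧
      (∀ p' ∈ Metric.ball p ρ, ∀ t ∈ Metric.sphere (0 : ℂ) 1, c ≤ ‖g (p' + t • v)‖) ∧
      (∀ z ∈ Metric.closedBall p (r / 2), ‖g z‖ ≤ A) := by
  have hsub : Metric.closedBall p (r / 2) ⊆ Metric.ball p r :=
    Metric.closedBall_subset_ball (by linarith)
  obtain ⟨A, hA⟩ := (isCompact_closedBall p (r / 2)).exists_bound_of_continuousOn
    (hg.continuousOn.mono hsub)
  set w := q - p with hw
  have han := analyticAt_comp_line Metric.isOpen_ball hg p w 0 (by simpa using hr)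
  have hne := han.eventually_eq_zero_or_eventually_ne_zero.resolve_left
    (not_eventually_comp_line_eq_zero hg hq hgq)
  rw [eventually_nhdsWithin_iff] at hne
  obtain ⟨δ₀, hδ₀, hδ₀'⟩ := Metric.eventually_nhds_iff.1 hne
  -- `δ < δ₀` puts the unit circle in the direction `v = δ w` inside the punctured disc where `g ≠
  -- 0`. The bound `5 δ ‖w‖ ≤ r / 4` keeps discs of radius `5` centred within `r / 4` of `p` inside
  -- the ball of radius `r / 2`.
  obtain ⟨δ, hδ, hδ1, hδ2⟩ : ∃ δ : ℝ, 0 < δ ∧ δ < δ₀ ∧ 5 * (δ * ‖w‖) ≤ r / 4 := by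
    refine ⟨min (δ₀ / 2) (r / 4 / (5 * (‖w‖ + 1))), by positivity, ?_, ?_⟩
    · exact (min_le_left _ _).trans_lt (by linarith)
    · have h1 : min (δ₀ / 2) (r / 4 / (5 * (‖w‖ + 1))) ≤ r / 4 / (5 * (‖w‖ + 1)) :=
        min_le_right _ _
      have h2 : r / 4 / (5 * (‖w‖ + 1)) * (5 * (‖w‖ + 1)) = r / 4 := by
        field_simp
      have h3 : 0 ≤ ‖w‖ := norm_nonneg _
      have h4 : 0 < min (δ₀ / 2) (r / 4 / (5 * (‖w‖ + 1))) := by positivity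
      nlinarith [mul_le_mul_of_nonneg_right h1 (by positivity : 0 ≤ 5 * (‖w‖ + 1))]
  set v : Cn (n + 1) := (δ : ℂ) • w with hv
  have hvn : ‖v‖ = δ * ‖w‖ := by
    rw [hv, norm_smul, Complex.norm_real, Real.norm_of_nonneg hδ.le]
  have hline : ∀ p' ∈ Metric.ball p (r / 4), ∀ t ∈ Metric.ball (0 : ℂ) 5,
      p' + t • v ∈ Metric.closedBall p (r / 2) := by
    intro p' hp' t ht
    rw [Metric.mem_closedBall, dist_eq_norm]
    rw [Metric.mem_ball, dist_eq_norm] at hp'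
    have ht' : ‖t‖ < 5 := by simpa using ht
    calc ‖p' + t • v - p‖ = ‖(p' - p) + t • v‖ := by congr 1; abel
      _ ≤ ‖p' - p‖ + ‖t • v‖ := norm_add_le _ _
      _ ≤ r / 4 + 5 * (δ * ‖w‖) := by
          rw [norm_smul, hvn]
          gcongr
      _ ≤ r / 2 := by linarith
  have hs : (Metric.sphere (0 : ℂ) 1) ⊆ Metric.ball 0 5 := fun t ht => by
    have : ‖t‖ = 1 := by simpa using ht
    simp [this]
  have hpp : p ∈ Metric.ball p (r / 4) := Metric.mem_ball_self (by linarith)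
  have hcont : ContinuousOn (fun t : ℂ => ‖g (p + t • v)‖) (Metric.sphere 0 1) :=
    (hg.continuousOn.comp (by fun_prop) fun t ht => hsub (hline p hpp t (hs ht))).norm
  obtain ⟨t₀, ht₀, hmin⟩ := (isCompact_sphere (0 : ℂ) 1).exists_isMinOn
    (NormedSpace.sphere_nonempty.2 zero_le_one) hcont
  have hpos : 0 < ‖g (p + t₀ • v)‖ := by
    rw [norm_pos_iff, hv, smul_smul]
    have ht : ‖t₀‖ = 1 := by simpa using ht₀
    refine hδ₀' ?_ ?_
    · rw [dist_zero_right, norm_mul, ht, one_mul, Complex.norm_real, Real.norm_of_nonneg hδ.le]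
      exact hδ1
    · simp only [Set.mem_compl_iff, Set.mem_singleton_iff, mul_eq_zero, not_or]
      exact ⟨fun h => by simp [h] at ht, by exact_mod_cast hδ.ne'⟩
  set c₀ := ‖g (p + t₀ • v)‖ with hc₀
  let Φ : Cn (n + 1) × ℂ → Cn (n + 1) := fun q => q.1 + q.2 • v
  have hΦ : Continuous Φ := by fun_prop
  have hO : IsOpen (Φ ⁻¹' (Metric.ball p r ∩ (fun z => ‖g z‖) ⁻¹' Set.Ioi (c₀ / 2))) :=
    (hg.continuousOn.norm.isOpen_inter_preimage Metric.isOpen_ball isOpen_Ioi).preimage hΦ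
  -- The minimum `c₀` on the circle around `p` persists as the bound `c₀ / 2` on the circles around
  -- all nearby centres.
  obtain ⟨u, u', hu, hu', hpu, hsu', huu'⟩ := generalized_tube_lemma (isCompact_singleton (x := p))
    (isCompact_sphere (0 : ℂ) 1) hO (by
      rintro ⟨p', t⟩ ⟨hp', ht⟩
      obtain rfl : p' = p := hp'
      refine ⟨hsub (hline _ hpp t (hs ht)), ?_⟩
      have : c₀ ≤ ‖g (p' + t • v)‖ := hmin ht
      simp only [Φ, Set.mem_preimage, Set.mem_Ioi]
      linarith)
  obtain ⟨ρ₀, hρ₀, hρ₀'⟩ := Metric.isOpen_iff.1 hu p (hpu rfl)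
  refine ⟨v, ?_, c₀ / 2, by positivity, A, min ρ₀ (r / 4), by positivity, min_le_right _ _,
    ?_, ?_, hA⟩
  · simp [hv, hw, hp, hq0]
  · intro p' hp'
    exact hline p' (Metric.ball_subset_ball (min_le_right _ _) hp')
  · intro p' hp' t ht
    have := huu' (Set.mk_mem_prod (hρ₀' (Metric.ball_subset_ball (min_le_left _ _) hp')) (hsu' ht))
    exact (Set.mem_Ioi.1 this.2).le

/-- The direction `v` is tangent to `z₁ = 0`, so a disc in this direction around a point off the
hyperplane stays off it, and `u` is smooth there. The division estimate is uniform in the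
holomorphic factor, so the bound does not degenerate as the disc approaches the hyperplane. The
radius `ρ` is fixed before `E`, `k`, `u` and `b` because the lemma will be applied to `u` and to its
derivatives. -/
theorem exists_bound_of_pow_smul {p q : Cn (n + 1)} (hp : p 0 = 0) {r : ℝ} (hr : 0 < r)
    {g : Cn (n + 1) → ℂ}
    (hg : ContDiffOn ℂ ∞ g (Metric.ball p r)) (hq : q ∈ Metric.ball p r) (hq0 : q 0 = 0)
    (hgq : g q ≠ 0) :
    ∃ ρ > 0, ρ ≤ r / 4 ∧ ∀ (E : Type) [NormedAddCommGroup E] [NormedSpace ℝ E] [NormedSpace ℂ E]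
      [IsScalarTower ℝ ℂ E] (k : ℕ) (u b : Cn (n + 1) → E),
      ContDiffOn ℝ ∞ u (Metric.ball p r ∩ {z | z 0 ≠ 0}) →
      ContDiffOn ℝ ∞ b (Metric.ball p r) →
      (∀ z ∈ Metric.ball p r, z 0 ≠ 0 → g z ^ k • u z = b z) →
      ∃ C : ℝ, ∀ z ∈ Metric.ball p ρ, z 0 ≠ 0 → ‖u z‖ ≤ C := by
  obtain ⟨v, hv0, c, hc, A, ρ, hρ, hρr, hline, hlow, hA⟩ := exists_direction hp hr hg hq hq0 hgq
  refine ⟨ρ, hρ, hρr, fun E _ _ _ _ k u b hu hb hub => ?_⟩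
  have hsub : Metric.closedBall p (r / 2) ⊆ Metric.ball p r :=
    Metric.closedBall_subset_ball (by linarith)
  have hK : ∀ i j : ℕ, ∃ K : ℝ, ∀ z ∈ Metric.closedBall p (r / 2),
      ‖(wd (-Complex.I) v)^[i] ((wd Complex.I v)^[j] b) z‖ ≤ K := fun i j =>
    (isCompact_closedBall p (r / 2)).exists_bound_of_continuousOn
      ((((hb.wd_iterate Metric.isOpen_ball j).wd_iterate
        Metric.isOpen_ball i).continuousOn).mono hsub)
  choose K hK using hK
  obtain ⟨N, hN⟩ := pow_unbounded_of_one_lt (A ^ k / c ^ k) (by norm_num : (1 : ℝ) < 3 / 2)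
  have hN' : A ^ k < (3 / 2) ^ N * c ^ k := by
    rwa [div_lt_iff₀ (by positivity)] at hN
  obtain ⟨C, hC⟩ := exists_bound_of_holomorphic_smul (E := E) N (A ^ k) (c ^ k) (by positivity)
    hN' K
  refine ⟨C, fun z hz hz0 => ?_⟩
  have hO : IsOpen (Metric.ball p r ∩ {z : Cn (n + 1) | z 0 ≠ 0}) :=
    Metric.isOpen_ball.inter (isOpen_ne_fun (by fun_prop) continuous_const)
  have hzl : ∀ t ∈ Metric.ball (0 : ℂ) 5, z + t • v ∈ Metric.ball p r ∩ {z | z 0 ≠ 0} :=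
    fun t ht => ⟨hsub (hline z hz t ht), by simpa [hv0] using hz0⟩
  have h15 : Metric.ball (0 : ℂ) 1 ⊆ Metric.ball 0 5 := Metric.ball_subset_ball (by norm_num)
  have hl : ContDiff ℝ ∞ fun t : ℂ => z + t • v := by fun_prop
  have key := hC (fun t => g (z + t • v) ^ k) (fun t => u (z + t • v)) ?_ ?_ ?_ ?_ ?_ 0 (by simp)
  · simpa using key
  · exact ((hg.differentiableOn (by simp)).comp (by fun_prop)
      fun t ht => (hzl t ht).1).pow k
  · intro t ht
    rw [norm_pow]
    gcongr
    refine hA _ (hline z hz t ?_)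
    exact Metric.closedBall_subset_ball (by norm_num) ht
  · intro t ht
    rw [norm_pow]
    gcongr
    exact hlow z hz t ht
  · exact hu.comp hl.contDiffOn fun t ht => hzl t (h15 ht)
  · intro i j t ht
    have heq : Set.EqOn (fun s : ℂ => g (z + s • v) ^ k • u (z + s • v)) (fun s => b (z + s • v))
        (Metric.ball 0 1) := fun s hs => hub _ (hzl s (h15 hs)).1 (hzl s (h15 hs)).2
    rw [wdd_eqOn Metric.isOpen_ball heq i j ht]
    have h1 := wd_iterate_comp_line (e := Complex.I) (W := Metric.ball (0 : ℂ) 1)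
      Metric.isOpen_ball Metric.isOpen_ball (fun t ht => (hzl t (h15 ht)).1) hb j
    have h2 := wd_iterate_comp_line (e := -Complex.I) (W := Metric.ball (0 : ℂ) 1)
      Metric.isOpen_ball Metric.isOpen_ball (fun t ht => (hzl t (h15 ht)).1)
      (hb.wd_iterate (e := Complex.I) (v := v) Metric.isOpen_ball j) i
    have h3 := wd_iterate_eqOn (e := -Complex.I) (v := (1 : ℂ)) Metric.isOpen_ball h1 i ht
    rw [wdd, h3, h2 ht]
    exact hK i j _ (hline z hz t (h15 ht))

theorem dense_first_ne_zero : Dense {z : Cn (n + 1) | z 0 ≠ 0} := by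
  have h : {z : Cn (n + 1) | z 0 ≠ 0} = (fun z : Cn (n + 1) => z 0) ⁻¹' {0}ᶜ := rfl
  rw [h]
  have ho : IsOpenMap (fun z : Cn (n + 1) => z 0) := isOpenMap_eval 0
  exact (dense_compl_singleton (0 : ℂ)).preimage ho

/-- The mean value inequality on the complement of `z₁ = 0`. -/
theorem norm_sub_le_of_norm_fderiv_le_first_ne_zero {E : Type*} [NormedAddCommGroup E]
    [NormedSpace ℝ E] {B : Set (Cn (n + 1))} (hB : IsOpen B) (hBc : Convex ℝ B)
    {f : Cn (n + 1) → E} {K : ℝ}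
    (hf : ∀ z ∈ B, z 0 ≠ 0 → DifferentiableAt ℝ f z)
    (hK : ∀ z ∈ B, z 0 ≠ 0 → ‖fderiv ℝ f z‖ ≤ K)
    {x y : Cn (n + 1)} (hx : x ∈ B) (hx0 : x 0 ≠ 0) (hy : y ∈ B) (hy0 : y 0 ≠ 0) :
    ‖f y - f x‖ ≤ K * ‖y - x‖ := by
  -- The segment from `x` to `y` may cross `z₁ = 0`. Moving the end point by `s i x₀` in the first
  -- coordinate avoids this: after division by `x₀`, a crossing forces the imaginary part of `y₀ /
  -- x₀ + s i` to vanish, which excludes a single value of `s`. Then `s` tends to `0`.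
  let Y : ℝ → Cn (n + 1) := fun s => y + ((s : ℂ) * (Complex.I * x 0)) • Pi.single 0 1
  have hYc : Continuous Y := by fun_prop
  have hY0 : Y 0 = y := by simp [Y]
  have hev : ∀ᶠ s in nhdsWithin (0 : ℝ) (Set.Ioi 0), ‖f (Y s) - f x‖ ≤ K * ‖Y s - x‖ := by
    have h1 : ∀ᶠ s in nhdsWithin (0 : ℝ) (Set.Ioi 0), Y s ∈ B :=
      (hYc.tendsto' 0 y hY0).mono_left nhdsWithin_le_nhds (hB.mem_nhds hy)
    have h2 : ∀ᶠ s in nhdsWithin (0 : ℝ) (Set.Ioi 0), s ≠ -(y 0 / x 0).im := by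
      by_cases h : (y 0 / x 0).im = 0
      · filter_upwards [self_mem_nhdsWithin] with s hs
        rw [h, neg_zero]
        exact (Set.mem_Ioi.1 hs).ne'
      · exact Filter.Eventually.filter_mono nhdsWithin_le_nhds
          (eventually_ne_nhds (neg_ne_zero.2 h).symm)
    filter_upwards [h1, h2] with s hs1 hs2
    have hseg : ∀ z ∈ segment ℝ x (Y s), z ∈ B ∧ z 0 ≠ 0 := by
      intro z hz
      refine ⟨hBc.segment_subset hx hs1 hz, ?_⟩
      obtain ⟨a, b, ha, hb, hab, rfl⟩ := hz
      intro h0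
      have h3 : (a : ℂ) * x 0 + b * (y 0 + s * (Complex.I * x 0)) = 0 := by
        simpa [Y, mul_add] using h0
      have h4 : (a : ℂ) + b * (y 0 / x 0 + s * Complex.I) = 0 := by
        have : ((a : ℂ) + b * (y 0 / x 0 + s * Complex.I)) * x 0 = 0 := by
          rw [← h3]; field_simp
        exact (mul_eq_zero.1 this).resolve_right hx0
      have him := congrArg Complex.im h4
      simp at him
      rcases him with hb0 | h5
      · have : a = 1 := by linarith
        rw [hb0, this] at h4
        simp at h4
      · exact hs2 (by linarith)
    exact Convex.norm_image_sub_le_of_norm_fderiv_le (s := segment ℝ x (Y s))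
      (fun z hz => hf z (hseg z hz).1 (hseg z hz).2) (fun z hz => hK z (hseg z hz).1 (hseg z hz).2)
      (convex_segment _ _) (left_mem_segment _ _ _) (right_mem_segment _ _ _)
  have hYt : Filter.Tendsto Y (nhdsWithin (0 : ℝ) (Set.Ioi 0)) (nhds y) :=
    (hYc.tendsto' 0 y hY0).mono_left nhdsWithin_le_nhds
  have hl : Filter.Tendsto (fun s => ‖f (Y s) - f x‖) (nhdsWithin (0 : ℝ) (Set.Ioi 0))
      (nhds ‖f y - f x‖) :=
    (((hf y hy hy0).continuousAt.tendsto.comp hYt).sub_const _).norm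
  have hr : Filter.Tendsto (fun s => K * ‖Y s - x‖) (nhdsWithin (0 : ℝ) (Set.Ioi 0))
      (nhds (K * ‖y - x‖)) := ((hYt.sub_const _).norm).const_mul K
  exact le_of_tendsto_of_tendsto hl hr hev

end Extension

/-! ### Smooth extension across the hyperplane. -/

section Extension

variable {n : ℕ}

theorem isOpen_first_ne_zero : IsOpen {z : Cn (n + 1) | z 0 ≠ 0} :=
  isOpen_ne_fun (by fun_prop) continuous_const

/-- A function with bounded derivative outside `z₁ = 0` has limits at the points of `z₁ = 0`. -/
theorem exists_tendsto_of_fderiv_bounded {E : Type*} [NormedAddCommGroup E]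
    [NormedSpace ℝ E] [CompleteSpace E] {p : Cn (n + 1)} {ρ : ℝ}
    {f : Cn (n + 1) → E} {K : ℝ}
    (hf : ∀ z ∈ Metric.ball p ρ, z 0 ≠ 0 → DifferentiableAt ℝ f z)
    (hK : ∀ z ∈ Metric.ball p ρ, z 0 ≠ 0 → ‖fderiv ℝ f z‖ ≤ K)
    {z : Cn (n + 1)} (hz : z ∈ Metric.ball p ρ) :
    ∃ y, Filter.Tendsto f (nhdsWithin z {z | z 0 ≠ 0}) (nhds y) := by
  have hne : (nhdsWithin z {z : Cn (n + 1) | z 0 ≠ 0}).NeBot :=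
    mem_closure_iff_nhdsWithin_neBot.1 (dense_first_ne_zero z)
  refine cauchy_map_iff_exists_tendsto.1 ?_
  rw [Metric.cauchy_iff]
  refine ⟨Filter.map_neBot, fun ε hε => ?_⟩
  let δ := ε / (2 * (|K| + 1))
  have hδ : 0 < δ := by positivity
  refine ⟨f '' (Metric.ball p ρ ∩ Metric.ball z δ ∩ {z | z 0 ≠ 0}), ?_, ?_⟩
  · refine Filter.image_mem_map (Filter.inter_mem (mem_nhdsWithin_of_mem_nhds
      (Filter.inter_mem (Metric.isOpen_ball.mem_nhds hz) (Metric.ball_mem_nhds z hδ)))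
      self_mem_nhdsWithin)
  · rintro _ ⟨x, ⟨⟨hx, hxz⟩, hx0⟩, rfl⟩ _ ⟨y, ⟨⟨hy, hyz⟩, hy0⟩, rfl⟩
    have h1 := norm_sub_le_of_norm_fderiv_le_first_ne_zero Metric.isOpen_ball (convex_ball p ρ)
      hf hK hy hy0 hx hx0
    rw [dist_eq_norm]
    have h2 : ‖x - y‖ < 2 * δ := by
      rw [← dist_eq_norm]
      linarith [dist_triangle_right x y z, Metric.mem_ball.1 hxz, Metric.mem_ball.1 hyz]
    calc ‖f x - f y‖ ≤ K * ‖x - y‖ := h1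
      _ ≤ (|K| + 1) * ‖x - y‖ := by
          gcongr
          linarith [le_abs_self K]
      _ < (|K| + 1) * (2 * δ) := by gcongr
      _ = ε := by simp only [δ]; field_simp

/-- If the derivative of `f` extends across `z₁ = 0`, so does `f`, and its extension is
differentiable. -/
theorem hasFDerivAt_extendFrom {E : Type*} [NormedAddCommGroup E]
    [NormedSpace ℝ E] {p : Cn (n + 1)} {ρ : ℝ}
    {f : Cn (n + 1) → E}
    (hf : ∀ z ∈ Metric.ball p ρ, z 0 ≠ 0 → DifferentiableAt ℝ f z)
    (hlim : ∀ z ∈ Metric.ball p ρ, ∃ y, Filter.Tendsto f (nhdsWithin z {z | z 0 ≠ 0}) (nhds y))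
    {z : Cn (n + 1)} (hz : z ∈ Metric.ball p ρ) {L : Cn (n + 1) →L[ℝ] E}
    (hL : Filter.Tendsto (fderiv ℝ f) (nhdsWithin z {z | z 0 ≠ 0}) (nhds L)) :
    HasFDerivAt (extendFrom {z | z 0 ≠ 0} f) L z := by
  set S := {z : Cn (n + 1) | z 0 ≠ 0} with hS
  have hne : ∀ z, (nhdsWithin z S).NeBot := fun z =>
    mem_closure_iff_nhdsWithin_neBot.1 (dense_first_ne_zero z)
  rw [hasFDerivAt_iff_isLittleO]
  refine Asymptotics.isLittleO_iff.2 fun ε hε => ?_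
  have h1 : ∀ᶠ x in nhdsWithin z S, ‖fderiv ℝ f x - L‖ ≤ ε := by
    have := hL.eventually (Metric.closedBall_mem_nhds L hε)
    filter_upwards [this] with x hx
    rwa [dist_eq_norm] at hx
  rw [eventually_nhdsWithin_iff, Metric.eventually_nhds_iff_ball] at h1
  obtain ⟨δ₀, hδ₀, h1⟩ := h1
  obtain ⟨δ, hδ, hδb⟩ := Metric.isOpen_iff.1 (Metric.isOpen_ball.inter Metric.isOpen_ball) z
    (show z ∈ Metric.ball z δ₀ ∩ Metric.ball p ρ from ⟨Metric.mem_ball_self hδ₀, hz⟩)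
  -- Near `z` the derivative of `f - L` is at most `ε`, so `f - L` is `ε`-Lipschitz off the
  -- hyperplane. `h3` and `h4` then pass to the limit in one end point and in the other.
  have h2 : ∀ x ∈ Metric.ball z δ, x ∈ S → ∀ y ∈ Metric.ball z δ, y ∈ S →
      ‖(f y - L y) - (f x - L x)‖ ≤ ε * ‖y - x‖ := by
    intro x hx hx0 y hy hy0
    refine norm_sub_le_of_norm_fderiv_le_first_ne_zero (f := fun w => f w - L w)
      Metric.isOpen_ball (convex_ball z δ) ?_ ?_ hx hx0 hy hy0
    · intro w hw hw0
      exact (hf w (hδb hw).2 hw0).sub L.differentiableAt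
    · intro w hw hw0
      rw [fderiv_fun_sub (hf w (hδb hw).2 hw0) L.differentiableAt, L.fderiv]
      exact h1 w (hδb hw).1 hw0
  have hF : ∀ x ∈ Metric.ball z δ, Filter.Tendsto (fun w => f w - L w) (nhdsWithin x S)
      (nhds (extendFrom S f x - L x)) := fun x hx =>
    (tendsto_extendFrom (hlim x (hδb hx).2)).sub
      ((L.continuous.tendsto x).mono_left nhdsWithin_le_nhds)
  have hball : ∀ x ∈ Metric.ball z δ, ∀ᶠ w in nhdsWithin x S, w ∈ Metric.ball z δ ∧ w ∈ S :=
    fun x hx => Filter.inter_mem (mem_nhdsWithin_of_mem_nhds (Metric.isOpen_ball.mem_nhds hx))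
      self_mem_nhdsWithin
  have hzb : z ∈ Metric.ball z δ := Metric.mem_ball_self hδ
  have h3 : ∀ y ∈ Metric.ball z δ, y ∈ S →
      ‖(f y - L y) - (extendFrom S f z - L z)‖ ≤ ε * ‖y - z‖ := by
    intro y hy hy0
    have hid : Filter.Tendsto (fun w : Cn (n + 1) => w) (nhdsWithin z S) (nhds z) :=
      nhdsWithin_le_nhds
    refine le_of_tendsto_of_tendsto ((tendsto_const_nhds.sub (hF z hzb)).norm)
      (((tendsto_const_nhds (x := y)).sub hid).norm.const_mul ε) ?_
    filter_upwards [hball z hzb] with w hw using h2 w hw.1 hw.2 y hy hy0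
  filter_upwards [Metric.ball_mem_nhds z hδ] with x hx
  have hid : Filter.Tendsto (fun w : Cn (n + 1) => w) (nhdsWithin x S) (nhds x) :=
    nhdsWithin_le_nhds
  have h4 : ‖(extendFrom S f x - L x) - (extendFrom S f z - L z)‖ ≤ ε * ‖x - z‖ := by
    refine le_of_tendsto_of_tendsto (((hF x hx).sub tendsto_const_nhds).norm)
      ((hid.sub (tendsto_const_nhds (x := z))).norm.const_mul ε) ?_
    filter_upwards [hball x hx] with w hw using h3 w hw.1 hw.2
  rw [map_sub]
  convert! h4 using 2
  abel

-- Induction on `m` over all `E` and `k` at once: if `g^k u` is smooth, then so is `g^{k+1} du`, and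
-- `du` satisfies the same hypothesis with values in a larger space. Applied to `du` and `d²u`, the
-- bounds give limits of `u` and `du` at the hyperplane; the extension of `u` then has the extension
-- of `du` as derivative.
set_option synthInstance.maxHeartbeats 200000 in
theorem contDiffOn_extendFrom_of_bounds {p : Cn (n + 1)} {r ρ : ℝ} (hρr : ρ ≤ r)
    {g : Cn (n + 1) → ℂ} (hg : ContDiffOn ℂ ∞ g (Metric.ball p r))
    (hbound : ∀ (E : Type) [NormedAddCommGroup E] [NormedSpace ℝ E] [NormedSpace ℂ E]
      [IsScalarTower ℝ ℂ E] (k : ℕ) (u b : Cn (n + 1) → E),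
      ContDiffOn ℝ ∞ u (Metric.ball p r ∩ {z | z 0 ≠ 0}) →
      ContDiffOn ℝ ∞ b (Metric.ball p r) →
      (∀ z ∈ Metric.ball p r, z 0 ≠ 0 → g z ^ k • u z = b z) →
      ∃ C : ℝ, ∀ z ∈ Metric.ball p ρ, z 0 ≠ 0 → ‖u z‖ ≤ C) (m : ℕ) :
    ∀ (E : Type) [NormedAddCommGroup E] [NormedSpace ℝ E] [NormedSpace ℂ E]
      [IsScalarTower ℝ ℂ E] [CompleteSpace E] (k : ℕ) (u b : Cn (n + 1) → E),
      ContDiffOn ℝ ∞ u (Metric.ball p r ∩ {z | z 0 ≠ 0}) →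
      ContDiffOn ℝ ∞ b (Metric.ball p r) →
      (∀ z ∈ Metric.ball p r, z 0 ≠ 0 → g z ^ k • u z = b z) →
      ContDiffOn ℝ m (extendFrom {z | z 0 ≠ 0} u) (Metric.ball p ρ) := by
  have hO : IsOpen (Metric.ball p r ∩ {z : Cn (n + 1) | z 0 ≠ 0}) :=
    Metric.isOpen_ball.inter isOpen_first_ne_zero
  have hgr : ContDiffOn ℝ ∞ g (Metric.ball p r) := hg.restrict_scalars ℝ
  have hbr := Metric.ball_subset_ball (x := p) hρr
  have hder : ∀ (E : Type) [NormedAddCommGroup E] [NormedSpace ℝ E] [NormedSpace ℂ E]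
      [IsScalarTower ℝ ℂ E] [CompleteSpace E] (k : ℕ) (u b : Cn (n + 1) → E),
      ContDiffOn ℝ ∞ u (Metric.ball p r ∩ {z | z 0 ≠ 0}) →
      ContDiffOn ℝ ∞ b (Metric.ball p r) →
      (∀ z ∈ Metric.ball p r, z 0 ≠ 0 → g z ^ k • u z = b z) →
      ∃ b' : Cn (n + 1) → (Cn (n + 1) →L[ℝ] E), ContDiffOn ℝ ∞ b' (Metric.ball p r) ∧
        ∀ z ∈ Metric.ball p r, z 0 ≠ 0 → g z ^ (k + 1) • fderiv ℝ u z = b' z := by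
    intro E _ _ _ _ _ k u b hu hb hub
    -- Differentiating `g^k u = b` and multiplying by `g` gives `g^{k+1} du = g db - k b dg`.
    refine ⟨fun z => g z • fderiv ℝ b z - (k : ℂ) •
      ((ContinuousLinearMap.lsmul ℝ ℂ : ℂ →L[ℝ] E →L[ℝ] E).flip (b z)).comp (fderiv ℝ g z),
      ?_, ?_⟩
    · have h1 : ContDiffOn ℝ ∞ (fderiv ℝ b) (Metric.ball p r) :=
        hb.fderiv_of_isOpen Metric.isOpen_ball (by simp)
      have h2 : ContDiffOn ℝ ∞ (fderiv ℝ g) (Metric.ball p r) :=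
        hgr.fderiv_of_isOpen Metric.isOpen_ball (by simp)
      refine (hgr.smul h1).sub (ContDiffOn.const_smul _ (ContDiffOn.clm_comp ?_ h2))
      exact (ContinuousLinearMap.contDiff _).comp_contDiffOn hb
    · intro z hz hz0
      have hdu : DifferentiableAt ℝ u z :=
        (hu.contDiffAt (hO.mem_nhds ⟨hz, hz0⟩)).differentiableAt (by simp)
      have hdg : DifferentiableAt ℝ g z :=
        (hgr.contDiffAt (Metric.isOpen_ball.mem_nhds hz)).differentiableAt (by simp)
      have hev : (fun w => g w ^ k • u w) =ᶠ[nhds z] b := by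
        filter_upwards [hO.mem_nhds ⟨hz, hz0⟩] with w hw using hub w hw.1 hw.2
      ext v
      have h1 := fderiv_complex_smul (hdg.pow k) hdu v
      have h2 : fderiv ℝ (fun w => (g ^ k) w • u w) z v = fderiv ℝ b z v := by
        have := hev.fderiv_eq (𝕜 := ℝ)
        exact congrArg (fun T => T v) this
      have h3 : fderiv ℝ (g ^ k) z v = k * g z ^ (k - 1) * fderiv ℝ g z v := by
        have : fderiv ℝ (g ^ k) z = _ := (hdg.hasFDerivAt.pow k).fderiv
        rw [this]
        simp [mul_assoc]
      rw [h2, h3] at h1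
      have h4 := hub z hz hz0
      simp only [smul_apply, sub_apply, ContinuousLinearMap.comp_apply,
        ContinuousLinearMap.flip_apply, ContinuousLinearMap.lsmul_apply]
      rw [h1, ← h4]
      rcases k with _ | k
      · simp
      · simp only [Pi.pow_apply, Nat.add_sub_cancel]
        match_scalars <;> ring
  induction m with
  | zero =>
    intro E _ _ _ _ _ k u b hu hb hub
    obtain ⟨b', hb', hub'⟩ := hder E k u b hu hb hub
    obtain ⟨C, hC⟩ := hbound _ (k + 1) (fderiv ℝ u) b' (hu.fderiv_of_isOpen hO (by simp)) hb' hub'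
    refine contDiffOn_zero.2 (continuousOn_extendFrom (fun z _ => dense_first_ne_zero z) ?_)
    intro z hz
    exact exists_tendsto_of_fderiv_bounded (fun w hw hw0 => (hu.contDiffAt (hO.mem_nhds
      ⟨hbr hw, hw0⟩)).differentiableAt (by simp)) hC hz
  | succ m ih =>
    intro E _ _ _ _ _ k u b hu hb hub
    obtain ⟨b', hb', hub'⟩ := hder E k u b hu hb hub
    have hu' : ContDiffOn ℝ ∞ (fderiv ℝ u) (Metric.ball p r ∩ {z | z 0 ≠ 0}) :=
      hu.fderiv_of_isOpen hO (by simp)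
    obtain ⟨b'', hb'', hub''⟩ := hder _ (k + 1) _ b' hu' hb' hub'
    obtain ⟨C, hC⟩ := hbound _ (k + 1) (fderiv ℝ u) b' hu' hb' hub'
    obtain ⟨C', hC'⟩ := hbound _ (k + 1 + 1) (fderiv ℝ (fderiv ℝ u)) b''
      (hu'.fderiv_of_isOpen hO (by simp)) hb'' hub''
    have hd : ∀ w ∈ Metric.ball p ρ, w 0 ≠ 0 → DifferentiableAt ℝ u w := fun w hw hw0 =>
      (hu.contDiffAt (hO.mem_nhds ⟨hbr hw, hw0⟩)).differentiableAt (by simp)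
    have hd' : ∀ w ∈ Metric.ball p ρ, w 0 ≠ 0 → DifferentiableAt ℝ (fderiv ℝ u) w :=
      fun w hw hw0 =>
        (hu'.contDiffAt (hO.mem_nhds ⟨hbr hw, hw0⟩)).differentiableAt (by simp)
    have hfd : ∀ z ∈ Metric.ball p ρ, HasFDerivAt (extendFrom {z | z 0 ≠ 0} u)
        (extendFrom {z | z 0 ≠ 0} (fderiv ℝ u) z) z := fun z hz =>
      hasFDerivAt_extendFrom hd (fun w hw => exists_tendsto_of_fderiv_bounded hd hC hw) hz
        (tendsto_extendFrom (exists_tendsto_of_fderiv_bounded hd' hC' hz))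
    have hcast : ((m + 1 : ℕ) : WithTop ℕ∞) = (m : WithTop ℕ∞) + 1 := by norm_cast
    rw [hcast, contDiffOn_succ_iff_fderiv_of_isOpen Metric.isOpen_ball]
    refine ⟨fun z hz => (hfd z hz).differentiableAt.differentiableWithinAt, by simp, ?_⟩
    exact (ih _ (k + 1) _ b' hu' hb' hub').congr fun z hz => (hfd z hz).fderiv

/-- If `u` is smooth outside `z₁ = 0` and `f u` is smooth for some holomorphic `f ≢ 0`, then
`z₁ ^ k u` extends smoothly across `z₁ = 0` for some `k`. -/
theorem exists_contDiffOn_eq_pow_first_smul {E : Type} [NormedAddCommGroup E] [NormedSpace ℝ E]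
    [NormedSpace ℂ E] [IsScalarTower ℝ ℂ E] [CompleteSpace E]
    {p : Cn (n + 1)} (hp : p 0 = 0) {r : ℝ} {f : Cn (n + 1) → ℂ}
    (hf : ContDiffOn ℂ ∞ f (Metric.ball p r)) {q : Cn (n + 1)} (hq : q ∈ Metric.ball p r)
    (hfq : f q ≠ 0) {u b : Cn (n + 1) → E}
    (hu : ContDiffOn ℝ ∞ u (Metric.ball p r ∩ {z | z 0 ≠ 0}))
    (hb : ContDiffOn ℝ ∞ b (Metric.ball p r))
    (hub : ∀ z ∈ Metric.ball p r, z 0 ≠ 0 → f z • u z = b z) :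
    ∃ (k : ℕ) (ρ : ℝ), 0 < ρ ∧ ρ ≤ r ∧ ∃ v : Cn (n + 1) → E,
      ContDiffOn ℝ ∞ v (Metric.ball p ρ) ∧
      ∀ z ∈ Metric.ball p ρ, z 0 ≠ 0 → v z = z 0 ^ k • u z := by
  have hr : 0 < r := dist_nonneg.trans_lt hq
  have hO : IsOpen (Metric.ball p r ∩ {z : Cn (n + 1) | z 0 ≠ 0}) :=
    Metric.isOpen_ball.inter isOpen_first_ne_zero
  obtain ⟨k, g, hg, hfg, q', hq', hq'0, hgq'⟩ := exists_eq_pow_first_mul hp hf hq hfq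
  obtain ⟨ρ, hρ, hρr, hbound⟩ := exists_bound_of_pow_smul hp hr hg hq' hq'0 hgq'
  have hρr' : ρ ≤ r := by linarith
  have hz0 : ContDiff ℝ ∞ fun z : Cn (n + 1) => z 0 ^ k := by fun_prop
  have hv : ContDiffOn ℝ ∞ (fun z => z 0 ^ k • u z) (Metric.ball p r ∩ {z | z 0 ≠ 0}) :=
    hz0.contDiffOn.smul hu
  refine ⟨k, ρ, hρ, hρr', extendFrom {z | z 0 ≠ 0} (fun z => z 0 ^ k • u z), ?_, ?_⟩
  · rw [contDiffOn_infty]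
    intro m
    -- The equation `f u = b` reads `g · (z₁^k u) = b`: the exponent of `g` is `1` at the start.
    refine contDiffOn_extendFrom_of_bounds hρr' hg hbound m E 1 _ b hv hb ?_
    intro z hz hz0
    rw [pow_one, ← hub z hz hz0, hfg z hz, smul_smul, mul_comm]
  · intro z hz hz0
    refine extendFrom_eq (dense_first_ne_zero z) ?_
    exact ((hv.contDiffAt (hO.mem_nhds
      ⟨Metric.ball_subset_ball hρr' hz, hz0⟩)).continuousAt.tendsto).mono_left nhdsWithin_le_nhds

/-- A holomorphic function with zero set `z₁ = 0` is locally a power of `z₁` times a function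
without zeros. -/
theorem exists_eq_pow_first_mul_ne_zero {p : Cn (n + 1)} (hp : p 0 = 0) {r : ℝ} (hr : 0 < r)
    {f : Cn (n + 1) → ℂ} (hf : ContDiffOn ℂ ∞ f (Metric.ball p r))
    (hz : ∀ z ∈ Metric.ball p r, f z = 0 ↔ z 0 = 0) :
    ∃ (k : ℕ) (ρ : ℝ) (g : Cn (n + 1) → ℂ), 1 ≤ k ∧ 0 < ρ ∧ ρ ≤ r ∧
      ContDiffOn ℂ ∞ g (Metric.ball p ρ) ∧
      ∀ z ∈ Metric.ball p ρ, g z ≠ 0 ∧ f z = z 0 ^ k * g z := by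
  obtain ⟨q, hq, hq0⟩ : ∃ q ∈ Metric.ball p r, q 0 ≠ 0 :=
    dense_first_ne_zero.exists_mem_open Metric.isOpen_ball ⟨p, Metric.mem_ball_self hr⟩ |>.imp
      fun q h => ⟨h.2, h.1⟩
  obtain ⟨k, g, hg, hfg, q', hq', hq'0, hgq'⟩ :=
    exists_eq_pow_first_mul hp hf hq fun h => hq0 ((hz q hq).1 h)
  have hk : 1 ≤ k := by
    by_contra hk
    obtain rfl : k = 0 := by omega
    have := hfg q' hq'
    rw [(hz q' hq').2 hq'0] at this
    simp at this
    exact hgq' this.symm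
  obtain ⟨v, hv0, c, hc, A, ρ, hρ, hρr, hline, hlow, -⟩ := exists_direction hp hr hg hq' hq'0 hgq'
  have hsub : Metric.closedBall p (r / 2) ⊆ Metric.ball p r :=
    Metric.closedBall_subset_ball (by linarith)
  have hbr : Metric.ball p ρ ⊆ Metric.ball p r := Metric.ball_subset_ball (by linarith)
  have hne : ∀ z ∈ Metric.ball p r, z 0 ≠ 0 → g z ≠ 0 := by
    intro z hz' hz0 h0
    have := hfg z hz'
    rw [h0, mul_zero, hz z hz'] at this
    exact hz0 this
  -- Off the hyperplane `g` has no zeros, and the tangential disc around `z` stays off it. The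
  -- maximum principle for `1 / g` therefore carries the lower bound from the circle to the centre
  -- `z`.
  have hlb : ∀ z ∈ Metric.ball p ρ, z 0 ≠ 0 → c ≤ ‖g z‖ := by
    intro z hz' hz0
    have h15 : Metric.closedBall (0 : ℂ) 1 ⊆ Metric.ball 0 5 :=
      Metric.closedBall_subset_ball (by norm_num)
    have hcl : closure (Metric.ball (0 : ℂ) 1) = Metric.closedBall 0 1 :=
      closure_ball _ (by norm_num)
    have hmem : ∀ t ∈ Metric.closedBall (0 : ℂ) 1, z + t • v ∈ Metric.ball p r :=
      fun t ht => hsub (hline z hz' t (h15 ht))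
    have hdc : DiffContOnCl ℂ (fun t : ℂ => (g (z + t • v))⁻¹) (Metric.ball 0 1) := by
      refine DifferentiableOn.diffContOnCl ?_
      rw [hcl]
      refine DifferentiableOn.inv ?_ fun t ht => hne _ (hmem t ht) (by simpa [hv0] using hz0)
      exact (hg.differentiableOn (by simp)).comp (by fun_prop) hmem
    have := Complex.norm_le_of_forall_mem_frontier_norm_le Metric.isBounded_ball hdc (C := c⁻¹)
      (fun t ht => ?_) (subset_closure (Metric.mem_ball_self one_pos))
    · simp only [zero_smul, add_zero, norm_inv] at this
      exact (inv_le_inv₀ (norm_pos_iff.2 (hne z (hbr hz') hz0)) hc).1 this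
    · rw [frontier_ball _ (by norm_num)] at ht
      rw [norm_inv]
      exact inv_anti₀ hc (hlow z hz' t ht)
  refine ⟨k, ρ, g, hk, hρ, by linarith, hg.mono hbr, fun z hz' => ⟨?_, hfg z (hbr hz')⟩⟩
  -- The lower bound extends to `z₁ = 0` by continuity and density.
  have hcont : Filter.Tendsto (fun w => ‖g w‖) (nhdsWithin z {z | z 0 ≠ 0}) (nhds ‖g z‖) :=
    ((hg.continuousOn.continuousAt (Metric.isOpen_ball.mem_nhds
      (hbr hz'))).norm.tendsto).mono_left nhdsWithin_le_nhds
  have hneb : (nhdsWithin z {z : Cn (n + 1) | z 0 ≠ 0}).NeBot :=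
    mem_closure_iff_nhdsWithin_neBot.1 (dense_first_ne_zero z)
  have hle : c ≤ ‖g z‖ := by
    refine ge_of_tendsto hcont ?_
    filter_upwards [mem_nhdsWithin_of_mem_nhds (Metric.isOpen_ball.mem_nhds hz'),
      self_mem_nhdsWithin] with w hw hw0 using hlb w hw hw0
  exact norm_pos_iff.1 (hc.trans_le hle)

end Extension

/-! ### The kernel `|z|^s z̄^a / z^m` and its derivatives. -/

section Kernel

open Filter Topology MeasureTheory

/-- The kernel `|z|^s z̄^a / z^m`. -/
noncomputable def pvKernel (s : ℂ) (a m : ℕ) (z : ℂ) : ℂ :=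
  (‖z‖ : ℂ) ^ s * (starRingEnd ℂ z) ^ a * (z ^ m)⁻¹

theorem norm_pvKernel {s : ℂ} {a m : ℕ} {z : ℂ} (hz : z ≠ 0) :
    ‖pvKernel s a m z‖ = ‖z‖ ^ (s.re + a - m) := by
  have hz' : 0 < ‖z‖ := norm_pos_iff.2 hz
  rw [pvKernel, norm_mul, norm_mul, norm_inv, norm_pow, norm_pow, RCLike.norm_conj,
    Complex.norm_cpow_eq_rpow_re_of_pos hz', Real.rpow_sub hz', Real.rpow_add hz',
    Real.rpow_natCast, Real.rpow_natCast, div_eq_mul_inv]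

/-- The factor `(z^m)⁻¹` does not vanish at `0` when `m = 0`, so another one must: for `a = 0` the
inequality forces `s ≠ 0`, hence `0 ^ s = 0`. -/
theorem pvKernel_zero {s : ℂ} {a m : ℕ} (h : (m : ℝ) < s.re + a) : pvKernel s a m 0 = 0 := by
  rcases a with _ | a
  · have hs : s ≠ 0 := by
      rintro rfl
      simp at h
      exact absurd h (not_lt.2 m.cast_nonneg)
    simp [pvKernel, Complex.zero_cpow hs]
  · simp [pvKernel]

/-- Write `|z|^s = exp((s/2) log(z z̄))`. -/
theorem hasFDerivAt_norm_cpow {s z : ℂ} (hz : z ≠ 0) :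
    DifferentiableAt ℝ (fun z : ℂ => (‖z‖ : ℂ) ^ s) z ∧
    wd Complex.I 1 (fun z : ℂ => (‖z‖ : ℂ) ^ s) z =
      s / 2 * (‖z‖ : ℂ) ^ s * (starRingEnd ℂ z)⁻¹ ∧
    wd (-Complex.I) 1 (fun z : ℂ => (‖z‖ : ℂ) ^ s) z = s / 2 * (‖z‖ : ℂ) ^ s * z⁻¹ := by
  have hz' : 0 < ‖z‖ := norm_pos_iff.2 hz
  have hns : 0 < Complex.normSq z := Complex.normSq_pos.2 hz
  let L : ℂ →L[ℝ] ℝ := (2 * z.re) • Complex.reCLM + (2 * z.im) • Complex.imCLM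
  have h1 : HasFDerivAt Complex.normSq L z := by
    have hre := (Complex.reCLM.hasFDerivAt (x := z)).mul (Complex.reCLM.hasFDerivAt (x := z))
    have him := (Complex.imCLM.hasFDerivAt (x := z)).mul (Complex.imCLM.hasFDerivAt (x := z))
    have h := hre.add him
    have e : (fun y : ℂ => Complex.normSq y) =
        fun y => Complex.reCLM y * Complex.reCLM y + Complex.imCLM y * Complex.imCLM y := by
      funext y; simp [Complex.normSq_apply]
    change HasFDerivAt (fun y : ℂ => Complex.normSq y) L z
    rw [e]
    convert! h using 1
    ext <;> simp [L] <;> ring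
  have h2 : HasFDerivAt (fun y : ℂ => Real.log (Complex.normSq y))
      ((Complex.normSq z)⁻¹ • L) z := h1.log hns.ne'
  have h3 : HasFDerivAt (fun y : ℂ => Complex.exp (s / 2 * (Real.log (Complex.normSq y) : ℂ)))
      (Complex.exp (s / 2 * (Real.log (Complex.normSq z) : ℂ)) •
        ((s / 2) • (Complex.ofRealCLM.comp ((Complex.normSq z)⁻¹ • L)))) z :=
    ((Complex.ofRealCLM.hasFDerivAt.comp z h2).const_mul (s / 2)).cexp
  have heq : ∀ y : ℂ, y ≠ 0 →
      (‖y‖ : ℂ) ^ s = Complex.exp (s / 2 * (Real.log (Complex.normSq y) : ℂ)) := by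
    intro y hy
    have hy' : 0 < ‖y‖ := norm_pos_iff.2 hy
    rw [Complex.cpow_def_of_ne_zero (by exact_mod_cast hy'.ne'), ← Complex.ofReal_log hy'.le,
      Complex.normSq_eq_norm_sq, Real.log_pow]
    congr 1
    push_cast
    ring
  have h4 : HasFDerivAt (fun y : ℂ => (‖y‖ : ℂ) ^ s)
      (Complex.exp (s / 2 * (Real.log (Complex.normSq z) : ℂ)) •
        ((s / 2) • (Complex.ofRealCLM.comp ((Complex.normSq z)⁻¹ • L)))) z := by
    refine h3.congr_of_eventuallyEq ?_
    filter_upwards [eventually_ne_nhds hz] with y hy using heq y hy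
  rw [← heq z hz] at h4
  have hcz : (starRingEnd ℂ z) ≠ 0 := by simpa using hz
  have hnn : (Complex.normSq z : ℂ) = z * starRingEnd ℂ z := (Complex.mul_conj z).symm
  have hz1 : z = z.re + z.im * Complex.I := (Complex.re_add_im z).symm
  have hz2 : starRingEnd ℂ z = z.re - z.im * Complex.I := by
    apply Complex.ext <;> simp
  refine ⟨h4.differentiableAt, ?_, ?_⟩
  · rw [wd, h4.fderiv]
    simp only [L, smul_apply, add_apply, ContinuousLinearMap.comp_apply, smul_eq_mul,
      Complex.reCLM_apply, Complex.imCLM_apply, Complex.ofRealCLM_apply, Complex.one_re,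
      Complex.one_im, Complex.I_re, Complex.I_im, mul_one, mul_zero, add_zero, zero_add]
    push_cast
    rw [hnn, mul_inv]
    have e : (2 : ℂ) * z.re + Complex.I * (2 * z.im) = 2 * z := by
      conv_rhs => rw [hz1]
      ring
    field_simp
    linear_combination ((‖z‖ : ℂ) ^ s * s / 2) * e
  · rw [wd, h4.fderiv]
    simp only [L, smul_apply, add_apply, ContinuousLinearMap.comp_apply, smul_eq_mul,
      Complex.reCLM_apply, Complex.imCLM_apply, Complex.ofRealCLM_apply, Complex.one_re,
      Complex.one_im, Complex.I_re, Complex.I_im, mul_one, mul_zero, add_zero, zero_add]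
    push_cast
    rw [hnn, mul_inv]
    have e : (2 : ℂ) * z.re - Complex.I * (2 * z.im) = 2 * starRingEnd ℂ z := by
      rw [hz2]
      ring
    field_simp
    linear_combination ((‖z‖ : ℂ) ^ s * s / 2) * e

theorem wd_conj_pow (a : ℕ) (z : ℂ) :
    DifferentiableAt ℝ (fun z : ℂ => (starRingEnd ℂ z) ^ a) z ∧
    wd Complex.I 1 (fun z : ℂ => (starRingEnd ℂ z) ^ a) z = a * (starRingEnd ℂ z) ^ (a - 1) ∧
    wd (-Complex.I) 1 (fun z : ℂ => (starRingEnd ℂ z) ^ a) z = 0 := by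
  have h : HasFDerivAt (fun z : ℂ => (starRingEnd ℂ z) ^ a)
      ((a • (starRingEnd ℂ z) ^ (a - 1)) • (Complex.conjCLE : ℂ →L[ℝ] ℂ)) z :=
    ((Complex.conjCLE : ℂ →L[ℝ] ℂ).hasFDerivAt (x := z)).pow a
  refine ⟨h.differentiableAt, ?_, ?_⟩
  · rw [wd, h.fderiv]
    simp
    have hI : Complex.I * Complex.I = -1 := Complex.I_mul_I
    linear_combination (-(1 / 2) * (a * (starRingEnd ℂ z) ^ (a - 1))) * hI
  · rw [wd, h.fderiv]
    simp
    have hI : Complex.I * Complex.I = -1 := Complex.I_mul_I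
    linear_combination (a * (starRingEnd ℂ z) ^ (a - 1)) * hI

theorem differentiableAt_pvKernel_of_ne {s : ℂ} {a m : ℕ} {z : ℂ} (hz : z ≠ 0) :
    DifferentiableAt ℝ (pvKernel s a m) z ∧
    wd Complex.I 1 (pvKernel s a m) z = (s / 2 + a) * (starRingEnd ℂ z)⁻¹ * pvKernel s a m z ∧
    wd (-Complex.I) 1 (pvKernel s a m) z = (s / 2 - m) * z⁻¹ * pvKernel s a m z := by
  obtain ⟨h1, h1b, h1d⟩ := hasFDerivAt_norm_cpow (s := s) hz
  obtain ⟨h2, h2b, h2d⟩ := wd_conj_pow a z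
  have h3c : DifferentiableAt ℂ (fun z : ℂ => (z ^ m)⁻¹) z :=
    (differentiableAt_pow m).inv (pow_ne_zero _ hz)
  have h3 : DifferentiableAt ℝ (fun z : ℂ => (z ^ m)⁻¹) z := h3c.restrictScalars ℝ
  obtain ⟨h3b, h3d⟩ := wd_of_differentiableAt_complex (v := (1 : ℂ)) h3c
  have h3d' : fderiv ℂ (fun z : ℂ => (z ^ m)⁻¹) z 1 = -m * z⁻¹ * (z ^ m)⁻¹ := by
    rw [fderiv_apply_one_eq_deriv, ((hasDerivAt_pow m z).fun_inv (pow_ne_zero _ hz)).deriv]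
    rcases m with _ | m
    · simp
    · rw [Nat.add_sub_cancel]
      field_simp
      ring
  have hcz : (starRingEnd ℂ z) ≠ 0 := by simpa using hz
  have e : pvKernel s a m = fun z => ((‖z‖ : ℂ) ^ s) • ((starRingEnd ℂ z) ^ a • (z ^ m)⁻¹) := by
    funext z
    simp [pvKernel, mul_assoc]
  have hda : (a : ℂ) * (starRingEnd ℂ z) ^ (a - 1) =
      a * ((starRingEnd ℂ z)⁻¹ * (starRingEnd ℂ z) ^ a) := by
    rcases a with _ | a
    · simp
    · rw [pow_succ', inv_mul_cancel_left₀ hcz, Nat.add_sub_cancel]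
  have h23 : DifferentiableAt ℝ (fun z : ℂ => (starRingEnd ℂ z) ^ a • (z ^ m)⁻¹) z := h2.smul h3
  rw [e]
  refine ⟨h1.smul h23, ?_, ?_⟩
  · rw [wd_smul h1 h23, wd_smul h2 h3, h1b, h2b, h3b, hda]
    simp only [smul_eq_mul, smul_zero, add_zero]
    ring
  · rw [wd_smul h1 h23, wd_smul h2 h3, h1d, h2d, h3d, h3d']
    simp only [smul_eq_mul, zero_mul, zero_add]
    ring

theorem continuous_pvKernel {s : ℂ} {a m : ℕ} (h : (m : ℝ) < s.re + a) :
    Continuous (pvKernel s a m) := by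
  rw [continuous_iff_continuousAt]
  intro z
  by_cases hz : z = 0
  · subst hz
    rw [ContinuousAt, pvKernel_zero h, tendsto_zero_iff_norm_tendsto_zero]
    have hpos : 0 < s.re + a - m := by linarith
    have h1 : Tendsto (fun z : ℂ => ‖z‖ ^ (s.re + a - m)) (𝓝 0) (𝓝 0) := by
      have := (continuous_norm (E := ℂ)).tendsto 0
      rw [norm_zero] at this
      have h2 := this.rpow_const (p := s.re + a - m) (Or.inr hpos.le)
      rwa [Real.zero_rpow hpos.ne'] at h2
    refine h1.congr fun z => ?_
    by_cases hz : z = 0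
    · subst hz
      rw [pvKernel_zero h, norm_zero, Real.zero_rpow hpos.ne']
    · rw [norm_pvKernel hz]
  · exact (differentiableAt_pvKernel_of_ne hz).1.continuousAt

/-- Away from `0` this is the product rule. At `0` the modulus `|z|^{Re s + a - m}` has exponent
greater than `1`, so the derivative is zero and both formulas read `0 = 0`. -/
theorem wd_pvKernel {s : ℂ} {a m : ℕ} (h : (m : ℝ) + 1 < s.re + a) (z : ℂ) :
    DifferentiableAt ℝ (pvKernel s a m) z ∧
    wd Complex.I 1 (pvKernel s a m) z = (s / 2 + a) * pvKernel s a m z * (starRingEnd ℂ z)⁻¹ ∧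
    wd (-Complex.I) 1 (pvKernel s a m) z = (s / 2 - m) * pvKernel s a (m + 1) z := by
  by_cases hz : z = 0
  · subst hz
    have h0 : HasFDerivAt (pvKernel s a m) (0 : ℂ →L[ℝ] ℂ) 0 := by
      rw [hasFDerivAt_iff_isLittleO_nhds_zero]
      refine Asymptotics.isLittleO_iff.2 fun ε hε => ?_
      have hpos : 0 < s.re + a - m - 1 := by linarith
      have h1 : Tendsto (fun z : ℂ => ‖z‖ ^ (s.re + a - m - 1)) (𝓝 0) (𝓝 0) := by
        have := (continuous_norm (E := ℂ)).tendsto 0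
        rw [norm_zero] at this
        have h2 := this.rpow_const (p := s.re + a - m - 1) (Or.inr hpos.le)
        rwa [Real.zero_rpow hpos.ne'] at h2
      filter_upwards [h1.eventually (gt_mem_nhds hε)] with z hz
      simp only [zero_add, zero_apply, sub_zero]
      rw [pvKernel_zero (by linarith), sub_zero]
      by_cases hz0 : z = 0
      · subst hz0
        rw [pvKernel_zero (by linarith)]
        simp
      · have hz' : 0 < ‖z‖ := norm_pos_iff.2 hz0
        rw [norm_pvKernel hz0]
        have : s.re + a - m = (s.re + a - m - 1) + 1 := by ring
        rw [this, Real.rpow_add_one hz'.ne']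
        gcongr
    refine ⟨h0.differentiableAt, ?_, ?_⟩
    · rw [wd, h0.fderiv, pvKernel_zero (by linarith)]
      simp
    · rw [wd, h0.fderiv, pvKernel_zero (by push_cast; linarith)]
      simp
  · obtain ⟨h1, h2, h3⟩ := differentiableAt_pvKernel_of_ne (s := s) (a := a) (m := m) hz
    refine ⟨h1, by rw [h2]; ring, ?_⟩
    rw [h3, pvKernel, pvKernel, pow_succ, mul_inv]
    ring

/-- The identity behind the analytic continuation: up to a scalar, the kernel with `z̄^a` is the
`∂̄`-derivative of the less singular kernel with `z̄^{a+1}`. -/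
theorem wd_pvKernel_succ {s : ℂ} {a m : ℕ} (h : (m : ℝ) < s.re + a) (z : ℂ) :
    wd Complex.I 1 (pvKernel s (a + 1) m) z = (s / 2 + (a + 1)) * pvKernel s a m z := by
  rw [(wd_pvKernel (by push_cast; linarith) z).2.1]
  by_cases hz : z = 0
  · subst hz
    rw [pvKernel_zero h, pvKernel_zero (by push_cast; linarith)]
    simp
  · have hcz : (starRingEnd ℂ z) ≠ 0 := by simpa using hz
    rw [pvKernel, pvKernel, pow_succ]
    push_cast
    field_simp

end Kernel

/-! ### Integration by parts for Wirtinger derivatives. -/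

section IntegrationByParts

open MeasureTheory

variable {V : Type*} [NormedAddCommGroup V] [NormedSpace ℝ V] [NormedSpace ℂ V]
  [IsScalarTower ℝ ℂ V]
  [MeasurableSpace V] [BorelSpace V] [FiniteDimensional ℝ V] {μ : Measure V} [μ.IsAddHaarMeasure]

/-- The function `F` will be a kernel that is not smooth at `z₁ = 0`, so only differentiability and
continuity of the Wirtinger derivatives are asked of it. Both of these are needed, because the
derivatives along `v` and `i v` are combinations of the two. -/
theorem integral_mul_wd_eq_neg {e : ℂ} {v : V} {F g : V → ℂ} (hF : Differentiable ℝ F)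
    (h1 : Continuous (wd Complex.I v F)) (h2 : Continuous (wd (-Complex.I) v F))
    (hg : ContDiff ℝ ∞ g) (hgs : HasCompactSupport g) :
    ∫ x, F x * wd e v g x ∂μ = - ∫ x, wd e v F x * g x ∂μ := by
  have hFc := hF.continuous
  have hdc : ∀ c : ℂ, Continuous fun x => fderiv ℝ F x (c • v) := by
    intro c
    simp only [fderiv_smul_direction, smul_eq_mul]
    exact (continuous_const.mul h2).add (continuous_const.mul h1)
  have hgd : ∀ w : V, Continuous fun x => fderiv ℝ g x w := fun w =>
    (hg.continuous_fderiv (by simp)).clm_apply continuous_const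
  have hgds : ∀ w : V, HasCompactSupport fun x => fderiv ℝ g x w := fun w =>
    hgs.fderiv_apply ℝ w
  have key : ∀ c : ℂ, Integrable (fun x => F x * fderiv ℝ g x (c • v)) μ ∧
      Integrable (fun x => fderiv ℝ F x (c • v) * g x) μ ∧
      ∫ x, F x * fderiv ℝ g x (c • v) ∂μ = - ∫ x, fderiv ℝ F x (c • v) * g x ∂μ := by
    intro c
    have i1 : Integrable (fun x => F x * fderiv ℝ g x (c • v)) μ :=
      (hFc.mul (hgd _)).integrable_of_hasCompactSupport (hgds _).mul_left
    have i2 : Integrable (fun x => fderiv ℝ F x (c • v) * g x) μ :=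
      ((hdc c).mul hg.continuous).integrable_of_hasCompactSupport hgs.mul_left
    have i3 : Integrable (fun x => F x * g x) μ :=
      (hFc.mul hg.continuous).integrable_of_hasCompactSupport hgs.mul_left
    exact ⟨i1, i2, integral_mul_fderiv_eq_neg_fderiv_mul_of_integrable i2 i1 i3
      (fun x _ => hF x) (fun x _ => (hg.differentiable (by simp)) x)⟩
  obtain ⟨a1, a2, a3⟩ := key 1
  obtain ⟨b1, b2, b3⟩ := key Complex.I
  simp only [one_smul] at a1 a2 a3
  have e1 : ∀ x, F x * wd e v g x = (1 / 2 : ℂ) * (F x * fderiv ℝ g x v) +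
      (1 / 2 * e) * (F x * fderiv ℝ g x (Complex.I • v)) := by
    intro x; simp only [wd, smul_eq_mul]; ring
  have e2 : ∀ x, wd e v F x * g x = (1 / 2 : ℂ) * (fderiv ℝ F x v * g x) +
      (1 / 2 * e) * (fderiv ℝ F x (Complex.I • v) * g x) := by
    intro x; simp only [wd, smul_eq_mul]; ring
  simp only [e1, e2]
  rw [integral_add (a1.const_mul _) (b1.const_mul _), integral_add (a2.const_mul _) (b2.const_mul _),
    integral_const_mul, integral_const_mul, integral_const_mul, integral_const_mul, a3, b3]
  ring

/-- Integration by parts against a function which is constant in the direction `v`. -/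
theorem integral_mul_wd_eq_zero {e : ℂ} {v : V} {F g : V → ℂ} (hF : Continuous F)
    (hv : ∀ x (c : ℂ), F (x + c • v) = F x)
    (hg : ContDiff ℝ ∞ g) (hgs : HasCompactSupport g) :
    ∫ x, F x * wd e v g x ∂μ = 0 := by
  have hgd : ∀ w : V, Continuous fun x => fderiv ℝ g x w := fun w =>
    (hg.continuous_fderiv (by simp)).clm_apply continuous_const
  have hgds : ∀ w : V, HasCompactSupport fun x => fderiv ℝ g x w := fun w =>
    hgs.fderiv_apply ℝ w
  have key : ∀ c : ℂ, Integrable (fun x => F x * fderiv ℝ g x (c • v)) μ ∧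
      ∫ x, F x * fderiv ℝ g x (c • v) ∂μ = 0 := by
    intro c
    have i1 : Integrable (fun x => F x * fderiv ℝ g x (c • v)) μ :=
      (hF.mul (hgd _)).integrable_of_hasCompactSupport (hgds _).mul_left
    have i3 : Integrable (fun x => F x * g x) μ :=
      (hF.mul hg.continuous).integrable_of_hasCompactSupport hgs.mul_left
    refine ⟨i1, ?_⟩
    have := integral_bilinear_hasLineDerivAt_right_eq_neg_left_of_integrable (μ := μ)
      (B := ContinuousLinearMap.mul ℝ ℂ) (f := F) (f' := fun _ => 0) (g := g)
      (g' := fun x => fderiv ℝ g x (c • v)) (v := c • v) (by simp) i1 i3 ?_ ?_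
    · simpa using this
    · intro x _
      have hx : (fun t : ℝ => F (x + t • c • v)) = fun _ => F x := by
        funext t
        rw [← hv x (t • c), smul_assoc]
      unfold HasLineDerivAt
      rw [hx]
      exact hasDerivAt_const _ _
    · intro x _
      exact ((hg.differentiable (by simp)) x).hasFDerivAt.hasLineDerivAt _
  obtain ⟨a1, a3⟩ := key 1
  obtain ⟨b1, b3⟩ := key Complex.I
  simp only [one_smul] at a1 a3
  have e1 : ∀ x, F x * wd e v g x = (1 / 2 : ℂ) * (F x * fderiv ℝ g x v) +
      (1 / 2 * e) * (F x * fderiv ℝ g x (Complex.I • v)) := by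
    intro x; simp only [wd, smul_eq_mul]; ring
  simp only [e1]
  rw [integral_add (a1.const_mul _) (b1.const_mul _), integral_const_mul, integral_const_mul, a3, b3]
  simp

end IntegrationByParts

/-! ### Holomorphic dependence of integrals on a parameter. -/

section HolomorphicIntegral

open MeasureTheory Filter Topology

/-- A bound on `f` alone suffices: Cauchy's estimate on discs of radius `δ / 2` bounds the
derivative by `2 B / δ`, and the derivative is measurable as a limit of difference quotients. -/
theorem differentiableOn_integral_of_bound {α : Type*} [MeasurableSpace α] {μ : Measure α}
    {Ω : Set ℂ} {f : ℂ → α → ℂ} (hmeas : ∀ z ∈ Ω, AEStronglyMeasurable (f z) μ)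
    (hdiff : ∀ a, DifferentiableOn ℂ (fun z => f z a) Ω)
    (hb : ∀ z₀ ∈ Ω, ∃ δ > 0, Metric.closedBall z₀ δ ⊆ Ω ∧ ∃ B : α → ℝ, Integrable B μ ∧
      ∀ z ∈ Metric.closedBall z₀ δ, ∀ a, ‖f z a‖ ≤ B a) :
    DifferentiableOn ℂ (fun z => ∫ a, f z a ∂μ) Ω := by
  intro z₀ hz₀
  obtain ⟨δ, hδ, hδΩ, B, hB, hfB⟩ := hb z₀ hz₀
  have hsub : ∀ z ∈ Metric.ball z₀ (δ / 2), Metric.closedBall z (δ / 2) ⊆ Metric.closedBall z₀ δ := by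
    intro z hz
    refine Metric.closedBall_subset_closedBall' ?_
    linarith [Metric.mem_ball.1 hz]
  have hder : ∀ a, ∀ z ∈ Metric.ball z₀ (δ / 2),
      HasDerivAt (fun z => f z a) (deriv (fun z => f z a) z) z := by
    intro a z hz
    refine (((hdiff a).mono hδΩ).differentiableAt ?_).hasDerivAt
    exact Filter.mem_of_superset (Metric.ball_mem_nhds z (half_pos hδ))
      (Metric.ball_subset_closedBall.trans (hsub z hz))
  have hbd : ∀ a, ∀ z ∈ Metric.ball z₀ (δ / 2), ‖deriv (fun z => f z a) z‖ ≤ B a / (δ / 2) := by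
    intro a z hz
    refine Complex.norm_deriv_le_of_forall_mem_sphere_norm_le (half_pos hδ) ?_ fun w hw =>
      hfB w (hsub z hz (Metric.sphere_subset_closedBall hw)) a
    refine DifferentiableOn.diffContOnCl ?_
    rw [closure_ball _ (half_pos hδ).ne']
    exact (hdiff a).mono ((hsub z hz).trans hδΩ)
  have hmd : AEStronglyMeasurable (fun a => deriv (fun z => f z a) z₀) μ := by
    let u : ℕ → ℂ := fun k => ((δ / 2 / (k + 1 : ℝ) : ℝ) : ℂ)
    have hu0 : ∀ k, u k ≠ 0 := fun k => by
      simp only [u, ne_eq, Complex.ofReal_eq_zero]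
      positivity
    have hu : Tendsto u atTop (𝓝 0) := by
      have h1 : Tendsto (fun k : ℕ => δ / 2 / (k + 1 : ℝ)) atTop (𝓝 0) :=
        (tendsto_const_div_atTop_nhds_zero_nat (δ / 2)).comp (tendsto_add_atTop_nat 1) |>.congr
          fun k => by simp
      have := (Complex.continuous_ofReal.tendsto 0).comp h1
      simpa [u, Function.comp_def] using this
    refine aestronglyMeasurable_of_tendsto_ae atTop
      (f := fun k a => (u k)⁻¹ • (f (z₀ + u k) a - f z₀ a)) (fun k => ?_) ?_
    · have hk : z₀ + u k ∈ Ω := by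
        refine hδΩ ?_
        rw [Metric.mem_closedBall, dist_eq_norm, add_sub_cancel_left]
        simp only [u, Complex.norm_real]
        rw [Real.norm_of_nonneg (by positivity)]
        calc δ / 2 / (k + 1 : ℝ) ≤ δ / 2 :=
              div_le_self (by positivity) (by linarith [k.cast_nonneg (α := ℝ)])
          _ ≤ δ := by linarith
      exact ((hmeas _ hk).sub (hmeas _ hz₀)).const_smul (u k)⁻¹
    · refine Filter.Eventually.of_forall fun a => ?_
      have h1 := (hder a z₀ (Metric.mem_ball_self (half_pos hδ))).tendsto_slope_zero
      exact h1.comp (tendsto_nhdsWithin_iff.2 ⟨hu, Filter.Eventually.of_forall hu0⟩)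
  have hint : Integrable (f z₀) μ := hB.mono' (hmeas z₀ hz₀)
    (Filter.Eventually.of_forall (hfB z₀ (Metric.mem_closedBall_self hδ.le)))
  have := hasDerivAt_integral_of_dominated_loc_of_deriv_le (F := f)
    (F' := fun z a => deriv (fun z => f z a) z) (bound := fun a => B a / (δ / 2))
    (Metric.ball_mem_nhds z₀ (half_pos hδ)) ?_ hint hmd
    (Filter.Eventually.of_forall hbd) (hB.div_const _) (Filter.Eventually.of_forall hder)
  · exact this.2.differentiableAt.differentiableWithinAt
  · filter_upwards [Metric.closedBall_mem_nhds z₀ hδ] with z hz using hmeas z (hδΩ hz)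

end HolomorphicIntegral

/-! ### Values at `0` of analytic continuations. -/

section Continuation

open Filter Topology

/-- `c` is the value at `0` of the analytic continuation to a half plane `Re z > -ε` of the function
given, for `Re z` large, by the relation `P`. -/
def HasContinuation (P : ℂ → ℂ → Prop) (c : ℂ) : Prop :=
  ∃ (R ε : ℝ) (G : ℂ → ℂ), 0 < ε ∧ AnalyticOnNhd ℂ G {z | -ε < z.re} ∧
    (∀ z : ℂ, R < z.re → P z (G z)) ∧ G 0 = c

namespace HasContinuation

theorem isPreconnected_halfPlane (ε : ℝ) : IsPreconnected {z : ℂ | -ε < z.re} :=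
  (convex_halfSpace_re_gt (-ε)).isPreconnected

/-- The two continuations agree for large real part because `P` is single valued, and hence on the
smaller of the two half planes, which is connected and contains `0`. -/
theorem unique {P : ℂ → ℂ → Prop} {c c' : ℂ} (h : HasContinuation P c)
    (h' : HasContinuation P c') (hP : ∀ z w w', P z w → P z w' → w = w') : c = c' := by
  obtain ⟨R, ε, G, hε, hG, hR, rfl⟩ := h
  obtain ⟨R', ε', G', hε', hG', hR', rfl⟩ := h'
  have hm : 0 < min ε ε' := lt_min hε hε'
  have h1 : AnalyticOnNhd ℂ G {z | -(min ε ε') < z.re} := hG.mono fun z hz => by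
    have : -(min ε ε') < z.re := hz
    have := min_le_left ε ε'
    simp only [Set.mem_ofPred_eq]; linarith
  have h2 : AnalyticOnNhd ℂ G' {z | -(min ε ε') < z.re} := hG'.mono fun z hz => by
    have : -(min ε ε') < z.re := hz
    have := min_le_right ε ε'
    simp only [Set.mem_ofPred_eq]; linarith
  have hx : 0 < |R| + |R'| + 1 := by positivity
  refine h1.eqOn_of_preconnected_of_eventuallyEq h2 (isPreconnected_halfPlane _)
    (z₀ := ((|R| + |R'| + 1 : ℝ) : ℂ)) ?_ ?_ ?_
  · simp only [Set.mem_ofPred_eq, Complex.ofReal_re]; linarith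
  · have ho : IsOpen {z : ℂ | |R| + |R'| < z.re} := isOpen_lt continuous_const Complex.continuous_re
    filter_upwards [ho.mem_nhds (show ((|R| + |R'| + 1 : ℝ) : ℂ) ∈ {z : ℂ | |R| + |R'| < z.re} by
      simp only [Set.mem_ofPred_eq, Complex.ofReal_re]; linarith)] with z hz
    have hz' : |R| + |R'| < z.re := hz
    exact hP z _ _ (hR z (by linarith [le_abs_self R, abs_nonneg R']))
      (hR' z (by linarith [le_abs_self R', abs_nonneg R]))
  · simp only [Set.mem_ofPred_eq, Complex.zero_re]; linarith

theorem imp {P Q : ℂ → ℂ → Prop} {c : ℂ} (h : HasContinuation P c) (R₀ : ℝ)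
    (hPQ : ∀ z w, R₀ < z.re → P z w → Q z w) : HasContinuation Q c := by
  obtain ⟨R, ε, G, hε, hG, hR, hc⟩ := h
  exact ⟨max R R₀, ε, G, hε, hG, fun z hz => hPQ z _ ((le_max_right _ _).trans_lt hz)
    (hR z ((le_max_left _ _).trans_lt hz)), hc⟩

theorem add {P Q S : ℂ → ℂ → Prop} {c d : ℂ} (h : HasContinuation P c) (h' : HasContinuation Q d)
    (hS : ∀ z w w', P z w → Q z w' → S z (w + w')) : HasContinuation S (c + d) := by
  obtain ⟨R, ε, G, hε, hG, hR, rfl⟩ := h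
  obtain ⟨R', ε', G', hε', hG', hR', rfl⟩ := h'
  refine ⟨max R R', min ε ε', fun z => G z + G' z, lt_min hε hε', ?_, fun z hz => hS z _ _
    (hR z ((le_max_left _ _).trans_lt hz)) (hR' z ((le_max_right _ _).trans_lt hz)), rfl⟩
  refine (hG.mono fun z hz => ?_).add (hG'.mono fun z hz => ?_)
  · have : -(min ε ε') < z.re := hz
    have := min_le_left ε ε'
    simp only [Set.mem_ofPred_eq]; linarith
  · have : -(min ε ε') < z.re := hz
    have := min_le_right ε ε'
    simp only [Set.mem_ofPred_eq]; linarith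

theorem const_mul {P Q : ℂ → ℂ → Prop} {c : ℂ} (a : ℂ) (h : HasContinuation P c)
    (hQ : ∀ z w, P z w → Q z (a * w)) : HasContinuation Q (a * c) := by
  obtain ⟨R, ε, G, hε, hG, hR, rfl⟩ := h
  exact ⟨R, ε, fun z => a * G z, hε, analyticOnNhd_const.mul hG, fun z hz => hQ z _ (hR z hz), rfl⟩

theorem sum {ι : Type*} (s : Finset ι) {P : ι → ℂ → ℂ → Prop} {c : ι → ℂ}
    (h : ∀ i ∈ s, HasContinuation (P i) (c i)) :
    HasContinuation (fun z w => ∃ u : ι → ℂ, (∀ i ∈ s, P i z (u i)) ∧ w = ∑ i ∈ s, u i)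
      (∑ i ∈ s, c i) := by
  classical
  induction s using Finset.induction_on with
  | empty =>
    exact ⟨0, 1, fun _ => 0, one_pos, analyticOnNhd_const, fun z _ => ⟨fun _ => 0, by simp, by simp⟩,
      by simp⟩
  | insert i s hi ih =>
    rw [Finset.sum_insert hi]
    refine (h i (Finset.mem_insert_self i s)).add (ih fun j hj => h j (Finset.mem_insert_of_mem hj))
      ?_
    rintro z w w' hw ⟨u, hu, rfl⟩
    refine ⟨fun j => if j = i then w else u j, fun j hj => ?_, ?_⟩
    · rcases Finset.mem_insert.1 hj with rfl | hj
      · simpa using hw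
      · have : j ≠ i := fun e => hi (e ▸ hj)
        simpa [this] using hu j hj
    · rw [Finset.sum_insert hi]
      simp only [if_true]
      congr 1
      refine Finset.sum_congr rfl fun j hj => ?_
      have : j ≠ i := fun e => hi (e ▸ hj)
      simp [this]

end HasContinuation

end Continuation

/-! ### The principal value on `ℂ^{n+1}`. -/

section LocalPrincipalValue

open MeasureTheory Filter Topology

variable {n : ℕ}

theorem wd_comp_first {e : ℂ} {v : Cn (n + 1)} {K : ℂ → ℂ} {y : Cn (n + 1)}
    (hK : DifferentiableAt ℝ K (y 0)) :
    wd e v (fun y : Cn (n + 1) => K (y 0)) y = wd e (v 0) K (y 0) := by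
  have h1 : HasFDerivAt (fun y : Cn (n + 1) => y 0)
      (ContinuousLinearMap.proj (R := ℝ) (φ := fun _ : Fin (n + 1) => ℂ) 0) y :=
    (ContinuousLinearMap.proj (R := ℝ) (φ := fun _ : Fin (n + 1) => ℂ) 0).hasFDerivAt
  have h2 : fderiv ℝ (fun y : Cn (n + 1) => K (y 0)) y = _ := (hK.hasFDerivAt.comp y h1).fderiv
  simp [wd, h2]

theorem wd_cexp_smul {e v : _} {ψ : Cn (n + 1) → ℝ} {b : Cn (n + 1) → ℂ} (hψ : ContDiff ℝ ∞ ψ)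
    (hb : ContDiff ℝ ∞ b) (z : ℂ) (y : Cn (n + 1)) :
    wd e v (fun y => Complex.exp (z * ψ y) * b y) y =
      Complex.exp (z * ψ y) * (wd e v b y + z * (wd e v (fun y => (ψ y : ℂ)) y * b y)) := by
  have h0 : DifferentiableAt ℝ (fun y => (ψ y : ℂ)) y :=
    Complex.ofRealCLM.differentiableAt.comp y ((hψ.differentiable (by simp)) y)
  have h1 : HasFDerivAt (fun y => Complex.exp (z * ψ y))
      (Complex.exp (z * ψ y) • (z • fderiv ℝ (fun y => (ψ y : ℂ)) y)) y :=
    (h0.hasFDerivAt.const_mul z).cexp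
  have h2 := wd_smul (e := e) (v := v) h1.differentiableAt ((hb.differentiable (by simp)) y)
  simp only [smul_eq_mul] at h2
  rw [h2]
  simp only [wd, h1.fderiv, smul_apply, smul_eq_mul]
  ring

theorem contDiff_cexp_mul {ψ : Cn (n + 1) → ℝ} (hψ : ContDiff ℝ ∞ ψ) (z : ℂ) :
    ContDiff ℝ ∞ (fun y => Complex.exp (z * ψ y)) :=
  (contDiff_const.mul (Complex.ofRealCLM.contDiff.comp hψ)).cexp

/-- The integrand `|y₀|^{2κz} ȳ₀^a y₀^{-m} e^{zψ} b`. -/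
noncomputable def pvIntegrand (κ m a : ℕ) (ψ : Cn (n + 1) → ℝ) (b : Cn (n + 1) → ℂ) (z : ℂ)
    (y : Cn (n + 1)) : ℂ :=
  pvKernel (2 * κ * z) a m (y 0) * (Complex.exp (z * ψ y) * b y)

theorem integrable_pvIntegrand {κ m a : ℕ} {ψ : Cn (n + 1) → ℝ} {b : Cn (n + 1) → ℂ}
    (hψ : Continuous ψ) (hb : Continuous b) (hbs : HasCompactSupport b) {z : ℂ}
    (hz : (m : ℝ) < 2 * κ * z.re + a) : Integrable (pvIntegrand κ m a ψ b z) := by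
  have h1 : Continuous fun y : Cn (n + 1) => pvKernel (2 * κ * z) a m (y 0) :=
    (continuous_pvKernel (by simpa using hz)).comp (continuous_apply 0)
  have h2 : Continuous fun y => Complex.exp (z * ψ y) := by fun_prop
  exact (h1.mul (h2.mul hb)).integrable_of_hasCompactSupport (hbs.mul_left.mul_left)

/-- For `a = m + 1` the kernel has modulus `|y₀|^{2κ Re z + 1}`, and the exponent is positive
exactly for `Re z > -1/(2κ)`. The integrand is then bounded with compact support. -/
theorem differentiableOn_integral_pvIntegrand {κ m : ℕ} (hκ : 1 ≤ κ) {ψ : Cn (n + 1) → ℝ}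
    {b : Cn (n + 1) → ℂ} (hψ : Continuous ψ) (hb : Continuous b) (hbs : HasCompactSupport b) :
    DifferentiableOn ℂ (fun z => ∫ y, pvIntegrand κ m (m + 1) ψ b z y)
      {z | -(1 / (2 * κ) : ℝ) < z.re} := by
  have hκ' : (0 : ℝ) < 2 * κ := by positivity
  have key : ∀ z : ℂ, -(1 / (2 * κ) : ℝ) < z.re → 0 < 2 * κ * z.re + 1 := fun z hz => by
    have := mul_lt_mul_of_pos_left hz hκ'
    rw [mul_neg, mul_one_div_cancel hκ'.ne'] at this
    linarith
  refine differentiableOn_integral_of_bound (fun z hz => ?_) (fun y => ?_) fun z₀ hz₀ => ?_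
  · exact (integrable_pvIntegrand hψ hb hbs (by push_cast; linarith [key z hz])).1
  · by_cases hy : y 0 = 0
    · have : (fun z => pvIntegrand κ m (m + 1) ψ b z y) = fun _ => 0 := by
        funext z
        simp [pvIntegrand, pvKernel, hy]
      rw [this]
      exact differentiableOn_const _
    · have hne : (‖y 0‖ : ℂ) ≠ 0 := by simpa using hy
      have : Differentiable ℂ (fun z => pvIntegrand κ m (m + 1) ψ b z y) := by
        unfold pvIntegrand pvKernel
        have h1 : Differentiable ℂ fun z : ℂ => (‖y 0‖ : ℂ) ^ (2 * κ * z) :=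
          (differentiable_id.const_mul _).const_cpow (Or.inl hne)
        fun_prop
      exact this.differentiableOn
  · have hz₀' : -(1 / (2 * κ) : ℝ) < z₀.re := hz₀
    set δ := (z₀.re + 1 / (2 * κ)) / 2 with hδ
    have hδ0 : 0 < δ := by rw [hδ]; linarith
    have hball : ∀ z ∈ Metric.closedBall z₀ δ, -(1 / (2 * κ) : ℝ) < z.re ∧ |z.re| ≤ ‖z₀‖ + δ := by
      intro z hz
      have h1 : ‖z - z₀‖ ≤ δ := by simpa [dist_eq_norm] using hz
      have h2 : |z.re - z₀.re| ≤ δ := by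
        simpa using (Complex.abs_re_le_norm (z - z₀)).trans h1
      refine ⟨?_, ?_⟩
      · have := (abs_le.1 h2).1
        linarith
      · have h3 : ‖z‖ ≤ ‖z₀‖ + ‖z - z₀‖ := by
          simpa using norm_add_le z₀ (z - z₀)
        exact (Complex.abs_re_le_norm z).trans (by linarith)
    set C := ‖z₀‖ + δ
    have hC : 0 ≤ C := by positivity
    -- Replacing `|y₀|` by `1 + |y₀| ≥ 1` makes the power increasing in the exponent, which is at
    -- most `2κC + 1` on the closed disc.
    refine ⟨δ, hδ0, fun z hz => (hball z hz).1,
      fun y => (1 + ‖y 0‖) ^ (2 * κ * C + 1) * (Real.exp (C * |ψ y|) * ‖b y‖), ?_, ?_⟩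
    · refine Continuous.integrable_of_hasCompactSupport ?_ (hbs.norm.mul_left.mul_left)
      have h1 : Continuous fun y : Cn (n + 1) => (1 + ‖y 0‖) ^ (2 * κ * C + 1) := by
        refine Continuous.rpow_const (by fun_prop) fun y => Or.inl ?_
        positivity
      exact h1.mul (by fun_prop)
    · intro z hz y
      obtain ⟨hz1, hz2⟩ := hball z hz
      have hk := key z hz1
      beta_reduce
      rw [pvIntegrand, norm_mul, norm_mul]
      gcongr ?_ * (?_ * _)
      · by_cases hy : y 0 = 0
        · rw [hy, pvKernel_zero (by simp; linarith)]
          simp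
        · rw [norm_pvKernel hy]
          have e : (2 * κ * z).re + ((m + 1 : ℕ) : ℝ) - m = 2 * κ * z.re + 1 := by
            simp; ring
          rw [e]
          calc ‖y 0‖ ^ (2 * κ * z.re + 1) ≤ (1 + ‖y 0‖) ^ (2 * κ * z.re + 1) :=
                Real.rpow_le_rpow (norm_nonneg _) (by linarith) hk.le
            _ ≤ _ := by
                refine Real.rpow_le_rpow_of_exponent_le (by linarith [norm_nonneg (y 0)]) ?_
                have := mul_le_mul_of_nonneg_left ((le_abs_self _).trans hz2) hκ'.le
                linarith
      · rw [Complex.norm_exp]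
        refine Real.exp_le_exp.2 ?_
        simp only [Complex.mul_re, Complex.ofReal_re, Complex.ofReal_im, mul_zero, sub_zero]
        refine (le_abs_self _).trans ?_
        rw [abs_mul]
        gcongr

/-- One integration by parts in `ȳ₀` raises the exponent `a` by one. The derivative of `e^{zψ} b`
splits into the term with `∂̄b` and a term with `∂̄ψ`, which carries a factor `z` and disappears at
`z = 0`. -/
theorem integral_pvIntegrand_succ {κ m a : ℕ} (hκ : 1 ≤ κ) {ψ : Cn (n + 1) → ℝ}
    {b : Cn (n + 1) → ℂ} (hψ : ContDiff ℝ ∞ ψ) (hb : ContDiff ℝ ∞ b) (hbs : HasCompactSupport b)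
    {z : ℂ} (hz : (m : ℝ) + 2 < z.re) :
    ∫ y, pvIntegrand κ m a ψ b z y = -(κ * z + (a + 1))⁻¹ *
      ((∫ y, pvIntegrand κ m (a + 1) ψ (wd Complex.I (Pi.single 0 1) b) z y) +
        z * ∫ y, pvIntegrand κ m (a + 1) ψ
          (fun y => wd Complex.I (Pi.single 0 1) (fun y => (ψ y : ℂ)) y * b y) z y) := by
  have hm0 : (0 : ℝ) ≤ m := m.cast_nonneg
  have ha0 : (0 : ℝ) ≤ a := a.cast_nonneg
  have hκ1 : (1 : ℝ) ≤ κ := by exact_mod_cast hκ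
  have hz0 : 0 < z.re := by linarith
  have h2 : (m : ℝ) + 2 < 2 * κ * z.re := by nlinarith
  have hne : (κ * z + (a + 1) : ℂ) ≠ 0 := by
    intro h
    have := congrArg Complex.re h
    simp at this
    nlinarith
  set F : Cn (n + 1) → ℂ := fun y => pvKernel (2 * κ * z) (a + 1) m (y 0) with hFd
  have hre : (2 * κ * z : ℂ).re = 2 * κ * z.re := by simp
  have hK : ∀ w : ℂ, DifferentiableAt ℝ (pvKernel (2 * κ * z) (a + 1) m) w := fun w =>
    (wd_pvKernel (by rw [hre]; push_cast; linarith) w).1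
  have hF : Differentiable ℝ F := by
    intro y
    have h1 : DifferentiableAt ℝ (fun y : Cn (n + 1) => y 0) y := by fun_prop
    exact (hK (y 0)).comp y h1
  have hw : ∀ e y, wd e (Pi.single 0 1) F y = wd e 1 (pvKernel (2 * κ * z) (a + 1) m) (y 0) := by
    intro e y
    rw [hFd, wd_comp_first (hK _), Pi.single_eq_same]
  have hw1 : wd Complex.I (Pi.single 0 1) F =
      fun y => (κ * z + (a + 1)) * pvKernel (2 * κ * z) a m (y 0) := by
    funext y
    rw [hw, wd_pvKernel_succ (by rw [hre]; linarith)]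
    ring
  have hw2 : wd (-Complex.I) (Pi.single 0 1) F =
      fun y => ((2 * κ * z) / 2 - m) * pvKernel (2 * κ * z) (a + 1) (m + 1) (y 0) := by
    funext y
    rw [hw, (wd_pvKernel (by rw [hre]; push_cast; linarith) _).2.2]
  have hc1 : Continuous (wd Complex.I (Pi.single 0 1) F) := by
    rw [hw1]
    exact continuous_const.mul ((continuous_pvKernel (by rw [hre]; linarith)).comp
      (continuous_apply 0))
  have hc2 : Continuous (wd (-Complex.I) (Pi.single 0 1) F) := by
    rw [hw2]
    exact continuous_const.mul ((continuous_pvKernel (by rw [hre]; push_cast; linarith)).comp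
      (continuous_apply 0))
  have hψC : ContDiff ℝ ∞ (fun y => (ψ y : ℂ)) := Complex.ofRealCLM.contDiff.comp hψ
  have ibp := integral_mul_wd_eq_neg (μ := volume) (e := Complex.I) hF hc1 hc2
    ((contDiff_cexp_mul hψ z).mul hb) hbs.mul_left
  simp only [wd_cexp_smul hψ hb] at ibp
  rw [hw1] at ibp
  have i1 : Integrable (pvIntegrand κ m (a + 1) ψ (wd Complex.I (Pi.single 0 1) b) z) :=
    integrable_pvIntegrand hψ.continuous hb.wd.continuous hbs.wd (by push_cast; linarith)
  have i2 : Integrable (pvIntegrand κ m (a + 1) ψ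
      (fun y => wd Complex.I (Pi.single 0 1) (fun y => (ψ y : ℂ)) y * b y) z) :=
    integrable_pvIntegrand hψ.continuous (hψC.wd.continuous.mul hb.continuous) hbs.mul_left
      (by push_cast; linarith)
  have e1 : ∫ y, F y * (Complex.exp (z * ψ y) * (wd Complex.I (Pi.single 0 1) b y +
      z * (wd Complex.I (Pi.single 0 1) (fun y => (ψ y : ℂ)) y * b y))) =
      (∫ y, pvIntegrand κ m (a + 1) ψ (wd Complex.I (Pi.single 0 1) b) z y) +
        z * ∫ y, pvIntegrand κ m (a + 1) ψ
          (fun y => wd Complex.I (Pi.single 0 1) (fun y => (ψ y : ℂ)) y * b y) z y := by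
    rw [← integral_const_mul, ← integral_add i1 (i2.const_mul z)]
    refine integral_congr_ae (Filter.Eventually.of_forall fun y => ?_)
    simp only [pvIntegrand, hFd]
    ring
  have e2 : ∫ y, (κ * z + (a + 1)) * pvKernel (2 * κ * z) a m (y 0) *
      (Complex.exp (z * ψ y) * b y) = (κ * z + (a + 1)) * ∫ y, pvIntegrand κ m a ψ b z y := by
    rw [← integral_const_mul]
    refine integral_congr_ae (Filter.Eventually.of_forall fun y => ?_)
    simp only [pvIntegrand]
    ring
  rw [← e1, ibp, e2]
  field_simp

/-- The number `j` counts the integrations by parts left before the kernel becomes integrable near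
`z = 0`. At `z = 0` the factors `(κz + a + 1)⁻¹` multiply to `a! / (m+1)!` and the `∂̄ψ` terms
vanish, so the value involves neither `κ` nor `ψ`. -/
theorem exists_continuation_pvIntegrand {κ m : ℕ} (hκ : 1 ≤ κ) {ψ : Cn (n + 1) → ℝ}
    (hψ : ContDiff ℝ ∞ ψ) (j : ℕ) : ∀ (a : ℕ) (b : Cn (n + 1) → ℂ), a + j = m + 1 →
    ContDiff ℝ ∞ b → HasCompactSupport b →
    ∃ G : ℂ → ℂ, DifferentiableOn ℂ G {z | -(1 / (2 * κ) : ℝ) < z.re} ∧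
      (∀ z : ℂ, (m : ℝ) + 2 < z.re → ∫ y, pvIntegrand κ m a ψ b z y = G z) ∧
      G 0 = (-1) ^ j * ((a.factorial : ℂ) / (m + 1).factorial) *
        ∫ y : Cn (n + 1), pvKernel 0 (m + 1) m (y 0) * (wd Complex.I (Pi.single 0 1))^[j] b y := by
  have hκ' : (0 : ℝ) < 2 * κ := by positivity
  induction j with
  | zero =>
    intro a b ha hb hbs
    obtain rfl : a = m + 1 := by omega
    refine ⟨_, differentiableOn_integral_pvIntegrand hκ hψ.continuous hb.continuous hbs,
      fun z _ => rfl, ?_⟩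
    have : ((m + 1).factorial : ℂ) ≠ 0 := by exact_mod_cast (Nat.factorial_ne_zero _)
    simp [pvIntegrand, div_self this]
  | succ j ih =>
    intro a b ha hb hbs
    have hψC : ContDiff ℝ ∞ (fun y => (ψ y : ℂ)) := Complex.ofRealCLM.contDiff.comp hψ
    obtain ⟨G₁, hd₁, he₁, h0₁⟩ := ih (a + 1) (wd Complex.I (Pi.single 0 1) b) (by omega) hb.wd hbs.wd
    obtain ⟨G₂, hd₂, he₂, -⟩ := ih (a + 1) (fun y => wd Complex.I (Pi.single 0 1)
      (fun y => (ψ y : ℂ)) y * b y) (by omega) (hψC.wd.mul hb) hbs.mul_left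
    -- The pole at `z = -(a+1)/κ` lies to the left of the half plane `Re z > -1/(2κ)`.
    refine ⟨fun z => -(κ * z + (a + 1))⁻¹ * (G₁ z + z * G₂ z), ?_, fun z hz => ?_, ?_⟩
    · have hne : ∀ z ∈ {z : ℂ | -(1 / (2 * κ) : ℝ) < z.re}, (κ * z + (a + 1) : ℂ) ≠ 0 := by
        intro z hz h
        have h1 : -(1 / (2 * κ) : ℝ) < z.re := hz
        have h2 := mul_lt_mul_of_pos_left h1 hκ'
        rw [mul_neg, mul_one_div_cancel hκ'.ne'] at h2
        have := congrArg Complex.re h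
        simp at this
        have := a.cast_nonneg (α := ℝ)
        linarith
      have hlin : DifferentiableOn ℂ (fun z : ℂ => (κ * z + (a + 1) : ℂ))
          {z | -(1 / (2 * κ) : ℝ) < z.re} := by fun_prop
      exact (hlin.inv hne).neg.mul (hd₁.add (differentiableOn_id.mul hd₂))
    · rw [integral_pvIntegrand_succ hκ hψ hb hbs hz, he₁ z hz, he₂ z hz]
    · beta_reduce
      rw [h0₁, ← Function.iterate_succ_apply, Nat.factorial_succ a]
      have h1 : ((m + 1).factorial : ℂ) ≠ 0 := by exact_mod_cast (Nat.factorial_ne_zero _)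
      have h2 : (a + 1 : ℂ) ≠ 0 := by exact_mod_cast a.succ_ne_zero
      push_cast
      simp only [mul_zero, zero_add, zero_mul, add_zero]
      field_simp
      ring

/-- The value at `z = 0` of the continuation of `∫ |y₀|^{2z} y₀^{-m} b`. -/
noncomputable def pvInt (m : ℕ) (b : Cn (n + 1) → ℂ) : ℂ :=
  (-1) ^ (m + 1) / ((m + 1).factorial : ℂ) *
    ∫ y : Cn (n + 1), pvKernel 0 (m + 1) m (y 0) * (wd Complex.I (Pi.single 0 1))^[m + 1] b y

theorem wd_iterate_sum {V E ι : Type*} [NormedAddCommGroup V] [NormedSpace ℝ V] [NormedSpace ℂ V]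
    [NormedAddCommGroup E] [NormedSpace ℝ E] [NormedSpace ℂ E] [IsScalarTower ℝ ℂ E] {e : ℂ} {v : V}
    {s : Finset ι} {f : ι → V → E} (hf : ∀ i ∈ s, ContDiff ℝ ∞ (f i)) (k : ℕ) :
    (wd e v)^[k] (fun y => ∑ i ∈ s, f i y) = fun y => ∑ i ∈ s, (wd e v)^[k] (f i) y := by
  induction k with
  | zero => rfl
  | succ k ih =>
    simp only [Function.iterate_succ_apply', ih]
    funext y
    exact wd_sum fun i hi => (((hf i hi).wd_iterate k).differentiable (by simp)) y

theorem integrable_pvInt {m : ℕ} {b : Cn (n + 1) → ℂ} (hb : Continuous b)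
    (hbs : HasCompactSupport b) :
    Integrable (fun y : Cn (n + 1) => pvKernel 0 (m + 1) m (y 0) * b y) :=
  (((continuous_pvKernel (by simp)).comp (continuous_apply 0)).mul
    hb).integrable_of_hasCompactSupport hbs.mul_left

theorem pvInt_sum {ι : Type*} {m : ℕ} {s : Finset ι} {b : ι → Cn (n + 1) → ℂ}
    (hb : ∀ i ∈ s, ContDiff ℝ ∞ (b i)) (hbs : ∀ i ∈ s, HasCompactSupport (b i)) :
    pvInt m (fun y => ∑ i ∈ s, b i y) = ∑ i ∈ s, pvInt m (b i) := by
  simp only [pvInt]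
  rw [wd_iterate_sum hb, ← Finset.mul_sum]
  congr 1
  simp only [Finset.mul_sum]
  exact integral_finsetSum s fun i hi =>
    integrable_pvInt ((hb i hi).wd_iterate _).continuous ((hbs i hi).wd_iterate _)

theorem hasContinuation_pvInt_of_contDiff {σ : Cn (n + 1) → ℝ} {b : Cn (n + 1) → ℂ}
    (hb : ContDiff ℝ ∞ b) (hbs : HasCompactSupport b) (m : ℕ) {κ : ℕ} (hκ : 1 ≤ κ)
    {ψ : Cn (n + 1) → ℝ} (hψ : ContDiff ℝ ∞ ψ)
    (hσ : ∀ y, b y ≠ 0 → σ y = ‖y 0‖ ^ κ * Real.exp (ψ y)) :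
    HasContinuation (fun z w => Integrable (fun y => (σ y : ℂ) ^ (2 * z) * ((y 0 ^ m)⁻¹ * b y)) ∧
      ∫ y, (σ y : ℂ) ^ (2 * z) * ((y 0 ^ m)⁻¹ * b y) = w) (pvInt m b) := by
  -- `σ^{2z} = |y₀|^{2κz} e^{2zψ}`, so the exponential factor of the integrand uses `2ψ`.
  have hψ2 : ContDiff ℝ ∞ (fun y => 2 * ψ y) := contDiff_const.mul hψ
  obtain ⟨G, hG, hGe, hG0⟩ := exists_continuation_pvIntegrand (m := m) hκ hψ2 (m + 1) 0 b (by omega)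
    hb hbs
  have hκ' : (1 : ℝ) ≤ κ := by exact_mod_cast hκ
  refine ⟨m + 2, 1 / (2 * κ), G, by positivity,
    hG.analyticOnNhd (isOpen_lt continuous_const Complex.continuous_re), fun z hz => ?_, ?_⟩
  · have hz0 : 0 < z.re := by linarith [m.cast_nonneg (α := ℝ)]
    have hzne : z ≠ 0 := by rintro rfl; simp at hz0
    have e : (fun y => (σ y : ℂ) ^ (2 * z) * ((y 0 ^ m)⁻¹ * b y)) =
        pvIntegrand κ m 0 (fun y => 2 * ψ y) b z := by
      funext y
      by_cases hy : b y = 0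
      · simp [pvIntegrand, hy]
      rw [pvIntegrand, hσ y hy]
      by_cases h0 : y 0 = 0
      · rw [h0, pvKernel_zero (by simp; nlinarith [m.cast_nonneg (α := ℝ)])]
        have : κ ≠ 0 := by omega
        simp [this, Complex.zero_cpow, hzne]
      · have hpos : 0 < ‖y 0‖ := norm_pos_iff.2 h0
        have hpos' : 0 < ‖y 0‖ ^ κ * Real.exp (ψ y) := by positivity
        rw [Complex.cpow_def_of_ne_zero (by exact_mod_cast hpos'.ne'), ← Complex.ofReal_log hpos'.le,
          Real.log_mul (by positivity) (Real.exp_pos _).ne', Real.log_pow, Real.log_exp, pvKernel,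
          Complex.cpow_def_of_ne_zero (by exact_mod_cast hpos.ne'), ← Complex.ofReal_log hpos.le]
        have : Complex.exp (((κ * Real.log ‖y 0‖ + ψ y : ℝ) : ℂ) * (2 * z)) =
            Complex.exp ((Real.log ‖y 0‖ : ℂ) * (2 * κ * z)) *
              Complex.exp (z * ((2 * ψ y : ℝ) : ℂ)) := by
          rw [← Complex.exp_add]
          congr 1
          push_cast
          ring
        rw [this]
        ring
    beta_reduce
    rw [e]
    refine ⟨integrable_pvIntegrand hψ2.continuous hb.continuous hbs ?_, hGe z hz⟩
    push_cast
    nlinarith [m.cast_nonneg (α := ℝ)]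
  · rw [hG0, pvInt]
    simp [div_eq_mul_inv]

/-- A function which is locally `|y₀|^κ e^ψ`, with `κ ≥ 1` and `ψ` smooth, near the points of `T`. -/
def IsNormLike (σ : Cn (n + 1) → ℝ) (T : Set (Cn (n + 1))) : Prop :=
  ∀ p ∈ T, ∃ r > 0, ∃ κ : ℕ, 1 ≤ κ ∧ ∃ ψ : Cn (n + 1) → ℝ, ContDiffOn ℝ ∞ ψ (Metric.ball p r) ∧
    ∀ y ∈ Metric.ball p r, σ y = ‖y 0‖ ^ κ * Real.exp (ψ y)

/-- The exponent `κ` and the function `ψ` exist only locally. Cutting `b` up by a partition of unity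
loses nothing, because each piece contributes `pvInt m` of itself whatever its `κ` and `ψ`, and
`pvInt m` is additive. -/
theorem hasContinuation_pvInt {σ : Cn (n + 1) → ℝ} {b : Cn (n + 1) → ℂ} (hb : ContDiff ℝ ∞ b)
    (hbs : HasCompactSupport b) (m : ℕ) (hσ : IsNormLike σ (tsupport b)) :
    HasContinuation (fun z w => Integrable (fun y => (σ y : ℂ) ^ (2 * z) * ((y 0 ^ m)⁻¹ * b y)) ∧
      ∫ y, (σ y : ℂ) ^ (2 * z) * ((y 0 ^ m)⁻¹ * b y) = w) (pvInt m b) := by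
  classical
  choose! r hr κ hκ ψ hψ hψσ using hσ
  have hbs' : IsCompact (tsupport b) := hbs
  obtain ⟨t, htT, htc⟩ := hbs'.elim_nhds_subcover (fun p => Metric.ball p (r p / 2))
    (fun p hp => Metric.ball_mem_nhds p (half_pos (hr p hp)))
  obtain ⟨f, hf⟩ := SmoothPartitionOfUnity.exists_isSubordinate 𝓘(ℝ, Cn (n + 1))
    (isClosed_tsupport b) (fun p : t => Metric.ball (p : Cn (n + 1)) (r p / 2))
    (fun _ => Metric.isOpen_ball) (fun y hy => by
      obtain ⟨p, hp, hyp⟩ := Set.mem_iUnion₂.1 (htc hy)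
      exact Set.mem_iUnion.2 ⟨⟨p, hp⟩, hyp⟩)
  have hfs : ∀ p, ContDiff ℝ ∞ (fun y => f p y) := fun p => contMDiff_iff_contDiff.1 (f p).contMDiff
  have hfC : ∀ p : t, ContDiff ℝ ∞ (fun y => (f p y : ℂ) * b y) := fun p =>
    (Complex.ofRealCLM.contDiff.comp (hfs p)).mul hb
  have hfK : ∀ p : t, HasCompactSupport (fun y => (f p y : ℂ) * b y) := fun p => hbs.mul_left
  have hsum : ∀ y, b y = ∑ p : t, (f p y : ℂ) * b y := by
    intro y
    by_cases hy : b y = 0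
    · simp [hy]
    · have h1 : ∑ᶠ p, f p y = 1 := f.sum_eq_one (subset_closure hy)
      rw [finsum_eq_sum_of_fintype] at h1
      rw [← Finset.sum_mul, ← Complex.ofReal_sum, h1]
      simp
  have hpv : pvInt m b = ∑ p : t, pvInt m (fun y => (f p y : ℂ) * b y) := by
    rw [← pvInt_sum (fun p _ => hfC p) (fun p _ => hfK p)]
    congr 1
    funext y
    exact hsum y
  rw [hpv]
  have hterm : ∀ p ∈ (Finset.univ : Finset t), HasContinuation (fun z w =>
      Integrable (fun y => (σ y : ℂ) ^ (2 * z) * ((y 0 ^ m)⁻¹ * ((f p y : ℂ) * b y))) ∧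
      ∫ y, (σ y : ℂ) ^ (2 * z) * ((y 0 ^ m)⁻¹ * ((f p y : ℂ) * b y)) = w)
      (pvInt m (fun y => (f p y : ℂ) * b y)) := by
    intro p _
    have hp := htT p p.2
    -- Multiplying `ψ` by a bump function makes it smooth on the whole space; it is unchanged where
    -- the piece of `b` is nonzero.
    let χ : ContDiffBump (p : Cn (n + 1)) :=
      ⟨r p / 2, 3 * r p / 4, half_pos (hr p hp), by linarith [hr p hp]⟩
    refine hasContinuation_pvInt_of_contDiff (hfC p) (hfK p) m (hκ p hp)
      (ψ := fun y => χ y * ψ p y) ?_ ?_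
    · rw [contDiff_iff_contDiffAt]
      intro y
      by_cases hy : y ∈ Metric.ball (p : Cn (n + 1)) (r p)
      · exact χ.contDiff.contDiffAt.mul ((hψ p hp).contDiffAt (Metric.isOpen_ball.mem_nhds hy))
      · have h0 : (fun y => χ y * ψ p y) =ᶠ[𝓝 y] fun _ => 0 := by
          have h1 : y ∈ (tsupport χ)ᶜ := by
            rw [χ.tsupport_eq]
            intro h2
            refine hy (Metric.closedBall_subset_ball ?_ h2)
            change 3 * r p / 4 < r p
            linarith [hr p hp]
          filter_upwards [(isClosed_tsupport χ).isOpen_compl.mem_nhds h1] with x hx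
          rw [image_eq_zero_of_notMem_tsupport hx, zero_mul]
        exact contDiffAt_const.congr_of_eventuallyEq h0
    · intro y hy
      have h1 : f p y ≠ 0 := by
        intro h
        simp [h] at hy
      have h2 : y ∈ Metric.ball (p : Cn (n + 1)) (r p / 2) := hf p (subset_closure h1)
      rw [hψσ p hp y (Metric.ball_subset_ball (by linarith [hr p hp]) h2),
        χ.one_of_mem_closedBall (Metric.ball_subset_closedBall h2), one_mul]
  refine (HasContinuation.sum Finset.univ hterm).imp 0 ?_
  rintro z w - ⟨u, hu, rfl⟩
  have e : (fun y => (σ y : ℂ) ^ (2 * z) * ((y 0 ^ m)⁻¹ * b y)) = fun y =>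
      ∑ p : t, (σ y : ℂ) ^ (2 * z) * ((y 0 ^ m)⁻¹ * ((f p y : ℂ) * b y)) := by
    funext y
    rw [← Finset.mul_sum, ← Finset.mul_sum, ← hsum]
  rw [e]
  refine ⟨integrable_finsetSum _ fun p hp => (hu p hp).1, ?_⟩
  rw [integral_finsetSum _ fun p hp => (hu p hp).1]
  exact Finset.sum_congr rfl fun p hp => (hu p hp).2

end LocalPrincipalValue

/-! ### The Cauchy-Pompeiu formula. -/

section CauchyPompeiu

open MeasureTheory Filter Topology Set

theorem integrableOn_polar_of_continuous {u : ℝ × ℝ → ℂ} (hu : Continuous u) {R : ℝ}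
    (h0 : ∀ r θ, R < r → u (r, θ) = 0) :
    IntegrableOn u (Ioi 0 ×ˢ Ioo (-Real.pi) Real.pi) := by
  have h1 : IntegrableOn u (Icc 0 R ×ˢ Icc (-Real.pi) Real.pi) :=
    hu.continuousOn.integrableOn_compact (isCompact_Icc.prod isCompact_Icc)
  refine h1.of_forall_sdiff_eq_zero (measurableSet_Ioi.prod measurableSet_Ioo) ?_
  rintro ⟨r, θ⟩ ⟨⟨hr, hθ⟩, hn⟩
  refine h0 r θ ?_
  by_contra hR
  exact hn ⟨⟨(mem_Ioi.1 hr).le, not_lt.1 hR⟩, Ioo_subset_Icc_self hθ⟩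

/-- The Cauchy-Pompeiu formula for a function with compact support. -/
theorem integral_inv_mul_wd {h : ℂ → ℂ} (hh : ContDiff ℝ ∞ h) (hs : HasCompactSupport h) :
    ∫ z : ℂ, z⁻¹ * wd Complex.I 1 h z = -Real.pi * h 0 := by
  obtain ⟨R, hR⟩ := hs.isCompact.isBounded.exists_norm_le
  have hzero : ∀ z : ℂ, |R| < ‖z‖ → h =ᶠ[𝓝 z] 0 := by
    intro z hz
    have : z ∉ tsupport h := fun hz' => by linarith [hR z hz', le_abs_self R]
    exact notMem_tsupport_iff_eventuallyEq.1 this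
  have hfd : ∀ z : ℂ, |R| < ‖z‖ → fderiv ℝ h z = 0 := fun z hz => by
    rw [(hzero z hz).fderiv_eq]; simp
  let c : ℝ → ℂ := fun θ => Complex.exp (θ * Complex.I)
  have hc : Continuous c := by fun_prop
  have hcn : ∀ θ, ‖c θ‖ = 1 := fun θ => Complex.norm_exp_ofReal_mul_I θ
  have hfc : Continuous (fderiv ℝ h) := hh.continuous_fderiv (by simp)
  -- At `z = r e^{iθ}`, `u = ∂_r h` and, for `r ≠ 0`, `v = r⁻¹ ∂_θ h`. The Jacobian `r` cancels the
  -- singularity: `r z⁻¹ ∂̄h = ½ u + (i/2) v`. The radial part integrates to `-2π h(0)`, the angular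
  -- part to `0` by periodicity.
  let u : ℝ × ℝ → ℂ := fun p => fderiv ℝ h (p.1 * c p.2) (c p.2)
  let v : ℝ × ℝ → ℂ := fun p => fderiv ℝ h (p.1 * c p.2) (Complex.I * c p.2)
  have hu : Continuous u := (hfc.comp (by fun_prop)).clm_apply (by fun_prop)
  have hv : Continuous v := (hfc.comp (by fun_prop)).clm_apply (by fun_prop)
  have hnorm : ∀ r θ, |R| < r → |R| < ‖(r : ℂ) * c θ‖ := fun r θ hr => by
    rw [norm_mul, hcn, mul_one, Complex.norm_real]
    exact hr.trans_le (le_abs_self r)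
  have hu0 : ∀ r θ, |R| < r → u (r, θ) = 0 := fun r θ hr => by
    simp only [u, hfd _ (hnorm r θ hr)]; simp
  have hv0 : ∀ r θ, |R| < r → v (r, θ) = 0 := fun r θ hr => by
    simp only [v, hfd _ (hnorm r θ hr)]; simp
  have hui := integrableOn_polar_of_continuous hu hu0
  have hvi := integrableOn_polar_of_continuous hv hv0
  have hd : Differentiable ℝ h := hh.differentiable (by simp)
  -- the radial part
  have hU : ∫ p in Ioi (0 : ℝ) ×ˢ Ioo (-Real.pi) Real.pi, u p = -(2 * Real.pi) * h 0 := by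
    rw [Measure.volume_eq_prod, ← setIntegral_prod_swap]
    have hswap : IntegrableOn (fun z : ℝ × ℝ => u z.swap) (Ioo (-Real.pi) Real.pi ×ˢ Ioi 0)
        (volume.prod volume) := by
      rw [IntegrableOn, ← Measure.prod_restrict]
      rw [IntegrableOn, Measure.volume_eq_prod, ← Measure.prod_restrict] at hui
      exact hui.swap
    rw [setIntegral_prod _ hswap]
    have inner : ∀ θ : ℝ, ∫ r in Ioi (0 : ℝ), u (r, θ) = - h 0 := by
      intro θ
      have hder : ∀ r : ℝ, HasDerivAt (fun r : ℝ => h (r * c θ)) (u (r, θ)) r := by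
        intro r
        have h1 : HasDerivAt (fun r : ℝ => (r : ℂ) * c θ) (c θ) r := by
          simpa using (Complex.ofRealCLM.hasDerivAt (x := r)).mul_const (c θ)
        exact (hd _).hasFDerivAt.comp_hasDerivAt r h1
      have hcont : Continuous fun r => u (r, θ) := hu.comp (by fun_prop)
      have hint : IntegrableOn (fun r => u (r, θ)) (Ioi 0) := by
        refine (hcont.continuousOn.integrableOn_compact
          (isCompact_Icc (a := 0) (b := |R|))).of_forall_sdiff_eq_zero measurableSet_Ioi ?_
        rintro r ⟨hr, hn⟩
        refine hu0 r θ ?_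
        by_contra hR
        exact hn ⟨(mem_Ioi.1 hr).le, not_lt.1 hR⟩
      have hlim : Tendsto (fun r : ℝ => h (r * c θ)) atTop (𝓝 0) := by
        refine tendsto_const_nhds.congr' ?_
        filter_upwards [eventually_gt_atTop |R|] with r hr
        exact (hzero _ (hnorm r θ hr)).eq_of_nhds.symm
      have := integral_Ioi_of_hasDerivAt_of_tendsto (hder 0).continuousAt.continuousWithinAt
        (fun r _ => hder r) hint hlim
      simpa using this
    simp only [Prod.swap_prod_mk, inner]
    rw [setIntegral_const]
    simp [Real.pi_pos.le]
    left
    ring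
  -- the angular part
  have hV : ∫ p in Ioi (0 : ℝ) ×ˢ Ioo (-Real.pi) Real.pi, v p = 0 := by
    rw [Measure.volume_eq_prod, setIntegral_prod _ hvi]
    refine setIntegral_eq_zero_of_forall_eq_zero fun r hr => ?_
    have hr' : (r : ℂ) ≠ 0 := by exact_mod_cast (mem_Ioi.1 hr).ne'
    have hder : ∀ θ : ℝ, HasDerivAt (fun θ : ℝ => h (r * c θ)) (r * v (r, θ)) θ := by
      intro θ
      have h0 : HasDerivAt (fun θ : ℝ => (θ : ℂ) * Complex.I) Complex.I θ := by
        simpa using (Complex.ofRealCLM.hasDerivAt (x := θ)).mul_const Complex.I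
      have h1 : HasDerivAt (fun θ : ℝ => (r : ℂ) * c θ) (r • (Complex.I * c θ)) θ := by
        have := h0.cexp.const_mul (r : ℂ)
        rw [Complex.real_smul, mul_comm Complex.I]
        exact this
      have h2 := (hd _).hasFDerivAt.comp_hasDerivAt θ h1
      rw [map_smul, Complex.real_smul] at h2
      exact h2
    have hcont : Continuous fun θ => (r : ℂ) * v (r, θ) :=
      continuous_const.mul (hv.comp (by fun_prop))
    have h3 := intervalIntegral.integral_eq_sub_of_hasDerivAt (a := -Real.pi) (b := Real.pi)
      (fun θ _ => hder θ) (hcont.intervalIntegrable _ _)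
    have h4 : c Real.pi = c (-Real.pi) := by simp [c, Complex.exp_neg]
    rw [h4, sub_self, intervalIntegral.integral_const_mul,
      intervalIntegral.integral_of_le (by linarith [Real.pi_pos]), integral_Ioc_eq_integral_Ioo] at h3
    exact (mul_eq_zero.1 h3).resolve_left hr'
  rw [← Complex.integral_comp_polarCoord_symm, polarCoord_target]
  have hker : ∀ p ∈ Ioi (0 : ℝ) ×ˢ Ioo (-Real.pi) Real.pi,
      p.1 • ((Complex.polarCoord.symm p)⁻¹ * wd Complex.I 1 h (Complex.polarCoord.symm p)) =
        (1 / 2) * u p + Complex.I / 2 * v p := by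
    rintro ⟨r, θ⟩ ⟨hr, -⟩
    have hr' : (r : ℂ) ≠ 0 := by exact_mod_cast (mem_Ioi.1 hr).ne'
    have hz : Complex.polarCoord.symm (r, θ) = r * c θ := by
      rw [Complex.polarCoord_symm_apply]
      simp [c, Complex.exp_mul_I]
    have hcc : c θ * starRingEnd ℂ (c θ) = 1 := by
      rw [Complex.mul_conj, Complex.normSq_eq_norm_sq, hcn]; simp
    have hc0 : c θ ≠ 0 := fun h => by simp [h] at hcc
    have e1 := fderiv_smul_direction h (r * c θ) 1 (c θ)
    have e2 := fderiv_smul_direction h (r * c θ) 1 (Complex.I * c θ)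
    simp only [smul_eq_mul, mul_one, map_mul, Complex.conj_I] at e1 e2
    rw [hz]
    simp only [u, v, e1, e2]
    rw [Complex.real_smul, mul_inv, ← mul_assoc, ← mul_assoc, mul_inv_cancel₀ hr', one_mul,
      inv_eq_of_mul_eq_one_right hcc]
    have hI : Complex.I * Complex.I = -1 := Complex.I_mul_I
    linear_combination ((starRingEnd ℂ) (c θ) * wd Complex.I 1 h (r * c θ) / 2 -
      c θ * wd (-Complex.I) 1 h (r * c θ) / 2) * hI
  rw [setIntegral_congr_fun (measurableSet_Ioi.prod measurableSet_Ioo) hker,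
    integral_add (hui.const_mul _) (hvi.const_mul _), integral_const_mul, integral_const_mul, hU, hV]
  ring

end CauchyPompeiu

/-! ### The principal value of a `∂̄`-derivative. -/

section ResidueFormula

open MeasureTheory Filter Topology

variable {n : ℕ}

/-- Fubini, with the Cauchy-Pompeiu formula on each line on which the other coordinates are
constant. -/
theorem integral_inv_first_mul_wd {H : Cn (n + 1) → ℂ} (hH : ContDiff ℝ ∞ H)
    (hs : HasCompactSupport H)
    (hi : Integrable fun y : Cn (n + 1) => (y 0)⁻¹ * wd Complex.I (Pi.single 0 1) H y) :
    ∫ y : Cn (n + 1), (y 0)⁻¹ * wd Complex.I (Pi.single 0 1) H y =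
      -Real.pi * ∫ z : Cn n, H (Fin.cons 0 z) := by
  let e := MeasurableEquiv.piFinSuccAbove (fun _ : Fin (n + 1) => ℂ) 0
  have he : MeasurePreserving e.symm volume volume :=
    (volume_preserving_piFinSuccAbove (fun _ : Fin (n + 1) => ℂ) 0).symm e
  have hes : ∀ (t : ℂ) (z : Cn n), e.symm (t, z) = Fin.cons t z := by
    intro t z
    simp [e, MeasurableEquiv.piFinSuccAbove, Fin.insertNthEquiv]
  have hline : ∀ (t : ℂ) (z : Cn n), (Fin.cons 0 z : Cn (n + 1)) + t • Pi.single 0 1 =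
      Fin.cons t z := by
    intro t z
    funext i
    refine Fin.cases ?_ (fun i => ?_) i <;> simp
  rw [← he.integral_comp']
  have hi' := (he.integrable_comp_emb e.symm.measurableEmbedding).2 hi
  rw [Measure.volume_eq_prod] at hi' ⊢
  simp only [Function.comp_def] at hi'
  rw [integral_prod_symm _ hi', ← integral_const_mul]
  refine integral_congr_ae (Filter.Eventually.of_forall fun z => ?_)
  beta_reduce
  have hL : ContDiff ℝ ∞ fun t : ℂ => (Fin.cons 0 z : Cn (n + 1)) + t • Pi.single 0 (1 : ℂ) := by
    fun_prop
  have hsl : ContDiff ℝ ∞ fun t : ℂ => H ((Fin.cons 0 z : Cn (n + 1)) + t • Pi.single 0 (1 : ℂ)) :=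
    hH.comp hL
  have hcs : HasCompactSupport
      fun t : ℂ => H ((Fin.cons 0 z : Cn (n + 1)) + t • Pi.single 0 (1 : ℂ)) := by
    refine HasCompactSupport.intro (K := (fun y : Cn (n + 1) => y 0) '' tsupport H)
      (hs.isCompact.image (continuous_apply 0)) fun t ht => ?_
    rw [hline]
    refine image_eq_zero_of_notMem_tsupport fun h => ht ⟨_, h, by simp⟩
  have := integral_inv_mul_wd hsl hcs
  simp only [zero_smul, add_zero] at this
  rw [← this]
  refine integral_congr_ae (Filter.Eventually.of_forall fun t => ?_)
  beta_reduce
  rw [wd_comp_line ((hH.differentiable (by simp)) _), hes, hline]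
  simp

theorem differentiable_pvKernel_first {a m : ℕ} (h : m + 1 < a) :
    Differentiable ℝ fun y : Cn (n + 1) => pvKernel 0 a m (y 0) := by
  intro y
  have h1 : DifferentiableAt ℝ (fun y : Cn (n + 1) => y 0) y := by fun_prop
  exact (wd_pvKernel (s := 0) (a := a) (m := m)
    (by rw [Complex.zero_re, zero_add]; exact_mod_cast h) (y 0)).1.comp y h1

theorem wd_pvKernel_first {a m : ℕ} (h : m + 1 < a + 1) (y : Cn (n + 1)) :
    wd Complex.I (Pi.single 0 1) (fun y : Cn (n + 1) => pvKernel 0 (a + 1) m (y 0)) y =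
        (a + 1) * pvKernel 0 a m (y 0) ∧
      wd (-Complex.I) (Pi.single 0 1) (fun y : Cn (n + 1) => pvKernel 0 (a + 1) m (y 0)) y =
        -m * pvKernel 0 (a + 1) (m + 1) (y 0) := by
  have hre : (m : ℝ) + 1 < (0 : ℂ).re + ((a + 1 : ℕ) : ℝ) := by
    rw [Complex.zero_re, zero_add]; exact_mod_cast h
  have hre' : (m : ℝ) < (0 : ℂ).re + (a : ℝ) := by push_cast at hre; linarith
  have hK := (wd_pvKernel hre (y 0)).1
  rw [wd_comp_first hK, wd_comp_first hK, Pi.single_eq_same, wd_pvKernel_succ hre',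
    (wd_pvKernel hre (y 0)).2.2]
  constructor <;> ring

theorem continuous_wd_pvKernel_first {a m : ℕ} (h : m + 1 < a + 1) :
    Continuous (wd Complex.I (Pi.single 0 1)
        (fun y : Cn (n + 1) => pvKernel 0 (a + 1) m (y 0))) ∧
      Continuous (wd (-Complex.I) (Pi.single 0 1)
        (fun y : Cn (n + 1) => pvKernel 0 (a + 1) m (y 0))) := by
  have h1 : (m : ℝ) + 1 < a + 1 := by exact_mod_cast h
  constructor
  · rw [funext fun y => (wd_pvKernel_first h y).1]
    exact continuous_const.mul ((continuous_pvKernel (by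
      rw [Complex.zero_re, zero_add]; linarith)).comp (continuous_apply 0))
  · rw [funext fun y => (wd_pvKernel_first h y).2]
    exact continuous_const.mul ((continuous_pvKernel (by
      rw [Complex.zero_re, zero_add]; push_cast; linarith)).comp (continuous_apply 0))

theorem wd_iterate_comm_of_contDiff {e e' : ℂ} {v v' : Cn (n + 1)} {f : Cn (n + 1) → ℂ}
    (hf : ContDiff ℝ ∞ f) (k : ℕ) :
    wd e v ((wd e' v')^[k] f) = (wd e' v')^[k] (wd e v f) :=
  funext fun y => wd_iterate_comm isOpen_univ hf.contDiffOn k (Set.mem_univ y)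

/-- The kernel depends on the first coordinate only, so integration by parts in another direction
leaves nothing. -/
theorem pvInt_wd_of_ne {m : ℕ} {b : Cn (n + 1) → ℂ} (hb : ContDiff ℝ ∞ b)
    (hs : HasCompactSupport b) {k : Fin (n + 1)} (hk : k ≠ 0) :
    pvInt m (wd Complex.I (Pi.single k 1) b) = 0 := by
  rw [pvInt, ← wd_iterate_comm_of_contDiff hb, integral_mul_wd_eq_zero (μ := volume)
    (F := fun y : Cn (n + 1) => pvKernel 0 (m + 1) m (y 0)) ?_ ?_ (hb.wd_iterate _)
    (hs.wd_iterate _), mul_zero]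
  · exact (continuous_pvKernel (by simp)).comp (continuous_apply 0)
  · intro x c
    simp [hk.symm]

/-- Formally `1 / y₀^{m+1} = -(1/m) ∂₁(1 / y₀^m)`. With the regularized kernels this is made
rigorous by taking `F = ȳ₀^{m+2} / y₀^m` and integrating `∂∂̄c` against it by parts in both ways:
`∂F` gives the kernel of order `m + 1` and `∂̄F` that of order `m`. -/
theorem pvInt_succ_wd {m : ℕ} (hm : 1 ≤ m) {b : Cn (n + 1) → ℂ} (hb : ContDiff ℝ ∞ b)
    (hs : HasCompactSupport b) :
    pvInt (m + 1) (wd Complex.I (Pi.single 0 1) b) =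
      (m : ℂ)⁻¹ * pvInt m (wd Complex.I (Pi.single 0 1) (wd (-Complex.I) (Pi.single 0 1) b)) := by
  have hm0 : (m : ℂ) ≠ 0 := by exact_mod_cast (by omega : m ≠ 0)
  set F : Cn (n + 1) → ℂ := fun y => pvKernel 0 (m + 1 + 1) m (y 0) with hF
  have hFd : Differentiable ℝ F := differentiable_pvKernel_first (by omega)
  obtain ⟨hc1, hc2⟩ := continuous_wd_pvKernel_first (n := n) (a := m + 1) (m := m) (by omega)
  have hw : ∀ y, wd Complex.I (Pi.single 0 1) F y =
        ((m + 1 : ℕ) + 1) * pvKernel 0 (m + 1) m (y 0) ∧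
      wd (-Complex.I) (Pi.single 0 1) F y = -m * pvKernel 0 (m + 1 + 1) (m + 1) (y 0) :=
    fun y => wd_pvKernel_first (by omega) y
  set c := (wd Complex.I (Pi.single 0 1))^[m + 1 + 1] b with hc
  have hcc : ContDiff ℝ ∞ c := hb.wd_iterate _
  have hcs : HasCompactSupport c := hs.wd_iterate _
  have i1 := integral_mul_wd_eq_neg (μ := volume) (e := -Complex.I) hFd hc1 hc2 hcc.wd hcs.wd
    (g := wd Complex.I (Pi.single 0 1) c)
  have i2 := integral_mul_wd_eq_neg (μ := volume) (e := Complex.I) hFd hc1 hc2 hcc.wd hcs.wd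
    (g := wd (-Complex.I) (Pi.single 0 1) c)
  simp only [(hw _).1, (hw _).2, mul_assoc] at i1 i2
  rw [integral_const_mul] at i1 i2
  have e1 : (fun y => wd (-Complex.I) (Pi.single 0 1) (wd Complex.I (Pi.single 0 1) c) y) =
      wd Complex.I (Pi.single 0 1) (wd (-Complex.I) (Pi.single 0 1) c) :=
    funext fun y => wd_comm hcc.contDiffAt
  simp only [congrFun e1] at i1
  rw [i2] at i1
  rw [pvInt, pvInt, ← Function.iterate_succ_apply, ← Function.iterate_succ_apply,
    Function.iterate_succ_apply', ← hc, ← wd_iterate_comm_of_contDiff hb, ← hc]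
  have h1 : ((m + 1).factorial : ℂ) ≠ 0 := by exact_mod_cast Nat.factorial_ne_zero _
  have h2 : (m + 1 + 1 : ℂ) ≠ 0 := by exact_mod_cast (by omega : m + 1 + 1 ≠ 0)
  have h3 : (((m + 1 + 1).factorial : ℕ) : ℂ) = (m + 1 + 1) * ((m + 1).factorial : ℂ) := by
    rw [Nat.factorial_succ]; push_cast; ring
  rw [h3]
  push_cast at i1
  simp only [neg_mul] at i1
  field_simp
  linear_combination -(-1) ^ m * i1

/-- The integrations by parts defining `pvInt 1` are undone: the regularized integrand is `y₀⁻¹ ∂̄H`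
for a compactly supported `H` which coincides with `b` on `y₀ = 0`. -/
theorem pvInt_one_wd {b : Cn (n + 1) → ℂ} (hb : ContDiff ℝ ∞ b) (hs : HasCompactSupport b) :
    pvInt 1 (wd Complex.I (Pi.single 0 1) b) = -Real.pi * ∫ z : Cn n, b (Fin.cons 0 z) := by
  set b1 := wd Complex.I (Pi.single 0 1) b with hb1
  set b2 := wd Complex.I (Pi.single 0 1) b1 with hb2
  set b3 := wd Complex.I (Pi.single 0 1) b2 with hb3
  have hb1c : ContDiff ℝ ∞ b1 := hb.wd
  have hb2c : ContDiff ℝ ∞ b2 := hb1c.wd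
  have hconj : ∀ k, ContDiff ℝ ∞ fun y : Cn (n + 1) => (starRingEnd ℂ (y 0)) ^ k := fun k => by
    have h1 : ContDiff ℝ ∞ fun y : Cn (n + 1) => y 0 := by fun_prop
    exact ((Complex.conjCLE : ℂ →L[ℝ] ℂ).contDiff.comp h1).pow k
  have hwc : ∀ (k : ℕ) (y : Cn (n + 1)), wd Complex.I (Pi.single 0 1)
      (fun y : Cn (n + 1) => (starRingEnd ℂ (y 0)) ^ k) y = k * (starRingEnd ℂ (y 0)) ^ (k - 1) := by
    intro k y
    rw [wd_comp_first (K := fun z => (starRingEnd ℂ z) ^ k) (wd_conj_pow k _).1, Pi.single_eq_same,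
      (wd_conj_pow k _).2.1]
  -- `H = ½ ȳ₀² ∂̄²b - ȳ₀ ∂̄b + b`; the lower order terms telescope in `∂̄H = ½ ȳ₀² ∂̄³b`.
  let H : Cn (n + 1) → ℂ := fun y => ((1 / 2 : ℂ) * ((starRingEnd ℂ (y 0)) ^ 2 * b2 y) +
    (-1 : ℂ) * ((starRingEnd ℂ (y 0)) ^ 1 * b1 y)) + b y
  have hHc : ContDiff ℝ ∞ H := ((contDiff_const.mul ((hconj 2).mul hb2c)).add
    (contDiff_const.mul ((hconj 1).mul hb1c))).add hb
  have hHs : HasCompactSupport H :=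
    ((hs.wd.wd.mul_left.mul_left).add hs.wd.mul_left.mul_left).add hs
  have hdiff : ∀ {f : Cn (n + 1) → ℂ}, ContDiff ℝ ∞ f → ∀ y, DifferentiableAt ℝ f y := fun hf y =>
    (hf.differentiable (by simp)) y
  have hwH : ∀ y, wd Complex.I (Pi.single 0 1) H y =
      1 / 2 * ((starRingEnd ℂ (y 0)) ^ 2 * b3 y) := by
    intro y
    have e2 := wd_smul (e := Complex.I) (v := Pi.single 0 1) (hdiff (hconj 2) y) (hdiff hb2c y)
    have e1 := wd_smul (e := Complex.I) (v := Pi.single 0 1) (hdiff (hconj 1) y) (hdiff hb1c y)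
    have c2 := wd_const_smul (e := Complex.I) (v := Pi.single 0 1) (1 / 2)
      (hdiff ((hconj 2).mul hb2c) y)
    have c1 := wd_const_smul (e := Complex.I) (v := Pi.single 0 1) (-1)
      (hdiff ((hconj 1).mul hb1c) y)
    simp only [smul_eq_mul] at e1 e2 c1 c2
    simp only [H]
    rw [wd_add (hdiff ((contDiff_const.mul ((hconj 2).mul hb2c)).add
      (contDiff_const.mul ((hconj 1).mul hb1c))) y) (hdiff hb y),
      wd_add (hdiff (contDiff_const.mul ((hconj 2).mul hb2c)) y)
        (hdiff (contDiff_const.mul ((hconj 1).mul hb1c)) y), c1, c2, e1, e2, hwc, hwc,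
      ← hb1, ← hb2, ← hb3]
    push_cast
    ring
  have hker : ∀ y : Cn (n + 1), (y 0)⁻¹ * wd Complex.I (Pi.single 0 1) H y =
      1 / 2 * (pvKernel 0 (1 + 1) 1 (y 0) * b3 y) := by
    intro y
    rw [hwH, pvKernel]
    simp
    ring
  have hint : Integrable fun y : Cn (n + 1) => (y 0)⁻¹ * wd Complex.I (Pi.single 0 1) H y := by
    simp only [hker]
    exact (integrable_pvInt hb2c.wd.continuous hs.wd.wd.wd).const_mul _
  have := integral_inv_first_mul_wd hHc hHs hint
  simp only [hker] at this
  rw [integral_const_mul] at this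
  have hH0 : ∀ z : Cn n, H (Fin.cons 0 z) = b (Fin.cons 0 z) := fun z => by simp [H]
  simp only [hH0] at this
  rw [← this, pvInt]
  simp [hb3, hb2]

theorem pvInt_succ_wd_eq {m : ℕ} : ∀ {b : Cn (n + 1) → ℂ}, ContDiff ℝ ∞ b → HasCompactSupport b →
    pvInt (m + 1) (wd Complex.I (Pi.single 0 1) b) =
      -Real.pi / (m.factorial : ℂ) *
        ∫ z : Cn n, (wd (-Complex.I) (Pi.single 0 1))^[m] b (Fin.cons 0 z) := by
  induction m with
  | zero =>
    intro b hb hs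
    simpa using pvInt_one_wd hb hs
  | succ m ih =>
    intro b hb hs
    rw [pvInt_succ_wd (by omega) hb hs, ih hb.wd hs.wd, ← Function.iterate_succ_apply,
      Nat.factorial_succ]
    have h1 : (m.factorial : ℂ) ≠ 0 := by exact_mod_cast Nat.factorial_ne_zero _
    have h2 : (m + 1 : ℂ) ≠ 0 := by exact_mod_cast (by omega : m + 1 ≠ 0)
    push_cast
    field_simp

end ResidueFormula

/-! ### Linear algebra of alternating forms. -/

namespace AltForm

variable {d k l : ℕ}

instance : FiniteDimensional ℝ (AltForm d k) := by
  let Φ : AltForm d k →ₗ[ℝ] MultilinearMap ℝ (fun _ : Fin k => Cn d) ℂ :=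
    { toFun := fun a => a.toMultilinearMap
      map_add' := fun _ _ => rfl
      map_smul' := fun _ _ => rfl }
  refine FiniteDimensional.of_injective Φ fun a b h => ?_
  ext v
  exact congrArg (fun m : MultilinearMap ℝ (fun _ : Fin k => Cn d) ℂ => m v) h

instance : CompleteSpace (AltForm d k) := FiniteDimensional.complete ℝ _

/-- Evaluation of a form at a tuple, as a continuous linear map. -/
noncomputable def evalCLM (v : Fin k → Cn d) : AltForm d k →L[ℝ] ℂ :=
  LinearMap.toContinuousLinearMap
    { toFun := fun a => a v
      map_add' := fun _ _ => rfl
      map_smul' := fun _ _ => rfl }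

/-- Values of a form on tuples of vectors of a basis. -/
noncomputable def basisEval (d k : ℕ) :
    AltForm d k →ₗ[ℝ] ((Fin k → Fin (Module.finrank ℝ (Cn d))) → ℂ) where
  toFun a w := a fun i => Module.finBasis ℝ (Cn d) (w i)
  map_add' _ _ := rfl
  map_smul' _ _ := rfl

theorem basisEval_injective : LinearMap.ker (basisEval d k) = ⊥ := by
  refine LinearMap.ker_eq_bot.2 fun a b h => ?_
  have : a.toMultilinearMap = b.toMultilinearMap :=
    (Module.Basis.ext_multilinear (fun _ : Fin k => Module.finBasis ℝ (Cn d))) fun w =>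
      congrFun h w
  ext v
  exact congrArg (fun m : MultilinearMap ℝ (fun _ : Fin k => Cn d) ℂ => m v) this

/-- The values on tuples of basis vectors determine a form, and a linear left inverse recovers the
form from these finitely many coefficients. Smoothness can therefore be tested coefficientwise. -/
theorem contDiffWithinAt_iff {V : Type*} [NormedAddCommGroup V] [NormedSpace ℝ V]
    {f : V → AltForm d k} {s : Set V} {x : V} :
    ContDiffWithinAt ℝ ∞ f s x ↔ ∀ v, ContDiffWithinAt ℝ ∞ (fun y => f y v) s x := by
  constructor
  · intro h v
    exact (evalCLM v).contDiff.comp_contDiffWithinAt h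
  · intro h
    obtain ⟨G, hG⟩ := (basisEval d k).exists_leftInverse_of_injective basisEval_injective
    have h1 : ContDiffWithinAt ℝ ∞ (fun y => basisEval d k (f y)) s x :=
      contDiffWithinAt_pi.2 fun w => h _
    have h2 : ContDiffWithinAt ℝ ∞ (fun y => LinearMap.toContinuousLinearMap G
      (basisEval d k (f y))) s x :=
      (LinearMap.toContinuousLinearMap G).contDiff.comp_contDiffWithinAt h1
    refine h2.congr_of_eventuallyEq (Filter.Eventually.of_forall fun y => ?_) ?_
    · exact (LinearMap.congr_fun hG (f y)).symm
    · exact (LinearMap.congr_fun hG (f x)).symm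

theorem contDiffOn_iff {V : Type*} [NormedAddCommGroup V] [NormedSpace ℝ V]
    {f : V → AltForm d k} {s : Set V} :
    ContDiffOn ℝ ∞ f s ↔ ∀ v, ContDiffOn ℝ ∞ (fun y => f y v) s :=
  ⟨fun h v x hx => contDiffWithinAt_iff.1 (h x hx) v,
    fun h x hx => contDiffWithinAt_iff.2 fun v => h v x hx⟩

theorem apply_eq_sum (a : AltForm d k) (v : Fin k → Cn d) :
    a v = ∑ w : Fin k → Fin (Module.finrank ℝ (Cn d)),
      (∏ i, (Module.finBasis ℝ (Cn d)).repr (v i) (w i)) •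
        a fun i => Module.finBasis ℝ (Cn d) (w i) := by
  have h1 : v = fun i => ∑ j, (Module.finBasis ℝ (Cn d)).repr (v i) j •
      Module.finBasis ℝ (Cn d) j := by
    funext i
    exact ((Module.finBasis ℝ (Cn d)).sum_repr (v i)).symm
  conv_lhs => rw [h1]
  change a.toMultilinearMap _ = _
  rw [MultilinearMap.map_sum]
  refine Finset.sum_congr rfl fun w _ => ?_
  exact a.toMultilinearMap.map_smul_univ _ _

theorem _root_.ContDiffWithinAt.altForm_apply {V : Type*} [NormedAddCommGroup V] [NormedSpace ℝ V]
    {f : V → AltForm d k} {v : V → Fin k → Cn d} {s : Set V} {x : V}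
    (hf : ContDiffWithinAt ℝ ∞ f s x) (hv : ∀ i, ContDiffWithinAt ℝ ∞ (fun y => v y i) s x) :
    ContDiffWithinAt ℝ ∞ (fun y => f y (v y)) s x := by
  rw [show (fun y => f y (v y)) = _ from funext fun y => apply_eq_sum (f y) (v y)]
  refine ContDiffWithinAt.sum fun w _ => ?_
  have h2 := contDiffWithinAt_iff.1 hf fun i => Module.finBasis ℝ (Cn d) (w i)
  refine ContDiffWithinAt.smul (f := fun y => ∏ i, (Module.finBasis ℝ (Cn d)).repr (v y i) (w i))
    ?_ h2
  refine contDiffWithinAt_prod fun i _ => ?_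
  have h1 : ContDiff ℝ ∞ fun u : Cn d => (Module.finBasis ℝ (Cn d)).repr u (w i) :=
    (LinearMap.toContinuousLinearMap ((Module.finBasis ℝ (Cn d)).coord (w i))).contDiff
  exact h1.comp_contDiffWithinAt (hv i)

theorem _root_.ContDiffWithinAt.altForm_comp {V : Type*} [NormedAddCommGroup V] [NormedSpace ℝ V]
    {e : ℕ} {f : V → AltForm d k} {L : V → Cn e →L[ℝ] Cn d} {s : Set V} {x : V}
    (hf : ContDiffWithinAt ℝ ∞ f s x) (hL : ContDiffWithinAt ℝ ∞ L s x) :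
    ContDiffWithinAt ℝ ∞ (fun y => (f y).compContinuousLinearMap (L y)) s x :=
  contDiffWithinAt_iff.2 fun v => hf.altForm_apply (v := fun y i => L y (v i)) fun _ =>
    hL.clm_apply contDiffWithinAt_const

theorem wedge_apply (a : AltForm d k) (b : AltForm d l) (v : Fin (k + l) → Cn d) :
    a.wedge b v = ((k.factorial * l.factorial : ℕ) : ℂ)⁻¹ *
      ∑ σ : Equiv.Perm (Fin (k + l)), (Equiv.Perm.sign σ : ℂ) *
        (a (fun i => v (σ (Fin.castAdd l i))) * b (fun i => v (σ (Fin.natAdd k i)))) := by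
  rw [wedge, ContinuousAlternatingMap.smul_apply,
    ContinuousMultilinearMap.alternatization_apply_apply, Complex.real_smul]
  congr 1
  · push_cast; rfl
  · refine Finset.sum_congr rfl fun σ _ => ?_
    rw [Units.smul_def, zsmul_eq_mul]
    congr 1

theorem _root_.ContDiffWithinAt.altForm_wedge {V : Type*} [NormedAddCommGroup V] [NormedSpace ℝ V]
    {f : V → AltForm d k} {g : V → AltForm d l} {s : Set V} {x : V}
    (hf : ContDiffWithinAt ℝ ∞ f s x) (hg : ContDiffWithinAt ℝ ∞ g s x) :
    ContDiffWithinAt ℝ ∞ (fun y => (f y).wedge (g y)) s x := by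
  refine contDiffWithinAt_iff.2 fun v => ?_
  simp only [wedge_apply]
  exact contDiffWithinAt_const.mul (ContDiffWithinAt.sum fun σ _ => contDiffWithinAt_const.mul
    ((contDiffWithinAt_iff.1 hf _).mul (contDiffWithinAt_iff.1 hg _)))

theorem wedge_smul_left (c : ℂ) (a : AltForm d k) (b : AltForm d l) :
    (c • a).wedge b = c • a.wedge b := by
  ext v
  rw [ContinuousAlternatingMap.smul_apply, wedge_apply, wedge_apply, smul_eq_mul, mul_left_comm,
    Finset.mul_sum (a := c)]
  congr 1
  refine Finset.sum_congr rfl fun σ _ => ?_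
  rw [ContinuousAlternatingMap.smul_apply, smul_eq_mul]
  ring

theorem wedge_smul_right (c : ℂ) (a : AltForm d k) (b : AltForm d l) :
    a.wedge (c • b) = c • a.wedge b := by
  ext v
  rw [ContinuousAlternatingMap.smul_apply, wedge_apply, wedge_apply, smul_eq_mul, mul_left_comm,
    Finset.mul_sum (a := c)]
  congr 1
  refine Finset.sum_congr rfl fun σ _ => ?_
  rw [ContinuousAlternatingMap.smul_apply, smul_eq_mul]
  ring

theorem wedge_compContinuousLinearMap {e : ℕ} (a : AltForm d k) (b : AltForm d l)
    (L : Cn e →L[ℝ] Cn d) :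
    (a.wedge b).compContinuousLinearMap L =
      wedge (a.compContinuousLinearMap L) (b.compContinuousLinearMap L) := by
  ext v
  rw [ContinuousAlternatingMap.compContinuousLinearMap_apply, wedge_apply, wedge_apply]
  rfl

theorem IsType.wedge {p q r t : ℕ} {a : AltForm d k} {b : AltForm d l} (ha : a.IsType p q)
    (hb : b.IsType r t) : (a.wedge b).IsType (p + r) (q + t) := by
  refine ⟨by have := ha.1; have := hb.1; omega, fun c v => ?_⟩
  rw [wedge_apply, wedge_apply, mul_left_comm, Finset.mul_sum (a := c ^ (p + r) * _)]
  congr 1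
  refine Finset.sum_congr rfl fun σ _ => ?_
  rw [ha.2 c fun i => v (σ (Fin.castAdd l i)), hb.2 c fun i => v (σ (Fin.natAdd k i))]
  ring

/-- Real alternating forms of top degree are multiples of the determinant; this applies to the real
and imaginary parts of `a`. -/
theorem map_comp_of_top (a : AltForm d k) (hk : k = 2 * d) (L : Cn d →L[ℝ] Cn d)
    (v : Fin k → Cn d) : a (fun i => L (v i)) = ((LinearMap.det (L : Cn d →ₗ[ℝ] Cn d) : ℝ) : ℂ) * a v := by
  have hfr : Module.finrank ℝ (Cn d) = k := by
    rw [hk, Module.finrank_pi_fintype]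
    simp [Complex.finrank_real_complex, mul_comm]
  let B := Module.finBasisOfFinrankEq ℝ (Cn d) hfr
  have key : ∀ f : Cn d [⋀^Fin k]→ₗ[ℝ] ℝ, f (fun i => L (v i)) =
      LinearMap.det (L : Cn d →ₗ[ℝ] Cn d) * f v := by
    intro f
    rw [f.eq_smul_basis_det B]
    simp only [AlternatingMap.smul_apply, smul_eq_mul]
    have := B.det_comp (L : Cn d →ₗ[ℝ] Cn d) v
    rw [show (fun i => L (v i)) = (L : Cn d →ₗ[ℝ] Cn d) ∘ v from rfl, this]
    ring
  have hre := key (Complex.reLm.compAlternatingMap a.toAlternatingMap)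
  have him := key (Complex.imLm.compAlternatingMap a.toAlternatingMap)
  apply Complex.ext
  · rw [Complex.re_ofReal_mul]; exact hre
  · rw [Complex.im_ofReal_mul]; exact him

/-- The sign of this determinant is why holomorphic coordinate changes preserve orientation. -/
theorem det_real_of_complex (L : Cn d →ₗ[ℂ] Cn d) :
    LinearMap.det (L.restrictScalars ℝ) = Complex.normSq (LinearMap.det L) := by
  rw [LinearMap.det_restrictScalars, Algebra.norm_complex_apply]

end AltForm

/-! ### The operators `∂` and `∂̄` on `ℂ^d`. -/

/-- The operator `½ (d + e d∘i)`: it is `∂̄` for `e = i` and `∂` for `e = -i`. -/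
noncomputable def dolb {d k : ℕ} (e : ℂ) (a : Cn d → AltForm d k) (y : Cn d) :
    AltForm d (k + 1) :=
  ContinuousAlternatingMap.alternatizeUncurryFin
    ((1 / 2 : ℂ) • (fderiv ℝ a y + e • (fderiv ℝ a y).comp (mulI d)))

section Dolb

variable {d k l : ℕ}

theorem delCn_eq_dolb (a : Cn d → AltForm d k) : delCn a = dolb (-Complex.I) a := by
  funext y
  rw [delCn, dolb, linPart]
  congr 2
  ext v w
  simp [sub_eq_add_neg]

theorem dolb_congr {e : ℂ} {a b : Cn d → AltForm d k} {y : Cn d} (h : a =ᶠ[nhds y] b) :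
    dolb e a y = dolb e b y := by
  rw [dolb, dolb, h.fderiv_eq]

theorem dolb_apply (e : ℂ) (a : Cn d → AltForm d k) (y : Cn d) (v : Fin (k + 1) → Cn d) :
    dolb e a y v = ∑ i : Fin (k + 1), (-1) ^ (i : ℕ) * wd e (v i) a y (i.removeNth v) := by
  rw [dolb, ContinuousAlternatingMap.alternatizeUncurryFin_apply]
  refine Finset.sum_congr rfl fun i _ => ?_
  rw [zsmul_eq_mul]
  push_cast
  rfl

theorem dolb_sum {ι : Type*} {s : Finset ι} {e : ℂ} {a : ι → Cn d → AltForm d k} {y : Cn d}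
    (ha : ∀ i ∈ s, DifferentiableAt ℝ (a i) y) :
    dolb e (fun y => ∑ i ∈ s, a i y) y = ∑ i ∈ s, dolb e (a i) y := by
  ext v
  rw [dolb_apply, ContinuousAlternatingMap.sum_apply]
  simp only [dolb_apply]
  rw [Finset.sum_comm]
  refine Finset.sum_congr rfl fun i _ => ?_
  rw [wd_sum ha, ContinuousAlternatingMap.sum_apply, Finset.mul_sum]

theorem wd_eval {e : ℂ} {w : Cn d} {a : Cn d → AltForm d k} {y : Cn d}
    (ha : DifferentiableAt ℝ a y) (v : Fin k → Cn d) :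
    wd e w a y v = wd e w (fun y => a y v) y :=
  (wd_clm (AltForm.evalCLM v) (fun _ _ => rfl) ha).symm

theorem ContDiffOn.dolb {e : ℂ} {a : Cn d → AltForm d k} {U : Set (Cn d)} (hU : IsOpen U)
    (ha : ContDiffOn ℝ ∞ a U) : ContDiffOn ℝ ∞ (dolb e a) U := by
  refine AltForm.contDiffOn_iff.2 fun v => ?_
  simp only [dolb_apply]
  exact ContDiffOn.sum fun i _ => contDiffOn_const.mul (AltForm.contDiffOn_iff.1 (ha.wd hU) _)

/-- Multiplication by a function `c` with `wd e _ c = 0` commutes with `dolb e`. -/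
theorem dolb_smul {e : ℂ} {c : Cn d → ℂ} {a : Cn d → AltForm d k} {y : Cn d}
    (hc : DifferentiableAt ℝ c y) (hc0 : ∀ v, wd e v c y = 0) (ha : DifferentiableAt ℝ a y) :
    dolb e (fun y => c y • a y) y = c y • dolb e a y := by
  ext v
  rw [ContinuousAlternatingMap.smul_apply, dolb_apply, dolb_apply, smul_eq_mul, Finset.mul_sum]
  refine Finset.sum_congr rfl fun i _ => ?_
  rw [wd_smul hc ha, hc0, zero_smul, zero_add, ContinuousAlternatingMap.smul_apply, smul_eq_mul]
  ring

end Dolb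

/-! ### Invariance of `∂` and `∂̄` under holomorphic maps. -/

section Pullback

variable {d k : ℕ}

/-- Differentiating the pull-back produces, besides the wanted term, a term with the second
derivative of `τ`. Alternation kills it as soon as the second derivative is symmetric; for the part
composed with `i` this symmetry uses that `τ` is holomorphic. -/
theorem dolb_pullback {e : ℂ} {η : Cn d → AltForm d k} {τ : Cn d → Cn d} {y : Cn d}
    (hη : DifferentiableAt ℝ η (τ y)) (hτ : ContDiffAt ℝ ∞ τ y)
    (hI : ∀ᶠ x in nhds y, ∀ v, fderiv ℝ τ x (Complex.I • v) = Complex.I • fderiv ℝ τ x v) :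
    dolb e (fun x => (η (τ x)).compContinuousLinearMap (fderiv ℝ τ x)) y =
      (dolb e η (τ y)).compContinuousLinearMap (fderiv ℝ τ y) := by
  have hdτ : DifferentiableAt ℝ τ y := hτ.differentiableAt (by simp)
  have hd2 : DifferentiableAt ℝ (fderiv ℝ τ) y :=
    (hτ.fderiv_right (m := ∞) (by simp)).differentiableAt (by simp)
  have hsymm : ∀ u w, fderiv ℝ (fderiv ℝ τ) y u w = fderiv ℝ (fderiv ℝ τ) y w u :=
    fun u w => (hτ.isSymmSndFDerivAt (by
      simp only [minSmoothness_of_isRCLikeNormedField]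
      exact WithTop.coe_le_coe.2 (le_top : (2 : ℕ∞) ≤ ⊤))) u w
  have hlin : ∀ u w, fderiv ℝ (fderiv ℝ τ) y u (Complex.I • w) =
      Complex.I • fderiv ℝ (fderiv ℝ τ) y u w := by
    intro u w
    have e0 : ∀ z, fderiv ℝ (fun x => fderiv ℝ τ x z) y u = fderiv ℝ (fderiv ℝ τ) y u z := by
      intro z
      rw [fderiv_clm_apply hd2 (differentiableAt_const z)]
      simp
    have hz : DifferentiableAt ℝ (fun x => fderiv ℝ τ x w) y :=
      hd2.clm_apply (differentiableAt_const w)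
    have e1 : (fun x => fderiv ℝ τ x (Complex.I • w)) =ᶠ[nhds y]
        fun x => Complex.I • fderiv ℝ τ x w := hI.mono fun x hx => hx w
    rw [← e0, ← e0, e1.fderiv_eq, fderiv_fun_const_smul hz]
    rfl
  set h := fderiv ℝ (fderiv ℝ τ) y with hh
  -- `h(iu, w) = i h(u, w) = h(u, iw)`, because `dτ` is complex linear near `y`.
  have hsymm' : ∀ u w, (h.comp (mulI d)) u w = (h.comp (mulI d)) w u := by
    intro u w
    change h (Complex.I • u) w = h (Complex.I • w) u
    rw [hsymm, hlin, hsymm, ← hlin, hsymm]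
  have hy := hI.self_of_nhds
  set K := (η (τ y)).fderivCompContinuousLinearMap (fderiv ℝ τ y)
  set T₁ : Cn d →L[ℝ] AltForm d k :=
    (ContinuousAlternatingMap.compContinuousLinearMapCLM (fderiv ℝ τ y)).comp
      ((fderiv ℝ η (τ y)).comp (fderiv ℝ τ y)) with hT₁
  have hT : fderiv ℝ (fun x => (η (τ x)).compContinuousLinearMap (fderiv ℝ τ x)) y =
      T₁ + K.comp h := by
    have hc : DifferentiableAt ℝ (fun x => η (τ x)) y := hη.comp y hdτ
    rw [fderiv_continuousAlternatingMapCompContinuousLinearMap hc hd2, fderiv_fun_comp y hη hdτ]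
  have hsplit : (1 / 2 : ℂ) • (T₁ + K.comp h + e • (T₁ + K.comp h).comp (mulI d)) =
      (1 / 2 : ℂ) • (T₁ + e • T₁.comp (mulI d)) +
        ((1 / 2 : ℂ) • K.comp h + (1 / 2 * e) • K.comp (h.comp (mulI d))) := by
    ext v w
    simp
    ring
  rw [dolb, hT, hsplit, ContinuousAlternatingMap.alternatizeUncurryFin_add,
    ContinuousAlternatingMap.alternatizeUncurryFin_add,
    ContinuousAlternatingMap.alternatizeUncurryFin_smul,
    ContinuousAlternatingMap.alternatizeUncurryFin_smul,
    ContinuousAlternatingMap.alternatizeUncurryFin_smul,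
    ContinuousAlternatingMap.alternatizeUncurryFin_fderivCompContinuousLinearMap_eq_zero _ _ hsymm,
    ContinuousAlternatingMap.alternatizeUncurryFin_fderivCompContinuousLinearMap_eq_zero _ _ hsymm',
    smul_zero, smul_zero, add_zero, add_zero]
  ext v
  rw [ContinuousAlternatingMap.compContinuousLinearMap_apply, dolb_apply,
    ContinuousAlternatingMap.smul_apply, ContinuousAlternatingMap.alternatizeUncurryFin_apply,
    Finset.smul_sum]
  refine Finset.sum_congr rfl fun i _ => ?_
  rw [zsmul_eq_mul, wd]
  simp only [Function.comp_apply]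
  rw [← hy]
  simp only [hT₁, ContinuousAlternatingMap.smul_apply, ContinuousAlternatingMap.add_apply,
    add_apply, smul_apply, ContinuousLinearMap.comp_apply, mulI, smul_eq_mul]
  push_cast
  rw [mul_left_comm]
  rfl

end Pullback

/-! ### The Leibniz rule for the wedge product. -/

section AlternatingSums

open Equiv

/-- The signed sum of a function of `N` variables over all permutations of the variables. -/
def altSum {V : Type*} {N : ℕ} (f : (Fin N → V) → ℂ) (v : Fin N → V) : ℂ :=
  ∑ σ : Perm (Fin N), (Perm.sign σ : ℂ) * f (v ∘ σ)

variable {V : Type*} {N : ℕ}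

theorem sign_mul_sign_self (σ : Perm (Fin N)) : (Perm.sign σ : ℂ) * (Perm.sign σ : ℂ) = 1 := by
  rcases Int.units_eq_one_or (Perm.sign σ) with h | h <;> simp [h]

theorem altSum_comp_perm (f : (Fin N → V) → ℂ) (τ : Perm (Fin N)) (v : Fin N → V) :
    altSum (fun w => f (w ∘ τ)) v = Perm.sign τ * altSum f v := by
  rw [altSum, altSum, Finset.mul_sum, ← Equiv.sum_comp (Equiv.mulRight τ)
    (fun σ : Perm (Fin N) => (Perm.sign τ : ℂ) * ((Perm.sign σ : ℂ) * f (v ∘ σ)))]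
  refine Finset.sum_congr rfl fun σ _ => ?_
  simp only [Equiv.coe_mulRight, Perm.sign_mul, Units.val_mul, Int.cast_mul, Perm.coe_mul]
  rw [Function.comp_assoc]
  linear_combination (-(Perm.sign σ : ℂ) * f (v ∘ σ ∘ τ)) * sign_mul_sign_self τ

theorem altSum_sum {ι : Type*} (s : Finset ι) (f : ι → (Fin N → V) → ℂ) (v : Fin N → V) :
    altSum (fun w => ∑ i ∈ s, f i w) v = ∑ i ∈ s, altSum (f i) v := by
  simp only [altSum, Finset.mul_sum]
  exact Finset.sum_comm

theorem altSum_const_mul (c : ℂ) (f : (Fin N → V) → ℂ) (v : Fin N → V) :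
    altSum (fun w => c * f w) v = c * altSum f v := by
  simp only [altSum, Finset.mul_sum]
  exact Finset.sum_congr rfl fun σ _ => by ring

/-- Antisymmetrizing a function that is already antisymmetrized in some of the variables. -/
theorem altSum_partial {k : ℕ} (ε : Fin k ↪ Fin N) (f : (Fin N → V) → ℂ) (v : Fin N → V) :
    altSum (fun w => ∑ τ : Perm (Fin k), (Perm.sign τ : ℂ) * f (w ∘ τ.viaFintypeEmbedding ε)) v =
      (k.factorial : ℂ) * altSum f v := by
  rw [altSum_sum]
  have : ∀ τ ∈ (Finset.univ : Finset (Perm (Fin k))),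
      altSum (fun w => (Perm.sign τ : ℂ) * f (w ∘ τ.viaFintypeEmbedding ε)) v = altSum f v := by
    intro τ _
    rw [altSum_const_mul, altSum_comp_perm, Perm.viaFintypeEmbedding_sign, ← mul_assoc,
      sign_mul_sign_self, one_mul]
  rw [Finset.sum_congr rfl this, Finset.sum_const, Finset.card_univ, Fintype.card_perm,
    Fintype.card_fin, nsmul_eq_mul]

theorem altSum_cast {M : ℕ} (h : N = M) (f : (Fin N → V) → ℂ) (v : Fin M → V) :
    altSum f (v ∘ Fin.cast h) = altSum (fun w => f (w ∘ Fin.cast h)) v := by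
  subst h
  rfl

variable {d k l : ℕ}

theorem altSum_altForm (a : AltForm d k) (v : Fin k → Cn d) :
    altSum (fun w => a w) v = (k.factorial : ℂ) * a v := by
  have : ∀ σ ∈ (Finset.univ : Finset (Perm (Fin k))), (Perm.sign σ : ℂ) * a (v ∘ σ) = a v := by
    intro σ _
    have h : a (v ∘ σ) = Perm.sign σ • a v := a.toAlternatingMap.map_perm v σ
    rw [h, Units.smul_def, zsmul_eq_mul, ← mul_assoc, sign_mul_sign_self, one_mul]
  rw [altSum, Finset.sum_congr rfl this, Finset.sum_const, Finset.card_univ, Fintype.card_perm,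
    Fintype.card_fin, nsmul_eq_mul]

/-- The `i`-th term of the alternatization is the zeroth one with its arguments permuted by a cycle
of sign `(-1)^i`. After alternating over all permutations the `k + 1` terms become equal. -/
theorem altSum_uncurry (A : Cn d →L[ℝ] AltForm d k) (v : Fin (k + 1) → Cn d) :
    altSum (fun w => A (w 0) fun i => w i.succ) v =
      (k.factorial : ℂ) * ContinuousAlternatingMap.alternatizeUncurryFin A v := by
  have h1 := altSum_altForm (ContinuousAlternatingMap.alternatizeUncurryFin A) v
  have h2 : (fun w => ContinuousAlternatingMap.alternatizeUncurryFin A w) = fun w =>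
      ∑ i : Fin (k + 1), (-1 : ℂ) ^ (i : ℕ) *
        (fun w : Fin (k + 1) → Cn d => A (w 0) fun i => w i.succ) (w ∘ i.cycleRange.symm) := by
    funext w
    rw [ContinuousAlternatingMap.alternatizeUncurryFin_apply]
    refine Finset.sum_congr rfl fun i _ => ?_
    rw [zsmul_eq_mul]
    push_cast
    simp only [Function.comp_apply, Fin.cycleRange_symm_zero, Fin.cycleRange_symm_succ]
    rfl
  rw [h2, altSum_sum] at h1
  have h3 : ∀ i ∈ (Finset.univ : Finset (Fin (k + 1))), altSum (fun w => (-1 : ℂ) ^ (i : ℕ) *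
        (fun w : Fin (k + 1) → Cn d => A (w 0) fun i => w i.succ) (w ∘ i.cycleRange.symm)) v =
      altSum (fun w => A (w 0) fun i => w i.succ) v := by
    intro i _
    rw [altSum_const_mul, altSum_comp_perm (fun w : Fin (k + 1) → Cn d => A (w 0) fun i => w i.succ),
      Perm.sign_symm, Fin.sign_cycleRange]
    push_cast
    rw [← mul_assoc, ← mul_pow]
    simp
  rw [Finset.sum_congr rfl h3, Finset.sum_const, Finset.card_univ, Fintype.card_fin, nsmul_eq_mul,
    Nat.factorial_succ] at h1
  have h4 : ((k + 1 : ℕ) : ℂ) ≠ 0 := by exact_mod_cast k.succ_ne_zero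
  refine mul_left_cancel₀ h4 ?_
  rw [h1]
  push_cast
  ring

theorem wedge_eq_altSum (a : AltForm d k) (b : AltForm d l) (v : Fin (k + l) → Cn d) :
    a.wedge b v = ((k.factorial : ℂ) * l.factorial)⁻¹ *
      altSum (fun w => a (fun i => w (Fin.castAdd l i)) * b (fun i => w (Fin.natAdd k i))) v := by
  rw [AltForm.wedge_apply]
  push_cast
  rfl

theorem factorial_ne_zero_complex (k : ℕ) : (k.factorial : ℂ) ≠ 0 := by
  exact_mod_cast k.factorial_ne_zero

/-- Both sides are multiples of the full alternation of `A(w₀)(…) b(…)`: by `altSum_partial` the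
inner alternations over some of the arguments only contribute factorials. -/
theorem alternatize_wedge_left (A : Cn d →L[ℝ] AltForm d k) (b : AltForm d l)
    (T : Cn d →L[ℝ] AltForm d (k + l)) (hT : ∀ w, T w = (A w).wedge b)
    (h : k + 1 + l = k + l + 1) (v : Fin (k + l + 1) → Cn d) :
    ContinuousAlternatingMap.alternatizeUncurryFin T v =
      (AltForm.wedge (ContinuousAlternatingMap.alternatizeUncurryFin A) b) (v ∘ Fin.cast h) := by
  have h1 := altSum_uncurry T v
  have h2 : (fun w : Fin (k + l + 1) → Cn d => T (w 0) fun i => w i.succ) = fun w =>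
      ((k.factorial : ℂ) * l.factorial)⁻¹ * ∑ σ : Perm (Fin (k + l)), (Perm.sign σ : ℂ) *
        (fun w : Fin (k + l + 1) → Cn d => A (w 0) (fun i => w (Fin.castAdd l i).succ) *
          b (fun i => w (Fin.natAdd k i).succ)) (w ∘ σ.viaFintypeEmbedding (Fin.succEmb (k + l))) := by
    funext w
    rw [hT, wedge_eq_altSum, altSum]
    congr 1
    refine Finset.sum_congr rfl fun σ _ => ?_
    have e0 : σ.viaFintypeEmbedding (Fin.succEmb (k + l)) 0 = 0 :=
      Perm.viaFintypeEmbedding_apply_notMem_range _ _ (by simp)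
    have e1 : ∀ i, σ.viaFintypeEmbedding (Fin.succEmb (k + l)) (Fin.succ i) = (σ i).succ := fun i =>
      Perm.viaFintypeEmbedding_apply_image σ (Fin.succEmb (k + l)) i
    simp only [Function.comp_apply, e0, e1]
  rw [h2, altSum_const_mul, altSum_partial (Fin.succEmb (k + l))
    (fun w : Fin (k + l + 1) → Cn d => A (w 0) (fun i => w (Fin.castAdd l i).succ) *
          b (fun i => w (Fin.natAdd k i).succ))] at h1
  have h3 : (fun w : Fin (k + 1 + l) → Cn d => ContinuousAlternatingMap.alternatizeUncurryFin A
        (fun i => w (Fin.castAdd l i)) * b (fun i => w (Fin.natAdd (k + 1) i))) = fun w =>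
      (k.factorial : ℂ)⁻¹ * ∑ σ : Perm (Fin (k + 1)), (Perm.sign σ : ℂ) *
        (fun w : Fin (k + 1 + l) → Cn d => A (w (Fin.castAdd l 0))
          (fun i => w (Fin.castAdd l i.succ)) * b (fun i => w (Fin.natAdd (k + 1) i)))
          (w ∘ σ.viaFintypeEmbedding (Fin.castAddEmb l)) := by
    funext w
    have e := altSum_uncurry A fun i => w (Fin.castAdd l i)
    rw [altSum] at e
    have e0 : ∀ (σ : Perm (Fin (k + 1))) i, σ.viaFintypeEmbedding (Fin.castAddEmb l)
        (Fin.natAdd (k + 1) i) = Fin.natAdd (k + 1) i := fun σ i =>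
      Perm.viaFintypeEmbedding_apply_notMem_range _ _ (by
        rintro ⟨x, hx⟩
        have := congrArg Fin.val hx
        simp at this
        omega)
    have e1 : ∀ (σ : Perm (Fin (k + 1))) i, σ.viaFintypeEmbedding (Fin.castAddEmb l)
        (Fin.castAdd l i) = Fin.castAdd l (σ i) := fun σ i =>
      Perm.viaFintypeEmbedding_apply_image σ (Fin.castAddEmb l) i
    simp only [Function.comp_apply] at e
    simp only [Function.comp_apply, e0, e1]
    have e2 : ContinuousAlternatingMap.alternatizeUncurryFin A (fun i => w (Fin.castAdd l i)) =
        (k.factorial : ℂ)⁻¹ * ((k.factorial : ℂ) *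
        ContinuousAlternatingMap.alternatizeUncurryFin A fun i => w (Fin.castAdd l i)) := by
      rw [inv_mul_cancel_left₀ (factorial_ne_zero_complex k)]
    rw [e2, ← e, mul_assoc, Finset.sum_mul]
    congr 1
    refine Finset.sum_congr rfl fun σ _ => ?_
    ring
  rw [wedge_eq_altSum, h3, altSum_const_mul, altSum_partial (Fin.castAddEmb l)
    (fun w : Fin (k + 1 + l) → Cn d => A (w (Fin.castAdd l 0))
          (fun i => w (Fin.castAdd l i.succ)) * b (fun i => w (Fin.natAdd (k + 1) i))),
    altSum_cast h]
  have hk := factorial_ne_zero_complex k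
  have hl := factorial_ne_zero_complex l
  have hkl := factorial_ne_zero_complex (k + l)
  have hk1 := factorial_ne_zero_complex (k + 1)
  have h4 : (fun w : Fin (k + l + 1) → Cn d => (fun w : Fin (k + 1 + l) → Cn d =>
      A (w (Fin.castAdd l 0)) (fun i => w (Fin.castAdd l i.succ)) *
        b (fun i => w (Fin.natAdd (k + 1) i))) (w ∘ Fin.cast h)) =
      fun w : Fin (k + l + 1) → Cn d => A (w 0) (fun i => w (Fin.castAdd l i).succ) *
          b (fun i => w (Fin.natAdd k i).succ) := by
    funext w
    have e1 : ∀ i : Fin k, Fin.cast h (Fin.castAdd l i.succ) = (Fin.castAdd l i).succ := fun i => by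
      ext; simp
    have e2 : ∀ i : Fin l, Fin.cast h (Fin.natAdd (k + 1) i) = (Fin.natAdd k i).succ := fun i => by
      ext; simp; omega
    have e3 : Fin.cast h (Fin.castAdd l 0) = 0 := by ext; simp
    simp only [Function.comp_apply, e1, e2, e3]
  rw [h4]
  refine mul_left_cancel₀ hkl ?_
  rw [← h1]
  field_simp

/-- As for the left factor, except that the differentiated argument has to move past the `k`
arguments of `a`; this is the source of the sign. -/
theorem alternatize_wedge_right (a : AltForm d k) (B : Cn d →L[ℝ] AltForm d l)
    (T : Cn d →L[ℝ] AltForm d (k + l)) (hT : ∀ w, T w = a.wedge (B w))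
    (v : Fin (k + l + 1) → Cn d) :
    ContinuousAlternatingMap.alternatizeUncurryFin T v =
      (-1) ^ k * (AltForm.wedge a (ContinuousAlternatingMap.alternatizeUncurryFin B)) v := by
  have h1 := altSum_uncurry T v
  let g : (Fin (k + (l + 1)) → Cn d) → ℂ := fun w => a (fun i => w (Fin.castAdd (l + 1) i)) *
    B (w (Fin.natAdd k 0)) (fun i => w (Fin.natAdd k i.succ))
  -- The cycle that moves the first argument of `B` to the front, of sign `(-1)^k`.
  let ϖ : Perm (Fin (k + (l + 1))) := (Fin.natAdd k (0 : Fin (l + 1))).cycleRange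
  have hϖ1 : ∀ i : Fin k, ϖ (Fin.castAdd (l + 1) i) = (Fin.castAdd l i).succ := fun i => by
    have := Fin.cycleRange_of_lt (j := Fin.natAdd k (0 : Fin (l + 1)))
      (i := Fin.castAdd (l + 1) i) (by simp [Fin.lt_def])
    ext
    simp only [ϖ, this]
    rw [Fin.val_add_one_of_lt (lt_of_lt_of_le (b := Fin.natAdd k (0 : Fin (l + 1)))
      (by simp [Fin.lt_def]) (Fin.le_last _))]
    simp
  have hϖ2 : ϖ (Fin.natAdd k 0) = 0 := Fin.cycleRange_self _
  have hϖ3 : ∀ i : Fin l, ϖ (Fin.natAdd k i.succ) = (Fin.natAdd k i).succ := fun i => by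
    have := Fin.cycleRange_of_gt (i := Fin.natAdd k (0 : Fin (l + 1)))
      (j := Fin.natAdd k i.succ) (by simp [Fin.lt_def])
    ext
    simp only [ϖ, this]
    simp
    omega
  have hϖs : (Perm.sign ϖ : ℂ) = (-1) ^ k := by
    rw [Fin.sign_cycleRange]
    simp
  have h2 : (fun w : Fin (k + l + 1) → Cn d => T (w 0) fun i => w i.succ) = fun w =>
      ((k.factorial : ℂ) * l.factorial)⁻¹ * ∑ σ : Perm (Fin (k + l)), (Perm.sign σ : ℂ) *
        (fun w : Fin (k + l + 1) → Cn d => g (w ∘ ϖ))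
          (w ∘ σ.viaFintypeEmbedding (Fin.succEmb (k + l))) := by
    funext w
    rw [hT, wedge_eq_altSum, altSum]
    congr 1
    refine Finset.sum_congr rfl fun σ _ => ?_
    have e0 : σ.viaFintypeEmbedding (Fin.succEmb (k + l)) 0 = 0 :=
      Perm.viaFintypeEmbedding_apply_notMem_range _ _ (by simp)
    have e1 : ∀ i, σ.viaFintypeEmbedding (Fin.succEmb (k + l)) (Fin.succ i) = (σ i).succ := fun i =>
      Perm.viaFintypeEmbedding_apply_image σ (Fin.succEmb (k + l)) i
    have e0' : σ.viaFintypeEmbedding (Fin.succEmb (k + l)) (ϖ (Fin.natAdd k 0)) = 0 := by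
      rw [hϖ2]; exact e0
    simp only [g, Function.comp_apply, hϖ1, hϖ3, e1, e0']
  rw [h2, altSum_const_mul, altSum_partial (Fin.succEmb (k + l))
    (fun w : Fin (k + l + 1) → Cn d => g (w ∘ ϖ))] at h1
  have h4 : altSum (fun w : Fin (k + l + 1) → Cn d => g (w ∘ ϖ)) v = (-1) ^ k * altSum g v := by
    rw [← hϖs]
    exact altSum_comp_perm g ϖ v
  rw [h4] at h1
  have h3 : (fun w : Fin (k + (l + 1)) → Cn d => a (fun i => w (Fin.castAdd (l + 1) i)) *
        ContinuousAlternatingMap.alternatizeUncurryFin B (fun i => w (Fin.natAdd k i))) = fun w =>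
      (l.factorial : ℂ)⁻¹ * ∑ σ : Perm (Fin (l + 1)), (Perm.sign σ : ℂ) *
        g (w ∘ σ.viaFintypeEmbedding (Fin.natAddEmb k)) := by
    funext w
    have e := altSum_uncurry B fun i => w (Fin.natAdd k i)
    rw [altSum] at e
    have e0 : ∀ (σ : Perm (Fin (l + 1))) i, σ.viaFintypeEmbedding (Fin.natAddEmb k)
        (Fin.castAdd (l + 1) i) = Fin.castAdd (l + 1) i := fun σ i =>
      Perm.viaFintypeEmbedding_apply_notMem_range _ _ (by
        rintro ⟨x, hx⟩
        have := congrArg Fin.val hx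
        simp at this
        omega)
    have e1 : ∀ (σ : Perm (Fin (l + 1))) i, σ.viaFintypeEmbedding (Fin.natAddEmb k)
        (Fin.natAdd k i) = Fin.natAdd k (σ i) := fun σ i =>
      Perm.viaFintypeEmbedding_apply_image σ (Fin.natAddEmb k) i
    simp only [Function.comp_apply] at e
    simp only [g, Function.comp_apply, e0, e1]
    have e2 : ContinuousAlternatingMap.alternatizeUncurryFin B (fun i => w (Fin.natAdd k i)) =
        (l.factorial : ℂ)⁻¹ * ((l.factorial : ℂ) *
        ContinuousAlternatingMap.alternatizeUncurryFin B fun i => w (Fin.natAdd k i)) := by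
      rw [inv_mul_cancel_left₀ (factorial_ne_zero_complex l)]
    rw [e2, ← e, mul_left_comm, Finset.mul_sum]
    congr 1
    refine Finset.sum_congr rfl fun σ _ => ?_
    ring
  rw [wedge_eq_altSum, h3, altSum_const_mul, altSum_partial (Fin.natAddEmb k) g]
  have hk := factorial_ne_zero_complex k
  have hl := factorial_ne_zero_complex l
  have hkl := factorial_ne_zero_complex (k + l)
  have hl1 := factorial_ne_zero_complex (l + 1)
  refine mul_left_cancel₀ hkl ?_
  rw [← h1]
  field_simp

theorem wd_wedge {e : ℂ} {w : Cn d} {a : Cn d → AltForm d k} {b : Cn d → AltForm d l} {y : Cn d}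
    (ha : ContDiffAt ℝ ∞ a y) (hb : ContDiffAt ℝ ∞ b y) :
    wd e w (fun y => (a y).wedge (b y)) y = (wd e w a y).wedge (b y) + (a y).wedge (wd e w b y) := by
  have ha' : DifferentiableAt ℝ a y := ha.differentiableAt (by simp)
  have hb' : DifferentiableAt ℝ b y := hb.differentiableAt (by simp)
  have hab : DifferentiableAt ℝ (fun y => (a y).wedge (b y)) y := by
    have : ContDiffAt ℝ ∞ (fun y => (a y).wedge (b y)) y :=
      ContDiffWithinAt.altForm_wedge ha hb
    exact this.differentiableAt (by simp)
  have hae : ∀ v, DifferentiableAt ℝ (fun y => a y v) y := fun v =>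
    (AltForm.evalCLM v).differentiableAt.comp y ha'
  have hbe : ∀ v, DifferentiableAt ℝ (fun y => b y v) y := fun v =>
    (AltForm.evalCLM v).differentiableAt.comp y hb'
  ext v
  rw [wd_eval hab, ContinuousAlternatingMap.add_apply]
  simp only [AltForm.wedge_apply]
  have hp : ∀ σ : Perm (Fin (k + l)), DifferentiableAt ℝ (fun y =>
      a y (fun i => v (σ (Fin.castAdd l i))) * b y (fun i => v (σ (Fin.natAdd k i)))) y :=
    fun σ => (hae _).mul (hbe _)
  have h1 := wd_const_smul (e := e) (v := w) (((k.factorial * l.factorial : ℕ) : ℂ)⁻¹)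
    (f := fun y => ∑ σ : Perm (Fin (k + l)), (Perm.sign σ : ℂ) *
      (a y (fun i => v (σ (Fin.castAdd l i))) * b y (fun i => v (σ (Fin.natAdd k i))))) (y := y)
    (DifferentiableAt.fun_sum fun σ _ => (hp σ).const_mul _)
  simp only [smul_eq_mul] at h1
  rw [h1, wd_sum fun σ _ => (hp σ).const_mul _, ← mul_add, ← Finset.sum_add_distrib]
  congr 1
  refine Finset.sum_congr rfl fun σ _ => ?_
  have h2 := wd_const_smul (e := e) (v := w) (Perm.sign σ : ℂ) (hp σ)
  have h3 := wd_smul (e := e) (v := w) (hae fun i => v (σ (Fin.castAdd l i)))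
    (hbe fun i => v (σ (Fin.natAdd k i)))
  simp only [smul_eq_mul] at h2 h3
  rw [h2, h3, wd_eval ha', wd_eval hb']
  ring

theorem dolb_wedge {e : ℂ} {a : Cn d → AltForm d k} {b : Cn d → AltForm d l} {y : Cn d}
    (ha : ContDiffAt ℝ ∞ a y) (hb : ContDiffAt ℝ ∞ b y) (h : k + 1 + l = k + l + 1)
    (v : Fin (k + l + 1) → Cn d) :
    dolb e (fun y => (a y).wedge (b y)) y v =
      (dolb e a y).wedge (b y) (v ∘ Fin.cast h) + (-1) ^ k * (a y).wedge (dolb e b y) v := by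
  let A : Cn d →L[ℝ] AltForm d k := (1 / 2 : ℂ) • (fderiv ℝ a y + e • (fderiv ℝ a y).comp (mulI d))
  let B : Cn d →L[ℝ] AltForm d l := (1 / 2 : ℂ) • (fderiv ℝ b y + e • (fderiv ℝ b y).comp (mulI d))
  have hadd1 : ∀ (x x' : AltForm d k) (z : AltForm d l), (x + x').wedge z = x.wedge z + x'.wedge z := by
    intro x x' z
    ext v
    simp only [ContinuousAlternatingMap.add_apply, AltForm.wedge_apply]
    rw [← mul_add, ← Finset.sum_add_distrib]
    congr 1
    exact Finset.sum_congr rfl fun σ _ => by ring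
  have hadd2 : ∀ (x : AltForm d k) (z z' : AltForm d l), x.wedge (z + z') = x.wedge z + x.wedge z' := by
    intro x z z'
    ext v
    simp only [ContinuousAlternatingMap.add_apply, AltForm.wedge_apply]
    rw [← mul_add, ← Finset.sum_add_distrib]
    congr 1
    exact Finset.sum_congr rfl fun σ _ => by ring
  have hr1 : ∀ (c : ℝ) (x : AltForm d k), c • x = (c : ℂ) • x := fun c x => by ext v; simp
  have hr2 : ∀ (c : ℝ) (x : AltForm d l), c • x = (c : ℂ) • x := fun c x => by ext v; simp
  have hr3 : ∀ (c : ℝ) (x : AltForm d (k + l)), c • x = (c : ℂ) • x := fun c x => by ext v; simp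
  let T₁ : Cn d →L[ℝ] AltForm d (k + l) := LinearMap.toContinuousLinearMap
    { toFun := fun w => (A w).wedge (b y)
      map_add' := fun w w' => by rw [map_add, hadd1]
      map_smul' := fun c w => by
        rw [map_smul, hr1, AltForm.wedge_smul_left, hr3, RingHom.id_apply] }
  let T₂ : Cn d →L[ℝ] AltForm d (k + l) := LinearMap.toContinuousLinearMap
    { toFun := fun w => (a y).wedge (B w)
      map_add' := fun w w' => by rw [map_add, hadd2]
      map_smul' := fun c w => by
        rw [map_smul, hr2, AltForm.wedge_smul_right, hr3, RingHom.id_apply] }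
  have hT : dolb e (fun y => (a y).wedge (b y)) y =
      ContinuousAlternatingMap.alternatizeUncurryFin (T₁ + T₂) := by
    rw [dolb]
    congr 1
    ext1 w
    exact wd_wedge ha hb
  rw [hT, ContinuousAlternatingMap.alternatizeUncurryFin_add, ContinuousAlternatingMap.add_apply,
    alternatize_wedge_left A (b y) T₁ (fun _ => rfl) h,
    alternatize_wedge_right (a y) B T₂ (fun _ => rfl)]
  rfl

end AlternatingSums

/-! ### Forms of degree `2d - 1` in the standard frame. -/

section Frame

variable {d k : ℕ}

/-- For `e = -i` this is `∂_{iv} = i ∂_v`, for `e = i` it is `∂̄_{iv} = -i ∂̄_v`. -/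
theorem wd_I_smul {V E : Type*} [NormedAddCommGroup V] [NormedSpace ℝ V] [NormedSpace ℂ V]
    [NormedAddCommGroup E] [NormedSpace ℝ E] [NormedSpace ℂ E] [IsScalarTower ℝ ℂ E]
    {e : ℂ} (he : e * e = -1) (v : V) (f : V → E) (y : V) :
    wd e (Complex.I • v) f y = -e • wd e v f y := by
  have h1 : Complex.I • Complex.I • v = -v := by
    rw [smul_smul, Complex.I_mul_I, neg_one_smul]
  rw [wd, wd, h1, map_neg]
  match_scalars
  · linear_combination (1 / 2 : ℂ) * he
  · ring

/-- The frame `e₁, i e₁, …, e_d, i e_d`, indexed by `Fin k` with `k = 2 d`. -/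
noncomputable def castFrame (d : ℕ) (hk : k = 2 * d) (i : Fin k) : Cn d := stdFrame d (Fin.cast hk i)

/-- The coefficient of a form of degree `2 d - 1` which is differentiated in the direction of the
`j`-th coordinate when applying `dolb e`. -/
noncomputable def frameCoeff (e : ℂ) (hk : k + 1 = 2 * d) (j : Fin d) (a : AltForm d k) : ℂ :=
  a ((⟨2 * j, by omega⟩ : Fin (k + 1)).removeNth (castFrame d hk)) +
    e * a ((⟨2 * j + 1, by omega⟩ : Fin (k + 1)).removeNth (castFrame d hk))

theorem contDiffOn_frameCoeff {e : ℂ} {hk : k + 1 = 2 * d} {j : Fin d} {V : Type*}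
    [NormedAddCommGroup V] [NormedSpace ℝ V] {a : V → AltForm d k} {s : Set V}
    (ha : ContDiffOn ℝ ∞ a s) : ContDiffOn ℝ ∞ (fun y => frameCoeff e hk j (a y)) s :=
  (AltForm.contDiffOn_iff.1 ha _).add (contDiffOn_const.mul (AltForm.contDiffOn_iff.1 ha _))

theorem frameCoeff_zero (e : ℂ) (hk : k + 1 = 2 * d) (j : Fin d) :
    frameCoeff e hk j (0 : AltForm d k) = 0 := by
  simp [frameCoeff]

theorem castFrame_even (hk : k + 1 = 2 * d) (j : Fin d) :
    castFrame d hk ⟨2 * j, by omega⟩ = Pi.single j 1 := by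
  unfold castFrame stdFrame
  have h1 : (2 * (j : ℕ)) / 2 = j := by omega
  have h2 : (2 * (j : ℕ)) % 2 = 0 := by omega
  simp only [Fin.cast_mk, h1, h2, if_true]

theorem castFrame_odd (hk : k + 1 = 2 * d) (j : Fin d) :
    castFrame d hk ⟨2 * j + 1, by omega⟩ = Complex.I • Pi.single j 1 := by
  unfold castFrame stdFrame
  have h1 : (2 * (j : ℕ) + 1) / 2 = j := by omega
  have h2 : (2 * (j : ℕ) + 1) % 2 = 1 := by omega
  simp only [Fin.cast_mk, h1, h2, one_ne_zero, if_false]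
  rw [← Pi.single_smul, smul_eq_mul, mul_one]

theorem sum_fin_pairs (hk : k + 1 = 2 * d) (F : Fin (k + 1) → ℂ) :
    ∑ i, F i = ∑ j : Fin d, (F ⟨2 * j, by omega⟩ + F ⟨2 * j + 1, by omega⟩) := by
  let E : Fin d × Fin 2 ≃ Fin (k + 1) := finProdFinEquiv.trans (finCongr (by omega))
  rw [← Equiv.sum_comp E, Fintype.sum_prod_type]
  refine Finset.sum_congr rfl fun j _ => ?_
  rw [Fin.sum_univ_two]
  congr 2 <;> ext <;> simp [E, finProdFinEquiv] <;> omega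

/-- In top degree, `dolb e` evaluated on the frame is a sum of Wirtinger derivatives. -/
theorem dolb_castFrame {e : ℂ} (he : e * e = -1) (hk : k + 1 = 2 * d) {a : Cn d → AltForm d k}
    {y : Cn d} (ha : DifferentiableAt ℝ a y) :
    dolb e a y (castFrame d hk) =
      ∑ j : Fin d, wd e (Pi.single j 1) (fun y => frameCoeff e hk j (a y)) y := by
  rw [dolb_apply, sum_fin_pairs hk]
  refine Finset.sum_congr rfl fun j _ => ?_
  have hc : ∀ v, DifferentiableAt ℝ (fun y => a y v) y := fun v =>
    (AltForm.evalCLM v).differentiableAt.comp y ha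
  have h1 := wd_const_smul (e := e) (v := Pi.single j 1) e
    (hc ((⟨2 * j + 1, by omega⟩ : Fin (k + 1)).removeNth (castFrame d hk)))
  simp only [smul_eq_mul] at h1
  simp only [frameCoeff]
  -- The frame vectors `e_j` and `i e_j` enter with opposite signs; by `wd_I_smul` the second term
  -- is a derivative in the same direction `e_j`, with factor `e`.
  rw [wd_add (hc _) ((hc _).const_mul e), h1, castFrame_even, castFrame_odd, wd_I_smul he,
    ContinuousAlternatingMap.smul_apply, wd_eval ha, wd_eval ha]
  have p1 : (-1 : ℂ) ^ (2 * (j : ℕ)) = 1 := by rw [pow_mul]; simp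
  have p2 : (-1 : ℂ) ^ (2 * (j : ℕ) + 1) = -1 := by rw [pow_succ, p1, one_mul]
  simp only [p1, p2, smul_eq_mul]
  ring

end Frame

/-! ### The wedge product with `dz₁`. -/

section FirstCoordinate

namespace AltForm

variable {n k : ℕ}

theorem dzOneWedge_apply (a : AltForm (n + 1) k) (v : Fin (k + 1) → Cn (n + 1)) :
    a.dzOneWedge v = ∑ i : Fin (k + 1), (-1) ^ (i : ℕ) * (v i 0 * a (i.removeNth v)) := by
  rw [dzOneWedge, ContinuousAlternatingMap.alternatizeUncurryFin_apply]
  refine Finset.sum_congr rfl fun i _ => ?_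
  rw [zsmul_eq_mul]
  push_cast
  rfl

theorem dzOneWedge_smul (c : ℂ) (a : AltForm (n + 1) k) :
    (c • a).dzOneWedge = c • a.dzOneWedge := by
  ext v
  rw [ContinuousAlternatingMap.smul_apply, dzOneWedge_apply, dzOneWedge_apply, smul_eq_mul,
    Finset.mul_sum]
  refine Finset.sum_congr rfl fun i _ => ?_
  rw [ContinuousAlternatingMap.smul_apply, smul_eq_mul]
  ring

theorem _root_.ContDiffOn.dzOneWedge {V : Type*} [NormedAddCommGroup V] [NormedSpace ℝ V]
    {a : V → AltForm (n + 1) k} {s : Set V} (ha : ContDiffOn ℝ ∞ a s) :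
    ContDiffOn ℝ ∞ (fun y => (a y).dzOneWedge) s := by
  refine contDiffOn_iff.2 fun v => ?_
  simp only [dzOneWedge_apply]
  exact ContDiffOn.sum fun i _ => contDiffOn_const.mul (contDiffOn_const.mul (contDiffOn_iff.1 ha _))

/-- Of the frame vectors only `e₁` and `i e₁` are seen by `dz₁`, with values `1` and `i`. The two
terms of `frameCoeff` contribute `i` each, which is the factor `2i` of the residue formula. -/
theorem frameCoeff_dzOneWedge (hk : k + 1 + 1 = 2 * (n + 1)) (a : AltForm (n + 1) k) :
    frameCoeff Complex.I hk 0 a.dzOneWedge =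
      2 * Complex.I * a fun i => Fin.cons 0 (castFrame n (by omega : k = 2 * n) i) := by
  have htail : ∀ i : Fin k, castFrame (n + 1) hk i.succ.succ =
      Fin.cons 0 (castFrame n (by omega : k = 2 * n) i) := by
    intro i
    unfold castFrame stdFrame
    funext m
    have h1 : (((i : ℕ) + 1 + 1) / 2 : ℕ) = i / 2 + 1 := by omega
    have h2 : (((i : ℕ) + 1 + 1) % 2 : ℕ) = i % 2 := by omega
    simp only [Fin.val_cast, Fin.val_succ, h2]
    refine Fin.cases ?_ (fun m => ?_) m
    · rw [Fin.cons_zero, Pi.single_apply, if_neg]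
      simp [Fin.ext_iff, h1]
    · rw [Fin.cons_succ, Pi.single_apply, Pi.single_apply]
      refine if_congr ?_ rfl rfl
      simp [Fin.ext_iff, h1]
  have h0 : castFrame (n + 1) hk 0 = Pi.single 0 1 := castFrame_even hk 0
  have h1 : castFrame (n + 1) hk 1 = Complex.I • Pi.single 0 1 := by
    have := castFrame_odd hk 0
    rw [← this]
    congr 1
  have e0 : (⟨2 * ((0 : Fin (n + 1)) : ℕ), by omega⟩ : Fin (k + 1 + 1)) = 0 := by ext; simp
  have e1 : (⟨2 * ((0 : Fin (n + 1)) : ℕ) + 1, by omega⟩ : Fin (k + 1 + 1)) = 1 := by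
    ext; simp
  have hsum : ∀ w : Fin (k + 1) → Cn (n + 1), (∀ i : Fin k, w i.succ =
      Fin.cons 0 (castFrame n (by omega : k = 2 * n) i)) → a.dzOneWedge w =
      w 0 0 * a fun i => Fin.cons 0 (castFrame n (by omega : k = 2 * n) i) := by
    intro w hw
    rw [dzOneWedge_apply, Fin.sum_univ_succ, Finset.sum_eq_zero]
    · simp only [Fin.val_zero, pow_zero, one_mul, add_zero]
      congr 2
      funext i
      exact hw i
    · intro i _
      rw [hw, Fin.cons_zero, zero_mul, mul_zero]
  rw [frameCoeff, e0, e1, hsum, hsum]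
  · have r0 : (0 : Fin (k + 1 + 1)).removeNth (castFrame (n + 1) hk) 0 =
        Complex.I • Pi.single 0 1 := by rw [← h1]; rfl
    have r1 : (1 : Fin (k + 1 + 1)).removeNth (castFrame (n + 1) hk) 0 = Pi.single 0 1 := by
      rw [← h0]; rfl
    rw [r0, r1]
    simp
    ring
  · intro i
    rw [← htail]
    change castFrame (n + 1) hk ((1 : Fin (k + 1 + 1)).succAbove i.succ) = _
    congr 1
  · intro i
    rw [← htail]
    rfl

/-- The contraction with `∂/∂z₁ = ½ (∂/∂x₁ - i ∂/∂y₁)`. -/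
noncomputable def contractOne (a : AltForm (n + 1) (k + 1)) : AltForm (n + 1) k :=
  (1 / 2 : ℂ) • (ContinuousAlternatingMap.curryLeft a (Pi.single 0 1) -
    Complex.I • ContinuousAlternatingMap.curryLeft a (Pi.single 0 Complex.I))

theorem contractOne_apply (a : AltForm (n + 1) (k + 1)) (v : Fin k → Cn (n + 1)) :
    contractOne a v = 1 / 2 * (a (Fin.cons (Pi.single 0 1) v) -
      Complex.I * a (Fin.cons (Pi.single 0 Complex.I) v)) := rfl

theorem _root_.ContDiffOn.contractOne {V : Type*} [NormedAddCommGroup V] [NormedSpace ℝ V]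
    {a : V → AltForm (n + 1) (k + 1)} {s : Set V} (ha : ContDiffOn ℝ ∞ a s) :
    ContDiffOn ℝ ∞ (fun y => contractOne (a y)) s := by
  refine contDiffOn_iff.2 fun v => ?_
  simp only [contractOne_apply]
  exact contDiffOn_const.mul ((contDiffOn_iff.1 ha _).sub
    (contDiffOn_const.mul (contDiffOn_iff.1 ha _)))

theorem noDzOne_contractOne (a : AltForm (n + 1) (k + 1)) : (contractOne a).NoDzOne := by
  intro v l
  have hsame : ∀ u : Cn (n + 1), a (Fin.cons u (Function.update v l u)) = 0 := fun u =>
    a.map_eq_zero_of_eq _ (i := 0) (j := l.succ) (by simp) (Fin.succ_ne_zero l).symm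
  have hswap : a (Fin.cons (Pi.single 0 Complex.I) (Function.update v l (Pi.single 0 1))) =
      - a (Fin.cons (Pi.single 0 1) (Function.update v l (Pi.single 0 Complex.I))) := by
    have := a.toAlternatingMap.map_swap
      (Fin.cons (Pi.single 0 1) (Function.update v l (Pi.single 0 Complex.I)))
      (Fin.succ_ne_zero l).symm
    change a _ = - a _ at this
    rw [← this]
    congr 1
    funext i
    refine Fin.cases ?_ (fun i => ?_) i
    · simp
    · by_cases h : i = l
      · subst h; simp [Function.update_of_ne (Fin.succ_ne_zero i).symm]
      · have h1 : Equiv.swap 0 l.succ i.succ = i.succ :=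
          Equiv.swap_apply_of_ne_of_ne (Fin.succ_ne_zero i) (by simpa using h)
        simp [h1, h]
  rw [contractOne_apply, contractOne_apply, hsame, hsame, hswap]
  ring

/-- The contraction rule `ι_u(dz₁ ∧ a) = dz₁(u) a - dz₁ ∧ ι_u a`. -/
theorem dzOneWedge_cons (a : AltForm (n + 1) (k + 1)) (u : Cn (n + 1))
    (v : Fin (k + 1) → Cn (n + 1)) :
    a.dzOneWedge (Fin.cons u v) = u 0 * a v -
      ∑ i : Fin (k + 1), (-1) ^ (i : ℕ) * (v i 0 * a (Fin.cons u (i.removeNth v))) := by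
  rw [dzOneWedge_apply, Fin.sum_univ_succ, sub_eq_add_neg, ← Finset.sum_neg_distrib]
  congr 1
  · simp only [Fin.val_zero, pow_zero, one_mul, Fin.cons_zero]
    congr 2
  · refine Finset.sum_congr rfl fun i _ => ?_
    have : i.succ.removeNth (Fin.cons u v : Fin (k + 1 + 1) → Cn (n + 1)) =
        Fin.cons u (i.removeNth v) := by
      funext j
      refine Fin.cases ?_ (fun j => ?_) j
      · simp [Fin.removeNth]
      · simp [Fin.removeNth]
    rw [this, Fin.val_succ, pow_succ, Fin.cons_succ]
    ring

/-- Contract `dz₁ ∧ a = 0` with `∂/∂z₁`, on which `dz₁` takes the value `1`. -/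
theorem eq_dzOneWedge_contractOne {a : AltForm (n + 1) (k + 1)} (h : a.dzOneWedge = 0) :
    a = (contractOne a).dzOneWedge := by
  ext v
  have h1 := dzOneWedge_cons a (Pi.single 0 1) v
  have h2 := dzOneWedge_cons a (Pi.single 0 Complex.I) v
  have hz : ∀ w, (0 : AltForm (n + 1) (k + 1 + 1)) w = 0 := fun _ => rfl
  rw [h, hz] at h1 h2
  simp only [Pi.single_eq_same, one_mul] at h1 h2
  rw [dzOneWedge_apply]
  simp only [contractOne_apply]
  have h3 : ∑ i : Fin (k + 1), (-1 : ℂ) ^ (i : ℕ) * (v i 0 * (1 / 2 *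
      (a (Fin.cons (Pi.single 0 1) (i.removeNth v)) -
        Complex.I * a (Fin.cons (Pi.single 0 Complex.I) (i.removeNth v))))) =
      1 / 2 * ∑ i : Fin (k + 1), (-1) ^ (i : ℕ) *
          (v i 0 * a (Fin.cons (Pi.single 0 1) (i.removeNth v))) -
      1 / 2 * Complex.I * ∑ i : Fin (k + 1), (-1) ^ (i : ℕ) *
          (v i 0 * a (Fin.cons (Pi.single 0 Complex.I) (i.removeNth v))) := by
    rw [Finset.mul_sum, Finset.mul_sum, ← Finset.sum_sub_distrib]
    refine Finset.sum_congr rfl fun i _ => ?_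
    ring
  rw [h3]
  have hI : Complex.I * Complex.I = -1 := Complex.I_mul_I
  linear_combination (-1 / 2 : ℂ) * h1 + 1 / 2 * Complex.I * h2 + 1 / 2 * a v * hI

theorem det_mulI (d : ℕ) : LinearMap.det (mulI d : Cn d →ₗ[ℝ] Cn d) = 1 := by
  have h := det_real_of_complex (Complex.I • (LinearMap.id : Cn d →ₗ[ℂ] Cn d))
  rw [LinearMap.det_smul, LinearMap.det_id, mul_one, map_pow, Complex.normSq_I, one_pow] at h
  exact h

/-- The product would have bidegree `(n + 2, n)`. Pulling it back by multiplication by `i` gives the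
factor `i^{n+2} (-i)^n = -1` by type, but `det i = 1` because the degree is the top one. -/
theorem dzOneWedge_eq_zero_of_isType {a : AltForm (n + 1) k} (hk : k + 1 = 2 * (n + 1))
    (ha : a.IsType (n + 1) n) : a.dzOneWedge = 0 := by
  ext v
  have h1 := map_comp_of_top a.dzOneWedge hk (mulI (n + 1)) v
  rw [det_mulI, Complex.ofReal_one, one_mul] at h1
  have h2 : a.dzOneWedge (fun i => mulI (n + 1) (v i)) = - a.dzOneWedge v := by
    rw [dzOneWedge_apply, dzOneWedge_apply, ← Finset.sum_neg_distrib]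
    refine Finset.sum_congr rfl fun i _ => ?_
    have h3 : a (i.removeNth fun i => mulI (n + 1) (v i)) =
        Complex.I ^ (n + 1) * (starRingEnd ℂ Complex.I) ^ n * a (i.removeNth v) :=
      ha.2 Complex.I (i.removeNth v)
    have h4 : Complex.I ^ (n + 1) * (starRingEnd ℂ Complex.I) ^ n = Complex.I := by
      rw [Complex.conj_I, pow_succ, mul_right_comm, ← mul_pow]
      simp
    have h5 : (mulI (n + 1) (v i)) 0 = Complex.I * v i 0 := rfl
    have hI : Complex.I * Complex.I = -1 := Complex.I_mul_I
    rw [h3, h4, h5]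
    linear_combination ((-1) ^ (i : ℕ) * v i 0 * a (i.removeNth v)) * hI
  rw [h2] at h1
  have h6 : a.dzOneWedge v = 0 := by linear_combination (-1 / 2 : ℂ) * h1
  rw [h6]
  rfl

/-- A form of top degree has bidegree `(d, d)`. -/
theorem isType_top {d k : ℕ} (a : AltForm d k) (hk : k = 2 * d) : a.IsType d d := by
  refine ⟨by omega, fun c v => ?_⟩
  have h := map_comp_of_top a hk (c • ContinuousLinearMap.id ℝ (Cn d)) v
  have h2 := det_real_of_complex (c • (LinearMap.id : Cn d →ₗ[ℂ] Cn d))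
  rw [LinearMap.det_smul, LinearMap.det_id, mul_one, map_pow, Module.finrank_fin_fun] at h2
  have h3 : LinearMap.det ((c • ContinuousLinearMap.id ℝ (Cn d) : Cn d →L[ℝ] Cn d) :
      Cn d →ₗ[ℝ] Cn d) = Complex.normSq c ^ d := by
    rw [← h2]
    rfl
  rw [h3] at h
  have h4 : (fun i => c • v i) = fun i => (c • ContinuousLinearMap.id ℝ (Cn d)) (v i) := rfl
  rw [h4, h, ← mul_pow, Complex.mul_conj]
  push_cast
  rfl

end AltForm

theorem wirtingerOne_eq_wd {n k : ℕ} (a : Cn (n + 1) → AltForm (n + 1) k) :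
    wirtingerOne a = wd (-Complex.I) (Pi.single 0 1) a := by
  funext y
  have h : (Complex.I • Pi.single 0 1 : Cn (n + 1)) = Pi.single 0 Complex.I := by
    rw [← Pi.single_smul, smul_eq_mul, mul_one]
  rw [wirtingerOne, wd, h, neg_smul, sub_eq_add_neg]

end FirstCoordinate

/-! ### Holomorphic charts and the underlying real manifold. -/

section Charts

variable {d k l : ℕ} {X : Type*} [TopologicalSpace X] [ChartedSpace (Cn d) X]

theorem contDiffOn_transition {φ ψ : OpenPartialHomeomorph X (Cn d)} (hφ : φ ∈ holCharts d X)
    (hψ : ψ ∈ holCharts d X) :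
    ContDiffOn ℂ ω (fun y => φ (ψ.symm y)) (ψ.target ∩ ψ.symm ⁻¹' φ.source) := by
  have h := IsManifold.compatible_of_mem_maximalAtlas (I := 𝓘(ℂ, Cn d)) (n := ω) hψ hφ
  have h2 := (mem_groupoid_of_pregroupoid.1 h).1
  simpa [contDiffPregroupoid, OpenPartialHomeomorph.trans_source, Function.comp_def] using h2

theorem isOpen_transition (φ ψ : OpenPartialHomeomorph X (Cn d)) :
    IsOpen (ψ.target ∩ ψ.symm ⁻¹' φ.source) :=
  ψ.isOpen_inter_preimage_symm φ.open_source

theorem contDiffOn_transition_real {φ ψ : OpenPartialHomeomorph X (Cn d)} (hφ : φ ∈ holCharts d X)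
    (hψ : ψ ∈ holCharts d X) :
    ContDiffOn ℝ ∞ (fun y => φ (ψ.symm y)) (ψ.target ∩ ψ.symm ⁻¹' φ.source) :=
  ((contDiffOn_transition hφ hψ).restrict_scalars ℝ).of_le le_top

theorem fderiv_transition_I {φ ψ : OpenPartialHomeomorph X (Cn d)} (hφ : φ ∈ holCharts d X)
    (hψ : ψ ∈ holCharts d X) {y : Cn d} (hy : y ∈ ψ.target ∩ ψ.symm ⁻¹' φ.source) :
    fderiv ℝ (fun y => φ (ψ.symm y)) y =
      (fderiv ℂ (fun y => φ (ψ.symm y)) y).restrictScalars ℝ := by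
  have h1 : DifferentiableAt ℂ (fun y => φ (ψ.symm y)) y :=
    ((contDiffOn_transition hφ hψ).contDiffAt ((isOpen_transition φ ψ).mem_nhds hy)).differentiableAt
      (by simp)
  exact (h1.hasFDerivAt.restrictScalars ℝ).fderiv

variable [IsManifold 𝓘(ℂ, Cn d) ω X]

theorem chartAt_mem_holCharts (x : X) : chartAt (Cn d) x ∈ holCharts d X :=
  IsManifold.chart_mem_maximalAtlas x

variable (d X) in
theorem isManifold_real : IsManifold 𝓘(ℝ, Cn d) ∞ X := by
  refine isManifold_of_contDiffOn _ _ _ fun e e' he he' => ?_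
  have h := contDiffOn_transition_real (d := d) (X := X)
    (IsManifold.subset_maximalAtlas (I := 𝓘(ℂ, Cn d)) (n := ω) he')
    (IsManifold.subset_maximalAtlas (I := 𝓘(ℂ, Cn d)) (n := ω) he)
  simpa [OpenPartialHomeomorph.trans_source, Function.comp_def] using h

theorem mem_maximalAtlas_real {φ : OpenPartialHomeomorph X (Cn d)} (hφ : φ ∈ holCharts d X) :
    φ ∈ IsManifold.maximalAtlas 𝓘(ℝ, Cn d) ∞ X := by
  rw [IsManifold.maximalAtlas, mem_maximalAtlas_iff]
  intro e he
  have he' : e ∈ holCharts d X := IsManifold.subset_maximalAtlas he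
  constructor
  · refine mem_groupoid_of_pregroupoid.2 ⟨?_, ?_⟩
    · simpa [contDiffPregroupoid, OpenPartialHomeomorph.trans_source, Function.comp_def] using
        contDiffOn_transition_real he' hφ
    · simpa [contDiffPregroupoid, OpenPartialHomeomorph.trans_source, Function.comp_def,
        Set.inter_comm] using contDiffOn_transition_real hφ he'
  · refine mem_groupoid_of_pregroupoid.2 ⟨?_, ?_⟩
    · simpa [contDiffPregroupoid, OpenPartialHomeomorph.trans_source, Function.comp_def] using
        contDiffOn_transition_real hφ he'
    · simpa [contDiffPregroupoid, OpenPartialHomeomorph.trans_source, Function.comp_def,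
        Set.inter_comm] using contDiffOn_transition_real he' hφ

/-- Tangent vectors at a point are read in the preferred chart there, so the derivative of `φ⁻¹` is
that of the transition map to this chart. -/
theorem mfderiv_symm_eq {φ : OpenPartialHomeomorph X (Cn d)} (hφ : φ ∈ holCharts d X) {y : Cn d}
    (hy : y ∈ φ.target) :
    (mfderiv 𝓘(ℝ, Cn d) 𝓘(ℝ, Cn d) φ.symm y : Cn d →L[ℝ] Cn d) =
      fderiv ℝ (fun z => chartAt (Cn d) (φ.symm y) (φ.symm z)) y := by
  have := isManifold_real d X
  have h1 : MDifferentiableAt 𝓘(ℝ, Cn d) 𝓘(ℝ, Cn d) φ.symm y :=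
    ((contMDiffOn_symm_of_mem_maximalAtlas (mem_maximalAtlas_real hφ)).contMDiffAt
      (φ.open_target.mem_nhds hy)).mdifferentiableAt (by simp)
  refine h1.mfderiv.trans ?_
  simp [writtenInExtChartAt, Function.comp_def]
  rfl

end Charts

/-! ### Forms in charts. -/

namespace DForm

variable {d k l : ℕ} {X : Type*} [TopologicalSpace X] [ChartedSpace (Cn d) X]

theorem inChart_smul (f : X → ℂ) (a : DForm d X k) (φ : OpenPartialHomeomorph X (Cn d)) (y : Cn d) :
    inChart (fun x => f x • a x) φ y = f (φ.symm y) • a.inChart φ y := rfl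

theorem inChart_add (a b : DForm d X k) (φ : OpenPartialHomeomorph X (Cn d)) (y : Cn d) :
    inChart (fun x => a x + b x) φ y = a.inChart φ y + b.inChart φ y := rfl

theorem inChart_sum {ι : Type*} (s : Finset ι) (a : ι → DForm d X k)
    (φ : OpenPartialHomeomorph X (Cn d)) (y : Cn d) :
    inChart (fun x => ∑ i ∈ s, a i x) φ y = ∑ i ∈ s, (a i).inChart φ y := by
  ext v
  rw [ContinuousAlternatingMap.sum_apply]
  change (∑ i ∈ s, a i (φ.symm y)) _ = _
  rw [ContinuousAlternatingMap.sum_apply]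
  rfl

theorem inChart_wedge (a : DForm d X k) (b : DForm d X l) (φ : OpenPartialHomeomorph X (Cn d))
    (y : Cn d) : (a.wedge b).inChart φ y = (a.inChart φ y).wedge (b.inChart φ y) :=
  AltForm.wedge_compContinuousLinearMap _ _ _

theorem inChart_recast (h : k = l) (a : DForm d X k) (φ : OpenPartialHomeomorph X (Cn d)) (y : Cn d)
    (v : Fin l → Cn d) : (recast h a).inChart φ y v = a.inChart φ y (v ∘ Fin.cast h) := by
  subst h
  rfl

theorem recast_apply (h : k = l) (a : DForm d X k) (x : X) (v : Fin l → Cn d) :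
    recast h a x v = a x (v ∘ Fin.cast h) := by
  subst h
  rfl

theorem SmoothOn.recast {a : DForm d X k} {U : Set X} (ha : a.SmoothOn U) (h : k = l) :
    (recast h a).SmoothOn U := by
  subst h
  exact ha

theorem IsTypeOn.recast {a : DForm d X k} {U : Set X} {p q : ℕ} (ha : a.IsTypeOn p q U)
    (h : k = l) : (DForm.recast h a).IsTypeOn p q U := by
  subst h
  exact ha

variable [IsManifold 𝓘(ℂ, Cn d) ω X]

/-- The chain rule: both expressions pass through the same preferred chart at the point. -/
theorem inChart_eq_comp {φ ψ : OpenPartialHomeomorph X (Cn d)} (hφ : φ ∈ holCharts d X)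
    (hψ : ψ ∈ holCharts d X) (a : DForm d X k) {y : Cn d}
    (hy : y ∈ ψ.target ∩ ψ.symm ⁻¹' φ.source) :
    a.inChart ψ y = (a.inChart φ (φ (ψ.symm y))).compContinuousLinearMap
      (fderiv ℝ (fun y => φ (ψ.symm y)) y) := by
  have hx : ψ.symm y ∈ φ.source := hy.2
  set x := ψ.symm y with hxd
  have hφy : φ x ∈ φ.target := φ.map_source hx
  have hφx : φ.symm (φ x) = x := φ.left_inv hx
  set c := chartAt (Cn d) x with hc
  have hcm : c ∈ holCharts d X := chartAt_mem_holCharts x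
  have hcx : x ∈ c.source := mem_chart_source _ x
  have h1 : (mfderiv 𝓘(ℝ, Cn d) 𝓘(ℝ, Cn d) ψ.symm y : Cn d →L[ℝ] Cn d) =
      fderiv ℝ (fun z => c (ψ.symm z)) y := mfderiv_symm_eq hψ hy.1
  have h2 : (mfderiv 𝓘(ℝ, Cn d) 𝓘(ℝ, Cn d) φ.symm (φ x) : Cn d →L[ℝ] Cn d) =
      fderiv ℝ (fun z => c (φ.symm z)) (φ x) :=
    (mfderiv_symm_eq hφ hφy).trans (by rw [hφx])
  have hd1 : DifferentiableAt ℝ (fun y => φ (ψ.symm y)) y :=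
    ((contDiffOn_transition_real hφ hψ).contDiffAt
      ((isOpen_transition φ ψ).mem_nhds hy)).differentiableAt (by simp)
  have hd2 : DifferentiableAt ℝ (fun z => c (φ.symm z)) (φ x) :=
    ((contDiffOn_transition_real hcm hφ).contDiffAt ((isOpen_transition c φ).mem_nhds
      ⟨hφy, by simpa [hφx] using hcx⟩)).differentiableAt (by simp)
  have h3 : fderiv ℝ (fun z => c (ψ.symm z)) y =
      (fderiv ℝ (fun z => c (φ.symm z)) (φ x)).comp (fderiv ℝ (fun y => φ (ψ.symm y)) y) := by
    have he : (fun z => c (ψ.symm z)) =ᶠ[nhds y] (fun z => c (φ.symm z)) ∘ fun y => φ (ψ.symm y) := by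
      filter_upwards [(isOpen_transition φ ψ).mem_nhds hy] with z hz
      simp only [Function.comp_apply, φ.left_inv hz.2]
    rw [he.fderiv_eq]
    exact fderiv_comp y hd2 hd1
  ext v
  simp only [inChart]
  rw [h1, h2, h3]
  simp only [← hxd, hφx]
  rfl

theorem contDiffAt_inChart {φ ψ : OpenPartialHomeomorph X (Cn d)} (hφ : φ ∈ holCharts d X)
    (hψ : ψ ∈ holCharts d X) {a : DForm d X k} {y : Cn d}
    (hy : y ∈ ψ.target ∩ ψ.symm ⁻¹' φ.source)
    (ha : ContDiffAt ℝ ∞ (a.inChart φ) (φ (ψ.symm y))) : ContDiffAt ℝ ∞ (a.inChart ψ) y := by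
  have ho := (isOpen_transition φ ψ).mem_nhds hy
  have hτ := contDiffOn_transition_real hφ hψ
  have h1 : ContDiffAt ℝ ∞ (fun z => a.inChart φ (φ (ψ.symm z))) y :=
    ContDiffAt.comp (g := a.inChart φ) y ha (hτ.contDiffAt ho)
  have h2 : ContDiffAt ℝ ∞ (fderiv ℝ fun y => φ (ψ.symm y)) y :=
    (hτ.contDiffAt ho).fderiv_right (by simp)
  have h3 : ContDiffAt ℝ ∞ (fun z => (a.inChart φ (φ (ψ.symm z))).compContinuousLinearMap
      (fderiv ℝ (fun y => φ (ψ.symm y)) z)) y := ContDiffWithinAt.altForm_comp h1 h2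
  refine h3.congr_of_eventuallyEq ?_
  filter_upwards [ho] with z hz using inChart_eq_comp hφ hψ a hz

theorem smoothOn_of_charts {a : DForm d X k} {U : Set X}
    (h : ∀ x ∈ U, ∃ φ ∈ holCharts d X, x ∈ φ.source ∧ ContDiffAt ℝ ∞ (a.inChart φ) (φ x)) :
    a.SmoothOn U := by
  intro ψ hψ y hy
  obtain ⟨φ, hφ, hx, ha⟩ := h _ hy.2
  exact (contDiffAt_inChart hφ hψ ⟨hy.1, hx⟩ ha).contDiffWithinAt

theorem SmoothOn.contDiffAt {a : DForm d X k} {U : Set X} (ha : a.SmoothOn U) (hU : IsOpen U)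
    {φ : OpenPartialHomeomorph X (Cn d)} (hφ : φ ∈ holCharts d X) {y : Cn d} (hy : y ∈ φ.target)
    (hyU : φ.symm y ∈ U) : ContDiffAt ℝ ∞ (a.inChart φ) y :=
  (ha φ hφ).contDiffAt ((φ.isOpen_inter_preimage_symm hU).mem_nhds ⟨hy, hyU⟩)

/-- The operators are defined pointwise in preferred charts; transition maps are holomorphic, so any
chart may be used instead by `dolb_pullback`. -/
theorem dolb_inChart {e : ℂ} {ψ : OpenPartialHomeomorph X (Cn d)} (hψ : ψ ∈ holCharts d X)
    {a : DForm d X k} {y : Cn d} (hy : y ∈ ψ.target) (ha : ContDiffAt ℝ ∞ (a.inChart ψ) y) :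
    inChart (fun x => dolb e (a.inChart (chartAt (Cn d) x)) (chartAt (Cn d) x x)) ψ y =
      dolb e (a.inChart ψ) y := by
  set x := ψ.symm y with hx
  set c := chartAt (Cn d) x with hc
  have hcm : c ∈ holCharts d X := chartAt_mem_holCharts x
  have hcx : x ∈ c.source := mem_chart_source _ x
  have hy2 : y ∈ ψ.target ∩ ψ.symm ⁻¹' c.source := ⟨hy, hcx⟩
  have ho := (isOpen_transition c ψ).mem_nhds hy2
  have hcy : c x ∈ c.target ∩ c.symm ⁻¹' ψ.source :=
    ⟨c.map_source hcx, by simpa [c.left_inv hcx] using ψ.map_target hy⟩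
  have ha' : ContDiffAt ℝ ∞ (a.inChart c) (c x) := by
    refine contDiffAt_inChart hψ hcm hcy ?_
    rw [c.left_inv hcx, hx, ψ.right_inv hy]
    exact ha
  have hcongr : a.inChart ψ =ᶠ[nhds y] fun z => (a.inChart c (c (ψ.symm z))).compContinuousLinearMap
      (fderiv ℝ (fun y => c (ψ.symm y)) z) := by
    filter_upwards [ho] with z hz using inChart_eq_comp hcm hψ a hz
  rw [dolb_congr hcongr, dolb_pullback (ha'.differentiableAt (by simp))
    ((contDiffOn_transition_real hcm hψ).contDiffAt ho)]
  · ext v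
    simp only [inChart]
    rw [mfderiv_symm_eq hψ hy]
  · filter_upwards [ho] with z hz v
    rw [fderiv_transition_I hcm hψ hz]
    simp

theorem dbar_inChart {ψ : OpenPartialHomeomorph X (Cn d)} (hψ : ψ ∈ holCharts d X)
    {a : DForm d X k} {y : Cn d} (hy : y ∈ ψ.target) (ha : ContDiffAt ℝ ∞ (a.inChart ψ) y) :
    a.dbar.inChart ψ y = dolb Complex.I (a.inChart ψ) y :=
  dolb_inChart hψ hy ha

theorem del_inChart {ψ : OpenPartialHomeomorph X (Cn d)} (hψ : ψ ∈ holCharts d X)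
    {a : DForm d X k} {y : Cn d} (hy : y ∈ ψ.target) (ha : ContDiffAt ℝ ∞ (a.inChart ψ) y) :
    a.del.inChart ψ y = dolb (-Complex.I) (a.inChart ψ) y := by
  have h : a.del = fun x => dolb (-Complex.I) (a.inChart (chartAt (Cn d) x)) (chartAt (Cn d) x x) := by
    funext x
    rw [del, delCn_eq_dolb]
  rw [h]
  exact dolb_inChart hψ hy ha

/-- A form can be recovered from its expression in a chart. -/
theorem eq_inChart_comp {φ : OpenPartialHomeomorph X (Cn d)} (hφ : φ ∈ holCharts d X)
    (a : DForm d X k) {x : X} (hx : x ∈ φ.source) :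
    a x = (a.inChart φ (φ x)).compContinuousLinearMap
      (fderiv ℝ (fun y => φ ((chartAt (Cn d) x).symm y)) (chartAt (Cn d) x x)) := by
  set c := chartAt (Cn d) x with hc
  have hcm : c ∈ holCharts d X := chartAt_mem_holCharts x
  have hcx : x ∈ c.source := mem_chart_source _ x
  have h := inChart_eq_comp hφ hcm a (y := c x)
    ⟨c.map_source hcx, by simpa [c.left_inv hcx] using hx⟩
  rw [c.left_inv hcx] at h
  rw [← h, inChart, mfderiv_symm_eq hcm (c.map_source hcx)]
  have hid : fderiv ℝ (fun z => chartAt (Cn d) (c.symm (c x)) (c.symm z)) (c x) =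
      ContinuousLinearMap.id ℝ (Cn d) := by
    rw [c.left_inv hcx]
    have he : (fun z => c (c.symm z)) =ᶠ[nhds (c x)] id := by
      filter_upwards [c.open_target.mem_nhds (c.map_source hcx)] with z hz using c.right_inv hz
    rw [he.fderiv_eq, fderiv_id]
  rw [hid, c.left_inv hcx]
  rfl

theorem isType_inChart {φ : OpenPartialHomeomorph X (Cn d)} (hφ : φ ∈ holCharts d X)
    {a : DForm d X k} {p q : ℕ} {y : Cn d} (hy : y ∈ φ.target)
    (ha : AltForm.IsType p q (a (φ.symm y))) : AltForm.IsType p q (a.inChart φ y) := by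
  refine ⟨ha.1, fun c v => ?_⟩
  have hx : φ.symm y ∈ (chartAt (Cn d) (φ.symm y)).source := mem_chart_source _ _
  let L : Cn d →L[ℝ] Cn d := mfderiv 𝓘(ℝ, Cn d) 𝓘(ℝ, Cn d) φ.symm y
  have hL : L = fderiv ℝ (fun z => chartAt (Cn d) (φ.symm y) (φ.symm z)) y := mfderiv_symm_eq hφ hy
  have hlin : ∀ w : Cn d, L (c • w) = c • L w := by
    intro w
    rw [hL, fderiv_transition_I (chartAt_mem_holCharts _) hφ ⟨hy, hx⟩]
    simp
  have h2 := ha.2 c fun i => L (v i)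
  simp only [← hlin] at h2
  exact h2

end DForm

/-! ### Partitions of unity subordinate to holomorphic charts. -/

section Partition

variable {d : ℕ} {X : Type*} [TopologicalSpace X] [ChartedSpace (Cn d) X]
  [IsManifold 𝓘(ℂ, Cn d) ω X]

/-- A finite partition of unity subordinate to a given family of charts. -/
theorem exists_chartPartition [T2Space X] [CompactSpace X]
    {c : X → OpenPartialHomeomorph X (Cn d)} (hc : ∀ x, c x ∈ holCharts d X)
    (hx : ∀ x, x ∈ (c x).source) :
    ∃ (P : ChartPartition d X) (g : Fin P.N → X), ∀ i, P.chart i = c (g i) := by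
  have := isManifold_real d X
  obtain ⟨t, ht⟩ := isCompact_univ.elim_nhds_subcover (fun x => (c x).source)
    (fun x _ => (c x).open_source.mem_nhds (hx x))
  let g : Fin t.card → X := fun i => (t.equivFin.symm i : X)
  obtain ⟨f, hf⟩ := SmoothPartitionOfUnity.exists_isSubordinate 𝓘(ℝ, Cn d)
    (isClosed_univ (X := X)) (fun i => (c (g i)).source) (fun i => (c (g i)).open_source) (by
      intro x _
      obtain ⟨y, hy, hxy⟩ := Set.mem_iUnion₂.1 (ht.2 (Set.mem_univ x))
      refine Set.mem_iUnion.2 ⟨t.equivFin ⟨y, hy⟩, ?_⟩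
      simpa [g] using hxy)
  refine ⟨⟨t.card, fun i => c (g i), fun i => hc _, fun i => f i, fun i => (f i).contMDiff,
    fun i x => f.nonneg i x, fun i => hf i, fun x => ?_⟩, g, fun i => rfl⟩
  rw [← finsum_eq_sum_of_fintype]
  exact f.sum_eq_one (Set.mem_univ x)

theorem nonempty_chartPartition [T2Space X] [CompactSpace X] : Nonempty (ChartPartition d X) :=
  let ⟨P, _⟩ := exists_chartPartition (d := d) (X := X) chartAt_mem_holCharts
    fun x => mem_chart_source (Cn d) x
  ⟨P⟩

namespace ChartPartition

theorem le_one (P : ChartPartition d X) (i : Fin P.N) (x : X) : P.ρ i x ≤ 1 := by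
  rw [← P.sum_eq_one x]
  exact Finset.single_le_sum (fun j _ => P.nonneg j x) (Finset.mem_univ i)

theorem eq_zero (P : ChartPartition d X) (i : Fin P.N) {x : X} (hx : x ∉ (P.chart i).source) :
    P.ρ i x = 0 := by
  by_contra h
  exact hx (P.support i (subset_tsupport _ h))

theorem contDiffOn (P : ChartPartition d X) (i : Fin P.N) {φ : OpenPartialHomeomorph X (Cn d)}
    (hφ : φ ∈ holCharts d X) : ContDiffOn ℝ ∞ (fun y => P.ρ i (φ.symm y)) φ.target := by
  have h := (P.smooth i).comp_contMDiffOn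
    (contMDiffOn_symm_of_mem_maximalAtlas (mem_maximalAtlas_real hφ))
  exact contMDiffOn_iff_contDiffOn.1 h

end ChartPartition

end Partition

/-! ### Integration of forms of top degree. -/

namespace DForm

open MeasureTheory

variable {d : ℕ} {X : Type*} [TopologicalSpace X] [ChartedSpace (Cn d) X]

theorem HasIntegral.add {a b : DForm d X (2 * d)} {u v : ℂ} (ha : a.HasIntegral u)
    (hb : b.HasIntegral v) : HasIntegral (fun x => a x + b x) (u + v) := by
  intro P
  obtain ⟨ha1, ha2⟩ := ha P
  obtain ⟨hb1, hb2⟩ := hb P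
  have e : ∀ i y, (P.ρ i ((P.chart i).symm y) : ℂ) *
      inChart (fun x => a x + b x) (P.chart i) y (stdFrame d) =
      (P.ρ i ((P.chart i).symm y) : ℂ) * a.inChart (P.chart i) y (stdFrame d) +
        (P.ρ i ((P.chart i).symm y) : ℂ) * b.inChart (P.chart i) y (stdFrame d) := by
    intro i y
    rw [inChart_add, ContinuousAlternatingMap.add_apply, mul_add]
  simp only [e]
  refine ⟨fun i => (ha1 i).add (hb1 i), ?_⟩
  rw [← ha2, ← hb2, ← Finset.sum_add_distrib]
  exact Finset.sum_congr rfl fun i _ => integral_add (ha1 i) (hb1 i)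

theorem HasIntegral.const_smul {a : DForm d X (2 * d)} {u : ℂ} (c : ℂ) (ha : a.HasIntegral u) :
    HasIntegral (fun x => c • a x) (c * u) := by
  intro P
  obtain ⟨ha1, ha2⟩ := ha P
  have e : ∀ i y, (P.ρ i ((P.chart i).symm y) : ℂ) *
      inChart (fun x => c • a x) (P.chart i) y (stdFrame d) =
      c * ((P.ρ i ((P.chart i).symm y) : ℂ) * a.inChart (P.chart i) y (stdFrame d)) := by
    intro i y
    rw [inChart_smul (fun _ => c), ContinuousAlternatingMap.smul_apply, smul_eq_mul]
    ring
  simp only [e]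
  refine ⟨fun i => (ha1 i).const_mul c, ?_⟩
  rw [← ha2, Finset.mul_sum]
  exact Finset.sum_congr rfl fun i _ => integral_const_mul _ _

theorem hasIntegral_zero : HasIntegral (fun _ => 0 : DForm d X (2 * d)) 0 := by
  intro P
  have e : ∀ i y, (P.ρ i ((P.chart i).symm y) : ℂ) *
      inChart (fun _ => 0 : DForm d X (2 * d)) (P.chart i) y (stdFrame d) = 0 := by
    intro i y
    exact mul_zero _
  simp only [e]
  exact ⟨fun i => integrableOn_zero, by simp⟩

theorem HasIntegral.sum {ι : Type*} (s : Finset ι) {a : ι → DForm d X (2 * d)} {u : ι → ℂ}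
    (ha : ∀ i ∈ s, (a i).HasIntegral (u i)) :
    HasIntegral (fun x => ∑ i ∈ s, a i x) (∑ i ∈ s, u i) := by
  classical
  induction s using Finset.induction_on with
  | empty => simpa using hasIntegral_zero
  | insert i s hi ih =>
    simp only [Finset.sum_insert hi]
    exact (ha i (Finset.mem_insert_self i s)).add
      (ih fun j hj => ha j (Finset.mem_insert_of_mem hj))

variable [IsManifold 𝓘(ℂ, Cn d) ω X]

theorem HasIntegral.unique [T2Space X] [CompactSpace X] {a : DForm d X (2 * d)} {u v : ℂ}
    (h : a.HasIntegral u) (h' : a.HasIntegral v) : u = v := by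
  obtain ⟨P⟩ := nonempty_chartPartition (d := d) (X := X)
  rw [← (h P).2, ← (h' P).2]

theorem HasIntegral.integral_eq [T2Space X] [CompactSpace X] {a : DForm d X (2 * d)} {u : ℂ}
    (h : a.HasIntegral u) : a.integral = u := by
  have hex : ∃ c, a.HasIntegral c := ⟨u, h⟩
  rw [integral, dif_pos hex]
  exact hex.choose_spec.unique h

/-- A form which vanishes outside the domain of a chart, and is integrable there. -/
theorem hasIntegral_of_chart {a : DForm d X (2 * d)} {φ : OpenPartialHomeomorph X (Cn d)}
    (hφ : φ ∈ holCharts d X) (h0 : ∀ x ∉ φ.source, a x = 0)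
    (hint : IntegrableOn (fun y => a.inChart φ y (stdFrame d)) φ.target) :
    a.HasIntegral (∫ y in φ.target, a.inChart φ y (stdFrame d)) := by
  intro P
  set F : Cn d → ℂ := fun y => a.inChart φ y (stdFrame d) with hF
  have hFi : ∀ i, IntegrableOn (fun y => (P.ρ i (φ.symm y) : ℂ) * F y) φ.target := by
    intro i
    refine Integrable.bdd_mul (c := 1) hint ?_ ?_
    · have h1 : ContinuousOn (fun y => (P.ρ i (φ.symm y) : ℂ)) φ.target :=
        Complex.continuous_ofReal.comp_continuousOn (P.contDiffOn i hφ).continuousOn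
      exact h1.aestronglyMeasurable φ.open_target.measurableSet
    · refine Filter.Eventually.of_forall fun y => ?_
      rw [Complex.norm_real, Real.norm_of_nonneg (P.nonneg i _)]
      exact P.le_one i _
  have key : ∀ i, IntegrableOn (fun y => (P.ρ i ((P.chart i).symm y) : ℂ) *
        a.inChart (P.chart i) y (stdFrame d)) (P.chart i).target ∧
      ∫ y in (P.chart i).target, (P.ρ i ((P.chart i).symm y) : ℂ) *
        a.inChart (P.chart i) y (stdFrame d) = ∫ y in φ.target, (P.ρ i (φ.symm y) : ℂ) * F y := by
    intro i
    set ψ := P.chart i with hψd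
    have hψ : ψ ∈ holCharts d X := P.chart_mem i
    set O := ψ.target ∩ ψ.symm ⁻¹' φ.source with hO
    have hOo : IsOpen O := isOpen_transition φ ψ
    let τ : Cn d → Cn d := fun y => φ (ψ.symm y)
    have hτ : ∀ y ∈ O, HasFDerivWithinAt τ (fderiv ℝ τ y) O y := fun y hy =>
      (((contDiffOn_transition_real hφ hψ).contDiffAt (hOo.mem_nhds hy)).differentiableAt
        (by simp)).hasFDerivAt.hasFDerivWithinAt
    have hinj : Set.InjOn τ O := by
      intro y hy z hz hyz
      have h1 : ψ.symm y = ψ.symm z := φ.injOn hy.2 hz.2 hyz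
      rw [← ψ.right_inv hy.1, ← ψ.right_inv hz.1, h1]
    have himg : τ '' O = φ.target ∩ φ.symm ⁻¹' ψ.source := by
      ext z
      constructor
      · rintro ⟨y, hy, rfl⟩
        refine ⟨φ.map_source hy.2, ?_⟩
        simp only [Set.mem_preimage, τ]
        rw [φ.left_inv hy.2]
        exact ψ.map_target hy.1
      · rintro ⟨hz1, hz2⟩
        have hz2' : φ.symm z ∈ ψ.source := hz2
        refine ⟨ψ (φ.symm z), ⟨ψ.map_source hz2', ?_⟩, ?_⟩
        · simp only [Set.mem_preimage]
          rw [ψ.left_inv hz2']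
          exact φ.map_target hz1
        · simp only [τ]
          rw [ψ.left_inv hz2', φ.right_inv hz1]
    -- A form of top degree changes by the determinant of `τ`, and integrals by its absolute value.
    -- The two agree because the determinant of a holomorphic transition map is the square modulus
    -- of a complex one.
    have hpt : ∀ y ∈ O, |(fderiv ℝ τ y).det| • ((P.ρ i (φ.symm (τ y)) : ℂ) * F (τ y)) =
        (P.ρ i (ψ.symm y) : ℂ) * a.inChart ψ y (stdFrame d) := by
      intro y hy
      have h1 : φ.symm (τ y) = ψ.symm y := φ.left_inv hy.2
      have h2 : a.inChart ψ y (stdFrame d) = ((fderiv ℝ τ y).det : ℂ) * F (τ y) := by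
        rw [inChart_eq_comp hφ hψ a hy]
        exact AltForm.map_comp_of_top (a.inChart φ (τ y)) rfl (fderiv ℝ τ y) (stdFrame d)
      have h3 : 0 ≤ (fderiv ℝ τ y).det := by
        have h4 : fderiv ℝ τ y = _ := fderiv_transition_I hφ hψ hy
        rw [h4]
        have h5 := AltForm.det_real_of_complex
          ((fderiv ℂ (fun y => φ (ψ.symm y)) y : Cn d →L[ℂ] Cn d) : Cn d →ₗ[ℂ] Cn d)
        exact (Complex.normSq_nonneg _).trans_eq h5.symm
      rw [h1, h2, abs_of_nonneg h3, Complex.real_smul]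
      ring
    have hsub : φ.target ∩ φ.symm ⁻¹' ψ.source ⊆ φ.target := Set.inter_subset_left
    have hz1 : ∀ y ∈ ψ.target \ O, (P.ρ i (ψ.symm y) : ℂ) * a.inChart ψ y (stdFrame d) = 0 := by
      rintro y ⟨hy1, hy2⟩
      have h1 : a (ψ.symm y) = 0 := h0 _ fun h => hy2 ⟨hy1, h⟩
      rw [inChart, h1]
      exact mul_zero _
    have hz2 : ∀ y ∈ φ.target \ (φ.target ∩ φ.symm ⁻¹' ψ.source),
        (P.ρ i (φ.symm y) : ℂ) * F y = 0 := by
      rintro y ⟨hy1, hy2⟩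
      rw [P.eq_zero i fun h => hy2 ⟨hy1, h⟩, Complex.ofReal_zero, zero_mul]
    have hI : IntegrableOn (fun y => (P.ρ i (ψ.symm y) : ℂ) * a.inChart ψ y (stdFrame d)) O := by
      have h1 := (hFi i).mono_set hsub
      rw [← himg, integrableOn_image_iff_integrableOn_abs_det_fderiv_smul _ hOo.measurableSet hτ
        hinj] at h1
      exact h1.congr_fun hpt hOo.measurableSet
    refine ⟨hI.of_forall_sdiff_eq_zero ψ.open_target.measurableSet hz1, ?_⟩
    rw [setIntegral_eq_of_subset_of_forall_sdiff_eq_zero ψ.open_target.measurableSet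
      Set.inter_subset_left hz1,
      setIntegral_eq_of_subset_of_forall_sdiff_eq_zero φ.open_target.measurableSet hsub hz2,
      ← himg, integral_image_eq_integral_abs_det_fderiv_smul _ hOo.measurableSet hτ hinj]
    exact (setIntegral_congr_fun hOo.measurableSet hpt).symm
  refine ⟨fun i => (key i).1, ?_⟩
  -- All the integrals now live in the single chart `φ`, where `∑ ρ_i = 1`.
  rw [Finset.sum_congr rfl fun i _ => (key i).2, ← integral_finsetSum _ fun i _ => hFi i]
  refine integral_congr_ae (Filter.Eventually.of_forall fun y => ?_)
  beta_reduce
  rw [← Finset.sum_mul, ← Complex.ofReal_sum, P.sum_eq_one, Complex.ofReal_one, one_mul]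

end DForm

/-! ### Principal values on the manifold. -/

namespace DForm

open MeasureTheory

section PrincipalValue

variable {d : ℕ} {X : Type*} [TopologicalSpace X] [ChartedSpace (Cn d) X] {σ : X → ℝ}

/-- For `Re z > 0` the factor `σ^{2z}` vanishes where `σ = 0`, so values of the form on the
hypersurface do not matter. -/
theorem IsPrincipalValue.congr {a b : DForm d X (2 * d)} {c : ℂ} (h : IsPrincipalValue σ a c)
    (hab : ∀ x, σ x ≠ 0 → a x = b x) : IsPrincipalValue σ b c := by
  refine HasContinuation.imp h 0 fun z w hz hw => ?_
  have e : (fun x => ((σ x : ℂ) ^ (2 * z)) • b x) = fun x => ((σ x : ℂ) ^ (2 * z)) • a x := by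
    funext x
    by_cases hx : σ x = 0
    · have : z ≠ 0 := by rintro rfl; simp at hz
      have h0 : (σ x : ℂ) ^ (2 * z) = 0 := by simp [hx, Complex.zero_cpow, this]
      rw [h0]
      exact (zero_smul ℂ (b x : AltForm d _)).trans (zero_smul ℂ (a x : AltForm d _)).symm
    · rw [hab x hx]
  rw [e]
  exact hw

theorem IsPrincipalValue.add {a b : DForm d X (2 * d)} {u v : ℂ} (ha : IsPrincipalValue σ a u)
    (hb : IsPrincipalValue σ b v) : IsPrincipalValue σ (fun x => a x + b x) (u + v) := by
  refine HasContinuation.add ha hb fun z w w' hw hw' => ?_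
  have := hw.add hw'
  simpa only [smul_add] using this

theorem IsPrincipalValue.const_smul {a : DForm d X (2 * d)} {u : ℂ} (c : ℂ)
    (ha : IsPrincipalValue σ a u) : IsPrincipalValue σ (fun x => c • a x) (c * u) := by
  refine HasContinuation.const_mul c ha fun z w hw => ?_
  have := hw.const_smul c
  simpa only [smul_comm c] using this

theorem IsPrincipalValue.sum {ι : Type*} (s : Finset ι) {a : ι → DForm d X (2 * d)} {u : ι → ℂ}
    (ha : ∀ i ∈ s, IsPrincipalValue σ (a i) (u i)) :
    IsPrincipalValue σ (fun x => ∑ i ∈ s, a i x) (∑ i ∈ s, u i) := by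
  refine (HasContinuation.sum s ha).imp 0 ?_
  rintro z w - ⟨v, hv, rfl⟩
  have := HasIntegral.sum s hv
  simpa only [Finset.smul_sum] using this

theorem IsPrincipalValue.unique [IsManifold 𝓘(ℂ, Cn d) ω X] [T2Space X] [CompactSpace X]
    {a : DForm d X (2 * d)} {u v : ℂ} (h : IsPrincipalValue σ a u) (h' : IsPrincipalValue σ a v) :
    u = v :=
  HasContinuation.unique h h' fun _ _ _ hw hw' => hw.unique hw'

end PrincipalValue

variable {n : ℕ} {X : Type*} [TopologicalSpace X] [ChartedSpace (Cn (n + 1)) X]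
  [IsManifold 𝓘(ℂ, Cn (n + 1)) ω X] {σ : X → ℝ}

/-- The principal value of a form with support in a chart. -/
theorem isPrincipalValue_of_chart {a : DForm (n + 1) X (2 * (n + 1))}
    {φ : OpenPartialHomeomorph X (Cn (n + 1))} (hφ : φ ∈ holCharts (n + 1) X)
    (h0 : ∀ x ∉ φ.source, σ x ≠ 0 → a x = 0) {m : ℕ} {b : Cn (n + 1) → ℂ} (hb : ContDiff ℝ ∞ b)
    (hbs : HasCompactSupport b) (hbt : tsupport b ⊆ φ.target)
    (hab : ∀ y ∈ φ.target, σ (φ.symm y) ≠ 0 →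
      a.inChart φ y (stdFrame (n + 1)) = (y 0 ^ m)⁻¹ * b y)
    (hσ : IsNormLike (fun y => σ (φ.symm y)) (tsupport b)) :
    IsPrincipalValue σ a (pvInt m b) := by
  refine (hasContinuation_pvInt hb hbs m hσ).imp 0 ?_
  rintro z w hz ⟨hi, rfl⟩
  have hz0 : z ≠ 0 := by rintro rfl; simp at hz
  have hcp : ∀ x, σ x = 0 → (σ x : ℂ) ^ (2 * z) = 0 := fun x hx => by
    simp [hx, Complex.zero_cpow, hz0]
  have e : Set.EqOn (fun y => inChart (fun x => ((σ x : ℂ) ^ (2 * z)) • a x) φ y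
      (stdFrame (n + 1))) (fun y => (σ (φ.symm y) : ℂ) ^ (2 * z) * ((y 0 ^ m)⁻¹ * b y))
      φ.target := by
    intro y hy
    beta_reduce
    rw [inChart_smul (fun x => (σ x : ℂ) ^ (2 * z)), ContinuousAlternatingMap.smul_apply,
      smul_eq_mul]
    by_cases hs : σ (φ.symm y) = 0
    · rw [hcp _ hs, zero_mul, zero_mul]
    · rw [hab y hy hs]
  have hw : ∫ y, (σ (φ.symm y) : ℂ) ^ (2 * z) * ((y 0 ^ m)⁻¹ * b y) =
      ∫ y in φ.target, inChart (fun x => ((σ x : ℂ) ^ (2 * z)) • a x) φ y (stdFrame (n + 1)) := by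
    rw [setIntegral_congr_fun φ.open_target.measurableSet e]
    refine (setIntegral_eq_integral_of_forall_compl_eq_zero fun y hy => ?_).symm
    rw [image_eq_zero_of_notMem_tsupport fun h => hy (hbt h)]
    simp
  rw [hw]
  refine hasIntegral_of_chart hφ (fun x hx => ?_) ?_
  · by_cases hs : σ x = 0
    · rw [hcp x hs]
      exact zero_smul ℂ (a x : AltForm (n + 1) _)
    · rw [h0 x hx hs]
      exact smul_zero (A := AltForm (n + 1) (2 * (n + 1))) ((σ x : ℂ) ^ (2 * z))
  · exact hi.integrableOn.congr_fun e.symm φ.open_target.measurableSet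

end DForm

/-! ### Charts adapted to the hypersurface. -/

section Adapted

variable {d n : ℕ} {X : Type*} [TopologicalSpace X]

theorem mem_holCharts_of_contDiffOn [ChartedSpace (Cn d) X] {φ : OpenPartialHomeomorph X (Cn d)}
    (h₁ : ∀ e ∈ atlas (Cn d) X,
      ContDiffOn ℂ ω (fun y => φ (e.symm y)) (e.target ∩ e.symm ⁻¹' φ.source))
    (h₂ : ∀ e ∈ atlas (Cn d) X,
      ContDiffOn ℂ ω (fun y => e (φ.symm y)) (φ.target ∩ φ.symm ⁻¹' e.source)) :
    φ ∈ holCharts d X := by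
  rw [holCharts, IsManifold.maximalAtlas, mem_maximalAtlas_iff]
  intro e he
  constructor
  · refine mem_groupoid_of_pregroupoid.2 ⟨?_, ?_⟩
    · simpa [contDiffPregroupoid, OpenPartialHomeomorph.trans_source, Function.comp_def] using
        h₂ e he
    · simpa [contDiffPregroupoid, OpenPartialHomeomorph.trans_source, Function.comp_def,
        Set.inter_comm] using h₁ e he
  · refine mem_groupoid_of_pregroupoid.2 ⟨?_, ?_⟩
    · simpa [contDiffPregroupoid, OpenPartialHomeomorph.trans_source, Function.comp_def] using
        h₁ e he
    · simpa [contDiffPregroupoid, OpenPartialHomeomorph.trans_source, Function.comp_def,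
        Set.inter_comm] using h₂ e he

theorem mem_holCharts_of_comp [ChartedSpace (Cn d) X] [IsManifold 𝓘(ℂ, Cn d) ω X]
    {φ ψ : OpenPartialHomeomorph X (Cn d)} (hφ : φ ∈ holCharts d X) {T T' : Cn d → Cn d}
    (hT : ContDiff ℂ ω T) (hT' : ContDiff ℂ ω T') (hs : ψ.source ⊆ φ.source)
    (h : ∀ x ∈ ψ.source, ψ x = T (φ x)) (hT'T : ∀ y, T' (T y) = y) : ψ ∈ holCharts d X := by
  have h' : ∀ y ∈ ψ.target, ψ.symm y = φ.symm (T' y) ∧ T' y ∈ φ.target := by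
    intro y hy
    have h1 := ψ.map_target hy
    have h2 := h _ h1
    rw [ψ.right_inv hy] at h2
    have h3 : T' y = φ (ψ.symm y) := by
      conv_lhs => rw [h2]
      exact hT'T _
    rw [h3]
    exact ⟨(φ.left_inv (hs h1)).symm, φ.map_source (hs h1)⟩
  refine mem_holCharts_of_contDiffOn (fun e he => ?_) fun e he => ?_
  · have he' : e ∈ holCharts d X := IsManifold.subset_maximalAtlas he
    have h1 := hT.comp_contDiffOn (contDiffOn_transition hφ he')
    refine (h1.mono fun y hy => ⟨hy.1, hs hy.2⟩).congr fun y hy => ?_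
    exact h _ hy.2
  · have he' : e ∈ holCharts d X := IsManifold.subset_maximalAtlas he
    have h1 := (contDiffOn_transition he' hφ).comp hT'.contDiffOn (s := ψ.target ∩ ψ.symm ⁻¹' e.source)
      fun y hy => ⟨(h' y hy.1).2, by simpa [← (h' y hy.1).1] using hy.2⟩
    refine h1.congr fun y hy => ?_
    simp only [Function.comp_apply, (h' y hy.1).1]

theorem restrOpen_mem_holCharts [ChartedSpace (Cn d) X] [IsManifold 𝓘(ℂ, Cn d) ω X]
    {φ : OpenPartialHomeomorph X (Cn d)} (hφ : φ ∈ holCharts d X) {s : Set X} (hs : IsOpen s) :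
    φ.restrOpen s hs ∈ holCharts d X :=
  mem_holCharts_of_comp hφ contDiff_id contDiff_id
    (by rw [OpenPartialHomeomorph.restrOpen_source]; exact Set.inter_subset_left)
    (fun _ _ => rfl) fun _ => rfl

/-- Near a point of the set `s`, a chart can be shrunk to a chart whose image is a small set. -/
theorem exists_chart_target_subset [ChartedSpace (Cn d) X] [IsManifold 𝓘(ℂ, Cn d) ω X]
    {φ : OpenPartialHomeomorph X (Cn d)} (hφ : φ ∈ holCharts d X) {x : X} (hx : x ∈ φ.source)
    {r : ℝ} (hr : 0 < r) :
    ∃ ψ ∈ holCharts d X, x ∈ ψ.source ∧ ψ.source ⊆ φ.source ∧ (∀ z, ψ z = φ z) ∧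
      (∀ z, ψ.symm z = φ.symm z) ∧ ψ.target ⊆ φ.target ∧ ψ.target ⊆ Metric.ball (φ x) r := by
  have ho := φ.isOpen_inter_preimage (Metric.isOpen_ball (x := φ x) (ε := r))
  refine ⟨φ.restrOpen _ ho, restrOpen_mem_holCharts hφ ho, ?_, ?_, fun z => rfl, fun z => rfl,
    ?_, ?_⟩
  · rw [OpenPartialHomeomorph.restrOpen_source]
    exact ⟨hx, hx, Metric.mem_ball_self hr⟩
  · rw [OpenPartialHomeomorph.restrOpen_source]
    exact Set.inter_subset_left
  · intro y hy
    have h1 := (φ.restrOpen _ ho).map_target hy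
    have h2 := (φ.restrOpen _ ho).right_inv hy
    rw [OpenPartialHomeomorph.restrOpen_source] at h1
    rw [← h2]
    exact φ.map_source h1.1
  · intro y hy
    have h1 := (φ.restrOpen _ ho).map_target hy
    have h2 := (φ.restrOpen _ ho).right_inv hy
    rw [OpenPartialHomeomorph.restrOpen_source] at h1
    rw [← h2]
    exact h1.2.2

/-- The chart `φ` is adapted to the hypersurface `D`, which it maps to `{z₁ = 0}`. -/
def IsAdapted [ChartedSpace (Cn (n + 1)) X] (D : Set X)
    (φ : OpenPartialHomeomorph X (Cn (n + 1))) : Prop :=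
  φ ∈ holCharts (n + 1) X ∧ ∀ x ∈ φ.source, x ∈ D ↔ φ x 0 = 0

theorem IsAdapted.symm_mem [ChartedSpace (Cn (n + 1)) X] {D : Set X}
    {φ : OpenPartialHomeomorph X (Cn (n + 1))} (h : IsAdapted D φ) {y : Cn (n + 1)}
    (hy : y ∈ φ.target) : φ.symm y ∈ D ↔ y 0 = 0 := by
  have := h.2 _ (φ.map_target hy)
  rwa [φ.right_inv hy] at this

/-- A chart is translated so that `x` is sent to `e₁` and shrunk to the unit ball around `e₁`, where
the first coordinate has no zeros; it is also cut down to the complement of `D`. -/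
theorem exists_isAdapted_of_notMem [ChartedSpace (Cn (n + 1)) X]
    [IsManifold 𝓘(ℂ, Cn (n + 1)) ω X] {D : Set X} (hD : IsClosed D) {x : X} (hx : x ∉ D) :
    ∃ φ : OpenPartialHomeomorph X (Cn (n + 1)), IsAdapted D φ ∧ x ∈ φ.source := by
  set c := chartAt (Cn (n + 1)) x with hc
  have hcx : x ∈ c.source := mem_chart_source _ x
  set v : Cn (n + 1) := Pi.single 0 1 - c x with hv
  let ψ := c.transHomeomorph (Homeomorph.addRight v)
  have hψ : ψ ∈ holCharts (n + 1) X :=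
    mem_holCharts_of_comp (chartAt_mem_holCharts x) (T := fun y => y + v) (T' := fun y => y - v)
      (by fun_prop) (by fun_prop) (by exact subset_rfl) (fun _ _ => rfl) (by simp)
  have hψx : ψ x = Pi.single 0 1 := by
    change c x + v = _
    simp [hv]
  have hψs : x ∈ ψ.source := hcx
  obtain ⟨φ, hφ, hx1, hs, he, -, -, hb⟩ := exists_chart_target_subset hψ hψs one_pos
  refine ⟨φ.restrOpen Dᶜ hD.isOpen_compl, ⟨restrOpen_mem_holCharts hφ _, ?_⟩, ?_⟩
  · intro z hz
    rw [OpenPartialHomeomorph.restrOpen_source] at hz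
    refine iff_of_false hz.2 fun h0 => ?_
    have h1 : φ z ∈ Metric.ball (ψ x) 1 := hb (φ.map_source hz.1)
    have h2 : φ z 0 = 0 := h0
    rw [hψx, Metric.mem_ball, dist_eq_norm] at h1
    have h3 := (norm_le_pi_norm (φ z - Pi.single 0 1) 0).trans_lt h1
    simp [h2] at h3
  · rw [OpenPartialHomeomorph.restrOpen_source]
    exact ⟨hx1, hx⟩

variable [ChartedSpace (Cn (n + 1)) X] [IsManifold 𝓘(ℂ, Cn (n + 1)) ω X]
  {Y : Type*} [TopologicalSpace Y] [ChartedSpace (Cn n) Y] {j : Y → X}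

/-- The normal form of an embedding of codimension one. -/
theorem exists_isAdapted_of_embedding
    (hj : Manifold.IsSmoothEmbedding 𝓘(ℂ, Cn n) 𝓘(ℂ, Cn (n + 1)) ω j) (y : Y) :
    ∃ (φ : OpenPartialHomeomorph X (Cn (n + 1))) (χ : OpenPartialHomeomorph Y (Cn n)),
      IsAdapted (Set.range j) φ ∧ χ ∈ holCharts n Y ∧ y ∈ χ.source ∧ j y ∈ φ.source ∧
      (∀ w ∈ χ.source, φ (j w) = Fin.cons 0 (χ w)) ∧ ∀ w, j w ∈ φ.source → w ∈ χ.source := by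
  obtain ⟨F, _, _, hF⟩ := hj.isImmersion
  have h := hF y
  set χ := h.domChart with hχ
  set c := h.codChart with hc
  have e := h.equiv
  -- The immersion normal form is `u ↦ (u, 0)` in `Cn n × F`, and counting dimensions shows that the
  -- complement is a line.
  have hfr : Module.finrank ℂ F = 1 := by
    have : FiniteDimensional ℂ F := by
      have hinj : Function.Injective
          ((h.equiv.toLinearEquiv : (Cn n × F) →ₗ[ℂ] Cn (n + 1)) ∘ₗ LinearMap.inr ℂ (Cn n) F) :=
        h.equiv.injective.comp (Prod.mk_right_injective 0)
      exact FiniteDimensional.of_injective _ hinj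
    have h1 := h.equiv.toLinearEquiv.finrank_eq
    rw [Module.finrank_prod] at h1
    simp at h1
    omega
  have : FiniteDimensional ℂ F := Module.finite_of_finrank_pos (by omega)
  let ι : F ≃L[ℂ] ℂ := ContinuousLinearEquiv.ofFinrankEq (by simp [hfr])
  -- The linear change of coordinates that puts the normal coordinate in `F` first.
  let A : Cn (n + 1) →L[ℂ] Cn (n + 1) := ContinuousLinearMap.pi
    (Fin.cons (α := fun _ => Cn (n + 1) →L[ℂ] ℂ)
      ((ι : F →L[ℂ] ℂ) ∘L ContinuousLinearMap.snd ℂ (Cn n) F ∘L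
        (h.equiv.symm : Cn (n + 1) →L[ℂ] Cn n × F))
      fun i => ContinuousLinearMap.proj i ∘L ContinuousLinearMap.fst ℂ (Cn n) F ∘L
        (h.equiv.symm : Cn (n + 1) →L[ℂ] Cn n × F))
  have hA : ∀ u f, A (h.equiv (u, f)) = Fin.cons (ι f) u := by
    intro u f
    ext i
    refine Fin.cases ?_ (fun i => ?_) i <;> simp [A]
  let B : Cn (n + 1) →L[ℂ] Cn (n + 1) := (h.equiv : (Cn n × F) →L[ℂ] Cn (n + 1)) ∘L
    (ContinuousLinearMap.prod (ContinuousLinearMap.pi fun i => ContinuousLinearMap.proj i.succ)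
      ((ι.symm : ℂ →L[ℂ] F) ∘L ContinuousLinearMap.proj 0))
  have hBA : ∀ v, B (A v) = v := by
    intro v
    obtain ⟨⟨u, f⟩, rfl⟩ := h.equiv.surjective v
    rw [hA]
    simp [B]
  have hAB : ∀ v, A (B v) = v := by
    intro v
    have hv : B v = h.equiv (fun i => v i.succ, ι.symm (v 0)) := rfl
    rw [hv, hA]
    ext i
    refine Fin.cases ?_ (fun i => ?_) i <;> simp
  let AE : Cn (n + 1) ≃ₜ Cn (n + 1) :=
    { toFun := A, invFun := B, left_inv := hBA, right_inv := hAB,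
      continuous_toFun := A.continuous, continuous_invFun := B.continuous }
  let ψ := c.transHomeomorph AE
  have hψs : ψ.source = c.source := rfl
  have hψ : ψ ∈ holCharts (n + 1) X :=
    mem_holCharts_of_comp h.codChart_mem_maximalAtlas A.contDiff B.contDiff
      (by exact subset_rfl) (fun _ _ => rfl) hBA
  have hw : ∀ w ∈ χ.source, ψ (j w) = Fin.cons 0 (χ w) := by
    intro w hw
    have h0 : χ w ∈ (χ.extend 𝓘(ℂ, Cn n)).target := by
      simpa using χ.map_source hw
    have h1 := h.writtenInCharts h0
    simp only [Function.comp_apply, OpenPartialHomeomorph.extend_coe,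
      OpenPartialHomeomorph.extend_coe_symm, modelWithCornersSelf_coe,
      modelWithCornersSelf_coe_symm, id] at h1
    rw [← hχ, χ.left_inv hw] at h1
    change A (c (j w)) = _
    rw [h1, hA, map_zero]
  -- Since `j` is a topological embedding, an open `O` with `j⁻¹(O)` equal to the domain of `χ`
  -- exists. Restricting to it excludes other parts of `D` that might return to this chart.
  obtain ⟨O, hO, hOχ⟩ := hj.isEmbedding.isInducing.isOpen_iff.1 χ.open_source
  have hso : IsOpen (ψ.source ∩ ψ ⁻¹' {v | (fun i => v (Fin.succ i)) ∈ χ.target}) :=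
    ψ.isOpen_inter_preimage (χ.open_target.preimage (by fun_prop))
  have hmem : ∀ w ∈ χ.source, j w ∈ O := fun w hw => by
    rw [← hOχ] at hw
    exact hw
  refine ⟨ψ.restrOpen _ (hO.inter hso), χ, ⟨restrOpen_mem_holCharts hψ _, ?_⟩,
    h.domChart_mem_maximalAtlas, h.mem_domChart_source, ?_, hw, ?_⟩
  · intro x hx
    rw [OpenPartialHomeomorph.restrOpen_source] at hx
    obtain ⟨hx1, hx2, -, hx3⟩ := hx
    constructor
    · rintro ⟨w, rfl⟩
      have hwχ : w ∈ χ.source := by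
        rw [← hOχ]
        exact hx2
      change ψ (j w) 0 = 0
      rw [hw w hwχ]
      rfl
    · intro h0
      have h0 : ψ x 0 = 0 := h0
      have hu : (fun i => ψ x (Fin.succ i)) ∈ χ.target := hx3
      refine ⟨χ.symm (fun i => ψ x (Fin.succ i)), ?_⟩
      have h1 := hw _ (χ.map_target hu)
      rw [χ.right_inv hu] at h1
      refine ψ.injOn (h.source_subset_preimage_source (χ.map_target hu)) hx1 ?_
      rw [h1]
      ext i
      refine Fin.cases ?_ (fun i => ?_) i
      · simp [h0]
      · simp
  · rw [OpenPartialHomeomorph.restrOpen_source]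
    refine ⟨h.mem_codChart_source, hmem y h.mem_domChart_source, h.mem_codChart_source, ?_⟩
    change (fun i => ψ (j y) (Fin.succ i)) ∈ χ.target
    rw [hw y h.mem_domChart_source]
    simpa using χ.map_source h.mem_domChart_source
  · intro w hw
    rw [OpenPartialHomeomorph.restrOpen_source] at hw
    rw [← hOχ]
    exact hw.2.1

theorem exists_isAdapted (hj : Manifold.IsSmoothEmbedding 𝓘(ℂ, Cn n) 𝓘(ℂ, Cn (n + 1)) ω j)
    (hclosed : IsClosed (Set.range j)) (x : X) :
    ∃ φ : OpenPartialHomeomorph X (Cn (n + 1)), IsAdapted (Set.range j) φ ∧ x ∈ φ.source := by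
  by_cases hx : x ∈ Set.range j
  · obtain ⟨y, rfl⟩ := hx
    obtain ⟨φ, -, h, -, -, hy, -⟩ := exists_isAdapted_of_embedding hj y
    exact ⟨φ, h, hy⟩
  · exact exists_isAdapted_of_notMem hclosed hx

/-- The chart of the hypersurface induced by an adapted chart. -/
theorem exists_induced_chart [IsManifold 𝓘(ℂ, Cn n) ω Y] [Nonempty Y]
    (hj : Manifold.IsSmoothEmbedding 𝓘(ℂ, Cn n) 𝓘(ℂ, Cn (n + 1)) ω j)
    {φ : OpenPartialHomeomorph X (Cn (n + 1))} (hφ : IsAdapted (Set.range j) φ) :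
    ∃ χ ∈ holCharts n Y, χ.source = j ⁻¹' φ.source ∧
      χ.target = {z | (Fin.cons 0 z : Cn (n + 1)) ∈ φ.target} ∧
      (∀ w ∈ χ.source, φ (j w) = Fin.cons 0 (χ w)) ∧
      ∀ z ∈ χ.target, j (χ.symm z) = φ.symm (Fin.cons 0 z) := by
  classical
  have hcons : Continuous fun z : Cn n => (Fin.cons 0 z : Cn (n + 1)) := by fun_prop
  have htail : Continuous fun (v : Cn (n + 1)) (i : Fin n) => v i.succ := by fun_prop
  have hinv : ∀ z : Cn n, (Fin.cons 0 z : Cn (n + 1)) ∈ φ.target →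
      j (Function.invFun j (φ.symm (Fin.cons 0 z))) = φ.symm (Fin.cons 0 z) := fun z hz =>
    Function.invFun_eq ((hφ.symm_mem hz).2 rfl)
  have hφj : ∀ w, j w ∈ φ.source → (Fin.cons 0 fun i => φ (j w) (Fin.succ i)) = φ (j w) := by
    intro w hw
    ext i
    refine Fin.cases ?_ (fun i => ?_) i
    · exact ((hφ.2 _ hw).1 ⟨w, rfl⟩).symm
    · simp
  have hjc : Continuous j := hj.isEmbedding.continuous
  let χ : OpenPartialHomeomorph Y (Cn n) :=
    { toFun := fun w i => φ (j w) (Fin.succ i)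
      invFun := fun z => Function.invFun j (φ.symm (Fin.cons 0 z))
      source := j ⁻¹' φ.source
      target := {z | (Fin.cons 0 z : Cn (n + 1)) ∈ φ.target}
      map_source' := fun w hw => by
        change (Fin.cons 0 fun i => φ (j w) (Fin.succ i)) ∈ φ.target
        rw [hφj w hw]
        exact φ.map_source hw
      map_target' := fun z hz => by
        change j (Function.invFun j (φ.symm (Fin.cons 0 z))) ∈ φ.source
        rw [hinv z hz]
        exact φ.map_target hz
      left_inv' := fun w hw => by
        rw [hφj w hw, φ.left_inv hw]
        exact Function.leftInverse_invFun hj.isEmbedding.injective w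
      right_inv' := fun z hz => by
        rw [hinv z hz, φ.right_inv hz]
        simp
      open_source := φ.open_source.preimage hjc
      open_target := φ.open_target.preimage hcons
      continuousOn_toFun := htail.comp_continuousOn
        (φ.continuousOn.comp hjc.continuousOn fun _ hw => hw)
      continuousOn_invFun := by
        rw [hj.isEmbedding.isInducing.continuousOn_iff]
        refine ContinuousOn.congr (φ.symm.continuousOn.comp hcons.continuousOn fun _ hz => hz)
          fun z hz => hinv z hz }
  have hχ : ∀ w ∈ χ.source, φ (j w) = Fin.cons 0 (χ w) := fun w hw => (hφj w hw).symm
  have hχs : ∀ z ∈ χ.target, j (χ.symm z) = φ.symm (Fin.cons 0 z) := hinv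
  refine ⟨χ, mem_holCharts_of_contDiffOn (fun e he => ?_) (fun e he => ?_), rfl, rfl, hχ, hχs⟩
  · have h1 : ContMDiffOn 𝓘(ℂ, Cn n) 𝓘(ℂ, Cn (n + 1)) ω (fun z => φ (j (e.symm z)))
        (e.target ∩ e.symm ⁻¹' χ.source) := by
      have h2 := contMDiffOn_of_mem_maximalAtlas hφ.1
      have h3 := hj.isImmersion.contMDiff.contMDiffOn (s := χ.source)
      have h4 : ContMDiffOn 𝓘(ℂ, Cn n) 𝓘(ℂ, Cn n) ω e.symm e.target :=
        contMDiffOn_symm_of_mem_maximalAtlas (IsManifold.subset_maximalAtlas he)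
      exact (h2.comp h3 fun _ h => h).comp (h4.mono Set.inter_subset_left) fun z hz => hz.2
    have h2 := contMDiffOn_iff_contDiffOn.1 h1
    rw [contDiffOn_pi]
    intro i
    exact contDiffOn_pi.1 h2 i.succ
  · intro z hz
    have hz1 : z ∈ χ.target := hz.1
    set w := χ.symm z with hw
    have hze : w ∈ e.source := hz.2
    -- The inverse of `j` on its image is not visibly holomorphic. Near `w` it factors through the
    -- normal form: `χ⁻¹(z)` is `χ₀⁻¹` of the last coordinates of `φ₀(φ⁻¹(0, z))`.
    obtain ⟨φ₀, χ₀, h0, hχ₀, hw0, hjw, h5, h6⟩ := exists_isAdapted_of_embedding hj w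
    have hzφ : (Fin.cons 0 z : Cn (n + 1)) ∈ φ.target ∩ φ.symm ⁻¹' φ₀.source := by
      refine ⟨hz1, ?_⟩
      change φ.symm (Fin.cons 0 z) ∈ φ₀.source
      rw [← hχs z hz1]
      exact hjw
    have g1 : ContDiffAt ℂ ω (fun y => φ₀ (φ.symm y)) (Fin.cons 0 z : Cn (n + 1)) :=
      (contDiffOn_transition h0.1 hφ.1).contDiffAt ((isOpen_transition φ₀ φ).mem_nhds hzφ)
    have g2 : ContDiff ℂ ω fun z : Cn n => (Fin.cons 0 z : Cn (n + 1)) := by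
      rw [contDiff_pi]
      intro i
      refine Fin.cases ?_ (fun i => ?_) i
      · exact contDiff_const
      · exact contDiff_apply ℂ ℂ i
    have g3 : ContDiffAt ℂ ω (fun (z : Cn n) (i : Fin n) => φ₀ (φ.symm (Fin.cons 0 z)) i.succ) z := by
      have g4 : ContDiffAt ℂ ω (fun z : Cn n => φ₀ (φ.symm (Fin.cons 0 z))) z :=
        ContDiffAt.comp (g := fun y => φ₀ (φ.symm y)) z g1 g2.contDiffAt
      rw [contDiffAt_pi] at g4 ⊢
      exact fun i => g4 i.succ
    have hmap : ∀ z' ∈ χ.target, φ.symm (Fin.cons 0 z') ∈ φ₀.source →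
        χ.symm z' ∈ χ₀.source ∧
        (fun i : Fin n => φ₀ (φ.symm (Fin.cons 0 z')) i.succ) = χ₀ (χ.symm z') := by
      intro z' hz' h
      rw [← hχs z' hz'] at h ⊢
      refine ⟨h6 _ h, ?_⟩
      rw [h5 _ (h6 _ h)]
      simp
    have hch : ContDiffOn ℂ ω (fun y => e (χ₀.symm y)) (χ₀.target ∩ χ₀.symm ⁻¹' e.source) := by
      have h := (mem_maximalAtlas_iff.1 hχ₀ e he).1
      have h2 := (mem_groupoid_of_pregroupoid.1 h).1
      simpa [contDiffPregroupoid, OpenPartialHomeomorph.trans_source, Function.comp_def] using h2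
    have hz0 := hmap z hz1 hzφ.2
    have hch' : ContDiffAt ℂ ω (fun y => e (χ₀.symm y))
        (fun i : Fin n => φ₀ (φ.symm (Fin.cons 0 z)) i.succ) := by
      refine hch.contDiffAt ((isOpen_transition e χ₀).mem_nhds ?_)
      rw [hz0.2]
      refine ⟨χ₀.map_source hz0.1, ?_⟩
      change χ₀.symm (χ₀ w) ∈ e.source
      rw [χ₀.left_inv hz0.1]
      exact hze
    have hcomp := ContDiffAt.comp (g := fun y => e (χ₀.symm y)) z hch' g3
    refine (hcomp.congr_of_eventuallyEq ?_).contDiffWithinAt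
    have hev : ∀ᶠ z' in nhds z, (Fin.cons 0 z' : Cn (n + 1)) ∈ φ.target ∩ φ.symm ⁻¹' φ₀.source :=
      hcons.continuousAt.eventually_mem ((isOpen_transition φ₀ φ).mem_nhds hzφ)
    filter_upwards [hev, χ.open_target.mem_nhds hz1] with z' h1 h2
    have h3 := hmap z' h2 h1.2
    simp only [Function.comp_apply]
    rw [h3.2, χ₀.left_inv h3.1]

end Adapted

/-! ### The norm of a holomorphic section. -/

namespace LineBundleMetric

variable {d : ℕ} {X : Type*} [TopologicalSpace X] [ChartedSpace (Cn d) X]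
  {L : X → Type*} [∀ x, AddCommGroup (L x)] [∀ x, Module ℂ (L x)]
  [∀ x, TopologicalSpace (L x)] [TopologicalSpace (TotalSpace ℂ L)]
  [FiberBundle ℂ L] [VectorBundle ℂ ℂ L]

theorem norm_zero (h : LineBundleMetric (d := d) L) (x : X) : h.norm x 0 = 0 := by
  have := h.homog x 0 0
  simpa using this

theorem norm_eq_zero (h : LineBundleMetric (d := d) L) {x : X} {v : L x} :
    h.norm x v = 0 ↔ v = 0 :=
  ⟨fun h0 => by_contra fun hv => (h.pos x v hv).ne' h0, fun hv => hv ▸ h.norm_zero x⟩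

variable [IsManifold 𝓘(ℂ, Cn d) ω X] [ContMDiffVectorBundle ω ℂ L 𝓘(ℂ, Cn d)]

/-- In a chart, the norm of a holomorphic section is locally the product of the modulus of a
holomorphic function and a smooth positive function. -/
theorem exists_norm_eq (h : LineBundleMetric (d := d) L) {s : ∀ x, L x}
    (hs : ContMDiff 𝓘(ℂ, Cn d) (𝓘(ℂ, Cn d).prod 𝓘(ℂ, ℂ)) ω (fun x => TotalSpace.mk' ℂ x (s x)))
    {φ : OpenPartialHomeomorph X (Cn d)} (hφ : φ ∈ holCharts d X) {p : Cn d} (hp : p ∈ φ.target) :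
    ∃ r > 0, Metric.ball p r ⊆ φ.target ∧ ∃ (f : Cn d → ℂ) (u : Cn d → ℝ),
      ContDiffOn ℂ ∞ f (Metric.ball p r) ∧ ContDiffOn ℝ ∞ u (Metric.ball p r) ∧
      ∀ y ∈ Metric.ball p r, 0 < u y ∧ h.norm (φ.symm y) (s (φ.symm y)) = ‖f y‖ * u y ∧
        (f y = 0 ↔ s (φ.symm y) = 0) := by
  set x := φ.symm p with hx
  let e := trivializationAt ℂ L x
  have hO : IsOpen (φ.target ∩ φ.symm ⁻¹' e.baseSet) := φ.isOpen_inter_preimage_symm e.open_baseSet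
  have hpO : p ∈ φ.target ∩ φ.symm ⁻¹' e.baseSet := ⟨hp, mem_baseSet_trivializationAt ℂ L x⟩
  obtain ⟨r, hr, hball⟩ := Metric.isOpen_iff.1 hO p hpO
  have hsm : ContMDiffOn 𝓘(ℂ, Cn d) 𝓘(ℂ, Cn d) ω φ.symm φ.target :=
    contMDiffOn_symm_of_mem_maximalAtlas hφ
  have := isManifold_real d X
  have hsmr : ContMDiffOn 𝓘(ℝ, Cn d) 𝓘(ℝ, Cn d) ∞ φ.symm φ.target :=
    contMDiffOn_symm_of_mem_maximalAtlas (mem_maximalAtlas_real hφ)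
  -- In a local trivialization, `f` is the coordinate of `s` and `u` the norm of the frame.
  refine ⟨r, hr, fun y hy => (hball hy).1, fun y => (e ⟨φ.symm y, s (φ.symm y)⟩).2,
    fun y => h.norm (φ.symm y) (e.symm (φ.symm y) 1), ?_, ?_, ?_⟩
  · have h1 := e.contMDiffOn_section_baseSet_iff.1 (hs.contMDiffOn (s := e.baseSet))
    have h2 := h1.comp (hsm.mono fun y hy => (hball hy).1) fun y hy => (hball hy).2
    exact (contMDiffOn_iff_contDiffOn.1 h2).of_le le_top
  · have h2 := (h.smooth e).comp (hsmr.mono fun y hy => (hball hy).1) fun y hy => (hball hy).2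
    exact contMDiffOn_iff_contDiffOn.1 h2
  · intro y hy
    have hb : φ.symm y ∈ e.baseSet := (hball hy).2
    have hsy : s (φ.symm y) = (e ⟨φ.symm y, s (φ.symm y)⟩).2 • e.symm (φ.symm y) 1 := by
      have h1 := e.symm_apply_apply_mk hb (s (φ.symm y))
      have h2 := (e.symmₗ ℂ (φ.symm y)).map_smul (e ⟨φ.symm y, s (φ.symm y)⟩).2 1
      rw [smul_eq_mul, mul_one, e.symmₗ_apply hb, e.symmₗ_apply hb] at h2
      rw [← h2]
      exact h1.symm
    have h1 : e.symm (φ.symm y) (1 : ℂ) ≠ 0 := by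
      intro h0
      have h2 := e.apply_mk_symm hb (1 : ℂ)
      rw [h0] at h2
      have h3 := (e.linearMapAt ℂ (φ.symm y)).map_zero
      rw [e.linearMapAt_apply, if_pos hb, h2] at h3
      exact one_ne_zero h3
    refine ⟨h.pos _ _ h1, ?_, ?_⟩
    · conv_lhs => rw [hsy]
      exact h.homog _ _ _
    · constructor
      · intro h0
        have h0 : (e ⟨φ.symm y, s (φ.symm y)⟩).2 = 0 := h0
        rw [hsy, h0, zero_smul]
      · intro h0
        exact (smul_eq_zero.1 (hsy.symm.trans h0)).resolve_right h1

end LineBundleMetric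

/-! ### Local form of the norm and of semi-meromorphic forms. -/

section Local

variable {n : ℕ} {X : Type*} [TopologicalSpace X] [ChartedSpace (Cn (n + 1)) X]
  [IsManifold 𝓘(ℂ, Cn (n + 1)) ω X]

theorem ContDiffOn.log_norm {E : Type*} [NormedAddCommGroup E] [NormedSpace ℝ E] {f : E → ℂ}
    {U : Set E} (hf : ContDiffOn ℝ ∞ f U) (h0 : ∀ y ∈ U, f y ≠ 0) :
    ContDiffOn ℝ ∞ (fun y => Real.log ‖f y‖) U :=
  (hf.norm ℂ h0).log fun y hy => norm_ne_zero_iff.2 (h0 y hy)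

theorem contDiff_first : ContDiff ℝ ∞ fun y : Cn (n + 1) => y 0 := contDiff_apply ℝ ℂ 0

theorem exists_ball_first_ne_zero {p : Cn (n + 1)} (hp : p 0 ≠ 0) :
    ∃ r > 0, ∀ y ∈ Metric.ball p r, y 0 ≠ 0 := by
  have h : IsOpen {y : Cn (n + 1) | y 0 ≠ 0} := isOpen_ne_fun (continuous_apply 0) continuous_const
  obtain ⟨r, hr, hb⟩ := Metric.isOpen_iff.1 h p hp
  exact ⟨r, hr, fun y hy => hb hy⟩

/-- Locally `|s| = |f| u`, and in an adapted chart `f` vanishes exactly on `z₁ = 0`. Hence `f = z₁^k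
g` with `g` zero free and `ψ = log |g| + log u`. -/
theorem isNormLike_norm {D : Set X} {L : X → Type*} [∀ x, AddCommGroup (L x)]
    [∀ x, Module ℂ (L x)] [∀ x, TopologicalSpace (L x)] [TopologicalSpace (TotalSpace ℂ L)]
    [FiberBundle ℂ L] [VectorBundle ℂ ℂ L] [ContMDiffVectorBundle ω ℂ L 𝓘(ℂ, Cn (n + 1))]
    (h : LineBundleMetric (d := n + 1) L) {s : ∀ x, L x}
    (hs : ContMDiff 𝓘(ℂ, Cn (n + 1)) (𝓘(ℂ, Cn (n + 1)).prod 𝓘(ℂ, ℂ)) ω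
      (fun x => TotalSpace.mk' ℂ x (s x)))
    (hD : ∀ x, s x = 0 ↔ x ∈ D) {φ : OpenPartialHomeomorph X (Cn (n + 1))} (hφ : IsAdapted D φ)
    {T : Set (Cn (n + 1))} (hT : T ⊆ φ.target) :
    IsNormLike (fun y => h.norm (φ.symm y) (s (φ.symm y))) T := by
  intro p hpT
  obtain ⟨r, hr, hball, f, u, hf, hu, hfu⟩ := h.exists_norm_eq hs hφ.1 (hT hpT)
  have hf0 : ∀ y ∈ Metric.ball p r, f y = 0 ↔ y 0 = 0 := fun y hy => by
    rw [(hfu y hy).2.2, hD, hφ.symm_mem (hball hy)]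
  by_cases hp : p 0 = 0
  · obtain ⟨k, ρ, g, hk, hρ, hρr, hg, hfg⟩ := exists_eq_pow_first_mul_ne_zero hp hr hf hf0
    have hsub : Metric.ball p ρ ⊆ Metric.ball p r := Metric.ball_subset_ball hρr
    refine ⟨ρ, hρ, k, hk, fun y => Real.log ‖g y‖ + Real.log (u y), ?_, fun y hy => ?_⟩
    · exact ((hg.restrict_scalars ℝ).log_norm fun y hy => (hfg y hy).1).add
        ((hu.mono hsub).log fun y hy => (hfu y (hsub hy)).1.ne')
    · beta_reduce
      rw [(hfu y (hsub hy)).2.1, (hfg y hy).2, norm_mul, norm_pow, Real.exp_add,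
        Real.exp_log (norm_pos_iff.2 (hfg y hy).1), Real.exp_log (hfu y (hsub hy)).1]
      ring
  · obtain ⟨r', hr', h0⟩ := exists_ball_first_ne_zero hp
    have hsub : Metric.ball p (min r r') ⊆ Metric.ball p r :=
      Metric.ball_subset_ball (min_le_left _ _)
    have h0' : ∀ y ∈ Metric.ball p (min r r'), y 0 ≠ 0 := fun y hy =>
      h0 y (Metric.ball_subset_ball (min_le_right _ _) hy)
    have hf0' : ∀ y ∈ Metric.ball p (min r r'), f y ≠ 0 := fun y hy hfy =>
      h0' y hy ((hf0 y (hsub hy)).1 hfy)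
    -- Off the hyperplane the norm has no zeros, but `κ ≥ 1` is required: a factor `|y₀|` is
    -- inserted and compensated in `ψ`.
    refine ⟨min r r', lt_min hr hr', 1, le_rfl,
      fun y => Real.log ‖f y‖ + Real.log (u y) - Real.log ‖y 0‖, ?_, fun y hy => ?_⟩
    · exact ((((hf.restrict_scalars ℝ).mono hsub).log_norm hf0').add
        ((hu.mono hsub).log fun y hy => (hfu y (hsub hy)).1.ne')).sub
        (contDiff_first.contDiffOn.log_norm h0')
    · have h1 : 0 < ‖y 0‖ := norm_pos_iff.2 (h0' y hy)
      beta_reduce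
      rw [(hfu y (hsub hy)).2.1, Real.exp_sub, Real.exp_add,
        Real.exp_log (norm_pos_iff.2 (hf0' y hy)), Real.exp_log (hfu y (hsub hy)).1,
        Real.exp_log h1, pow_one]
      field_simp

/-- Semi-meromorphic forms have poles of finite order along the hypersurface. -/
theorem DForm.IsSemiMeromorphic.exists_pow_smul {k : ℕ} {D : Set X} (hD : IsClosed D)
    {α : DForm (n + 1) X k} (hα : α.IsSemiMeromorphic D)
    {φ : OpenPartialHomeomorph X (Cn (n + 1))} (hφ : IsAdapted D φ) {x : X} (hx : x ∈ φ.source) :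
    ∃ ψ, IsAdapted D ψ ∧ x ∈ ψ.source ∧ ∃ (N : ℕ) (v : Cn (n + 1) → AltForm (n + 1) k),
      ContDiffOn ℝ ∞ v ψ.target ∧ ∀ y ∈ ψ.target, y 0 ≠ 0 → v y = y 0 ^ N • α.inChart ψ y := by
  have hsm : ∀ y ∈ φ.target, y 0 ≠ 0 → ContDiffAt ℝ ∞ (α.inChart φ) y := fun y hy h0 =>
    hα.1.contDiffAt hD.isOpen_compl hφ.1 hy (by
      rw [Set.mem_compl_iff, hφ.symm_mem hy]
      exact h0)
  have main : ∃ ρ > 0, ∃ (N : ℕ) (v : Cn (n + 1) → AltForm (n + 1) k),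
      ContDiffOn ℝ ∞ v (Metric.ball (φ x) ρ) ∧ Metric.ball (φ x) ρ ⊆ φ.target ∧
      ∀ y ∈ Metric.ball (φ x) ρ, y 0 ≠ 0 → v y = y 0 ^ N • α.inChart φ y := by
    have hp : φ x ∈ φ.target := φ.map_source hx
    obtain ⟨r₀, hr₀, hb₀⟩ := Metric.isOpen_iff.1 φ.open_target _ hp
    by_cases h0 : φ x 0 = 0
    · obtain ⟨U, hU, hxU, f, b, hf, hf0, hb, hbf⟩ := hα.2 x
      have hO := φ.isOpen_inter_preimage_symm hU
      obtain ⟨r, hr, hball⟩ := Metric.isOpen_iff.1 hO (φ x) ⟨hp, by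
        change φ.symm (φ x) ∈ U
        rwa [φ.left_inv hx]⟩
      have hfφ : ContDiffOn ℂ ∞ (fun y => f (φ.symm y)) (Metric.ball (φ x) r) := by
        have h1 : ContMDiffOn 𝓘(ℂ, Cn (n + 1)) 𝓘(ℂ, Cn (n + 1)) ω φ.symm φ.target :=
          contMDiffOn_symm_of_mem_maximalAtlas hφ.1
        have h2 := hf.comp (h1.mono fun y hy => (hball hy).1) fun y hy => (hball hy).2
        exact (contMDiffOn_iff_contDiffOn.1 h2).of_le le_top
      -- The denominator `f` vanishes on no nonempty open set, so some point of the small ball has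
      -- `f ≠ 0`.
      obtain ⟨z, hz, hfz⟩ := hf0 (U ∩ (φ.source ∩ φ ⁻¹' Metric.ball (φ x) r)) Set.inter_subset_left
        (hU.inter (φ.isOpen_inter_preimage Metric.isOpen_ball))
        ⟨x, hxU, hx, Metric.mem_ball_self hr⟩
      obtain ⟨N, ρ, hρ, hρr, v, hv, hvu⟩ := exists_contDiffOn_eq_pow_first_smul h0 hfφ
        (q := φ z) hz.2.2 (by rwa [φ.left_inv hz.2.1]) (u := α.inChart φ) (b := b.inChart φ)
        (fun y hy => (hsm y (hball hy.1).1 hy.2).contDiffWithinAt)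
        ((hb φ hφ.1).mono hball) (fun y hy hy0 => by
          have h1 := hbf (φ.symm y) ⟨(hball hy).2, by
            rw [hφ.symm_mem (hball hy).1]
            exact hy0⟩
          have h2 : b.inChart φ y = inChart (fun x => f x • α x) φ y := by
            simp only [inChart]
            rw [h1]
          rw [h2]
          rfl)
      exact ⟨ρ, hρ, N, v, hv, fun y hy => (hball (Metric.ball_subset_ball hρr hy)).1, hvu⟩
    · obtain ⟨r', hr', h0'⟩ := exists_ball_first_ne_zero h0
      refine ⟨min r₀ r', lt_min hr₀ hr', 0, α.inChart φ, fun y hy => ?_,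
        (Metric.ball_subset_ball (min_le_left _ _)).trans hb₀, fun y _ _ => by
          rw [pow_zero, one_smul]⟩
      exact (hsm y (hb₀ (Metric.ball_subset_ball (min_le_left _ _) hy))
        (h0' y (Metric.ball_subset_ball (min_le_right _ _) hy))).contDiffWithinAt
  obtain ⟨ρ, hρ, N, v, hv, hsub, hvα⟩ := main
  -- Shrinking the chart makes the extension available on its whole target, as global statements in
  -- a chart require.
  obtain ⟨ψ, hψ, hxψ, hs, he, hes, -, ht⟩ := exists_chart_target_subset hφ.1 hx hρ
  refine ⟨ψ, ⟨hψ, fun z hz => ?_⟩, hxψ, N, v, hv.mono ht, fun y hy hy0 => ?_⟩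
  · rw [he]
    exact hφ.2 z (hs hz)
  · have hinv : α.inChart ψ y = α.inChart φ y := by
      have h1 := DForm.inChart_eq_comp hφ.1 hψ α (y := y) ⟨hy, hs (ψ.map_target hy)⟩
      have h2 : (fun y => φ (ψ.symm y)) =ᶠ[nhds y] id := by
        filter_upwards [ψ.open_target.mem_nhds hy] with w hw
        rw [← he, ψ.right_inv hw]
        rfl
      rw [h2.fderiv_eq, ← he, ψ.right_inv hy, fderiv_id] at h1
      rw [h1]
      rfl
    rw [hvα y (ht hy) hy0, hinv]

end Local

/-! ### Functions cut off in a chart and extended by zero. -/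

namespace ChartPartition

variable {d : ℕ} {X : Type*} [TopologicalSpace X] [ChartedSpace (Cn d) X]

/-- The function `ρ_i g` on `ℂ^d`, where `g` is a function on the image of the `i`-th chart. -/
noncomputable def localize {E : Type*} [Zero E] [SMul ℂ E] (P : ChartPartition d X)
    (i : Fin P.N) (g : Cn d → E) : Cn d → E :=
  (P.chart i).target.indicator fun y => (P.ρ i ((P.chart i).symm y) : ℂ) • g y

variable {E : Type*} [NormedAddCommGroup E] [NormedSpace ℝ E] [NormedSpace ℂ E]
  [IsScalarTower ℝ ℂ E] (P : ChartPartition d X) (i : Fin P.N) {g : Cn d → E}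

theorem localize_of_mem {y : Cn d} (hy : y ∈ (P.chart i).target) :
    P.localize i g y = (P.ρ i ((P.chart i).symm y) : ℂ) • g y :=
  Set.indicator_of_mem hy _

variable [T2Space X] [CompactSpace X]

theorem isCompact_image_tsupport : IsCompact (P.chart i '' tsupport (P.ρ i)) :=
  (isClosed_tsupport _).isCompact.image_of_continuousOn
    ((P.chart i).continuousOn.mono (P.support i))

theorem image_tsupport_subset : P.chart i '' tsupport (P.ρ i) ⊆ (P.chart i).target := by
  rintro _ ⟨x, hx, rfl⟩
  exact (P.chart i).map_source (P.support i hx)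

theorem localize_eq_zero {y : Cn d} (hy : y ∉ P.chart i '' tsupport (P.ρ i)) :
    P.localize i g y = 0 := by
  by_cases hyt : y ∈ (P.chart i).target
  · rw [P.localize_of_mem i hyt]
    have h : P.ρ i ((P.chart i).symm y) = 0 := by
      by_contra h
      exact hy ⟨_, subset_tsupport _ h, (P.chart i).right_inv hyt⟩
    rw [h, Complex.ofReal_zero, zero_smul]
  · exact Set.indicator_of_notMem hyt _

theorem tsupport_localize_subset_image :
    tsupport (P.localize i g) ⊆ P.chart i '' tsupport (P.ρ i) :=
  closure_minimal (fun _ hy => by_contra fun h => hy (P.localize_eq_zero i h))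
    (P.isCompact_image_tsupport i).isClosed

theorem tsupport_localize_subset : tsupport (P.localize i g) ⊆ (P.chart i).target :=
  (P.tsupport_localize_subset_image i).trans (P.image_tsupport_subset i)

theorem hasCompactSupport_localize : HasCompactSupport (P.localize i g) :=
  (P.isCompact_image_tsupport i).of_isClosed_subset (isClosed_tsupport _)
    (P.tsupport_localize_subset_image i)

/-- The support of `ρ_i` is compact, so its image is closed in `ℂ^d`; outside the target, the
extension vanishes on a neighbourhood. -/
theorem contDiff_localize [IsManifold 𝓘(ℂ, Cn d) ω X]
    (hg : ContDiffOn ℝ ∞ g (P.chart i).target) : ContDiff ℝ ∞ (P.localize i g) := by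
  rw [contDiff_iff_contDiffAt]
  intro y
  by_cases hy : y ∈ (P.chart i).target
  · have hn := (P.chart i).open_target.mem_nhds hy
    have h1 : ContDiffOn ℝ ∞ (fun y => (P.ρ i ((P.chart i).symm y) : ℂ) • g y)
        (P.chart i).target := by
      have h2 : ContDiffOn ℝ ∞ (fun y => (P.ρ i ((P.chart i).symm y) : ℂ)) (P.chart i).target :=
        Complex.ofRealCLM.contDiff.comp_contDiffOn (P.contDiffOn i (P.chart_mem i))
      exact h2.smul hg
    refine (h1.contDiffAt hn).congr_of_eventuallyEq ?_
    filter_upwards [hn] with z hz using P.localize_of_mem i hz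
  · have hn : (P.chart i '' tsupport (P.ρ i))ᶜ ∈ nhds y :=
      (P.isCompact_image_tsupport i).isClosed.isOpen_compl.mem_nhds
        fun h => hy (P.image_tsupport_subset i h)
    refine (contDiffAt_const (c := (0 : E))).congr_of_eventuallyEq ?_
    filter_upwards [hn] with z hz using P.localize_eq_zero i hz

end ChartPartition

/-! ### Poles along the hypersurface and existence of principal values and residue data. -/

namespace DForm

variable {n k l : ℕ} {X : Type*} [TopologicalSpace X] [ChartedSpace (Cn (n + 1)) X]

/-- In the chart `φ` the form `a` has a pole of order at most `N` along `{z₁ = 0}`. -/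
def HasPole (φ : OpenPartialHomeomorph X (Cn (n + 1))) (N : ℕ) (a : DForm (n + 1) X k) : Prop :=
  ∃ v : Cn (n + 1) → AltForm (n + 1) k, ContDiffOn ℝ ∞ v φ.target ∧
    ∀ y ∈ φ.target, y 0 ≠ 0 → v y = y 0 ^ N • a.inChart φ y

variable {φ : OpenPartialHomeomorph X (Cn (n + 1))} {N : ℕ}

theorem HasPole.recast {a : DForm (n + 1) X k} (ha : HasPole φ N a) (h : k = l) :
    HasPole φ N (recast h a) := by
  subst h
  exact ha

theorem HasPole.wedge {a : DForm (n + 1) X k} {b : DForm (n + 1) X l} (ha : HasPole φ N a)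
    (hb : b.SmoothOn Set.univ) (hφ : φ ∈ holCharts (n + 1) X) : HasPole φ N (a.wedge b) := by
  obtain ⟨v, hv, hva⟩ := ha
  have hb' : ContDiffOn ℝ ∞ (b.inChart φ) φ.target := by simpa using hb φ hφ
  refine ⟨fun y => (v y).wedge (b.inChart φ y),
    fun y hy => (hv y hy).altForm_wedge (hb' y hy), fun y hy h0 => ?_⟩
  beta_reduce
  rw [inChart_wedge, hva y hy h0, AltForm.wedge_smul_left]

variable [IsManifold 𝓘(ℂ, Cn (n + 1)) ω X]

theorem SmoothOn.dbar {d : ℕ} {X : Type*} [TopologicalSpace X] [ChartedSpace (Cn d) X]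
    [IsManifold 𝓘(ℂ, Cn d) ω X] {a : DForm d X k} {U : Set X} (hU : IsOpen U)
    (ha : a.SmoothOn U) : a.dbar.SmoothOn U := by
  intro φ hφ
  have ho := φ.isOpen_inter_preimage_symm hU
  refine (ContDiffOn.dolb (e := Complex.I) ho (ha φ hφ)).congr fun y hy => ?_
  exact dbar_inChart hφ hy.1 (ha.contDiffAt hU hφ hy.1 hy.2)

theorem contDiffAt_of_isAdapted {D : Set X} (hD : IsClosed D) (hφ : IsAdapted D φ)
    {a : DForm (n + 1) X k} (ha : a.SmoothOn Dᶜ) {y : Cn (n + 1)} (hy : y ∈ φ.target)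
    (h0 : y 0 ≠ 0) : ContDiffAt ℝ ∞ (a.inChart φ) y :=
  ha.contDiffAt hD.isOpen_compl hφ.1 hy (by
    rw [Set.mem_compl_iff, hφ.symm_mem hy]
    exact h0)

theorem wd_I_pow_first (v y : Cn (n + 1)) (N : ℕ) :
    wd Complex.I v (fun z : Cn (n + 1) => z 0 ^ N) y = 0 :=
  (wd_of_differentiableAt_complex (f := fun z : Cn (n + 1) => z 0 ^ N) (by fun_prop)).1

/-- Multiplication by the holomorphic function `z₁^N` commutes with `∂̄`, so the pole order does not
increase. -/
theorem HasPole.dbar {D : Set X} (hD : IsClosed D) (hφ : IsAdapted D φ)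
    {a : DForm (n + 1) X k} (ha : HasPole φ N a) (hs : a.SmoothOn Dᶜ) : HasPole φ N a.dbar := by
  obtain ⟨v, hv, hva⟩ := ha
  refine ⟨dolb Complex.I v, ContDiffOn.dolb φ.open_target hv, fun y hy h0 => ?_⟩
  have hsm := contDiffAt_of_isAdapted hD hφ hs hy h0
  rw [dbar_inChart hφ.1 hy hsm]
  have he : v =ᶠ[nhds y] fun y => y 0 ^ N • a.inChart φ y := by
    filter_upwards [φ.open_target.mem_nhds hy, isOpen_first_ne_zero.mem_nhds h0] with z hz hz0
      using hva z hz hz0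
  rw [dolb_congr he]
  exact dolb_smul (by fun_prop) (fun w => wd_I_pow_first w y N) (hsm.differentiableAt (by simp))

/-- Principal values of forms with poles along the hypersurface exist. -/
theorem exists_isPrincipalValue [T2Space X] [CompactSpace X] {D : Set X} {σ : X → ℝ}
    (hσD : ∀ x, σ x = 0 ↔ x ∈ D)
    (hσ : ∀ φ : OpenPartialHomeomorph X (Cn (n + 1)), IsAdapted D φ → ∀ T ⊆ φ.target,
      IsNormLike (fun y => σ (φ.symm y)) T)
    {a : DForm (n + 1) X (2 * (n + 1))}
    (ha : ∀ x, ∃ φ, IsAdapted D φ ∧ x ∈ φ.source ∧ ∃ N, HasPole φ N a) :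
    ∃ c, IsPrincipalValue σ a c := by
  choose c hc hx N hN using ha
  obtain ⟨P, g, hP⟩ := exists_chartPartition (fun x => (hc x).1) hx
  have hPc : ∀ i, IsAdapted D (P.chart i) := fun i => by
    rw [hP]
    exact hc _
  have hloc : ∀ i, ∃ u, IsPrincipalValue σ (fun x => (P.ρ i x : ℂ) • a x) u := by
    intro i
    have hp := hN (g i)
    rw [← hP] at hp
    obtain ⟨v, hv, hva⟩ := hp
    refine ⟨_, isPrincipalValue_of_chart (P.chart_mem i) (m := N (g i))
      (b := P.localize i fun y => v y (stdFrame (n + 1))) ?_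
      (P.contDiff_localize i (AltForm.contDiffOn_iff.1 hv _)) (P.hasCompactSupport_localize i)
      (P.tsupport_localize_subset i) ?_ (hσ _ (hPc i) _ (P.tsupport_localize_subset i))⟩
    · intro x hx _
      rw [P.eq_zero i hx, Complex.ofReal_zero]
      exact zero_smul ℂ (a x : AltForm (n + 1) _)
    · intro y hy h0
      have hy0 : y 0 ≠ 0 := fun h => h0 ((hσD _).2 (((hPc i).symm_mem hy).2 h))
      rw [inChart_smul fun x => (P.ρ i x : ℂ), P.localize_of_mem i hy, hva y hy hy0,
        ContinuousAlternatingMap.smul_apply, ContinuousAlternatingMap.smul_apply]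
      simp only [smul_eq_mul]
      field_simp
  choose u hu using hloc
  refine ⟨_, (IsPrincipalValue.sum Finset.univ fun i _ => hu i).congr fun x _ => ?_⟩
  rw [← Finset.sum_smul, ← Complex.ofReal_sum, P.sum_eq_one, Complex.ofReal_one]
  exact one_smul ℂ (a x : AltForm (n + 1) _)

/-- The data defining the residue of a form of bidegree `(n + 1, n)` exist. -/
theorem nonempty_residueData [T2Space X] [CompactSpace X] {D : Set X}
    (hk : k + 1 + 1 = 2 * (n + 1)) {a : DForm (n + 1) X (k + 1)}
    (hat : a.IsTypeOn (n + 1) n Dᶜ)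
    (ha : ∀ x, ∃ φ, IsAdapted D φ ∧ x ∈ φ.source ∧ ∃ N, HasPole φ N a) :
    Nonempty (ResidueData D a) := by
  choose c hc hx N v hv hva using ha
  obtain ⟨P, g, hP⟩ := exists_chartPartition (fun x => (hc x).1) hx
  -- Off the hyperplane this holds because of the bidegree, on the whole target by density.
  have hz : ∀ x, ∀ y ∈ (c x).target, (v x y).dzOneWedge = 0 := by
    intro x y hy
    have h : Set.EqOn (fun y => (v x y).dzOneWedge) (fun _ => 0)
        ((c x).target ∩ {z | z 0 ≠ 0}) := by
      rintro z ⟨hz, hz0⟩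
      beta_reduce
      rw [hva x z hz hz0, AltForm.dzOneWedge_smul, AltForm.dzOneWedge_eq_zero_of_isType hk
        (isType_inChart (hc x).1 hz (hat _ fun h => hz0 (((hc x).symm_mem hz).1 h)))]
      exact smul_zero (A := AltForm (n + 1) (k + 1 + 1)) (z 0 ^ N x)
    exact h.of_subset_closure (hv x).dzOneWedge.continuousOn continuousOn_const
      Set.inter_subset_left (dense_first_ne_zero.open_subset_closure_inter (c x).open_target) hy
  -- With `v = z₁^N a` and `dz₁ ∧ v = 0`, the form `v` is `dz₁` wedge its contraction. An extra
  -- factor `z₁` in numerator and denominator ensures that the exponent is at least `1` even for `N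
  -- = 0`.
  refine ⟨⟨P, fun i => ?_, fun i => N (g i) + 1, fun i => Nat.le_add_left _ _,
    fun i y => y 0 • AltForm.contractOne (v (g i) y), fun i => ?_, fun i => ?_, fun i => ?_⟩⟩
  · rw [hP]
    exact (hc _).2
  · rw [hP]
    exact contDiff_first.contDiffOn.smul (hv _).contractOne
  · intro y hy w l
    have h := AltForm.noDzOne_contractOne (v (g i) y) w l
    simp only [ContinuousAlternatingMap.smul_apply, smul_eq_mul]
    linear_combination y 0 * h
  · rw [hP]
    intro y hy h0
    rw [AltForm.dzOneWedge_smul, ← AltForm.eq_dzOneWedge_contractOne (hz _ y hy), hva _ y hy h0,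
      smul_smul, smul_smul]
    have : (y 0 ^ (N (g i) + 1))⁻¹ * (y 0 * y 0 ^ N (g i)) = 1 := by
      rw [← pow_succ', inv_mul_cancel₀ (pow_ne_zero _ h0)]
    rw [mul_assoc, this, one_smul]

end DForm

/-! ### The local residue formula. -/

section

variable {n k : ℕ}

theorem AltForm.dzOneWedge_zero : (0 : AltForm (n + 1) k).dzOneWedge = 0 := by
  ext v
  rw [AltForm.dzOneWedge_apply]
  simp

theorem wd_iterate_apply {m : ℕ} {B : Cn (n + 1) → AltForm (n + 1) k} (hB : ContDiff ℝ ∞ B)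
    (v : Fin k → Cn (n + 1)) (y : Cn (n + 1)) :
    (wd (-Complex.I) (Pi.single 0 1))^[m] (fun y => B y v) y = wirtingerOne^[m] B y v := by
  have h := wd_iterate_clm (e := -Complex.I) (v := (Pi.single 0 1 : Cn (n + 1))) isOpen_univ
    hB.contDiffOn (AltForm.evalCLM v) (fun _ _ => rfl) m (Set.mem_univ y)
  have h2 : (wirtingerOne : (Cn (n + 1) → AltForm (n + 1) k) → _) =
      wd (-Complex.I) (Pi.single 0 1) := funext wirtingerOne_eq_wd
  rw [h2]
  exact h

theorem wd_const_mul_iterate {e : ℂ} {w : Cn n} {m : ℕ} {f : Cn n → ℂ} (hf : ContDiff ℝ ∞ f)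
    (c : ℂ) (y : Cn n) : (wd e w)^[m] (fun y => c * f y) y = c * (wd e w)^[m] f y :=
  wd_iterate_clm (e := e) (v := w) isOpen_univ hf.contDiffOn
    (((ContinuousLinearMap.mul ℂ ℂ c).restrictScalars ℝ)) (fun a x => by simp; ring) m
    (Set.mem_univ y)

/-- The frame `e₂, i e₂, …, e_{n+1}, i e_{n+1}` of the hyperplane `{z₁ = 0}`. -/
noncomputable def tailFrame (n : ℕ) (hk : k = 2 * n) (i : Fin k) : Cn (n + 1) :=
  Fin.cons 0 (castFrame n hk i)

/-- The local form of the residue formula. -/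
theorem pvInt_dolb_dzOneWedge {m : ℕ} (hm : 1 ≤ m) (hk : k + 1 + 1 = 2 * (n + 1))
    {B : Cn (n + 1) → AltForm (n + 1) k} (hB : ContDiff ℝ ∞ B) (hBs : HasCompactSupport B) :
    pvInt m (fun y => dolb Complex.I (fun y => (B y).dzOneWedge) y (castFrame (n + 1) hk)) =
      -(2 * Real.pi * Complex.I) * ∫ z : Cn n, (((m - 1).factorial : ℂ)⁻¹) *
        wirtingerOne^[m - 1] B (Fin.cons 0 z) (tailFrame n (by omega)) := by
  obtain ⟨m, rfl⟩ : ∃ m', m = m' + 1 := ⟨m - 1, by omega⟩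
  have hdz : ContDiff ℝ ∞ fun y => (B y).dzOneWedge := contDiffOn_univ.1 hB.contDiffOn.dzOneWedge
  have hb : ∀ j, ContDiff ℝ ∞ fun y => frameCoeff Complex.I hk j (B y).dzOneWedge := fun j =>
    contDiffOn_univ.1 (contDiffOn_frameCoeff hdz.contDiffOn)
  have hbs : ∀ j, HasCompactSupport fun y => frameCoeff Complex.I hk j (B y).dzOneWedge := fun j => by
    refine hBs.mono fun y hy => ?_
    contrapose! hy
    rw [Function.notMem_support] at hy ⊢
    rw [hy, AltForm.dzOneWedge_zero, frameCoeff_zero]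
  have e1 : (fun y => dolb Complex.I (fun y => (B y).dzOneWedge) y (castFrame (n + 1) hk)) =
      fun y => ∑ j, wd Complex.I (Pi.single j 1)
        (fun y => frameCoeff Complex.I hk j (B y).dzOneWedge) y :=
    funext fun y => dolb_castFrame Complex.I_mul_I hk ((hdz.differentiable (by simp)) y)
  -- Only the derivative in `z̄₁` survives. Its contribution `-π`, times the factor `2i` of
  -- `frameCoeff_dzOneWedge`, is the constant `-2πi`.
  rw [e1, pvInt_sum (fun j _ => (hb j).wd) fun j _ => (hbs j).wd, Fin.sum_univ_succ,
    Finset.sum_eq_zero fun j _ => pvInt_wd_of_ne (hb _) (hbs _) (Fin.succ_ne_zero j), add_zero,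
    pvInt_succ_wd_eq (hb 0) (hbs 0)]
  have e2 : (fun y => frameCoeff Complex.I hk 0 (B y).dzOneWedge) =
      fun y => 2 * Complex.I * B y (tailFrame n (by omega)) :=
    funext fun y => AltForm.frameCoeff_dzOneWedge hk (B y)
  have hBv : ContDiff ℝ ∞ fun y => B y (tailFrame n (by omega)) :=
    contDiffOn_univ.1 (AltForm.contDiffOn_iff.1 hB.contDiffOn _)
  rw [e2]
  simp only [wd_const_mul_iterate hBv, wd_iterate_apply hB, Nat.add_sub_cancel]
  rw [MeasureTheory.integral_const_mul, MeasureTheory.integral_const_mul]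
  ring

end

/-! ### Calculus of `∂̄` on the manifold. -/

namespace DForm

variable {n k l : ℕ} {X : Type*} [TopologicalSpace X] 

section Dbar

variable {d : ℕ} [ChartedSpace (Cn d) X]

theorem dbar_recast (h : k = l) (h' : k + 1 = l + 1) (a : DForm d X k) :
    (recast h a).dbar = recast h' a.dbar := by
  subst h
  rfl

theorem recast_recast {m : ℕ} (h : k = l) (h' : l = m) (a : DForm d X k) :
    recast h' (recast h a) = recast (h.trans h') a := by
  subst h h'
  rfl

variable [IsManifold 𝓘(ℂ, Cn d) ω X]

theorem SmoothOn.contDiffAt_chartAt {a : DForm d X k} {U : Set X} (hU : IsOpen U)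
    (ha : a.SmoothOn U) {x : X} (hx : x ∈ U) :
    ContDiffAt ℝ ∞ (a.inChart (chartAt (Cn d) x)) (chartAt (Cn d) x x) := by
  refine ha.contDiffAt hU (chartAt_mem_holCharts x)
    ((chartAt (Cn d) x).map_source (mem_chart_source _ x)) ?_
  rwa [(chartAt (Cn d) x).left_inv (mem_chart_source _ x)]

/-- Evaluated in the preferred chart at `x`, where a form coincides with its own expression, this is
`dolb_wedge`. The degree `m` is left free so that the three terms can be compared in one type. -/
theorem dbar_wedge {a : DForm d X k} {b : DForm d X l} {U : Set X} (hU : IsOpen U)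
    (ha : a.SmoothOn U) (hb : b.SmoothOn U) {x : X} (hx : x ∈ U) {m : ℕ} (h₁ : k + l + 1 = m)
    (h₂ : k + 1 + l = m) :
    recast h₁ (a.wedge b).dbar x =
      recast h₂ (a.dbar.wedge b) x + (-1 : ℂ) ^ k • recast h₁ (a.wedge b.dbar) x := by
  subst h₁
  ext v
  have e : ∀ y, (a.wedge b).inChart (chartAt (Cn d) x) y =
      (a.inChart (chartAt (Cn d) x) y).wedge (b.inChart (chartAt (Cn d) x) y) := fun y =>
    inChart_wedge a b _ y
  have hself : ∀ {r : ℕ} (c : DForm d X r), c.inChart (chartAt (Cn d) x) (chartAt (Cn d) x x) = c x := by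
    intro r c
    have h := eq_inChart_comp (chartAt_mem_holCharts (d := d) x) c (mem_chart_source (Cn d) x)
    have hid : fderiv ℝ (fun y => chartAt (Cn d) x ((chartAt (Cn d) x).symm y))
        (chartAt (Cn d) x x) = ContinuousLinearMap.id ℝ (Cn d) := by
      have he : (fun z => chartAt (Cn d) x ((chartAt (Cn d) x).symm z)) =ᶠ[nhds (chartAt (Cn d) x x)]
          id := by
        filter_upwards [(chartAt (Cn d) x).open_target.mem_nhds
          ((chartAt (Cn d) x).map_source (mem_chart_source _ x))] with z hz
          using (chartAt (Cn d) x).right_inv hz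
      rw [he.fderiv_eq, fderiv_id]
    rw [hid] at h
    exact h.symm
  have key := dolb_wedge (e := Complex.I) (ha.contDiffAt_chartAt hU hx) (hb.contDiffAt_chartAt hU hx)
    h₂ v
  simp only [← e] at key
  rw [hself, hself] at key
  rw [ContinuousAlternatingMap.add_apply, ContinuousAlternatingMap.smul_apply, recast_apply,
    recast_apply, recast_apply]
  exact key

theorem dolb_inChart_sum (e : ℂ) {ι : Type*} (s : Finset ι) {a : ι → DForm d X k} {U : Set X}
    (hU : IsOpen U) (ha : ∀ i ∈ s, (a i).SmoothOn U) {x : X} (hx : x ∈ U) :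
    dolb e (inChart (fun x => ∑ i ∈ s, a i x) (chartAt (Cn d) x)) (chartAt (Cn d) x x) =
      ∑ i ∈ s, dolb e ((a i).inChart (chartAt (Cn d) x)) (chartAt (Cn d) x x) := by
  have h : inChart (fun x => ∑ i ∈ s, a i x) (chartAt (Cn d) x) =
      fun y => ∑ i ∈ s, (a i).inChart (chartAt (Cn d) x) y :=
    funext fun y => inChart_sum s a _ y
  rw [h]
  exact dolb_sum (e := e) fun i hi =>
    ((ha i hi).contDiffAt_chartAt hU hx).differentiableAt (by simp)

theorem dbar_sum {ι : Type*} (s : Finset ι) {a : ι → DForm d X k} {U : Set X} (hU : IsOpen U)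
    (ha : ∀ i ∈ s, (a i).SmoothOn U) {x : X} (hx : x ∈ U) :
    dbar (fun x => ∑ i ∈ s, a i x) x = ∑ i ∈ s, (a i).dbar x :=
  dolb_inChart_sum Complex.I s hU ha hx

theorem del_sum {ι : Type*} (s : Finset ι) {a : ι → DForm d X k} {U : Set X} (hU : IsOpen U)
    (ha : ∀ i ∈ s, (a i).SmoothOn U) {x : X} (hx : x ∈ U) :
    del (fun x => ∑ i ∈ s, a i x) x = ∑ i ∈ s, (a i).del x := by
  simp only [del, delCn_eq_dolb]
  exact dolb_inChart_sum (-Complex.I) s hU ha hx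

theorem SmoothOn.smul_partition {a : DForm d X k} {U : Set X} (ha : a.SmoothOn U)
    (P : ChartPartition d X) (i : Fin P.N) : SmoothOn (fun x => (P.ρ i x : ℂ) • a x) U := by
  intro φ hφ
  have h1 : ContDiffOn ℝ ∞ (fun y => (P.ρ i (φ.symm y) : ℂ)) φ.target :=
    Complex.ofRealCLM.contDiff.comp_contDiffOn (P.contDiffOn i hφ)
  exact (h1.mono Set.inter_subset_left).smul (ha φ hφ)

theorem inChart_eventuallyEq_zero {a : DForm d X k} {K : Set X} (hK : IsClosed K)
    (ha : ∀ x ∉ K, a x = 0) {x : X} (hx : x ∉ K) :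
    a.inChart (chartAt (Cn d) x) =ᶠ[nhds (chartAt (Cn d) x x)] fun _ => 0 := by
  have hO := (chartAt (Cn d) x).isOpen_inter_preimage_symm hK.isOpen_compl
  filter_upwards [hO.mem_nhds ⟨(chartAt (Cn d) x).map_source (mem_chart_source _ x), by
    simpa [(chartAt (Cn d) x).left_inv (mem_chart_source _ x)] using hx⟩] with y hy
  rw [inChart, ha _ hy.2]
  rfl

theorem dolb_eventuallyEq_zero {e : ℂ} {a : Cn d → AltForm d k} {y : Cn d}
    (h : a =ᶠ[nhds y] fun _ => 0) : dolb e a y = 0 := by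
  rw [dolb_congr h]
  ext v
  rw [dolb_apply]
  simp [wd]

theorem dbar_eq_zero {a : DForm d X k} {K : Set X} (hK : IsClosed K)
    (ha : ∀ x ∉ K, a x = 0) {x : X} (hx : x ∉ K) : a.dbar x = 0 :=
  dolb_eventuallyEq_zero (e := Complex.I) (inChart_eventuallyEq_zero hK ha hx)

theorem del_eq_zero {a : DForm d X k} {K : Set X} (hK : IsClosed K)
    (ha : ∀ x ∉ K, a x = 0) {x : X} (hx : x ∉ K) : a.del x = 0 := by
  rw [del, delCn_eq_dolb]
  exact dolb_eventuallyEq_zero (inChart_eventuallyEq_zero hK ha hx)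

end Dbar

variable [ChartedSpace (Cn (n + 1)) X] [IsManifold 𝓘(ℂ, Cn (n + 1)) ω X]

/-- The principal value of `∂̄(ρ_i a)` for `a` as in the definition of the residue. -/
theorem isPrincipalValue_dbar_residueData [T2Space X] [CompactSpace X] {D : Set X}
    (hD : IsClosed D) {σ : X → ℝ} (hσD : ∀ x, σ x = 0 ↔ x ∈ D)
    (hσ : ∀ φ : OpenPartialHomeomorph X (Cn (n + 1)), IsAdapted D φ → ∀ T ⊆ φ.target,
      IsNormLike (fun y => σ (φ.symm y)) T)
    (hk : k + 1 + 1 = 2 * (n + 1)) {a : DForm (n + 1) X (k + 1)} (ha : a.SmoothOn Dᶜ)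
    (R : ResidueData D a) (i : Fin R.N) :
    IsPrincipalValue σ (recast hk (dbar fun x => (R.ρ i x : ℂ) • a x))
      (-(2 * Real.pi * Complex.I) * ∫ z : Cn n, (((R.m i - 1).factorial : ℂ)⁻¹) *
        wirtingerOne^[R.m i - 1] (R.localize i (R.coeff i)) (Fin.cons 0 z)
          (tailFrame n (by omega))) := by
  have hφ : IsAdapted D (R.chart i) := ⟨R.chart_mem i, R.adapted i⟩
  set B := R.localize i (R.coeff i) with hB
  have hBd : ContDiff ℝ ∞ B := R.contDiff_localize i (R.coeff_smooth i)
  have hBs : HasCompactSupport B := R.hasCompactSupport_localize i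
  have hBt : tsupport B ⊆ (R.chart i).target := R.tsupport_localize_subset i
  have hdz : ContDiff ℝ ∞ fun y => (B y).dzOneWedge := contDiffOn_univ.1 hBd.contDiffOn.dzOneWedge
  rw [← pvInt_dolb_dzOneWedge (R.m_pos i) hk hBd hBs]
  set b : Cn (n + 1) → ℂ := fun y =>
    dolb Complex.I (fun y => (B y).dzOneWedge) y (castFrame (n + 1) hk) with hb
  have hbd : ContDiff ℝ ∞ b := contDiffOn_univ.1
    (AltForm.contDiffOn_iff.1 (ContDiffOn.dolb isOpen_univ hdz.contDiffOn) _)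
  have hb0 : ∀ y ∉ tsupport B, b y = 0 := by
    intro y hy
    have h : (fun y => (B y).dzOneWedge) =ᶠ[nhds y] fun _ => 0 := by
      filter_upwards [(isClosed_tsupport B).isOpen_compl.mem_nhds hy] with z hz
      rw [image_eq_zero_of_notMem_tsupport hz, AltForm.dzOneWedge_zero]
    rw [hb]
    beta_reduce
    rw [dolb_eventuallyEq_zero h]
    rfl
  have hbt : tsupport b ⊆ tsupport B :=
    closure_minimal (fun y hy => by_contra fun h => hy (hb0 y h)) (isClosed_tsupport _)
  refine isPrincipalValue_of_chart (R.chart_mem i) (fun x hx _ => ?_) hbd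
    (hBs.of_isClosed_subset (isClosed_tsupport _) hbt) (hbt.trans hBt) (fun y hy h0 => ?_)
    (hσ _ hφ _ (hbt.trans hBt))
  · have h1 : dbar (fun x => (R.ρ i x : ℂ) • a x) x = 0 := by
      refine dbar_eq_zero (isClosed_tsupport (R.ρ i)) (fun z hz => ?_)
        fun h => hx (R.support i h)
      rw [image_eq_zero_of_notMem_tsupport hz, Complex.ofReal_zero]
      exact zero_smul ℂ (a z : AltForm (n + 1) _)
    ext v
    rw [recast_apply, h1]
    rfl
  · have hy0 : y 0 ≠ 0 := fun h => h0 ((hσD _).2 ((hφ.symm_mem hy).2 h))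
    have hsm : ContDiffAt ℝ ∞ (inChart (fun x => (R.ρ i x : ℂ) • a x) (R.chart i)) y :=
      contDiffAt_of_isAdapted hD hφ (ha.smul_partition R.toChartPartition i) hy hy0
    rw [inChart_recast, dbar_inChart (R.chart_mem i) hy hsm]
    have he : inChart (fun x => (R.ρ i x : ℂ) • a x) (R.chart i) =ᶠ[nhds y]
        fun y => (y 0 ^ R.m i)⁻¹ • (B y).dzOneWedge := by
      filter_upwards [(R.chart i).open_target.mem_nhds hy, isOpen_first_ne_zero.mem_nhds hy0]
        with z hz hz0
      rw [inChart_smul fun x => (R.ρ i x : ℂ), R.eq_coeff i z hz hz0, hB, R.localize_of_mem i hz,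
        AltForm.dzOneWedge_smul, smul_comm]
    -- Away from the hyperplane `z₁^{-m}` is holomorphic, so `∂̄` passes to the smooth compactly
    -- supported form `dz₁ ∧ B`.
    rw [dolb_congr he, dolb_smul]
    · rfl
    · have : y 0 ^ R.m i ≠ 0 := pow_ne_zero _ hy0
      fun_prop (disch := assumption)
    · intro v
      refine (wd_of_differentiableAt_complex
        (f := fun z : Cn (n + 1) => (z 0 ^ R.m i)⁻¹) ?_).1
      have : y 0 ^ R.m i ≠ 0 := pow_ne_zero _ hy0
      fun_prop (disch := assumption)
    · exact hdz.differentiable (by simp) y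

end DForm

/-! ### Stokes' theorem for `∂`. -/

open MeasureTheory in
/-- Stokes' theorem for `∂` on a compact complex manifold. -/
theorem DForm.hasIntegral_del {d k : ℕ} {X : Type*} [TopologicalSpace X] [ChartedSpace (Cn d) X]
    [IsManifold 𝓘(ℂ, Cn d) ω X] [T2Space X] [CompactSpace X] {a : DForm d X k}
    (hk : k + 1 = 2 * d) (ha : a.SmoothOn Set.univ) : (recast hk a.del).HasIntegral 0 := by
  obtain ⟨P⟩ := nonempty_chartPartition (d := d) (X := X)
  have hloc : ∀ i, (recast hk (del fun x => (P.ρ i x : ℂ) • a x)).HasIntegral 0 := by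
    intro i
    set φ := P.chart i with hφd
    have hφ : φ ∈ holCharts d X := P.chart_mem i
    have haφ : ContDiffOn ℝ ∞ (a.inChart φ) φ.target := by simpa using ha φ hφ
    set B := P.localize i (a.inChart φ) with hB
    have hBd : ContDiff ℝ ∞ B := P.contDiff_localize i haφ
    have hBs : HasCompactSupport B := P.hasCompactSupport_localize i
    have hb : ∀ j, ContDiff ℝ ∞ fun y => frameCoeff (-Complex.I) hk j (B y) := fun j =>
      contDiffOn_univ.1 (contDiffOn_frameCoeff hBd.contDiffOn)
    have hbs : ∀ j, HasCompactSupport fun y => frameCoeff (-Complex.I) hk j (B y) := fun j => by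
      refine hBs.mono fun y hy => ?_
      contrapose! hy
      rw [Function.notMem_support] at hy ⊢
      rw [hy, frameCoeff_zero]
    set G : Cn d → ℂ := fun y => ∑ j, wd (-Complex.I) (Pi.single j 1)
      (fun y => frameCoeff (-Complex.I) hk j (B y)) y with hG
    have hGi : ∀ j, Integrable (wd (-Complex.I) (Pi.single j 1)
        (fun y => frameCoeff (-Complex.I) hk j (B y))) := fun j =>
      (hb j).wd.continuous.integrable_of_hasCompactSupport (hbs j).wd
    have hGe : Set.EqOn (fun y => (recast hk (del fun x => (P.ρ i x : ℂ) • a x)).inChart φ y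
        (stdFrame d)) G φ.target := by
      intro y hy
      have hsm : ContDiffAt ℝ ∞ (inChart (fun x => (P.ρ i x : ℂ) • a x) φ) y :=
        (ha.smul_partition P i).contDiffAt isOpen_univ hφ hy (Set.mem_univ _)
      have he : inChart (fun x => (P.ρ i x : ℂ) • a x) φ =ᶠ[nhds y] B := by
        filter_upwards [φ.open_target.mem_nhds hy] with z hz
        rw [inChart_smul fun x => (P.ρ i x : ℂ), hB, P.localize_of_mem i hz]
      beta_reduce
      rw [inChart_recast, del_inChart hφ hy hsm, dolb_congr he]
      exact dolb_castFrame (by ring_nf; simp) hk (hBd.differentiable (by simp) y)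
    have hG0 : ∀ y ∉ φ.target, G y = 0 := by
      intro y hy
      refine Finset.sum_eq_zero fun j _ => ?_
      refine image_eq_zero_of_notMem_tsupport fun h => hy ?_
      refine P.tsupport_localize_subset i (g := a.inChart φ) (closure_mono (fun z hz => ?_)
        (tsupport_wd_subset (f := fun y => frameCoeff (-Complex.I) hk j (B y)) h))
      contrapose! hz
      rw [Function.notMem_support] at hz ⊢
      rw [← hB] at hz
      rw [hz, frameCoeff_zero]
    have hint : ∫ y in φ.target, (recast hk (del fun x => (P.ρ i x : ℂ) • a x)).inChart φ y
        (stdFrame d) = 0 := by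
      rw [setIntegral_congr_fun φ.open_target.measurableSet hGe,
        setIntegral_eq_integral_of_forall_compl_eq_zero hG0, hG, integral_finsetSum _ fun j _ => hGi j]
      refine Finset.sum_eq_zero fun j _ => ?_
      -- In top degree the integrand is a sum of derivatives of compactly supported functions,
      -- integrated by parts against the constant `1`.
      have := integral_mul_wd_eq_zero (μ := (volume : Measure (Cn d))) (e := -Complex.I)
        (v := (Pi.single j 1 : Cn d)) (F := fun _ => 1)
        continuous_const (fun _ _ => rfl) (hb j) (hbs j)
      simpa using this
    rw [← hint]
    refine hasIntegral_of_chart hφ (fun x hx => ?_) ?_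
    · have h1 : del (fun x => (P.ρ i x : ℂ) • a x) x = 0 := by
        refine del_eq_zero (isClosed_tsupport (P.ρ i)) (fun z hz => ?_)
          fun h => hx (P.support i h)
        rw [image_eq_zero_of_notMem_tsupport hz, Complex.ofReal_zero]
        exact zero_smul ℂ (a z : AltForm d _)
      ext v
      rw [recast_apply, h1]
      rfl
    · exact (integrable_finsetSum _ fun j _ => hGi j).integrableOn.congr_fun hGe.symm
        φ.open_target.measurableSet
  have h := HasIntegral.sum Finset.univ fun i _ => hloc i
  rw [Finset.sum_const_zero] at h
  -- It remains to see that `∂a = ∑ ∂(ρ_i a)`, which follows from `∑ ρ_i = 1`.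
  convert h using 1
  funext x
  have h1 : a = fun x => ∑ i, (P.ρ i x : ℂ) • a x := by
    funext x
    rw [← Finset.sum_smul, ← Complex.ofReal_sum, P.sum_eq_one, Complex.ofReal_one]
    exact (one_smul ℂ (a x : AltForm d _)).symm
  have h2 := del_sum Finset.univ isOpen_univ (fun i _ => ha.smul_partition P i) (Set.mem_univ x)
  rw [← h1] at h2
  ext v
  rw [recast_apply, h2, ContinuousAlternatingMap.sum_apply, ContinuousAlternatingMap.sum_apply]
  refine Finset.sum_congr rfl fun i _ => ?_
  rw [recast_apply]

/-! ### The residue form on the hypersurface and its integral. -/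

namespace ResidueData

open MeasureTheory

variable {n k : ℕ} {X : Type*} [TopologicalSpace X] [ChartedSpace (Cn (n + 1)) X]
  [IsManifold 𝓘(ℂ, Cn (n + 1)) ω X]
  {Y : Type*} [TopologicalSpace Y] [ChartedSpace (Cn n) Y] {j : Y → X}
  {a : DForm (n + 1) X (k + 1)}

/-- The inclusion of the hyperplane `{z₁ = 0}`. -/
noncomputable def _root_.consZero (n : ℕ) : Cn n →L[ℝ] Cn (n + 1) :=
  ContinuousLinearMap.pi
    (Fin.cons (α := fun _ => Cn n →L[ℝ] ℂ) 0 fun i => ContinuousLinearMap.proj i)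

theorem _root_.consZero_apply (z : Cn n) : consZero n z = Fin.cons 0 z := by
  ext i
  refine Fin.cases ?_ (fun i => ?_) i <;> simp [consZero]

theorem _root_.wirtingerOne_iterate_eqOn {f g : Cn (n + 1) → AltForm (n + 1) k}
    {U : Set (Cn (n + 1))} (hU : IsOpen U) (h : Set.EqOn f g U) (m : ℕ) :
    Set.EqOn (wirtingerOne^[m] f) (wirtingerOne^[m] g) U := by
  have h2 : (wirtingerOne : (Cn (n + 1) → AltForm (n + 1) k) → _) =
      wd (-Complex.I) (Pi.single 0 1) := funext wirtingerOne_eq_wd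
  rw [h2]
  exact wd_iterate_eqOn hU h m

theorem _root_.ContDiff.wirtingerOne_iterate {f : Cn (n + 1) → AltForm (n + 1) k}
    (hf : ContDiff ℝ ∞ f) (m : ℕ) : ContDiff ℝ ∞ (_root_.wirtingerOne^[m] f) := by
  have h2 : (wirtingerOne : (Cn (n + 1) → AltForm (n + 1) k) → _) =
      wd (-Complex.I) (Pi.single 0 1) := funext wirtingerOne_eq_wd
  rw [h2]
  exact hf.wd_iterate m

theorem _root_.tsupport_wirtingerOne_iterate_subset {f : Cn (n + 1) → AltForm (n + 1) k} (m : ℕ) :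
    tsupport (wirtingerOne^[m] f) ⊆ tsupport f := by
  induction m with
  | zero => exact subset_rfl
  | succ m ih =>
    rw [Function.iterate_succ_apply', wirtingerOne_eq_wd]
    exact tsupport_wd_subset.trans ih

section

variable {D : Set X} (R : ResidueData D a) (i : Fin R.N)

/-- The Wirtinger derivative `∂^{m-1}(ρ ã)/∂z₁^{m-1} / (m-1)!` on `ℂ^{n+1}`. -/
noncomputable def localCoeff : Cn (n + 1) → AltForm (n + 1) k := fun w =>
  (((R.m i - 1).factorial : ℂ)⁻¹) • wirtingerOne^[R.m i - 1] (R.localize i (R.coeff i)) w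

variable [T2Space X] [CompactSpace X]

theorem contDiff_localCoeff : ContDiff ℝ ∞ (R.localCoeff i) :=
  ContDiff.const_smul (((R.m i - 1).factorial : ℂ)⁻¹)
    ((R.contDiff_localize i (R.coeff_smooth i)).wirtingerOne_iterate _)

theorem localCoeff_eq_zero {w : Cn (n + 1)} (hw : w ∉ R.chart i '' tsupport (R.ρ i)) :
    R.localCoeff i w = 0 := by
  rw [localCoeff, image_eq_zero_of_notMem_tsupport fun h =>
    hw (R.tsupport_localize_subset_image i (tsupport_wirtingerOne_iterate_subset _ h))]
  exact smul_zero (A := AltForm (n + 1) k) (((R.m i - 1).factorial : ℂ)⁻¹)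

theorem hasCompactSupport_localCoeff : HasCompactSupport (R.localCoeff i) :=
  HasCompactSupport.intro (R.isCompact_image_tsupport i) fun _ hw => R.localCoeff_eq_zero i hw

end

open Classical in
/-- The contribution of the `i`-th chart to the residue form. -/
noncomputable def localForm (R : ResidueData (Set.range j) a) (i : Fin R.N) : DForm n Y k :=
  fun y => if j y ∈ (R.chart i).source then
      (((R.m i - 1).factorial : ℂ)⁻¹) •
        ((wirtingerOne^[R.m i - 1]
            (fun w => (R.ρ i ((R.chart i).symm w) : ℂ) • R.coeff i w))
          (R.chart i (j y))).compContinuousLinearMap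
        (mfderiv 𝓘(ℝ, Cn n) 𝓘(ℝ, Cn (n + 1)) (fun y' => R.chart i (j y')) y :
          Cn n →L[ℝ] Cn (n + 1))
    else 0

theorem form_eq_sum (R : ResidueData (Set.range j) a) :
    R.form = fun y => ∑ i, R.localForm i y := rfl

variable (R : ResidueData (Set.range j) a) (i : Fin R.N)

section
variable [T2Space X] [CompactSpace X]

theorem localForm_of_mem {y : Y} (hy : j y ∈ (R.chart i).source) : R.localForm i y =
    (R.localCoeff i (R.chart i (j y))).compContinuousLinearMap
      (mfderiv 𝓘(ℝ, Cn n) 𝓘(ℝ, Cn (n + 1)) (fun y' => R.chart i (j y')) y :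
          Cn n →L[ℝ] Cn (n + 1)) := by
  have h : Set.EqOn (R.localize i (R.coeff i))
      (fun w => (R.ρ i ((R.chart i).symm w) : ℂ) • R.coeff i w) (R.chart i).target := fun w hw =>
    R.localize_of_mem i hw
  let L : Cn n →L[ℝ] Cn (n + 1) :=
    mfderiv 𝓘(ℝ, Cn n) 𝓘(ℝ, Cn (n + 1)) (fun y' => R.chart i (j y')) y
  exact (if_pos hy).trans (congrArg (fun A : AltForm (n + 1) k =>
    (((R.m i - 1).factorial : ℂ)⁻¹ • A).compContinuousLinearMap L)
      (wirtingerOne_iterate_eqOn (R.chart i).open_target h (R.m i - 1)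
        ((R.chart i).map_source hy)).symm)

theorem localForm_of_notMem {y : Y} (hy : j y ∉ tsupport (R.ρ i)) : R.localForm i y = 0 := by
  by_cases h : j y ∈ (R.chart i).source
  · rw [R.localForm_of_mem i h, R.localCoeff_eq_zero i]
    · rfl
    · rintro ⟨x, hx, hxy⟩
      exact hy ((R.chart i).injOn (R.support i hx) h hxy ▸ hx)
  · exact if_neg h

variable [IsManifold 𝓘(ℂ, Cn n) ω Y]

/-- In the chart `χ` induced by the adapted chart the embedding is `z ↦ (0, z)`, so restriction to
`D` is pull-back by `consZero`. -/
theorem inChart_localForm {χ : OpenPartialHomeomorph Y (Cn n)} (hχ : χ ∈ holCharts n Y)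
    (hs : χ.source = j ⁻¹' (R.chart i).source)
    (hχj : ∀ w ∈ χ.source, R.chart i (j w) = Fin.cons 0 (χ w)) {z : Cn n} (hz : z ∈ χ.target) :
    (R.localForm i).inChart χ z =
      (R.localCoeff i (consZero n z)).compContinuousLinearMap (consZero n) := by
  have := isManifold_real n Y
  have hw := χ.map_target hz
  have hjw : j (χ.symm z) ∈ (R.chart i).source := by
    rw [hs] at hw
    exact hw
  have h1 : MDifferentiableAt 𝓘(ℝ, Cn n) 𝓘(ℝ, Cn n) χ.symm z :=
    ((contMDiffOn_symm_of_mem_maximalAtlas (mem_maximalAtlas_real hχ)).contMDiffAt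
      (χ.open_target.mem_nhds hz)).mdifferentiableAt (by simp)
  have h2 : MDifferentiableAt 𝓘(ℝ, Cn n) 𝓘(ℝ, Cn (n + 1)) (fun y => R.chart i (j y))
      (χ.symm z) := by
    have h3 : MDifferentiableAt 𝓘(ℝ, Cn n) 𝓘(ℝ, Cn n) χ (χ.symm z) :=
      ((contMDiffOn_of_mem_maximalAtlas (mem_maximalAtlas_real hχ)).contMDiffAt
        (χ.open_source.mem_nhds hw)).mdifferentiableAt (by simp)
    have h4 : MDifferentiableAt 𝓘(ℝ, Cn n) 𝓘(ℝ, Cn (n + 1)) (consZero n ∘ χ) (χ.symm z) :=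
      (consZero n).mdifferentiableAt.comp _ h3
    refine h4.congr_of_eventuallyEq ?_
    filter_upwards [χ.open_source.mem_nhds hw] with y hy
    rw [hχj y hy, Function.comp_apply, consZero_apply]
  have h5 := mfderiv_comp z h2 h1
  have h6 : (fun y => R.chart i (j y)) ∘ χ.symm =ᶠ[nhds z] consZero n := by
    filter_upwards [χ.open_target.mem_nhds hz] with y hy
    rw [Function.comp_apply, hχj _ (χ.map_target hy), χ.right_inv hy, consZero_apply]
  rw [h6.mfderiv_eq, (consZero n).mfderiv_eq] at h5
  have h7 : R.chart i (j (χ.symm z)) = consZero n z := h6.eq_of_nhds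
  rw [DForm.inChart, R.localForm_of_mem i hjw, h7]
  ext v
  have h8 : ∀ u, consZero n u = _ := fun u => congrArg (fun L : Cn n →L[ℝ] Cn (n + 1) => L u) h5
  exact congrArg (fun u : Fin k → Cn (n + 1) => R.localCoeff i (consZero n z) u)
    (funext fun l => (h8 (v l)).symm)

variable (hj : Manifold.IsSmoothEmbedding 𝓘(ℂ, Cn n) 𝓘(ℂ, Cn (n + 1)) ω j)
include hj

/-- Two kinds of points of the hypersurface occur: in the domain of the adapted chart the induced
chart gives an explicit smooth expression; elsewhere the form vanishes nearby, since the closed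
support of `ρ_i` lies in that domain. -/
theorem smoothOn_localForm : (R.localForm i).SmoothOn Set.univ := by
  have hjc : Continuous j := hj.isEmbedding.continuous
  refine DForm.smoothOn_of_charts fun y _ => ?_
  by_cases hy : j y ∈ (R.chart i).source
  · have : Nonempty Y := ⟨y⟩
    obtain ⟨χ, hχ, hs, ht, hχj, -⟩ := exists_induced_chart hj ⟨R.chart_mem i, R.adapted i⟩
    have hyχ : y ∈ χ.source := by
      rw [hs]
      exact hy
    refine ⟨χ, hχ, hyχ, ?_⟩
    have h1 : ContDiffAt ℝ ∞ (fun z => (R.localCoeff i (consZero n z)).compContinuousLinearMap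
        (consZero n)) (χ y) :=
      ContDiffWithinAt.altForm_comp (((R.contDiff_localCoeff i).comp
        (consZero n).contDiff).contDiffAt (x := χ y)) contDiffWithinAt_const
    refine h1.congr_of_eventuallyEq ?_
    filter_upwards [χ.open_target.mem_nhds (χ.map_source hyχ)] with z hz
      using R.inChart_localForm i hχ hs hχj hz
  · refine ⟨chartAt (Cn n) y, chartAt_mem_holCharts y, mem_chart_source _ y, ?_⟩
    refine (contDiffAt_const (c := (0 : AltForm n k))).congr_of_eventuallyEq ?_
    exact DForm.inChart_eventuallyEq_zero ((isClosed_tsupport (R.ρ i)).preimage hjc)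
      (fun w hw => R.localForm_of_notMem i hw) fun h => hy (R.support i h)

theorem hasIntegral_localForm (hk : k = 2 * n) : (DForm.recast hk (R.localForm i)).HasIntegral
    (∫ z : Cn n, R.localCoeff i (Fin.cons 0 z) (tailFrame n hk)) := by
  have hint : Integrable fun z : Cn n => R.localCoeff i (Fin.cons 0 z) (tailFrame n hk) := by
    have h1 : HasCompactSupport fun z : Cn n => R.localCoeff i (consZero n z) := by
      refine (R.hasCompactSupport_localCoeff i).comp_isClosedEmbedding
        (LinearMap.isClosedEmbedding_of_injective (f := (consZero n : Cn n →ₗ[ℝ] Cn (n + 1))) ?_)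
      rw [LinearMap.ker_eq_bot]
      intro z w hzw
      have h2 : consZero n z = consZero n w := hzw
      rw [consZero_apply, consZero_apply] at h2
      exact (Fin.cons_injective2 h2).2
    have h2 : Continuous fun z : Cn n => R.localCoeff i (consZero n z) (tailFrame n hk) :=
      (AltForm.evalCLM (tailFrame n hk)).continuous.comp
        ((R.contDiff_localCoeff i).continuous.comp (consZero n).continuous)
    have h3 := h2.integrable_of_hasCompactSupport (μ := volume)
      (h1.comp_left (g := AltForm.evalCLM (tailFrame n hk)) (map_zero _))
    simpa only [consZero_apply] using h3
  have hz0 : ∀ z : Cn n, (Fin.cons 0 z : Cn (n + 1)) ∉ (R.chart i).target →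
      R.localCoeff i (Fin.cons 0 z) (tailFrame n hk) = 0 := by
    intro z hz
    rw [R.localCoeff_eq_zero i fun h => hz (R.image_tsupport_subset i h)]
    rfl
  -- If `D` is empty there is no induced chart; then the target of the chart does not meet `z₁ = 0`
  -- and both integrals vanish.
  rcases isEmpty_or_nonempty Y with hY | hY
  · have h0 : ∫ z : Cn n, R.localCoeff i (Fin.cons 0 z) (tailFrame n hk) = 0 := by
      rw [integral_eq_zero_of_ae]
      refine Filter.Eventually.of_forall fun z => hz0 z fun h => ?_
      obtain ⟨y, -⟩ := (IsAdapted.symm_mem ⟨R.chart_mem i, R.adapted i⟩ h).2 rfl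
      exact hY.false y
    rw [h0]
    intro P
    have hP : IsEmpty (Fin P.N) := ⟨fun l => hY.false ((P.chart l).symm 0)⟩
    exact ⟨fun l => hP.elim l, Finset.sum_of_isEmpty _⟩
  · obtain ⟨χ, hχ, hs, ht, hχj, -⟩ := exists_induced_chart hj ⟨R.chart_mem i, R.adapted i⟩
    have he : Set.EqOn (fun z => (DForm.recast hk (R.localForm i)).inChart χ z (stdFrame n))
        (fun z => R.localCoeff i (Fin.cons 0 z) (tailFrame n hk)) χ.target := by
      intro z hz
      beta_reduce
      rw [DForm.inChart_recast, R.inChart_localForm i hχ hs hχj hz, consZero_apply]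
      exact congrArg (fun u : Fin k → Cn (n + 1) => R.localCoeff i (Fin.cons 0 z) u)
        (funext fun l => consZero_apply _)
    have h1 : ∫ z : Cn n, R.localCoeff i (Fin.cons 0 z) (tailFrame n hk) =
        ∫ z in χ.target, (DForm.recast hk (R.localForm i)).inChart χ z (stdFrame n) := by
      rw [setIntegral_congr_fun χ.open_target.measurableSet he,
        setIntegral_eq_integral_of_forall_compl_eq_zero]
      intro z hz
      refine hz0 z fun h => hz ?_
      rw [ht]
      exact h
    rw [h1]
    have hT : T2Space Y := hj.isEmbedding.t2Space
    refine DForm.hasIntegral_of_chart hχ (fun y hy => ?_)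
      (hint.integrableOn.congr_fun he.symm χ.open_target.measurableSet)
    ext v
    rw [DForm.recast_apply, R.localForm_of_notMem i fun h => hy (by
      rw [hs]
      exact R.support i h)]
    rfl

theorem smoothOn_form : R.form.SmoothOn Set.univ := by
  intro φ hφ
  have h : R.form.inChart φ = fun y => ∑ i, (R.localForm i).inChart φ y :=
    funext fun y => DForm.inChart_sum Finset.univ (fun i => R.localForm i) φ y
  rw [h]
  exact ContDiffOn.sum fun i _ => R.smoothOn_localForm i hj φ hφ

theorem hasIntegral_form (hk : k = 2 * n) : (DForm.recast hk R.form).HasIntegral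
    (∑ i, ∫ z : Cn n, R.localCoeff i (Fin.cons 0 z) (tailFrame n hk)) := by
  have h := DForm.HasIntegral.sum Finset.univ fun i _ => R.hasIntegral_localForm i hj hk
  convert h using 1
  funext y
  ext v
  rw [DForm.recast_apply, form_eq_sum, ContinuousAlternatingMap.sum_apply,
    ContinuousAlternatingMap.sum_apply]
  exact Finset.sum_congr rfl fun i _ => (DForm.recast_apply hk (R.localForm i) y v).symm

end

end ResidueData

/-! ### The residue formula and independence of the representative. -/

namespace DForm

theorem IsPrincipalValue.pvCurrent_eq {d k l : ℕ} {X : Type*} [TopologicalSpace X] [ChartedSpace (Cn d) X]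
    [IsManifold 𝓘(ℂ, Cn d) ω X] [T2Space X] [CompactSpace X] {σ : X → ℝ} {hkl : k + l = 2 * d}
    {a : DForm d X k} {ξ : DForm d X l} {c : ℂ} (hc : IsPrincipalValue σ (recast hkl (a.wedge ξ)) c) :
    pvCurrent σ hkl a ξ = c := by
  have hex : PVDefined σ hkl a ξ := ⟨c, hc⟩
  rw [pvCurrent, dif_pos hex]
  exact hex.choose_spec.unique hc

/-- Every form representing the residue has the same integral as the residue form. -/
theorem hasIntegral_of_isDelExact {d : ℕ} {X : Type*} [TopologicalSpace X]
    [ChartedSpace (Cn d) X] [IsManifold 𝓘(ℂ, Cn d) ω X] [T2Space X] [CompactSpace X]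
    {p q : ℕ} (hk : p + q = 2 * d) {η θ : DForm d X (p + q)} (hηθ : IsDelExact p q (η - θ)) {c : ℂ}
    (hθ : (recast hk θ).HasIntegral c) : (recast hk η).HasIntegral c := by
  have h0 : (recast hk (η - θ)).HasIntegral 0 := by
    rcases hηθ with h | ⟨p', hp, b, hb, -, h⟩
    · rw [h]
      convert hasIntegral_zero (d := d) (X := X) using 1
      funext x
      ext v
      rw [recast_apply]
      rfl
    · rw [h, recast_recast]
      exact hasIntegral_del (by omega) hb
  have h := hθ.add h0
  rw [add_zero] at h
  convert h using 1
  funext x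
  ext v
  rw [ContinuousAlternatingMap.add_apply, recast_apply, recast_apply, recast_apply]
  change _ = _ + (η x - θ x) _
  rw [ContinuousAlternatingMap.sub_apply]
  ring

variable {n k l : ℕ} {X : Type*} [TopologicalSpace X] [T2Space X] [CompactSpace X]
  [ChartedSpace (Cn (n + 1)) X] [IsManifold 𝓘(ℂ, Cn (n + 1)) ω X]

/-- The residue formula, with the residue expressed in charts. -/
theorem isPrincipalValue_dbar_wedge {D : Set X} (hD : IsClosed D) {σ : X → ℝ}
    (hσD : ∀ x, σ x = 0 ↔ x ∈ D)
    (hσ : ∀ φ : OpenPartialHomeomorph X (Cn (n + 1)), IsAdapted D φ → ∀ T ⊆ φ.target,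
      IsNormLike (fun y => σ (φ.symm y)) T)
    {m : ℕ} (hm : m + 1 + 1 = 2 * (n + 1)) {α : DForm (n + 1) X k} (hα : α.SmoothOn Dᶜ)
    {ξ : DForm (n + 1) X l} (hξ : ξ.SmoothOn Set.univ) (hkl : k + l = m + 1)
    (R : ResidueData D (recast hkl (α.wedge ξ))) {u v : ℂ}
    (hu : IsPrincipalValue σ (recast (by omega) (α.wedge ξ.dbar)) u)
    (hv : IsPrincipalValue σ (recast (by omega) (α.dbar.wedge ξ)) v) :
    v + (-1) ^ k * u = -(2 * Real.pi * Complex.I) *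
      ∑ i, ∫ z : Cn n, R.localCoeff i (Fin.cons 0 z) (tailFrame n (by omega)) := by
  have hDo := hD.isOpen_compl
  have hξ' : ξ.SmoothOn Dᶜ := fun φ hφ => (hξ φ hφ).mono (by simp)
  have ha : (α.wedge ξ).SmoothOn Dᶜ := by
    intro φ hφ
    have e : (α.wedge ξ).inChart φ = fun y => (α.inChart φ y).wedge (ξ.inChart φ y) :=
      funext fun y => inChart_wedge α ξ φ y
    rw [e]
    exact fun y hy => (hα φ hφ y hy).altForm_wedge (hξ' φ hφ y hy)
  have ha' := ha.recast hkl
  have h1 := IsPrincipalValue.sum Finset.univ fun i _ =>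
    isPrincipalValue_dbar_residueData hD hσD hσ hm ha' R i
  have h2 := hv.add (hu.const_smul ((-1) ^ k))
  rw [← Finset.mul_sum] at h1
  -- Off `D` the two forms coincide: `∑ ∂̄(ρ_i α ∧ ξ) = ∂̄(α ∧ ξ) = ∂̄α ∧ ξ + (-1)^k α ∧ ∂̄ξ`.
  -- Uniqueness of principal values then compares the numbers.
  refine h2.unique (h1.congr fun x hx => ?_)
  have hxD : x ∈ Dᶜ := fun h => hx ((hσD x).2 h)
  have h3 := dbar_wedge hDo hα hξ' hxD (m := 2 * (n + 1)) (by omega) (by omega)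
  refine Eq.trans ?_ h3
  have h4 := dbar_sum Finset.univ hDo (fun i _ => ha'.smul_partition R.toChartPartition i) hxD
  have h5 : (fun x => ∑ i, (R.ρ i x : ℂ) • recast hkl (α.wedge ξ) x) =
      recast hkl (α.wedge ξ) := by
    funext x
    rw [← Finset.sum_smul, ← Complex.ofReal_sum, R.sum_eq_one, Complex.ofReal_one]
    exact one_smul ℂ (recast hkl (α.wedge ξ) x : AltForm (n + 1) _)
  rw [h5, dbar_recast hkl (by omega)] at h4
  ext w
  rw [ContinuousAlternatingMap.sum_apply]
  simp only [recast_apply]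
  have h6 := congrArg (fun A : AltForm (n + 1) (m + 1 + 1) => A (w ∘ Fin.cast hm)) h4
  simp only [recast_apply, ContinuousAlternatingMap.sum_apply] at h6
  rw [← h6]
  rfl

end DForm

/-! ### The theorem. -/

theorem theorem3p4 {n : ℕ}
    -- a compact complex manifold `X` of dimension `d = n + 1`
    {X : Type*} [TopologicalSpace X] [T2Space X] [CompactSpace X]
    [ChartedSpace (Cn (n + 1)) X] [IsManifold 𝓘(ℂ, Cn (n + 1)) ω X]
    -- a smooth hypersurface `D`, the image of a closed holomorphic embedding `j : Y → X`
    {Y : Type*} [TopologicalSpace Y] [ChartedSpace (Cn n) Y] [IsManifold 𝓘(ℂ, Cn n) ω Y]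
    (j : Y → X) (hj : Manifold.IsSmoothEmbedding 𝓘(ℂ, Cn n) 𝓘(ℂ, Cn (n + 1)) ω j)
    (hclosed : IsClosed (Set.range j))
    -- a holomorphic section `s` of a hermitian line bundle with `D = {s = 0}`
    {L : X → Type*} [∀ x, AddCommGroup (L x)] [∀ x, Module ℂ (L x)]
    [∀ x, TopologicalSpace (L x)] [TopologicalSpace (TotalSpace ℂ L)]
    [FiberBundle ℂ L] [VectorBundle ℂ ℂ L]
    [ContMDiffVectorBundle ω ℂ L 𝓘(ℂ, Cn (n + 1))]
    (h : LineBundleMetric (d := n + 1) L) (s : ∀ x, L x)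
    (hs : ContMDiff 𝓘(ℂ, Cn (n + 1)) (𝓘(ℂ, Cn (n + 1)).prod 𝓘(ℂ, ℂ)) ω
      (fun x => TotalSpace.mk' ℂ x (s x)))
    (hD : ∀ x, s x = 0 ↔ x ∈ Set.range j)
    -- bidegrees: `(r, t) = (d - p, d - q - 1)`
    {p q r t : ℕ} (hp : p + r = n + 1) (hq : q + t = n)
    (α : DForm (n + 1) X (p + q)) (hα : α.IsSemiMeromorphic (Set.range j))
    (hαpq : α.IsTypeOn p q (Set.range j)ᶜ)
    (ξ : DForm (n + 1) X (r + t)) (hξ : ξ.SmoothOn Set.univ)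
    (hξrt : ξ.IsTypeOn r t Set.univ) :
    DForm.PVDefined (fun x => h.norm x (s x)) (by omega) α ξ.dbar ∧
    DForm.PVDefined (fun x => h.norm x (s x)) (by omega) α.dbar ξ ∧
    (conjDolbeaultResidue j (DForm.recast (by omega : p + q + (r + t) = n + n + 1)
      (α.wedge ξ))).Nonempty ∧
    ∀ η ∈ conjDolbeaultResidue j (DForm.recast (by omega : p + q + (r + t) = n + n + 1)
      (α.wedge ξ)),
      (∃ c, (DForm.recast (by omega : n + n = 2 * n) η).HasIntegral c) ∧
      DForm.dbarCurrent (p + q)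
          (DForm.pvCurrent (fun x => h.norm x (s x)) (by omega) α) ξ =
        DForm.pvCurrent (fun x => h.norm x (s x)) (by omega) α.dbar ξ +
          2 * Real.pi * Complex.I * (DForm.recast (by omega : n + n = 2 * n) η).integral := by
  have hσD : ∀ x, h.norm x (s x) = 0 ↔ x ∈ Set.range j := fun x => h.norm_eq_zero.trans (hD x)
  have hσ : ∀ φ : OpenPartialHomeomorph X (Cn (n + 1)), IsAdapted (Set.range j) φ →
      ∀ T ⊆ φ.target, IsNormLike (fun y => h.norm (φ.symm y) (s (φ.symm y))) T :=
    fun φ hφ T hT => isNormLike_norm h hs hD hφ hT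
  have hpole : ∀ x, ∃ φ, IsAdapted (Set.range j) φ ∧ x ∈ φ.source ∧ ∃ N, DForm.HasPole φ N α := by
    intro x
    obtain ⟨φ, hφ, hx⟩ := exists_isAdapted hj hclosed x
    obtain ⟨ψ, hψ, hxψ, N, hN⟩ := hα.exists_pow_smul hclosed hφ hx
    exact ⟨ψ, hψ, hxψ, N, hN⟩
  have h₁ : DForm.PVDefined (fun x => h.norm x (s x)) (by omega) α ξ.dbar :=
    DForm.exists_isPrincipalValue hσD hσ fun x => by
      obtain ⟨φ, hφ, hx, N, hN⟩ := hpole x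
      exact ⟨φ, hφ, hx, N, (hN.wedge (hξ.dbar isOpen_univ) hφ.1).recast _⟩
  have h₂ : DForm.PVDefined (fun x => h.norm x (s x)) (by omega) α.dbar ξ :=
    DForm.exists_isPrincipalValue hσD hσ fun x => by
      obtain ⟨φ, hφ, hx, N, hN⟩ := hpole x
      exact ⟨φ, hφ, hx, N, ((hN.dbar hclosed hφ hα.1).wedge hξ hφ.1).recast _⟩
  refine ⟨h₁, h₂, ?_, ?_⟩
  · obtain ⟨R⟩ := DForm.nonempty_residueData (D := Set.range j) (by omega)
      (a := DForm.recast (by omega : p + q + (r + t) = n + n + 1) (α.wedge ξ))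
      (DForm.IsTypeOn.recast (fun x hx => by
        have := (hαpq x hx).wedge (hξrt x (Set.mem_univ x))
        rwa [hp, hq] at this) _) (fun x => by
        obtain ⟨φ, hφ, hx, N, hN⟩ := hpole x
        exact ⟨φ, hφ, hx, N, (hN.wedge hξ hφ.1).recast _⟩)
    -- The residue form itself is a representative; it has top degree on `D`, so its bidegree `(n,
    -- n)` is automatic.
    exact ⟨R.form, R.smoothOn_form hj, fun y _ => AltForm.isType_top _ (by omega), R,
      Or.inl (sub_self _)⟩
  · rintro η ⟨-, -, R, hR⟩
    have : T2Space Y := hj.isEmbedding.t2Space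
    have : CompactSpace Y := Topology.IsClosedEmbedding.compactSpace ⟨hj.isEmbedding, hclosed⟩
    have hη := DForm.hasIntegral_of_isDelExact (by omega) hR (R.hasIntegral_form hj (by omega))
    refine ⟨⟨_, hη⟩, ?_⟩
    obtain ⟨u, hu⟩ := h₁
    obtain ⟨v, hv⟩ := h₂
    have key := DForm.isPrincipalValue_dbar_wedge hclosed hσD hσ (by omega) hα.1 hξ (by omega) R
      hu hv
    rw [DForm.dbarCurrent, DForm.IsPrincipalValue.pvCurrent_eq hu, DForm.IsPrincipalValue.pvCurrent_eq hv,
      hη.integral_eq]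
    -- With `⟨[α], ∂̄ξ⟩ = u` and `⟨[∂̄α], ξ⟩ = v`, `key` reads `v + (-1)^{p+q} u = -2πi ∫_D Res`,
    -- and the definition of `∂̄` on currents gives `⟨∂̄[α], ξ⟩ = -(-1)^{p+q} u`.
    linear_combination -key
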